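/- Fix an integer $k\ge 4$. **Definitions.** A *caterpillar* is a finite tree $G$ whose vertex set can be partitioned into a set $S$ (the spine) inducing a path in $G$ and a set $L$ of vertices of degree $1$ whose unique neighbour lies in $S$. A *$k$-path vertex cover* ($k$-PVC) of a graph $G$ is a set $I\subseteq V(G)$ that meets every path on $k$ vertices of $G$. A *token-sliding sequence* from $I$ to $J$ is a sequence $I=I_0,I_1,\dots,I_q=J$ ($q\ge 0$) of $k$-PVCs of $G$ such that for each $i<q$ there is an edge $x_iy_i$ of $G$ with $I_i\setminus I_{i+1}=\{x_i\}$ and $I_{i+1}\setminus I_i=\{y_i\}$. If one exists, $J$ is *reachable* from $I$. For a $k$-PVC $I$ let $\mathcal R(G,I)$ be the set of vertices $u\in I$ carrying a *rigid* token, that is, such that $u\in J$ for every $k$-PVC $J$ reachable from $I$. **Theorem.** 1. Let $I,J$ be $k$-PVCs of a caterpillar $G$. Then $J$ is reachable from $I$ if and only if $|I|=|J|$, $\mathcal R(G,I)=\mathcal R(G,J)$, and $|I\cap V(C)|=|J\cap V(C)|$ for every connected component $C$ of $G-\mathcal R(G,I)$. 2. There is an algorithm that, given an $n$-vertex caterpillar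 $G$ and a $k$-PVC $I$ of $G$, computes $\mathcal R(G,I)$ in $O(n^3)$ time. 3. There is an algorithm that, given an $n$-vertex caterpillar $G$ and two $k$-PVCs $I,J$ of $G$, decides in $O(n^3)$ time whether $J$ is reachable from $I$. 4. There is an algorithm that, given an $n$-vertex caterpillar $G$ and two $k$-PVCs $I,J$ of $G$ such that $J$ is reachable from $I$, constructs in time polynomial in $n$ a token-sliding sequence from $I$ to $J$, written as its list of slides $(x_0,y_0),(x_1,y_1),\dots,(x_{q-1},y_{q-1})$. Here algorithms are programs, depending only on $k$, for a word RAM with words of $O(\log n)$ bits and unit cost for each arithmetic operation, comparison, memory access and branch; graphs on the vertex set $\{0,\dots,n-1\}$ are given by their adjacency matrices and vertex sets by their characteristic vectors. The implied constants and the polynomial depend only on $k$. -/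

import Mathlib

universe u

namespace PVCR

section Graphs

variable {V : Type u}

/-- A caterpillar: a tree whose vertices are the vertices of an induced path (the spine) together
with leaves, i.e. vertices of degree one whose only neighbour lies on the spine. -/
def IsCaterpillar (G : SimpleGraph V) : Prop :=
  G.IsTree ∧ ∃ (m : ℕ) (s : SimpleGraph.pathGraph m ↪g G),
    ∀ v : V, v ∉ Set.range s → ∃ i : Fin m, G.neighborSet v = {s i}

/-- `I` is a `k`-path vertex cover: every path on `k` vertices contains a member of `I`. -/
def IsPVC (G : SimpleGraph V) (k : ℕ) (I : Finset V) : Prop :=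
  ∀ (a b : V) (p : G.Walk a b), p.IsPath → p.support.length = k → ∃ w ∈ p.support, w ∈ I

variable [DecidableEq V]

/-- `J` is obtained from `I` by sliding a token along the edge `xy` from `x` to `y`. -/
def Slides (G : SimpleGraph V) (I J : Finset V) (x y : V) : Prop :=
  G.Adj x y ∧ I \ J = {x} ∧ J \ I = {y}

/-- `⟨S 0, S 1, …, S q⟩` is a token-sliding sequence of `k`-path vertex covers of `G`. -/
structure IsTSSequence (G : SimpleGraph V) (k q : ℕ) (S : ℕ → Finset V) : Prop where
  isPVC : ∀ i, i ≤ q → IsPVC G k (S i)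
  slides : ∀ i, i < q → ∃ x y, Slides G (S i) (S (i + 1)) x y

/-- There is a token-sliding sequence between `I` and `J`. -/
def Reachable (G : SimpleGraph V) (k : ℕ) (I J : Finset V) : Prop :=
  ∃ (q : ℕ) (S : ℕ → Finset V), IsTSSequence G k q S ∧ S 0 = I ∧ S q = J

/-- The set of vertices carrying a `(G, I)`-rigid token: one that is occupied in every
`k`-path vertex cover reachable from `I`. -/
def rigidSet (G : SimpleGraph V) (k : ℕ) (I : Finset V) : Set V :=
  {u | u ∈ I ∧ ∀ J, Reachable G k I J → u ∈ J}

end Graphs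

/-- The graph `G - R`. -/
abbrev removeVerts {V : Type u} (G : SimpleGraph V) (R : Set V) : SimpleGraph ↥Rᶜ :=
  G.induce Rᶜ

/-- The number of tokens of `I` in a component `C` of `G - R`. -/
noncomputable def tokensIn {V : Type u} {G : SimpleGraph V} {R : Set V} (I : Finset V)
    (C : (removeVerts G R).ConnectedComponent) : ℕ :=
  {v : ↥Rᶜ | v ∈ C.supp ∧ (v : V) ∈ I}.ncard

/-! ### A word RAM

Programs work on finitely many named registers and on an array of memory cells.  Every arithmetic
operation, comparison, memory access, assignment and branch costs one unit of time, and all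
numbers that a run handles have to be at most a bound `W`, the largest value of a machine word. -/

/-- Expressions. -/
inductive AExp : Type
  | const (c : ℕ)
  | reg (r : ℕ)
  | load (a : AExp)
  | add (a b : AExp)
  | sub (a b : AExp)
  | mul (a b : AExp)
  | lt (a b : AExp)
  | eq (a b : AExp)

/-- Programs. -/
inductive Cmd : Type
  | skip
  | assign (r : ℕ) (e : AExp)
  | store (a e : AExp)
  | seq (c₁ c₂ : Cmd)
  | cond (e : AExp) (c₁ c₂ : Cmd)
  | loop (e : AExp) (c : Cmd)

/-- Contents of the registers and of the memory. -/
structure State : Type where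
  regs : ℕ → ℕ
  mem : ℕ → ℕ

/-- The value of an expression (subtraction is truncated, comparisons give `0` or `1`). -/
def AExp.eval (σ : State) : AExp → ℕ
  | .const c => c
  | .reg r => σ.regs r
  | .load a => σ.mem (a.eval σ)
  | .add a b => a.eval σ + b.eval σ
  | .sub a b => a.eval σ - b.eval σ
  | .mul a b => a.eval σ * b.eval σ
  | .lt a b => if a.eval σ < b.eval σ then 1 else 0
  | .eq a b => if a.eval σ = b.eval σ then 1 else 0

/-- All values met while evaluating an expression, including memory addresses, fit into a
machine word. -/
def AExp.Fits (W : ℕ) (σ : State) : AExp → Prop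
  | .const c => c ≤ W
  | .reg r => σ.regs r ≤ W
  | .load a => a.Fits W σ ∧ σ.mem (a.eval σ) ≤ W
  | .add a b => a.Fits W σ ∧ b.Fits W σ ∧ a.eval σ + b.eval σ ≤ W
  | .sub a b => a.Fits W σ ∧ b.Fits W σ
  | .mul a b => a.Fits W σ ∧ b.Fits W σ ∧ a.eval σ * b.eval σ ≤ W
  | .lt a b => a.Fits W σ ∧ b.Fits W σ
  | .eq a b => a.Fits W σ ∧ b.Fits W σ

/-- The time needed to evaluate an expression: one unit per constant, register or operation. -/
def AExp.cost : AExp → ℕ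
  | .const _ => 1
  | .reg _ => 1
  | .load a => a.cost + 1
  | .add a b => a.cost + b.cost + 1
  | .sub a b => a.cost + b.cost + 1
  | .mul a b => a.cost + b.cost + 1
  | .lt a b => a.cost + b.cost + 1
  | .eq a b => a.cost + b.cost + 1

/-- `Exec W c σ t τ`: started in `σ` on a machine with word bound `W`, the program `c` halts in `τ`
after exactly `t` units of time, without overflow. -/
inductive Exec (W : ℕ) : Cmd → State → ℕ → State → Prop
  | skip (σ : State) : Exec W .skip σ 1 σ
  | assign (σ : State) (r : ℕ) (e : AExp) (he : e.Fits W σ) :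
      Exec W (.assign r e) σ (e.cost + 1)
        { regs := Function.update σ.regs r (e.eval σ), mem := σ.mem }
  | store (σ : State) (a e : AExp) (ha : a.Fits W σ) (he : e.Fits W σ) :
      Exec W (.store a e) σ (a.cost + e.cost + 1)
        { regs := σ.regs, mem := Function.update σ.mem (a.eval σ) (e.eval σ) }
  | seq {c₁ c₂ : Cmd} {σ τ ρ : State} {t₁ t₂ : ℕ}
      (h₁ : Exec W c₁ σ t₁ τ) (h₂ : Exec W c₂ τ t₂ ρ) :
      Exec W (.seq c₁ c₂) σ (t₁ + t₂) ρ
  | condTrue {e : AExp} {c₁ c₂ : Cmd} {σ τ : State} {t : ℕ} (he : e.Fits W σ)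
      (hv : e.eval σ ≠ 0) (h : Exec W c₁ σ t τ) :
      Exec W (.cond e c₁ c₂) σ (e.cost + 1 + t) τ
  | condFalse {e : AExp} {c₁ c₂ : Cmd} {σ τ : State} {t : ℕ} (he : e.Fits W σ)
      (hv : e.eval σ = 0) (h : Exec W c₂ σ t τ) :
      Exec W (.cond e c₁ c₂) σ (e.cost + 1 + t) τ
  | loopDone {e : AExp} {c : Cmd} {σ : State} (he : e.Fits W σ) (hv : e.eval σ = 0) :
      Exec W (.loop e c) σ (e.cost + 1) σ
  | loopStep {e : AExp} {c : Cmd} {σ τ ρ : State} {t₁ t₂ : ℕ} (he : e.Fits W σ)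
      (hv : e.eval σ ≠ 0) (h₁ : Exec W c σ t₁ τ) (h₂ : Exec W (.loop e c) τ t₂ ρ) :
      Exec W (.loop e c) σ (e.cost + 1 + t₁ + t₂) ρ

open Classical in
/-- The input: the number `n` of vertices, then the `n × n` adjacency matrix of `G`, row by row,
then the characteristic vectors of the given vertex sets. -/
noncomputable def inputList {n : ℕ} (G : SimpleGraph (Fin n)) (sets : List (Finset (Fin n))) :
    List ℕ :=
  [n] ++ (List.finRange n).flatMap
      (fun i => (List.finRange n).map fun j => if G.Adj i j then 1 else 0)
    ++ sets.flatMap (fun I => (List.finRange n).map fun i => if i ∈ I then 1 else 0)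

/-- The initial state: the input is in the memory from address `0` on, all else is zero. -/
noncomputable def inputState {n : ℕ} (G : SimpleGraph (Fin n)) (sets : List (Finset (Fin n))) :
    State where
  regs _ := 0
  mem a := (inputList G sets).getD a 0

/-- Within time `T` and with word bound `W`, the program `P` started in `σ` halts in a state
satisfying `Q`. -/
def HaltsWith (P : Cmd) (W T : ℕ) (σ : State) (Q : State → Prop) : Prop :=
  ∃ (t : ℕ) (τ : State), t ≤ T ∧ Exec W P σ t τ ∧ Q τ

open Classical in
/-- The answer to the question `A` is in register `0`: `1` for yes and `0` for no. -/
def Answers (A : Prop) (τ : State) : Prop :=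
  τ.regs 0 = if A then 1 else 0

open Classical in
/-- The characteristic vector of `R` is in the memory, from the address in register `0` on. -/
def OutputsSet {n : ℕ} (R : Set (Fin n)) (τ : State) : Prop :=
  ∀ i : Fin n, τ.mem (τ.regs 0 + i) = if i ∈ R then 1 else 0

/-- The output is a token-sliding sequence from `I` to `J`: register `0` holds its length `q`, and
the memory holds, from the address `b` in register `1` on, the pairs `x₀, y₀, x₁, y₁, …` where the
`i`-th slide moves a token from `xᵢ` to `yᵢ`. -/
def OutputsTSSequence {n : ℕ} (G : SimpleGraph (Fin n)) (k : ℕ) (I J : Finset (Fin n))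
    (τ : State) : Prop :=
  ∃ S : ℕ → Finset (Fin n), IsTSSequence G k (τ.regs 0) S ∧ S 0 = I ∧ S (τ.regs 0) = J ∧
    ∀ i, i < τ.regs 0 → ∃ x y : Fin n, Slides G (S i) (S (i + 1)) x y ∧
      τ.mem (τ.regs 1 + 2 * i) = x ∧ τ.mem (τ.regs 1 + 2 * i + 1) = y

end PVCR

set_option linter.unusedSectionVars false
set_option linter.unusedSimpArgs false

namespace PVCR

/-! ### Path vertex covers of caterpillars in terms of windows of the spine -/

section Spine

variable {V : Type u}

/-! Windows. Number the spine vertices of the caterpillar and let every vertex belong to the star of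
a spine vertex. As `k ≥ 4`, a path on `k` vertices has at least two inner vertices; these are not
leaves, so they are consecutive on the spine, and only the two end vertices may be leaves. Hence a
set is a `k`-PVC iff every token-free stretch of at least two spine vertices is short, where a
vacant leaf at either end counts as one more vertex (`isPVC_iff_ok`).

Terminal positions. A token on a leaf may always be lifted to its vacant spine neighbour, so every
leaf token may be assumed to have a token at its owner. Then push tokens to the right along the
spine while this is legal; when a token leaves a spine vertex with an occupied leaf, the leaf token
moves up into the gap. Do the same to the left, and repeat until a pair of phases leaves the number
of leaf tokens unchanged. This yields a right-fixed position `X` and, from it, a left-fixed position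
`Z` with the same leaf tokens (`Terminal`, `exists_terminal`).

Rigidity. In a right-fixed position, a token in front of an empty spine vertex is held back by a
window to its left that would become too long. A counting argument (`count_le_count_of_fixed`) shows
that such positions are extremal: no normal PVC with the same number of spine tokens has fewer of
them in a prefix of the spine. Now let a spine vertex be occupied in both `X` and `Z`, with equally
many tokens in front of it. Extremality of `X` forces an empty window to its left in every reachable
position, and extremality of `Z` forces one to its right. A step to the left frees the right window,
a step to the right frees the left one, and a step onto a leaf frees a window one vertex longer: the
token cannot move (`star_fixed`). So, unless the spine is full, the rigid tokens are those that no
slide on the way to `Z` has touched (`Terminal.rigidSet_eq`). If the spine is full and some vertex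
is vacant, a hole can be opened on the spine and moved anywhere; then nothing is rigid, and any two
such positions of equal size are connected (`Full.reachable`).

Characterisation. Size, rigid set and token numbers in the components are invariants of slides.
Conversely, let `Z` and `W` be terminal positions of `I` and `J`. The leaf tokens of a terminal
position that is not full are rigid, and a left-fixed normal position is determined by its leaf
tokens and its size. Hence equal sizes and equal rigid sets give `Z = W` or two full spines
(`Terminal.eq_or_full`), and in both cases `I` and `J` are connected through `Z` and `W`.

Algorithms. A potential of size `O(n²)` drops with each push and pays for a whole sweep; every pair
of sweeps but the last lowers the number of leaf tokens, so there are `O(n)` sweeps and cubic time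
suffices. Word size is handled once and for all: a `tame` program raises the largest value by at
most 2 per time unit, so polynomial time implies values of polynomial size (`Run.exec`). -/

theorem isPVC_iff_forall_fun {G : SimpleGraph V} {k : ℕ} (hk : 1 ≤ k) {X : Finset V} :
    IsPVC G k X ↔ ∀ p : ℕ → V, (∀ i, i + 1 < k → G.Adj (p i) (p (i + 1))) →
      (∀ i j, i < k → j < k → p i = p j → i = j) → ∃ i < k, p i ∈ X := by
  constructor
  · intro h p hadj hinj
    set l : List V := (List.range k).map p with hl
    have hlen : l.length = k := by simp [hl]
    have hne : l ≠ [] := by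
      intro h0; rw [h0] at hlen; simp at hlen; omega
    have hch : l.IsChain G.Adj := by
      rw [List.isChain_iff_getElem]
      intro i hi
      simp only [hl, List.getElem_map, List.getElem_range]
      exact hadj i (by omega)
    have hnd : l.Nodup := by
      rw [hl]
      refine List.Nodup.map_on ?_ List.nodup_range
      intro x hx y hy hxy
      exact hinj x y (List.mem_range.1 hx) (List.mem_range.1 hy) hxy
    obtain ⟨w, hw, hwX⟩ := h _ _ (SimpleGraph.Walk.ofSupport l hne hch)
      (by rw [SimpleGraph.Walk.isPath_def, SimpleGraph.Walk.support_ofSupport]; exact hnd)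
      (by rw [SimpleGraph.Walk.support_ofSupport]; exact hlen)
    rw [SimpleGraph.Walk.support_ofSupport, hl, List.mem_map] at hw
    obtain ⟨i, hi, rfl⟩ := hw
    exact ⟨i, List.mem_range.1 hi, hwX⟩
  · intro h a b p hp hlen
    have hch := p.isChain_adj_support
    rw [SimpleGraph.Walk.isPath_def] at hp
    rw [List.isChain_iff_getElem] at hch
    obtain ⟨i, hi, hiX⟩ := h (fun i => p.support.getD i a)
      (by
        intro i hi
        have := hch i (by omega)
        simp only [List.getD_eq_getElem _ _ (show i < p.support.length by omega),
          List.getD_eq_getElem _ _ (show i + 1 < p.support.length by omega)]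
        exact this)
      (by
        intro i j hi hj hij
        simp only [List.getD_eq_getElem _ _ (show i < p.support.length by omega),
          List.getD_eq_getElem _ _ (show j < p.support.length by omega)] at hij
        exact (List.Nodup.getElem_inj_iff hp).1 hij)
    refine ⟨_, ?_, hiX⟩
    simp only [List.getD_eq_getElem _ _ (show i < p.support.length by omega)]
    exact List.getElem_mem _

/-- Coordinates on a caterpillar: `s 0, …, s (m - 1)` is the spine, and the vertex `v` belongs to
the star around `s (o v)`. -/
structure Spine (G : SimpleGraph V) where
  m : ℕ
  s : ℕ → V
  o : V → ℕ
  o_lt : ∀ v, o v < m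
  o_s : ∀ i, i < m → o (s i) = i
  adj_iff : ∀ u v, G.Adj u v ↔
    (u = s (o u) ∧ v = s (o v) ∧ (o u + 1 = o v ∨ o v + 1 = o u)) ∨
    (o u = o v ∧ u ≠ v ∧ (u = s (o u) ∨ v = s (o v)))

theorem IsCaterpillar.exists_spine {G : SimpleGraph V} (h : IsCaterpillar G) :
    Nonempty (Spine G) := by
  classical
  obtain ⟨hT, m, s, hs⟩ := h
  have hne : Nonempty V := hT.1.nonempty
  have hm : 0 < m := by
    obtain ⟨v⟩ := hne
    by_cases hv : v ∈ Set.range s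
    · obtain ⟨i, -⟩ := hv; exact i.pos
    · obtain ⟨i, -⟩ := hs v hv; exact i.pos
  have hown : ∀ v : V, ∃ i : Fin m, (v ∈ Set.range s → s i = v) ∧
      (v ∉ Set.range s → G.neighborSet v = {s i}) := by
    intro v
    by_cases hv : v ∈ Set.range s
    · obtain ⟨i, hi⟩ := hv
      exact ⟨i, fun _ => hi, fun h => absurd ⟨i, hi⟩ h⟩
    · obtain ⟨i, hi⟩ := hs v hv
      exact ⟨i, fun h => absurd h hv, fun _ => hi⟩
  choose o ho1 ho2 using hown
  have hss : ∀ i : Fin m, (if h : (i : ℕ) < m then s ⟨i, h⟩ else s ⟨0, hm⟩) = s i := by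
    intro i; simp
  have hrange : ∀ v, v = s (o v) ↔ v ∈ Set.range s := by
    intro v
    exact ⟨fun h => ⟨_, h.symm⟩, fun h => (ho1 v h).symm⟩
  -- Beyond the spine `s` takes the junk value `s 0`. The adjacency condition evaluates it only at
  -- `o u` and `o v`, which are in range.
  refine ⟨⟨m, fun i => if h : i < m then s ⟨i, h⟩ else s ⟨0, hm⟩, fun v => o v,
    fun v => (o v).2, ?_, ?_⟩⟩
  · intro i hi
    simp only [hi, dite_true]
    have := s.injective (ho1 (s ⟨i, hi⟩) ⟨_, rfl⟩)
    rw [this]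
  · intro u v
    simp only [hss]
    by_cases hu : u ∈ Set.range s <;> by_cases hv : v ∈ Set.range s
    · have h1 := (hrange u).2 hu
      have h2 := (hrange v).2 hv
      have : G.Adj u v ↔ ((o u : ℕ) + 1 = o v ∨ (o v : ℕ) + 1 = o u) := by
        conv_lhs => rw [h1, h2]
        rw [s.map_adj_iff, SimpleGraph.pathGraph_adj]
      rw [this]
      constructor
      · intro h; exact Or.inl ⟨h1, h2, h⟩
      · rintro (h | ⟨h3, h4, -⟩)
        · exact h.2.2
        · exfalso; apply h4; rw [h1, h2, Fin.ext h3]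
    · have h1 := (hrange u).2 hu
      have h2 := mt (hrange v).1 hv
      have : G.Adj u v ↔ u = s (o v) := by
        rw [G.adj_comm, ← SimpleGraph.mem_neighborSet, ho2 v hv, Set.mem_singleton_iff]
      rw [this]
      constructor
      · intro h
        have h3 : o u = o v := s.injective (h1.symm.trans h)
        exact Or.inr ⟨by rw [h3], fun h => hv (h ▸ hu), Or.inl h1⟩
      · rintro (h | ⟨h3, h4, -⟩)
        · exact absurd h.2.1 h2
        · rw [← Fin.ext h3]; exact h1
    · have h1 := mt (hrange u).1 hu
      have h2 := (hrange v).2 hv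
      have : G.Adj u v ↔ v = s (o u) := by
        rw [← SimpleGraph.mem_neighborSet, ho2 u hu, Set.mem_singleton_iff]
      rw [this]
      constructor
      · intro h
        have h3 : o v = o u := s.injective (h2.symm.trans h)
        exact Or.inr ⟨by rw [h3], fun h => hu (h ▸ hv), Or.inr h2⟩
      · rintro (h | ⟨h3, h4, -⟩)
        · exact absurd h.1 h1
        · rw [Fin.ext h3]; exact h2
    · have h1 := mt (hrange u).1 hu
      have h2 := mt (hrange v).1 hv
      have : ¬ G.Adj u v := by
        rw [← SimpleGraph.mem_neighborSet, ho2 u hu, Set.mem_singleton_iff]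
        rintro rfl
        exact hv ⟨_, rfl⟩
      simp only [this, false_iff]
      rintro (h | h)
      · exact h1 h.1
      · exact h.2.2.elim h1 h2

namespace Spine

variable {G : SimpleGraph V} (C : Spine G)

/-- The spine vertex of the star of `v`. -/
def ow (v : V) : V := C.s (C.o v)

/-- The same caterpillar with the spine read backwards. -/
def mirror : Spine G where
  m := C.m
  s i := C.s (C.m - 1 - i)
  o v := C.m - 1 - C.o v
  o_lt v := by have := C.o_lt v; omega
  o_s i hi := by rw [C.o_s _ (by omega)]; omega
  adj_iff u v := by
    have h1 := C.o_lt u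
    have h2 := C.o_lt v
    rw [C.adj_iff, show C.m - 1 - (C.m - 1 - C.o u) = C.o u by omega,
      show C.m - 1 - (C.m - 1 - C.o v) = C.o v by omega,
      show (C.m - 1 - C.o u + 1 = C.m - 1 - C.o v ∨ C.m - 1 - C.o v + 1 = C.m - 1 - C.o u) ↔
        (C.o u + 1 = C.o v ∨ C.o v + 1 = C.o u) by omega,
      show (C.m - 1 - C.o u = C.m - 1 - C.o v) ↔ (C.o u = C.o v) by omega]

theorem mirror_m : C.mirror.m = C.m := rfl
theorem mirror_s (i : ℕ) : C.mirror.s i = C.s (C.m - 1 - i) := rfl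
theorem mirror_o (v : V) : C.mirror.o v = C.m - 1 - C.o v := rfl

@[simp] theorem mirror_ow (v : V) : C.mirror.ow v = C.ow v := by
  have := C.o_lt v
  simp only [ow, mirror_s, mirror_o]
  congr 1; omega

theorem o_ow (v : V) : C.o (C.ow v) = C.o v := C.o_s _ (C.o_lt v)

theorem ow_s {i : ℕ} (hi : i < C.m) : C.ow (C.s i) = C.s i := by rw [ow, C.o_s i hi]

theorem ow_ow (v : V) : C.ow (C.ow v) = C.ow v := by rw [ow, o_ow]; rfl

theorem s_inj {i j : ℕ} (hi : i < C.m) (hj : j < C.m) (h : C.s i = C.s j) : i = j := by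
  rw [← C.o_s i hi, h, C.o_s j hj]

theorem m_pos (v : V) : 0 < C.m := lt_of_le_of_lt (Nat.zero_le _) (C.o_lt v)

theorem adj_succ {i : ℕ} (hi : i + 1 < C.m) : G.Adj (C.s i) (C.s (i + 1)) := by
  rw [C.adj_iff, C.o_s i (by omega), C.o_s _ hi]
  exact Or.inl ⟨rfl, rfl, Or.inl rfl⟩

theorem adj_ow {v : V} (h : C.ow v ≠ v) : G.Adj v (C.ow v) := by
  rw [C.adj_iff, C.o_ow]
  exact Or.inr ⟨rfl, h.symm, Or.inr rfl⟩

theorem adj_leaf_iff {v w : V} (h : C.ow v ≠ v) : G.Adj v w ↔ w = C.ow v := by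
  constructor
  · intro hw
    rcases (C.adj_iff v w).1 hw with h1 | ⟨h1, h2, h3 | h3⟩
    · exact absurd h1.1.symm h
    · exact absurd h3.symm h
    · rw [h3, ← h1]; rfl
  · rintro rfl; exact C.adj_ow h

theorem o_of_adj {v w : V} (h : G.Adj v w) :
    C.o v = C.o w ∨ C.o v + 1 = C.o w ∨ C.o w + 1 = C.o v := by
  rcases (C.adj_iff v w).1 h with h1 | h1
  · exact Or.inr h1.2.2
  · exact Or.inl h1.1

open Classical in
/-- `1` if some leaf at the `i`-th spine vertex is not in `X`, and `0` otherwise. -/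
noncomputable def vac (X : Finset V) (i : ℕ) : ℕ :=
  if ∃ v, C.o v = i ∧ C.ow v ≠ v ∧ v ∉ X then 1 else 0

theorem vac_le_one (X : Finset V) (i : ℕ) : C.vac X i ≤ 1 := by
  unfold vac; split_ifs <;> omega

theorem vac_le_vac {X Y : Finset V} {i j : ℕ} (h : ∀ v, C.o v = i → C.ow v ≠ v → v ∉ X →
    ∃ w, C.o w = j ∧ C.ow w ≠ w ∧ w ∉ Y) : C.vac X i ≤ C.vac Y j := by
  unfold vac
  split_ifs with h1 h2
  · rfl
  · obtain ⟨v, a, b, c⟩ := h1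
    exact absurd (h v a b c) h2
  · omega
  · omega

theorem vac_mirror (X : Finset V) {i : ℕ} (hi : i < C.m) :
    C.mirror.vac X (C.m - 1 - i) = C.vac X i := by
  have h : (∃ v, C.mirror.o v = C.m - 1 - i ∧ C.mirror.ow v ≠ v ∧ v ∉ X) ↔
      ∃ v, C.o v = i ∧ C.ow v ≠ v ∧ v ∉ X := by
    refine exists_congr fun v => ?_
    have := C.o_lt v
    rw [mirror_ow, mirror_o, show (C.m - 1 - C.o v = C.m - 1 - i) ↔ C.o v = i by omega]
  unfold vac
  by_cases hh : ∃ v, C.o v = i ∧ C.ow v ≠ v ∧ v ∉ X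
  · rw [if_pos hh, if_pos (h.2 hh)]
  · rw [if_neg hh, if_neg (mt h.1 hh)]

theorem vac_mirror' (X : Finset V) {i : ℕ} (hi : i < C.m) :
    C.mirror.vac X i = C.vac X (C.m - 1 - i) := by
  rw [← C.vac_mirror X (by omega)]; congr 1; omega

/-- Every window of the spine that is free of `X` is short. -/
def Ok (k : ℕ) (X : Finset V) : Prop :=
  -- Windows with a single vertex are left out: leaf, spine vertex, leaf is a path on three vertices
  -- only, which is less than `k`.
  ∀ a b, a < b → b < C.m → (∀ i, a ≤ i → i ≤ b → C.s i ∉ X) →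
    (b - a + 1) + C.vac X a + C.vac X b < k

theorem Ok.mirror {C : Spine G} {k : ℕ} {X : Finset V} (h : C.Ok k X) : C.mirror.Ok k X := by
  intro a b hab hb hX
  rw [mirror_m] at hb
  have := h (C.m - 1 - b) (C.m - 1 - a) (by omega) (by omega) (by
    intro i h1 h2 h3
    apply hX (C.m - 1 - i) (by omega) (by omega)
    rw [mirror_s]
    rwa [show C.m - 1 - (C.m - 1 - i) = i by omega])
  rw [C.vac_mirror' X (by omega), C.vac_mirror' X (by omega)]
  omega

/-- The path starts at a vacant leaf of `a`, if there is one, runs through the window and ends at a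
vacant leaf of `b`, if there is one. Only the first `k` values of `p` matter, so a window that is
longer than needed is simply cut off. -/
theorem exists_path {k : ℕ} {X : Finset V} {a b : ℕ} (hab : a < b) (hb : b < C.m)
    (hX : ∀ i, a ≤ i → i ≤ b → C.s i ∉ X)
    (hw : k ≤ (b - a + 1) + C.vac X a + C.vac X b) :
    ∃ p : ℕ → V, (∀ i, i + 1 < k → G.Adj (p i) (p (i + 1))) ∧
      (∀ i j, i < k → j < k → p i = p j → i = j) ∧ ∀ i < k, p i ∉ X := by
  by_cases hy : ∃ v, C.o v = b ∧ C.ow v ≠ v ∧ v ∉ X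
  · obtain ⟨y, hyb, hy1, hyX⟩ := hy
    have hvb : C.vac X b ≤ 1 := C.vac_le_one X b
    have hyadj := C.adj_ow hy1
    by_cases hx : ∃ v, C.o v = a ∧ C.ow v ≠ v ∧ v ∉ X
    · obtain ⟨x, hxa, hx1, hxX⟩ := hx
      have hva : C.vac X a ≤ 1 := C.vac_le_one X a
      have hxadj := C.adj_ow hx1
      have hxs : ∀ i, i < C.m → C.s i ≠ x := fun i hi h => hx1 (by rw [← h, C.ow_s hi])
      have hys : ∀ i, i < C.m → C.s i ≠ y := fun i hi h => hy1 (by rw [← h, C.ow_s hi])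
      have hxy : x ≠ y := by rintro rfl; omega
      refine ⟨fun i => if i = 0 then x else if i ≤ b - a + 1 then C.s (a + i - 1) else y,
        ?_, ?_, ?_⟩
      · intro i hi
        rcases Nat.eq_zero_or_pos i with rfl | h0
        · simp only [if_true, show ¬ (0 + 1 = 0) by omega, if_false,
            show 0 + 1 ≤ b - a + 1 by omega, show a + (0 + 1) - 1 = a by omega]
          rwa [ow, hxa] at hxadj
        · simp only [show ¬ i = 0 by omega, show ¬ (i + 1 = 0) by omega, if_false]
          by_cases h1 : i + 1 ≤ b - a + 1
          · simp only [h1, show i ≤ b - a + 1 by omega, if_true]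
            have := C.adj_succ (i := a + i - 1) (by omega)
            rwa [show a + i - 1 + 1 = a + (i + 1) - 1 by omega] at this
          · simp only [h1, show i ≤ b - a + 1 by omega, if_true, if_false]
            rw [ow, hyb] at hyadj
            rw [show a + i - 1 = b by omega]
            exact hyadj.symm
      · intro i j hi hj hij
        dsimp only at hij
        split_ifs at hij with h1 h2 h3 h4 h5 h6 h7
        · omega
        · exact absurd hij.symm (hxs _ (by omega))
        · exact absurd hij hxy
        · exact absurd hij (hxs _ (by omega))
        · have := C.s_inj (by omega) (by omega) hij; omega
        · exact absurd hij (hys _ (by omega))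
        · exact absurd hij.symm hxy
        · exact absurd hij.symm (hys _ (by omega))
        · omega
      · intro i hi
        dsimp only
        split_ifs with h1 h2
        · exact hxX
        · exact hX _ (by omega) (by omega)
        · exact hyX
    · have hva : C.vac X a = 0 := by rw [vac, if_neg hx]
      have hys : ∀ i, i < C.m → C.s i ≠ y := fun i hi h => hy1 (by rw [← h, C.ow_s hi])
      refine ⟨fun i => if i ≤ b - a then C.s (a + i) else y, ?_, ?_, ?_⟩
      · intro i hi
        dsimp only
        by_cases h1 : i + 1 ≤ b - a
        · simp only [h1, show i ≤ b - a by omega, if_true]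
          exact C.adj_succ (i := a + i) (by omega)
        · simp only [h1, show i ≤ b - a by omega, if_true, if_false]
          rw [ow, hyb] at hyadj
          rw [show a + i = b by omega]
          exact hyadj.symm
      · intro i j hi hj hij
        dsimp only at hij
        split_ifs at hij with h1 h2 h3
        · have := C.s_inj (by omega) (by omega) hij; omega
        · exact absurd hij (hys _ (by omega))
        · exact absurd hij.symm (hys _ (by omega))
        · omega
      · intro i hi
        dsimp only
        split_ifs with h1
        · exact hX _ (by omega) (by omega)
        · exact hyX
  · have hvb : C.vac X b = 0 := by rw [vac, if_neg hy]
    by_cases hx : ∃ v, C.o v = a ∧ C.ow v ≠ v ∧ v ∉ X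
    · obtain ⟨x, hxa, hx1, hxX⟩ := hx
      have hva : C.vac X a ≤ 1 := C.vac_le_one X a
      have hxadj := C.adj_ow hx1
      have hxs : ∀ i, i < C.m → C.s i ≠ x := fun i hi h => hx1 (by rw [← h, C.ow_s hi])
      refine ⟨fun i => if i = 0 then x else C.s (a + i - 1), ?_, ?_, ?_⟩
      · intro i hi
        rcases Nat.eq_zero_or_pos i with rfl | h0
        · simp only [if_true, show ¬ (0 + 1 = 0) by omega, if_false,
            show a + (0 + 1) - 1 = a by omega]
          rwa [ow, hxa] at hxadj
        · simp only [show ¬ i = 0 by omega, show ¬ (i + 1 = 0) by omega, if_false]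
          have := C.adj_succ (i := a + i - 1) (by omega)
          rwa [show a + i - 1 + 1 = a + (i + 1) - 1 by omega] at this
      · intro i j hi hj hij
        dsimp only at hij
        split_ifs at hij with h1 h2 h3
        · omega
        · exact absurd hij.symm (hxs _ (by omega))
        · exact absurd hij (hxs _ (by omega))
        · have := C.s_inj (by omega) (by omega) hij; omega
      · intro i hi
        dsimp only
        split_ifs with h1
        · exact hxX
        · exact hX _ (by omega) (by omega)
    · have hva : C.vac X a = 0 := by rw [vac, if_neg hx]
      refine ⟨fun i => C.s (a + i), ?_, ?_, ?_⟩
      · intro i hi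
        exact C.adj_succ (i := a + i) (by omega)
      · intro i j hi hj hij
        have := C.s_inj (by omega) (by omega) hij; omega
      · intro i hi
        exact hX _ (by omega) (by omega)

/-- An inner vertex of a path has two distinct neighbours and hence is no leaf. So `p 1, …, p (k -
2)` run along the spine without turning back, in the direction given by `hdir`. Each end vertex is
either one more spine vertex of the window or a vacant leaf counted by `vac`; either way it adds
one. -/
theorem not_ok_of_path {k : ℕ} (hk : 4 ≤ k) {X : Finset V} {p : ℕ → V}
    (hadj : ∀ i, i + 1 < k → G.Adj (p i) (p (i + 1)))
    (hinj : ∀ i j, i < k → j < k → p i = p j → i = j) (hX : ∀ i < k, p i ∉ X)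
    (hdir : C.o (p 2) = C.o (p 1) + 1) : ¬ C.Ok k X := by
  have hsp : ∀ i, 0 < i → i + 1 < k → p i = C.ow (p i) := by
    intro i h0 h1
    by_contra hne
    have e1 := (C.adj_leaf_iff (Ne.symm hne)).1 (hadj i h1)
    have e2 := hadj (i - 1) (by omega)
    rw [show i - 1 + 1 = i by omega] at e2
    have e3 := (C.adj_leaf_iff (Ne.symm hne)).1 e2.symm
    have := hinj _ _ (by omega) (by omega) (e1.trans e3.symm)
    omega
  have hstep : ∀ i, 0 < i → i + 2 < k → C.o (p (i + 1)) = C.o (p i) + 1 := by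
    intro i h0
    induction i with
    | zero => omega
    | succ j ih =>
      intro h2
      rcases Nat.eq_zero_or_pos j with rfl | hj
      · exact hdir
      · have e := ih hj (by omega)
        have a1 := hsp (j + 1) (by omega) (by omega)
        have a2 := hsp (j + 1 + 1) (by omega) (by omega)
        have a3 := hsp j (by omega) (by omega)
        rcases C.o_of_adj (hadj (j + 1) (by omega)) with h | h | h
        · exfalso
          have : p (j + 1) = p (j + 1 + 1) := by rw [a1, a2, ow, ow, h]
          have := hinj _ _ (by omega) (by omega) this; omega
        · omega
        · exfalso
          have : p j = p (j + 1 + 1) := by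
            rw [a3, a2, ow, ow]; congr 1; omega
          have := hinj _ _ (by omega) (by omega) this; omega
  have hpos : ∀ i, i + 2 < k → C.o (p (1 + i)) = C.o (p 1) + i := by
    intro i
    induction i with
    | zero => intro _; rfl
    | succ j ih =>
      intro h
      have := hstep (1 + j) (by omega) (by omega)
      rw [show 1 + (j + 1) = 1 + j + 1 by omega, this, ih (by omega)]; omega
  have hlast := hpos (k - 3) (by omega)
  rw [show 1 + (k - 3) = k - 2 by omega] at hlast
  have hmid : ∀ i, C.o (p 1) ≤ i → i ≤ C.o (p (k - 2)) → C.s i ∉ X := by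
    intro i h1 h2
    have e := hpos (i - C.o (p 1)) (by omega)
    have e2 := hsp (1 + (i - C.o (p 1))) (by omega) (by omega)
    have e3 : C.s i = p (1 + (i - C.o (p 1))) := by
      rw [e2, ow, e]; congr 1; omega
    rw [e3]; exact hX _ (by omega)
  have hm := C.o_lt (p (k - 2))
  -- The vertex `p 0` either moves the left end of the window one step outwards or is a vacant leaf
  -- at that end.
  obtain ⟨a, ha1, ha2, ha3⟩ : ∃ a, a ≤ C.o (p 1) ∧ 1 ≤ C.o (p 1) - a + C.vac X a ∧
      ∀ i, a ≤ i → i < C.o (p 1) → C.s i ∉ X := by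
    by_cases h0 : C.ow (p 0) = p 0
    · have a0 := hX 0 (by omega)
      have a1 := hsp 1 (by omega) (by omega)
      have a2 := hsp 2 (by omega) (by omega)
      rcases C.o_of_adj (hadj 0 (by omega)) with h | h | h
      · exfalso
        have : p 0 = p (0 + 1) := by rw [← h0, zero_add, a1, ow, ow, h]
        have := hinj _ _ (by omega) (by omega) this; omega
      · rw [zero_add] at h
        refine ⟨C.o (p 0), by omega, by omega, fun i h1 h2 => ?_⟩
        rw [show i = C.o (p 0) by omega]
        rw [← h0] at a0; exact a0
      · exfalso
        rw [zero_add] at h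
        have : p 0 = p 2 := by rw [← h0, a2, ow, ow, hdir, h]
        have := hinj _ _ (by omega) (by omega) this; omega
    · have e := (C.adj_leaf_iff h0).1 (hadj 0 (by omega))
      refine ⟨C.o (p 1), le_rfl, ?_, fun i h1 h2 => by omega⟩
      have : C.vac X (C.o (p 1)) = 1 :=
        if_pos ⟨p 0, by rw [← C.o_ow (p 0), ← e], h0, hX 0 (by omega)⟩
      omega
  obtain ⟨b, hb1, hb2, hb3, hb4⟩ : ∃ b, C.o (p (k - 2)) ≤ b ∧ b < C.m ∧
      1 ≤ b - C.o (p (k - 2)) + C.vac X b ∧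
      ∀ i, C.o (p (k - 2)) < i → i ≤ b → C.s i ∉ X := by
    have hadj' := hadj (k - 2) (by omega)
    rw [show k - 2 + 1 = k - 1 by omega] at hadj'
    have hprev := hstep (k - 3) (by omega) (by omega)
    rw [show k - 3 + 1 = k - 2 by omega] at hprev
    by_cases h0 : C.ow (p (k - 1)) = p (k - 1)
    · have a0 := hX (k - 1) (by omega)
      have a1 := hsp (k - 2) (by omega) (by omega)
      have a2 := hsp (k - 3) (by omega) (by omega)
      rcases C.o_of_adj hadj' with h | h | h
      · exfalso
        have : p (k - 1) = p (k - 2) := by rw [← h0, a1, ow, ow, h]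
        have := hinj _ _ (by omega) (by omega) this; omega
      · refine ⟨C.o (p (k - 1)), by omega, C.o_lt _, by omega, fun i h1 h2 => ?_⟩
        rw [show i = C.o (p (k - 1)) by omega]
        rw [← h0] at a0; exact a0
      · exfalso
        have : p (k - 1) = p (k - 3) := by
          rw [← h0, a2, ow, ow]; congr 1; omega
        have := hinj _ _ (by omega) (by omega) this; omega
    · have e := (C.adj_leaf_iff h0).1 hadj'.symm
      refine ⟨C.o (p (k - 2)), le_rfl, hm, ?_, fun i h1 h2 => by omega⟩
      have : C.vac X (C.o (p (k - 2))) = 1 :=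
        if_pos ⟨p (k - 1), by rw [← C.o_ow (p (k - 1)), ← e], h0, hX (k - 1) (by omega)⟩
      omega
  intro hok
  have := hok a b (by omega) hb2 (by
    intro i h1 h2
    by_cases c1 : i < C.o (p 1)
    · exact ha3 i h1 c1
    · by_cases c2 : i ≤ C.o (p (k - 2))
      · exact hmid i (by omega) c2
      · exact hb4 i (by omega) h2)
  omega

theorem isPVC_iff_ok {k : ℕ} (hk : 4 ≤ k) {X : Finset V} : IsPVC G k X ↔ C.Ok k X := by
  rw [isPVC_iff_forall_fun (by omega)]
  constructor
  · intro h a b hab hb hX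
    by_contra hw
    obtain ⟨p, h1, h2, h3⟩ := C.exists_path hab hb hX (k := k) (by omega)
    obtain ⟨i, hi, hiX⟩ := h p h1 h2
    exact h3 i hi hiX
  · intro hok p hadj hinj
    by_contra! hX
    have h12 := hadj 1 (by omega)
    have hne : ∀ i, 0 < i → i < 3 → C.ow (p i) = p i := by
      intro i h0 h3
      by_contra hne
      have e1 := (C.adj_leaf_iff hne).1 (hadj i (by omega))
      have e2 := hadj (i - 1) (by omega)
      rw [show i - 1 + 1 = i by omega] at e2
      have e3 := (C.adj_leaf_iff hne).1 e2.symm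
      have := hinj _ _ (by omega) (by omega) (e1.trans e3.symm)
      omega
    -- A path may traverse the spine in either direction; the decreasing case is the increasing one
    -- on the mirrored spine.
    rcases C.o_of_adj h12 with h | h | h
    · have : p 1 = p (1 + 1) := by
        rw [← hne 1 (by omega) (by omega), ← hne (1 + 1) (by omega) (by omega), ow, ow, h]
      have := hinj _ _ (by omega) (by omega) this; omega
    · exact C.not_ok_of_path hk hadj hinj hX h.symm hok
    · refine C.mirror.not_ok_of_path hk hadj hinj hX ?_ hok.mirror
      have := C.o_lt (p 1)
      have := C.o_lt (p 2)
      simp only [mirror_o]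
      norm_num at h
      omega

end Spine
end Spine
-- Token-sliding sequences as lists of slides
section Logs

variable {V : Type u} [DecidableEq V]

/-- The set `X` after a token has moved from `x` to `y`. -/
def mv (X : Finset V) (x y : V) : Finset V := insert y (X.erase x)

theorem mem_mv {X : Finset V} {x y v : V} : v ∈ mv X x y ↔ v = y ∨ (v ≠ x ∧ v ∈ X) := by
  simp [mv]

theorem card_mv {X : Finset V} {x y : V} (hx : x ∈ X) (hy : y ∉ X) :
    (mv X x y).card = X.card := by
  rw [mv, Finset.card_insert_of_notMem (fun h => hy (Finset.mem_of_mem_erase h)),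
    Finset.card_erase_of_mem hx]
  have := Finset.card_pos.2 ⟨x, hx⟩
  omega

theorem mv_mv {X : Finset V} {x y : V} (hx : x ∈ X) (hy : y ∉ X) : mv (mv X x y) y x = X := by
  ext v
  simp only [mem_mv]
  by_cases h1 : v = x
  · subst h1; simp [hx]
  · by_cases h2 : v = y
    · subst h2; simp [h1, hy]
    · simp [h1, h2]

/-- Replaces the two set differences by the update `mv`, the form in which positions are tracked
throughout. -/
theorem slides_iff {G : SimpleGraph V} {X Y : Finset V} {x y : V} :
    Slides G X Y x y ↔ G.Adj x y ∧ x ∈ X ∧ y ∉ X ∧ Y = mv X x y := by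
  unfold Slides
  constructor
  · rintro ⟨h1, h2, h3⟩
    have hx : x ∈ X \ Y := by rw [h2]; simp
    have hy : y ∈ Y \ X := by rw [h3]; simp
    rw [Finset.mem_sdiff] at hx hy
    refine ⟨h1, hx.1, hy.2, ?_⟩
    ext v
    have e2 := congrArg (fun S => v ∈ S) h2
    have e3 := congrArg (fun S => v ∈ S) h3
    simp only [Finset.mem_sdiff, Finset.mem_singleton, eq_iff_iff] at e2 e3
    rw [mem_mv]
    by_cases a1 : v = x
    · subst a1
      have : v ≠ y := h1.ne
      simp [this, hx.2]
    · by_cases a2 : v = y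
      · subst a2; simp [hy.1]
      · simp [a1, a2] at e2 e3 ⊢
        exact ⟨e3, e2⟩
  · rintro ⟨h1, hx, hy, rfl⟩
    have hne := h1.ne
    refine ⟨h1, ?_, ?_⟩ <;>
    · ext v
      simp only [Finset.mem_sdiff, mem_mv, Finset.mem_singleton]
      by_cases a1 : v = x <;> by_cases a2 : v = y <;> simp_all

/-- `Log G k I l X`: the slides in the list `l` lead from `I` to `X`. -/
inductive Log (G : SimpleGraph V) (k : ℕ) (I : Finset V) : List (V × V) → Finset V → Prop
  | nil (h : IsPVC G k I) : Log G k I [] I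
  | snoc {l : List (V × V)} {X : Finset V} {x y : V} (h : Log G k I l X) (hadj : G.Adj x y)
      (hx : x ∈ X) (hy : y ∉ X) (hX : IsPVC G k (mv X x y)) :
      Log G k I (l ++ [(x, y)]) (mv X x y)

namespace Log

variable {G : SimpleGraph V} {k : ℕ} {I X Y : Finset V} {l l' : List (V × V)}

theorem isPVC_left (h : Log G k I l X) : IsPVC G k I := by
  induction h with
  | nil h => exact h
  | snoc _ _ _ _ _ ih => exact ih

theorem isPVC_right (h : Log G k I l X) : IsPVC G k X := by
  cases h with
  | nil h => exact h
  | snoc _ _ _ _ h => exact h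

theorem card_eq (h : Log G k I l X) : X.card = I.card := by
  induction h with
  | nil h => rfl
  | snoc _ _ hx hy _ ih => rw [card_mv hx hy, ih]

theorem append (h : Log G k I l X) (h' : Log G k X l' Y) : Log G k I (l ++ l') Y := by
  induction h' with
  | nil _ => simpa using h
  | snoc _ hadj hx hy hX ih => rw [← List.append_assoc]; exact ih.snoc hadj hx hy hX

theorem single {x y : V} (h : IsPVC G k X) (hadj : G.Adj x y) (hx : x ∈ X) (hy : y ∉ X)
    (hX : IsPVC G k (mv X x y)) : Log G k X [(x, y)] (mv X x y) :=
  (Log.nil h).snoc hadj hx hy hX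

/-- Sliding back restores the previous position (`mv_mv`), which is a cover as well. This makes
reachability symmetric and lets two sequences with a common end be joined. -/
theorem reverse (h : Log G k I l X) : Log G k X (l.reverse.map Prod.swap) I := by
  induction h with
  | nil h => exact .nil h
  | @snoc l X x y h hadj hx hy hX ih =>
    have h1 : y ∈ mv X x y := mem_mv.2 (Or.inl rfl)
    have h2 : x ∉ mv X x y := by
      rw [mem_mv]; rintro (h | h)
      · exact hadj.ne h
      · exact h.1 rfl
    have := single hX hadj.symm h1 h2 (by rw [mv_mv hx hy]; exact h.isPVC_right)
    rw [mv_mv hx hy] at this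
    simpa using this.append ih

theorem exists_seq (h : Log G k I l X) : ∃ S : ℕ → Finset V, IsTSSequence G k l.length S ∧
    S 0 = I ∧ S l.length = X ∧
    ∀ (i : ℕ) (hi : i < l.length), Slides G (S i) (S (i + 1)) (l[i]).1 (l[i]).2 := by
  induction h with
  | nil h =>
    exact ⟨fun _ => I, ⟨fun _ _ => h, fun i hi => absurd hi (Nat.not_lt_zero _)⟩, rfl, rfl,
      fun i hi => absurd hi (Nat.not_lt_zero _)⟩
  | @snoc l X x y h hadj hx hy hX ih =>
    obtain ⟨S, hS, h0, hq, hsl⟩ := ih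
    have key : ∀ (i : ℕ) (hi : i < (l ++ [(x, y)]).length),
        Slides G ((fun j => if j ≤ l.length then S j else mv X x y) i)
          ((fun j => if j ≤ l.length then S j else mv X x y) (i + 1))
          ((l ++ [(x, y)])[i]).1 ((l ++ [(x, y)])[i]).2 := by
      intro i hi
      simp only [List.length_append, List.length_singleton] at hi
      by_cases h1 : i < l.length
      · simp only [show i ≤ l.length by omega, show i + 1 ≤ l.length by omega, if_true,
          List.getElem_append_left h1]
        exact hsl i h1
      · have e : i = l.length := by omega
        subst e
        simp only [le_refl, if_true, show ¬ (l.length + 1 ≤ l.length) by omega, if_false, hq,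
          List.getElem_append_right (le_refl _), Nat.sub_self, List.getElem_cons_zero]
        exact slides_iff.2 ⟨hadj, hx, hy, rfl⟩
    refine ⟨fun j => if j ≤ l.length then S j else mv X x y, ⟨?_, ?_⟩, by simp [h0], by simp, key⟩
    · intro i hi
      split_ifs with h1
      · exact hS.isPVC i h1
      · exact hX
    · intro i hi
      exact ⟨_, _, key i hi⟩

theorem reachable (h : Log G k I l X) : Reachable G k I X := by
  obtain ⟨S, hS, h0, hq, -⟩ := h.exists_seq
  exact ⟨_, S, hS, h0, hq⟩

end Log

theorem reachable_iff_log {G : SimpleGraph V} {k : ℕ} {I J : Finset V} :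
    Reachable G k I J ↔ ∃ l, Log G k I l J := by
  constructor
  · rintro ⟨q, S, hS, rfl, rfl⟩
    have : ∀ i, i ≤ q → ∃ l, Log G k (S 0) l (S i) := by
      intro i
      induction i with
      | zero => intro _; exact ⟨[], .nil (hS.isPVC 0 (Nat.zero_le _))⟩
      | succ i ih =>
        intro hi
        obtain ⟨l, hl⟩ := ih (by omega)
        obtain ⟨x, y, hxy⟩ := hS.slides i (by omega)
        obtain ⟨h1, h2, h3, h4⟩ := slides_iff.1 hxy
        have := hS.isPVC (i + 1) hi
        rw [h4] at this ⊢
        exact ⟨_, hl.snoc h1 h2 h3 this⟩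
    exact this q le_rfl
  · rintro ⟨l, h⟩; exact h.reachable

theorem Reachable.symm {G : SimpleGraph V} {k : ℕ} {I J : Finset V} (h : Reachable G k I J) :
    Reachable G k J I := by
  obtain ⟨l, hl⟩ := reachable_iff_log.1 h
  exact hl.reverse.reachable

theorem Reachable.trans {G : SimpleGraph V} {k : ℕ} {I J K : Finset V} (h : Reachable G k I J)
    (h' : Reachable G k J K) : Reachable G k I K := by
  obtain ⟨l, hl⟩ := reachable_iff_log.1 h
  obtain ⟨l', hl'⟩ := reachable_iff_log.1 h'
  exact (hl.append hl').reachable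

theorem Reachable.card_eq {G : SimpleGraph V} {k : ℕ} {I J : Finset V} (h : Reachable G k I J) :
    J.card = I.card := by
  obtain ⟨l, hl⟩ := reachable_iff_log.1 h
  exact hl.card_eq

/-- Reachability is symmetric and transitive, so both positions reach the same positions. -/
theorem Reachable.rigidSet_eq {G : SimpleGraph V} {k : ℕ} {I J : Finset V}
    (h : Reachable G k I J) : rigidSet G k I = rigidSet G k J := by
  have key : ∀ {I J : Finset V}, Reachable G k I J → rigidSet G k I ⊆ rigidSet G k J := by
    intro I J h u hu
    exact ⟨hu.2 J h, fun K hK => hu.2 K (h.trans hK)⟩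
  exact Set.Subset.antisymm (key h) (key h.symm)

end Logs

/-! ### Extremality of blocked sets of integers -/

section Counting

/-- `P` is packed to the right as tightly as the `Bad` intervals allow: each block of `P` that ends
before `f` is held by a `Bad` interval that contains no other element of `P`. Any `Q` of the same
size that meets all `Bad` intervals therefore runs ahead of `P`. The proof takes the first prefix
where this fails. Its last element is in `P` but not in `Q`, and the interval that holds it exposes
a shorter prefix where it fails too. -/
theorem count_le_count_of_fixed {f : ℕ} {P Q : ℕ → Prop} [DecidablePred P] [DecidablePred Q]
    (Bad : ℕ → ℕ → Prop) (hQ : ∀ a b, b < f → Bad a b → ∃ i, a ≤ i ∧ i ≤ b ∧ Q i)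
    (hP : ∀ i, i + 1 < f → P i → ¬ P (i + 1) →
      ∃ a, a < i ∧ Bad a i ∧ ∀ j, a ≤ j → j < i → ¬ P j)
    (hc : Nat.count P f = Nat.count Q f) : ∀ i, i ≤ f → Nat.count P i ≤ Nat.count Q i := by
  by_contra! hcon
  have hex : ∃ i, i ≤ f ∧ Nat.count Q i < Nat.count P i := hcon
  classical
  obtain ⟨hif, hlt⟩ := Nat.find_spec hex
  have hmin := fun j => @Nat.find_min _ _ hex j
  generalize Nat.find hex = i at *
  rcases i with _ | i
  · simp at hlt
  have hle : Nat.count P i ≤ Nat.count Q i := by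
    by_contra h
    exact hmin i (by omega) ⟨by omega, by omega⟩
  rw [Nat.count_succ, Nat.count_succ] at hlt
  have hPi : P i := by
    by_contra h
    rw [if_neg h] at hlt; split_ifs at hlt <;> omega
  have hQi : ¬ Q i := by
    intro h
    rw [if_pos h] at hlt; split_ifs at hlt; omega
  rw [if_pos hPi, if_neg hQi] at hlt
  -- the block of elements of `P` from `i` on does not reach `f`
  have hblock : ∃ j, i ≤ j ∧ j + 1 < f ∧ (∀ t, i ≤ t → t ≤ j → P t) ∧ ¬ P (j + 1) := by
    by_contra! hno
    have hall : ∀ t, i + t < f → ∀ t', t' ≤ t → P (i + t') := by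
      intro t
      induction t with
      | zero => intro _ t' ht'; rw [Nat.le_zero.1 ht']; exact hPi
      | succ t ih =>
        intro ht t' ht'
        have ih' := ih (by omega)
        rcases Nat.lt_or_ge t' (t + 1) with h | h
        · exact ih' t' (by omega)
        · rw [show t' = t + 1 by omega]
          apply hno (i + t) (by omega) (by omega)
          intro r h1 h2
          have := ih' (r - i) (by omega)
          rwa [show i + (r - i) = r by omega] at this
    have e1 : Nat.count P f = Nat.count P i + (f - i) := by
      conv_lhs => rw [show f = i + (f - i) by omega]
      rw [Nat.count_add]
      congr 1
      rw [Nat.count_iff_forall]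
      intro t ht
      exact hall t (by omega) t le_rfl
    have e2 : Nat.count Q f ≤ Nat.count Q (i + 1) + (f - (i + 1)) := by
      conv_lhs => rw [show f = (i + 1) + (f - (i + 1)) by omega]
      rw [Nat.count_add]
      exact Nat.add_le_add_left (Nat.count_le _) _
    rw [Nat.count_succ, if_neg hQi] at e2
    omega
  obtain ⟨j, hij, hjf, hall, hj⟩ := hblock
  obtain ⟨a, haj, hbad, hemp⟩ := hP j hjf (hall j hij le_rfl) hj
  -- The interval that holds `j` has no element of `P` before `j`, so the block consists of `i`
  -- alone.
  have hji : j = i := by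
    by_contra hne
    exact hemp (j - 1) (by omega) (by omega) (hall _ (by omega) (by omega))
  subst hji
  -- `Q` has an element in the interval before `j` and `P` has none, so already the prefix up to `a`
  -- is a counterexample.
  obtain ⟨t, h1, h2, h3⟩ := hQ a j (by omega) hbad
  have htj : t < j := lt_of_le_of_ne h2 (fun h => hQi (h ▸ h3))
  have c1 : Nat.count Q a < Nat.count Q j :=
    lt_of_le_of_lt (Nat.count_monotone Q h1) (Nat.count_strict_mono h3 htj)
  have c2 : Nat.count P a = Nat.count P j := by
    conv_rhs => rw [show j = a + (j - a) by omega]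
    rw [Nat.count_add]
    have : Nat.count (fun r => P (a + r)) (j - a) = 0 := by
      rw [Nat.count_iff_forall_not]
      intro r hr
      exact hemp _ (by omega) (by omega)
    omega
  exact hmin a (by omega) ⟨by omega, by omega⟩

end Counting
/-! ### Normal positions -/

namespace Spine

variable {V : Type u} {G : SimpleGraph V} (C : Spine G)

/-- Every token on a leaf is accompanied by a token on the neighbour of the leaf. -/
def Norm (X : Finset V) : Prop := ∀ v ∈ X, C.ow v ∈ X

variable [DecidableEq V]

/-- The tokens on leaves. -/
def leafTok (X : Finset V) : Finset V := X.filter fun v => C.ow v ≠ v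

/-- The number of tokens in the stars before the `f`-th one. -/
def below (X : Finset V) (f : ℕ) : ℕ := (X.filter fun v => C.o v < f).card

/-- The number of tokens on the spine before the `f`-th spine vertex. -/
def cnt (X : Finset V) (f : ℕ) : ℕ := Nat.count (fun i => C.s i ∈ X) f

/-- No token can slide from a spine vertex to the next one. -/
def RightFixed (k : ℕ) (X : Finset V) : Prop :=
  ∀ i, i + 1 < C.m → C.s i ∈ X → C.s (i + 1) ∉ X → ¬ IsPVC G k (mv X (C.s i) (C.s (i + 1)))

/-- All spine vertices are occupied. -/
def Full (X : Finset V) : Prop := ∀ i, i < C.m → C.s i ∈ X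

theorem norm_mirror {X : Finset V} : C.mirror.Norm X ↔ C.Norm X := by simp [Norm]

theorem leafTok_mirror (X : Finset V) : C.mirror.leafTok X = C.leafTok X := by
  simp [leafTok]

theorem full_mirror {X : Finset V} : C.mirror.Full X ↔ C.Full X := by
  constructor
  · intro h i hi
    have := h (C.m - 1 - i) (by rw [mirror_m]; omega)
    rwa [mirror_s, show C.m - 1 - (C.m - 1 - i) = i by omega] at this
  · intro h i hi
    rw [mirror_m] at hi
    exact h _ (by omega)

theorem rightFixed_mirror_mirror {k : ℕ} {X : Finset V} :
    C.mirror.mirror.RightFixed k X ↔ C.RightFixed k X := by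
  have : ∀ i, i < C.m → C.mirror.mirror.s i = C.s i := by
    intro i hi
    rw [mirror_s, mirror_s, mirror_m]; congr 1; omega
  unfold RightFixed
  refine forall_congr' fun i => ?_
  refine forall_congr' fun hi => ?_
  have hi' : i + 1 < C.m := hi
  rw [this i (by omega), this (i + 1) hi']

theorem mem_leafTok {X : Finset V} {v : V} : v ∈ C.leafTok X ↔ v ∈ X ∧ C.ow v ≠ v := by
  simp [leafTok]

theorem leaf_ne_s {v : V} (h : C.ow v ≠ v) {i : ℕ} (hi : i < C.m) : C.s i ≠ v := by
  rintro rfl; exact h (C.ow_s hi)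

theorem card_spine_below (X : Finset V) {f : ℕ} (hf : f ≤ C.m) :
    (X.filter fun v => C.ow v = v ∧ C.o v < f).card = C.cnt X f := by
  rw [cnt, Nat.count_eq_card_filter_range]
  refine Finset.card_nbij' C.o C.s ?_ ?_ ?_ ?_
  · intro v hv
    simp only [Finset.coe_filter, Set.mem_ofPred_eq, Finset.mem_range] at hv ⊢
    refine ⟨hv.2.2, ?_⟩
    have := hv.2.1
    rw [ow] at this
    rw [this]; exact hv.1
  · intro i hi
    simp only [Finset.coe_filter, Set.mem_ofPred_eq, Finset.mem_range] at hi ⊢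
    exact ⟨hi.2, C.ow_s (by omega), by rw [C.o_s _ (by omega)]; exact hi.1⟩
  · intro v hv
    simp only [Finset.coe_filter, Set.mem_ofPred_eq] at hv
    exact hv.2.1
  · intro i hi
    simp only [Finset.coe_filter, Set.mem_ofPred_eq, Finset.mem_range] at hi
    exact C.o_s _ (by omega)

theorem below_eq (X : Finset V) {f : ℕ} (hf : f ≤ C.m) :
    C.below X f = C.cnt X f + C.below (C.leafTok X) f := by
  rw [← C.card_spine_below X hf, below, below, leafTok, ← Finset.card_union_of_disjoint]
  · congr 1; ext v
    simp only [Finset.mem_filter, Finset.mem_union]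
    tauto
  · rw [Finset.disjoint_left]
    intro v h1 h2
    simp only [Finset.mem_filter] at h1 h2
    exact h2.1.2 h1.2.1

theorem below_m (X : Finset V) : C.below X C.m = X.card := by
  rw [below, Finset.filter_true_of_mem]
  intro v _; exact C.o_lt v

theorem card_eq (X : Finset V) : X.card = C.cnt X C.m + (C.leafTok X).card := by
  rw [← C.below_m X, C.below_eq X le_rfl, C.below_m]

theorem mirror_below (X : Finset V) {f : ℕ} (hf : f < C.m) :
    C.mirror.below X (C.m - 1 - f) = (X.filter fun v => f < C.o v).card := by
  unfold below
  congr 1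
  refine Finset.filter_congr fun v _ => ?_
  have := C.o_lt v
  rw [mirror_o]; omega

/-- Tokens after, before and in a star add up to all tokens; this translates counts from the left
end into counts from the right end. -/
theorem below_mirror (X : Finset V) {f : ℕ} (hf : f < C.m) :
    C.mirror.below X (C.m - 1 - f) + C.below X f + (X.filter fun v => C.o v = f).card = X.card := by
  rw [C.mirror_below X hf, below, ← Finset.card_union_of_disjoint, ← Finset.card_union_of_disjoint]
  · congr 1; ext v
    simp only [Finset.mem_filter, Finset.mem_union]
    have := Nat.lt_trichotomy (C.o v) f
    tauto
  · rw [Finset.disjoint_left]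
    intro v h1 h2
    simp only [Finset.mem_filter, Finset.mem_union] at h1 h2
    omega
  · rw [Finset.disjoint_left]
    intro v h1 h2
    simp only [Finset.mem_filter] at h1 h2
    omega

/-- Only windows through the abandoned vertex are at risk, and `hw` provides another occupied vertex
in each of them. -/
theorem ok_mv {k : ℕ} {X : Finset V} {i : ℕ} {y : V} (h : C.Ok k X)
    (hw : ∀ a b, a < b → b < C.m → a ≤ i → i ≤ b →
      ∃ j, a ≤ j ∧ j ≤ b ∧ (j < C.m → C.s j = y ∨ (j ≠ i ∧ C.s j ∈ X))) (hi : i < C.m) :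
    C.Ok k (mv X (C.s i) y) := by
  intro a b hab hb hX
  have hX' : ∀ j, a ≤ j → j ≤ b → C.s j ≠ y ∧ (j ≠ i → C.s j ∉ X) := by
    intro j h1 h2
    have := hX j h1 h2
    rw [mem_mv] at this
    push Not at this
    refine ⟨this.1, fun hj => this.2 fun he => hj (C.s_inj (by omega) hi he)⟩
  have hvac : ∀ j, C.vac (mv X (C.s i) y) j ≤ C.vac X j := by
    intro j
    apply C.vac_le_vac
    intro v h1 h2 h3
    refine ⟨v, h1, h2, fun h4 => h3 (mem_mv.2 (Or.inr ⟨(C.leaf_ne_s h2 hi).symm, h4⟩))⟩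
  by_cases hin : a ≤ i ∧ i ≤ b
  · exfalso
    obtain ⟨j, h1, h2, h3⟩ := hw a b hab hb hin.1 hin.2
    have := hX' j h1 h2
    rcases h3 (by omega) with h | h
    · exact this.1 h
    · exact this.2 h.1 h.2
  · have := h a b hab hb (fun j h1 h2 => (hX' j h1 h2).2 (by rintro rfl; exact hin ⟨h1, h2⟩))
    have := hvac a
    have := hvac b
    omega

/-- A window has at least two vertices and does not fit into one hole. This is what lets a hole
travel along a full spine. -/
theorem ok_of_single_hole {k : ℕ} {X : Finset V} {i : ℕ}
    (h : ∀ j, j < C.m → j ≠ i → C.s j ∈ X) : C.Ok k X := by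
  intro a b hab hb hX
  exfalso
  by_cases hai : a = i
  · exact hX b (by omega) le_rfl (h b hb (by omega))
  · exact hX a le_rfl (by omega) (h a (by omega) hai)

/-- A window of the new position avoids the owner of `v`, and nothing changes outside the star of
`v`. -/
theorem ok_lift {k : ℕ} {X : Finset V} {v : V} (h : C.Ok k X) (hv : C.ow v ≠ v) :
    C.Ok k (mv X v (C.ow v)) := by
  intro a b hab hb hX
  have hX' : ∀ j, a ≤ j → j ≤ b → j ≠ C.o v ∧ C.s j ∉ X := by
    intro j h1 h2
    have h3 := hX j h1 h2
    rw [mem_mv] at h3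
    push Not at h3
    refine ⟨?_, h3.2 (C.leaf_ne_s hv (by omega))⟩
    rintro rfl; exact h3.1 rfl
  have hvac : ∀ j, j ≠ C.o v → C.vac (mv X v (C.ow v)) j ≤ C.vac X j := by
    intro j hj
    apply C.vac_le_vac
    intro w h1 h2 h3
    refine ⟨w, h1, h2, fun h4 => h3 (mem_mv.2 (Or.inr ⟨?_, h4⟩))⟩
    rintro rfl; exact hj h1.symm
  have := h a b hab hb (fun j h1 h2 => (hX' j h1 h2).2)
  have := hvac a (hX' a le_rfl (by omega)).1
  have := hvac b (hX' b (by omega) le_rfl).1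
  omega

/-- The window that forbids the slide contains `i`, since otherwise it was a window of `X` already,
and it ends at `i`, since `i + 1` becomes occupied. At `a` the weaker `vac ∅` is recorded, which
does not depend on the leaf tokens there. -/
theorem window_of_rightFixed {k : ℕ} (hk : 4 ≤ k) {X : Finset V} (hX : IsPVC G k X)
    (hR : C.RightFixed k X) {i : ℕ} (hi : i + 1 < C.m) (h1 : C.s i ∈ X) (h2 : C.s (i + 1) ∉ X) :
    ∃ a, a < i ∧ k ≤ (i - a + 1) + C.vac ∅ a + C.vac X i ∧ ∀ j, a ≤ j → j < i → C.s j ∉ X := by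
  have hno := hR i hi h1 h2
  rw [C.isPVC_iff_ok hk] at hno hX
  unfold Ok at hno
  push Not at hno
  obtain ⟨a, b, hab, hb, hemp, hw⟩ := hno
  have hX' : ∀ j, a ≤ j → j ≤ b → j ≠ i + 1 ∧ (j ≠ i → C.s j ∉ X) := by
    intro j h3 h4
    have := hemp j h3 h4
    rw [mem_mv] at this
    push Not at this
    refine ⟨by rintro rfl; exact this.1 rfl, fun hj => this.2 fun he =>
      hj (C.s_inj (by omega) (by omega) he)⟩
  have hvac : ∀ j, C.vac (mv X (C.s i) (C.s (i + 1))) j ≤ C.vac X j := by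
    intro j
    apply C.vac_le_vac
    intro v h1 h2 h3
    refine ⟨v, h1, h2, fun h4 => h3 (mem_mv.2 (Or.inr ⟨(C.leaf_ne_s h2 (by omega)).symm, h4⟩))⟩
  have va := hvac a
  have vb := hvac b
  have vmono : C.vac X a ≤ C.vac ∅ a :=
    C.vac_le_vac fun v h1 h2 _ => ⟨v, h1, h2, by simp⟩
  by_cases hin : a ≤ i ∧ i ≤ b
  · have hbi : b = i := by
      by_contra hne
      exact (hX' (i + 1) (by omega) (by omega)).1 rfl
    subst hbi
    exact ⟨a, hab, by omega, fun j h3 h4 => (hX' j h3 (by omega)).2 (by omega)⟩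
  · exfalso
    have := hX a b hab hb (fun j h3 h4 => (hX' j h3 h4).2 (by rintro rfl; exact hin ⟨h3, h4⟩))
    omega

/-- The windows of the spine that need a token on the spine. -/
def Bad (k a b : ℕ) : Prop := a < b ∧ b < C.m ∧ k ≤ (b - a + 1) + C.vac ∅ a + C.vac ∅ b

/-- Without a token in the stars of the window all leaves at its ends would be vacant, and the
window would be too long for `Y`. -/
theorem exists_of_bad {k : ℕ} {Y : Finset V} (hY : C.Ok k Y) {a b : ℕ} (h : C.Bad k a b) :
    ∃ i, a ≤ i ∧ i ≤ b ∧ ∃ v ∈ Y, C.o v = i := by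
  by_contra! hno
  have hvac : ∀ j, a ≤ j → j ≤ b → C.vac ∅ j ≤ C.vac Y j := by
    intro j h1 h2
    apply C.vac_le_vac
    intro v h3 h4 _
    exact ⟨v, h3, h4, fun h5 => hno j h1 h2 v h5 h3⟩
  have h1 := h.1
  have := hY a b h.1 h.2.1 (fun i h1 h2 h3 => hno i h1 h2 _ h3 (C.o_s i (by have := h.2.1; omega)))
  have := hvac a le_rfl (by omega)
  have := hvac b (by omega) le_rfl
  have := h.2.2
  omega

theorem rightFixed_window {k : ℕ} (hk : 4 ≤ k) {X : Finset V} (hX : IsPVC G k X)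
    (hR : C.RightFixed k X) {i : ℕ} (hi : i + 1 < C.m) (h1 : C.s i ∈ X) (h2 : C.s (i + 1) ∉ X) :
    ∃ a, a < i ∧ C.Bad k a i ∧ ∀ j, a ≤ j → j < i → C.s j ∉ X := by
  obtain ⟨a, h3, h4, h5⟩ := C.window_of_rightFixed hk hX hR hi h1 h2
  have vmono : C.vac X i ≤ C.vac ∅ i :=
    C.vac_le_vac fun v h1 h2 _ => ⟨v, h1, h2, by simp⟩
  exact ⟨a, h3, ⟨h3, by omega, by omega⟩, h5⟩

/-- Extremality of `X` applied to `Y`. The stars before `f` that contain a token of `Y` meet all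
`Bad` windows and are at most as many as the spine tokens of `X` before `f`. As `X` has no token
between `a` and `f`, the comparison of prefix counts at `a` leaves no such star there either. -/
theorem exists_empty_window {k : ℕ} (hk : 4 ≤ k) {X Y : Finset V} (hX : IsPVC G k X)
    (hR : C.RightFixed k X) {f : ℕ} (hf : f + 1 < C.m) (h1 : C.s f ∈ X) (h2 : C.s (f + 1) ∉ X)
    (hY : C.Ok k Y) (hE : C.leafTok X ⊆ Y) (hE' : ∀ v ∈ C.leafTok X, C.ow v ∈ Y)
    (hb : C.below Y f = C.below X f) :
    ∃ a, a < f ∧ k ≤ (f - a + 1) + C.vac ∅ a + C.vac X f ∧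
      ∀ v ∈ Y, a ≤ C.o v → C.o v < f → False := by
  classical
  obtain ⟨a, ha, hw, hemp⟩ := C.window_of_rightFixed hk hX hR hf h1 h2
  refine ⟨a, ha, hw, ?_⟩
  set A : Finset ℕ := (Y.filter fun v => C.o v < f).image C.o with hA
  have hAsub : A ⊆ Finset.range f := by
    intro i hi
    simp only [hA, Finset.mem_image, Finset.mem_filter] at hi
    obtain ⟨v, hv, rfl⟩ := hi
    exact Finset.mem_range.2 hv.2
  -- Every leaf token of `X` is in `Y` together with its owner, so it can be dropped without losing
  -- a star. What remains is counted by `below Y f` minus these leaf tokens, which is `cnt X f`.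
  have hAcard : A.card ≤ C.cnt X f := by
    have e1 : A ⊆ ((Y \ C.leafTok X).filter fun v => C.o v < f).image C.o := by
      intro i hi
      simp only [hA, Finset.mem_image, Finset.mem_filter] at hi
      obtain ⟨v, hv, rfl⟩ := hi
      by_cases hvE : v ∈ C.leafTok X
      · refine Finset.mem_image.2 ⟨C.ow v, ?_, C.o_ow v⟩
        rw [Finset.mem_filter, Finset.mem_sdiff, C.o_ow, C.mem_leafTok, C.ow_ow]
        exact ⟨⟨hE' v hvE, by simp⟩, hv.2⟩
      · exact Finset.mem_image_of_mem _ (Finset.mem_filter.2 ⟨Finset.mem_sdiff.2 ⟨hv.1, hvE⟩, hv.2⟩)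
    have e2 : ((Y \ C.leafTok X).filter fun v => C.o v < f).card + C.below (C.leafTok X) f =
        C.below Y f := by
      rw [below, below, ← Finset.card_union_of_disjoint]
      · congr 1; ext v
        simp only [Finset.mem_union, Finset.mem_filter, Finset.mem_sdiff]
        have := @hE v
        tauto
      · rw [Finset.disjoint_left]
        intro v h3 h4
        simp only [Finset.mem_filter, Finset.mem_sdiff] at h3 h4
        exact h3.1.2 h4.1
    have e3 := C.below_eq X (f := f) (by omega)
    have := (Finset.card_le_card e1).trans Finset.card_image_le
    omega
  -- Padding to exactly `cnt X f` elements, because the counting lemma compares sets of equal size.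
  obtain ⟨Q, hAQ, hQr, hQc⟩ := Finset.exists_subsuperset_card_eq hAsub hAcard
    (by rw [Finset.card_range]; exact Nat.count_le _)
  have hcQ : Nat.count (fun i => i ∈ Q) f = C.cnt X f := by
    rw [Nat.count_eq_card_filter_range, ← hQc]
    congr 1; ext i
    simp only [Finset.mem_filter, Finset.mem_range]
    exact ⟨fun h => h.2, fun h => ⟨Finset.mem_range.1 (hQr h), h⟩⟩
  have hmin := count_le_count_of_fixed (f := f) (P := fun i => C.s i ∈ X) (Q := fun i => i ∈ Q)
    (C.Bad k) (by
      intro b c hc hbad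
      obtain ⟨i, h3, h4, v, h5, h6⟩ := C.exists_of_bad hY hbad
      refine ⟨i, h3, h4, hAQ (Finset.mem_image.2 ⟨v, Finset.mem_filter.2 ⟨h5, by omega⟩, h6⟩)⟩) (by
      intro i hi h3 h4
      exact C.rightFixed_window hk hX hR (by omega) h3 h4) hcQ.symm
  have c1 := hmin a (by omega)
  have c2 : Nat.count (fun i => C.s i ∈ X) f = Nat.count (fun i => C.s i ∈ X) a := by
    conv_lhs => rw [show f = a + (f - a) by omega]
    rw [Nat.count_add]
    have : Nat.count (fun r => C.s (a + r) ∈ X) (f - a) = 0 := by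
      rw [Nat.count_iff_forall_not]
      intro r hr
      exact hemp _ (by omega) (by omega)
    omega
  intro v hv h3 h4
  have hvQ : C.o v ∈ Q := hAQ (Finset.mem_image.2 ⟨v, Finset.mem_filter.2 ⟨hv, h4⟩, rfl⟩)
  have c3 := Nat.count_strict_mono (p := fun i => i ∈ Q) hvQ h4
  have c4 := Nat.count_monotone (fun i => i ∈ Q) h3
  have c5 : C.cnt X f = Nat.count (fun i => C.s i ∈ X) f := rfl
  omega

theorem cnt_eq_of_below_eq {X Z : Finset V} (hE : C.leafTok X = C.leafTok Z) {f : ℕ}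
    (hf : f ≤ C.m) (h : C.below X f = C.below Z f) : C.cnt X f = C.cnt Z f := by
  have := C.below_eq X hf
  have := C.below_eq Z hf
  rw [hE] at *
  omega

theorem cnt_m_eq {X Z : Finset V} (hE : C.leafTok X = C.leafTok Z) (h : X.card = Z.card) :
    C.cnt X C.m = C.cnt Z C.m :=
  C.cnt_eq_of_below_eq hE le_rfl (by rw [below_m, below_m, h])

theorem full_iff_cnt {X : Finset V} : C.Full X ↔ C.cnt X C.m = C.m := by
  rw [cnt, Nat.count_iff_forall]; rfl

/-- A token with an occupied vertex behind it can move on freely, so two adjacent tokens of `X`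
force a block up to the right end. If `f` starts such a block or is the last vertex, equal counts
fill the same part of `Z`. Since no token of `Z` can move to the left, this block extends down to
the left end. Then `Z` is full, and so is `X`. -/
theorem succ_notMem {k : ℕ} (hk : 4 ≤ k) {X Z : Finset V} (hX : IsPVC G k X) (hZ : IsPVC G k Z)
    (hXR : C.RightFixed k X) (hZR : C.mirror.RightFixed k Z) (hE : C.leafTok X = C.leafTok Z)
    (hc : X.card = Z.card) {f : ℕ} (hf : f < C.m) (hfX : C.s f ∈ X)
    (hb : C.below X f = C.below Z f) (hfull : ¬ C.Full X) :
    f + 1 < C.m ∧ C.s (f + 1) ∉ X := by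
  by_contra hcon
  have h1 : f + 1 < C.m → C.s (f + 1) ∈ X := by
    intro h; by_contra h2; exact hcon ⟨h, h2⟩
  rw [C.isPVC_iff_ok hk] at hX hZ
  have hright : ∀ j, f + j < C.m → C.s (f + j) ∈ X ∧ (1 ≤ j → C.s (f + j - 1) ∈ X) := by
    intro j
    induction j with
    | zero => intro _; exact ⟨hfX, fun h => absurd h (by omega)⟩
    | succ j ih =>
      intro hj
      obtain ⟨ih1, ih2⟩ := ih (by omega)
      refine ⟨?_, fun _ => ih1⟩
      rcases Nat.eq_zero_or_pos j with rfl | hj0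
      · exact h1 hj
      by_contra hno
      apply hXR (f + j) hj ih1 hno
      rw [C.isPVC_iff_ok hk]
      refine C.ok_mv hX ?_ (by omega)
      intro a b hab hb h3 h4
      rcases Nat.lt_or_ge (f + j) b with h5 | h5
      · exact ⟨f + j + 1, by omega, by omega, fun _ => Or.inl rfl⟩
      · exact ⟨f + j - 1, by omega, by omega, fun _ => Or.inr ⟨by omega, ih2 hj0⟩⟩
  have c1 := C.cnt_m_eq hE hc
  have c2 := C.cnt_eq_of_below_eq hE (f := f) (by omega) hb
  have split : ∀ W : Finset V, C.cnt W C.m = C.cnt W f +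
      Nat.count (fun j => C.s (f + j) ∈ W) (C.m - f) := by
    intro W
    rw [cnt, cnt, ← Nat.count_add]; congr 1; omega
  have c3 : Nat.count (fun j => C.s (f + j) ∈ X) (C.m - f) = C.m - f := by
    rw [Nat.count_iff_forall]
    intro j hj
    exact (hright j (by omega)).1
  have c4 : Nat.count (fun j => C.s (f + j) ∈ Z) (C.m - f) = C.m - f := by
    have := split X
    have := split Z
    omega
  rw [Nat.count_iff_forall] at c4
  have hleft : ∀ j, j ≤ f → ∀ i, f - j ≤ i → i < C.m → C.s i ∈ Z := by
    intro j
    induction j with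
    | zero =>
      intro _ i h2 h3
      have := c4 (i - f) (by omega)
      rwa [show f + (i - f) = i by omega] at this
    | succ j ih =>
      intro hj i h2 h3
      rcases Nat.lt_or_ge i (f - j) with h4 | h4
      swap
      · exact ih (by omega) i h4 h3
      by_contra hno
      have e1 : C.mirror.s (C.m - 1 - (i + 1)) = C.s (i + 1) := by
        rw [mirror_s]; congr 1; omega
      have e2 : C.mirror.s (C.m - 1 - (i + 1) + 1) = C.s i := by
        rw [mirror_s]; congr 1; omega
      have h5 : C.s (i + 1) ∈ Z := ih (by omega) _ (by omega) (by omega)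
      apply hZR (C.m - 1 - (i + 1)) (by rw [mirror_m]; omega) (by rwa [e1]) (by rwa [e2])
      rw [e1, e2, C.isPVC_iff_ok hk]
      refine C.ok_mv hZ ?_ (by omega)
      intro a b hab hb h6 h7
      rcases Nat.lt_or_ge a (i + 1) with h8 | h8
      · exact ⟨i, by omega, by omega, fun _ => Or.inl rfl⟩
      · exact ⟨i + 2, by omega, by omega, fun h9 => Or.inr ⟨by omega, ih (by omega) _ (by omega) h9⟩⟩
  apply hfull
  rw [full_iff_cnt, c1, ← full_iff_cnt]
  intro i hi
  exact hleft f le_rfl i (by omega) hi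

theorem below_mv {Y : Finset V} {x y : V} (hx : x ∈ Y) (hy : y ∉ Y) {f : ℕ}
    (h : C.o x < f ↔ C.o y < f) : C.below (mv Y x y) f = C.below Y f := by
  unfold below
  by_cases hxf : C.o x < f
  · rw [← card_mv (X := Y.filter fun v => C.o v < f) (x := x) (y := y)
      (Finset.mem_filter.2 ⟨hx, hxf⟩) (fun h' => hy (Finset.mem_filter.1 h').1)]
    congr 1; ext v
    simp only [Finset.mem_filter, mem_mv]
    constructor
    · tauto
    · rintro (rfl | h1)
      · exact ⟨Or.inl rfl, h.1 hxf⟩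
      · tauto
  · congr 1; ext v
    simp only [Finset.mem_filter, mem_mv]
    constructor
    · rintro ⟨rfl | h1, h2⟩
      · exact absurd (h.2 h2) hxf
      · exact ⟨h1.2, h2⟩
    · rintro ⟨h1, h2⟩
      exact ⟨Or.inr ⟨by rintro rfl; exact hxf h2, h1⟩, h2⟩

theorem ok_vac_congr {X Y : Finset V} {f : ℕ} (h : ∀ v, C.o v = f → (v ∈ Y ↔ v ∈ X)) :
    C.vac X f ≤ C.vac Y f :=
  C.vac_le_vac fun v h1 h2 h3 => ⟨v, h1, h2, fun h4 => h3 ((h v h1).1 h4)⟩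

/-- If `X` and `Z` have the same leaf tokens, no token of `X` can move to the right and no token of
`Z` can move to the left, then the tokens common to `X` and `Z` are rigid. -/
theorem star_fixed {k : ℕ} (hk : 4 ≤ k) {X Z : Finset V} (hZ : IsPVC G k Z)
    (hXN : C.Norm X) (hZN : C.Norm Z) (hXR : C.RightFixed k X) (hZR : C.mirror.RightFixed k Z)
    (hE : C.leafTok X = C.leafTok Z) (hheavy : ∀ v ∈ C.leafTok X, C.below X (C.o v) = C.below Z (C.o v))
    (hc : X.card = Z.card) (hfull : ¬ C.Full X) {l : List (V × V)} {Y : Finset V}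
    (hl : Log G k X l Y) : ∀ f, f < C.m → C.s f ∈ X → C.s f ∈ Z → C.below X f = C.below Z f →
      (∀ v, C.o v = f → (v ∈ Y ↔ v ∈ X)) ∧ C.below Y f = C.below X f := by
  have hX := hl.isPVC_left
  have hEN : ∀ v ∈ C.leafTok X, C.s (C.o v) ∈ X ∧ C.s (C.o v) ∈ Z := by
    intro v hv
    refine ⟨hXN v (C.mem_leafTok.1 hv).1, ?_⟩
    rw [hE] at hv
    exact hZN v (C.mem_leafTok.1 hv).1
  induction hl with
  | nil _ => intro f _ _ _ _; exact ⟨fun v _ => Iff.rfl, rfl⟩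
  | @snoc l Y x y h hadj hx hy hY' ih =>
    have hY := h.isPVC_right
    have hcY := h.card_eq
    have hEY : C.leafTok X ⊆ Y := by
      intro v hv
      have hv' := hEN v hv
      exact ((ih _ (C.o_lt v) hv'.1 hv'.2 (hheavy v hv)).1 v rfl).2 (C.mem_leafTok.1 hv).1
    have hEY' : ∀ v ∈ C.leafTok X, C.ow v ∈ Y := by
      intro v hv
      have hv' := hEN v hv
      exact ((ih _ (C.o_lt v) hv'.1 hv'.2 (hheavy v hv)).1 (C.ow v) (C.o_ow v)).2 hv'.1
    -- the spine token in question does not move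
    have hne : ∀ f, f < C.m → C.s f ∈ X → C.s f ∈ Z → C.below X f = C.below Z f → x ≠ C.s f := by
      rintro f hf h1 h2 h3 rfl
      obtain ⟨i1, i2⟩ := ih f hf h1 h2 h3
      obtain ⟨n1, n2⟩ := C.succ_notMem hk hX hZ hXR hZR hE hc hf h1 h3 hfull
      have hstarXZ : ∀ v, C.o v = f → (v ∈ X ↔ v ∈ Z) := by
        intro v hv
        by_cases hvl : C.ow v = v
        · have : v = C.s f := by rw [← hv]; exact hvl.symm
          subst this; simp [h1, h2]
        · have := C.mem_leafTok (X := X) (v := v)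
          have h' := C.mem_leafTok (X := Z) (v := v)
          rw [hE] at this
          tauto
      have ef : C.mirror.s (C.m - 1 - f) = C.s f := by rw [mirror_s]; congr 1; omega
      have starcard : ∀ S T : Finset V, (∀ v, C.o v = f → (v ∈ S ↔ v ∈ T)) →
          (S.filter fun v => C.o v = f).card = (T.filter fun v => C.o v = f).card := by
        intro S T hST
        congr 1; ext v
        simp only [Finset.mem_filter]
        have := hST v
        tauto
      have mX := C.below_mirror X hf
      have mZ := C.below_mirror Z hf
      have mY := C.below_mirror Y hf
      have sXZ := starcard X Z hstarXZ
      have sYX := starcard Y X i1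
      have hfullZ : ¬ C.mirror.Full Z := by
        rw [full_mirror, full_iff_cnt, ← C.cnt_m_eq hE hc, ← full_iff_cnt]; exact hfull
      obtain ⟨p1, p2⟩ := C.mirror.succ_notMem hk hZ hX hZR (C.rightFixed_mirror_mirror.2 hXR)
        (by rw [leafTok_mirror, leafTok_mirror, hE]) hc.symm (f := C.m - 1 - f)
        (by rw [mirror_m]; omega) (by rwa [ef]) (by omega) hfullZ
      rw [mirror_m] at p1
      -- Empty windows on both sides of `f`: the left one from the right-fixed `X`, the right one
      -- from the left-fixed `Z` on the mirrored spine.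
      obtain ⟨a, a1, a2, a3⟩ := C.exists_empty_window hk hX hXR n1 h1 n2
        ((C.isPVC_iff_ok hk).1 hY) hEY hEY' i2
      obtain ⟨b', b1, b2, b3⟩ := C.mirror.exists_empty_window hk hZ hZR p1 (by rwa [ef]) p2
        ((C.mirror.isPVC_iff_ok hk).1 hY) (by rw [leafTok_mirror, ← hE]; exact hEY)
        (by rw [leafTok_mirror, ← hE]; simpa using hEY') (by omega)
      obtain ⟨b, hb, rfl⟩ : ∃ b, b < C.m ∧ b' = C.m - 1 - b :=
        ⟨C.m - 1 - b', by omega, by omega⟩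
      rw [C.vac_mirror ∅ hb, C.vac_mirror Z hf] at b2
      have b3' : ∀ v ∈ Y, f < C.o v → C.o v ≤ b → False := by
        intro v hv h4 h5
        refine b3 v hv ?_ ?_ <;> rw [mirror_o] <;> omega
      have vXY := C.ok_vac_congr (X := X) (Y := Y) i1
      have vZX := C.ok_vac_congr (X := Z) (Y := X) hstarXZ
      have hok := (C.isPVC_iff_ok hk).1 hY'
      -- The star of `f` keeps its vacant leaf unless the token itself moves onto a leaf.
      have vf : C.vac Y f ≤ C.vac (mv Y (C.s f) y) f + (if C.ow y = y then 0 else 1) := by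
        split_ifs with hyl
        · rw [Nat.add_zero]
          apply C.vac_le_vac
          intro v h4 h5 h6
          refine ⟨v, h4, h5, fun h7 => ?_⟩
          rcases mem_mv.1 h7 with h8 | h8
          · subst h8; exact h5 hyl
          · exact h6 h8.2
        · have := C.vac_le_one Y f
          omega
      have va : ∀ j, j ≠ C.o y → (∀ v ∈ Y, C.o v ≠ j) →
          C.vac ∅ j ≤ C.vac (mv Y (C.s f) y) j := by
        intro j hj hjY
        apply C.vac_le_vac
        intro v h4 h5 _
        refine ⟨v, h4, h5, fun h7 => ?_⟩
        rcases mem_mv.1 h7 with h8 | h8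
        · subst h8; exact hj h4.symm
        · exact hjY v h8.2 h4
      have hemp : ∀ j, a ≤ j → j ≤ b → C.s j ≠ y → C.s j ∉ mv Y (C.s f) y := by
        intro j h4 h5 h6 h7
        rcases mem_mv.1 h7 with h8 | h8
        · exact h6 h8
        · have hjm : j < C.m := by omega
          rcases Nat.lt_trichotomy j f with h9 | h9 | h9
          · exact a3 _ h8.2 (by rw [C.o_s j hjm]; exact h4) (by rw [C.o_s j hjm]; exact h9)
          · subst h9; exact h8.1 rfl
          · exact b3' _ h8.2 (by rw [C.o_s j hjm]; exact h9) (by rw [C.o_s j hjm]; exact h5)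
      -- A step to the left frees the window from `f` to `b`, a step to the right the one from `a`
      -- to `f`; both are too long.
      by_cases hyl : C.ow y = y
      · rw [if_pos hyl] at vf
        have hoy : C.o y + 1 = f ∨ C.o y = f + 1 := by
          rcases C.o_of_adj hadj with h4 | h4 | h4
          · exfalso
            rw [C.o_s f hf] at h4
            apply hadj.ne; rw [← hyl, ow, ← h4]
          · rw [C.o_s f hf] at h4; omega
          · rw [C.o_s f hf] at h4; omega
        have hsy : ∀ j, j < C.m → j ≠ C.o y → C.s j ≠ y := by
          intro j hj h4 h5; subst h5; exact h4 (C.o_s j hj).symm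
        rcases hoy with h4 | h4
        · have := hok f b (by omega) hb
            (fun j h5 h6 => hemp j (by omega) h6 (hsy j (by omega) (by omega)))
          have := va b (by omega) (fun v hv h5 => b3' v hv (by omega) (by omega))
          omega
        · have := hok a f a1 hf
            (fun j h5 h6 => hemp j h5 (by omega) (hsy j (by omega) (by omega)))
          have := va a (by omega) (fun v hv h5 => a3 v hv (by omega) (by omega))
          omega
      · have hoy : C.o y = f := by
          have := (C.adj_leaf_iff hyl).1 hadj.symm
          rw [← C.o_ow y, ← this, C.o_s f hf]
        -- The token may take the last vacant leaf at `f`, but then the window extends to the empty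
        -- vertex `f + 1`, which makes up for it.
        have := hok a (f + 1) (by omega) (by omega)
          (fun j h5 h6 => hemp j h5 (by omega) (C.leaf_ne_s hyl (by omega)))
        have := va a (by omega) (fun v hv h5 => a3 v hv (by omega) (by omega))
        have := C.vac_le_one X f
        omega
    -- While `s f` keeps its token, the leaves of its star cannot take part in a slide, and no token
    -- can pass from one side of the star to the other.
    intro f hf h1 h2 h3
    obtain ⟨i1, i2⟩ := ih f hf h1 h2 h3
    have hxf := hne f hf h1 h2 h3
    have hfY : C.s f ∈ Y := (i1 _ (C.o_s f hf)).2 h1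
    have hyf : y ≠ C.s f := by rintro rfl; exact hy hfY
    have hspine : ∀ v, C.o v = f → v ≠ C.s f → C.ow v ≠ v := by
      intro v h4 h5 h6; apply h5; rw [← h6, ow, h4]
    have hox : C.o x ≠ f := by
      intro h4
      have := (C.adj_leaf_iff (hspine x h4 hxf)).1 hadj
      rw [ow, h4] at this; exact hyf this
    have hoy : C.o y ≠ f := by
      intro h4
      have := (C.adj_leaf_iff (hspine y h4 hyf)).1 hadj.symm
      rw [ow, h4] at this; exact hxf this
    refine ⟨?_, ?_⟩
    · intro v hv
      rw [← i1 v hv, mem_mv]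
      constructor
      · rintro (rfl | h4)
        · exact absurd hv hoy
        · exact h4.2
      · intro h4
        exact Or.inr ⟨by rintro rfl; exact hox hv, h4⟩
    · rw [← i2]
      refine C.below_mv hx hy ?_
      have := C.o_of_adj hadj
      omega

end Spine
/-! ### Rigid tokens and reachability -/

section Reachability

variable {V : Type u} [DecidableEq V] {G : SimpleGraph V} {k : ℕ}

theorem Log.mem_iff {I X : Finset V} {l : List (V × V)} (h : Log G k I l X) {u : V}
    (hu : ∀ p ∈ l, p.1 ≠ u ∧ p.2 ≠ u) : u ∈ X ↔ u ∈ I := by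
  induction h with
  | nil _ => rfl
  | @snoc l X x y h hadj hx hy hX ih =>
    rw [← ih fun p hp => hu p (by simp [hp]), mem_mv]
    have := hu (x, y) (by simp)
    have h1 : u ≠ x := fun h => this.1 h.symm
    have h2 : u ≠ y := fun h => this.2 h.symm
    simp [h1, h2]

theorem Log.notMem_of_mem_rigidSet {I X : Finset V} {l : List (V × V)} (h : Log G k I l X) {u : V}
    (hu : u ∈ rigidSet G k I) : ∀ p ∈ l, p.1 ≠ u ∧ p.2 ≠ u := by
  induction h with
  | nil _ => simp
  | @snoc l X x y h hadj hx hy hX ih =>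
    intro p hp
    rcases List.mem_append.1 hp with h1 | h1
    · exact ih p h1
    · rw [List.mem_singleton] at h1
      subst h1
      have h2 := hu.2 _ h.reachable
      have h3 := hu.2 _ (h.snoc hadj hx hy hX).reachable
      refine ⟨?_, ?_⟩
      · rintro rfl
        rcases mem_mv.1 h3 with h4 | h4
        · exact hadj.ne h4
        · exact h4.1 rfl
      · rintro rfl; exact hy h2

/-- No slide starts or ends at a rigid token, so each slide uses an edge of `G - R` and stays in one
component. -/
theorem Log.tokensIn_eq {I X : Finset V} {l : List (V × V)} (h : Log G k I l X)
    (D : (removeVerts G (rigidSet G k I)).ConnectedComponent) : tokensIn X D = tokensIn I D := by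
  induction h with
  | nil _ => rfl
  | @snoc l X x y h hadj hx hy hX ih =>
    rw [← ih]
    have hxR : x ∈ (rigidSet G k I)ᶜ := by
      intro hR
      rcases mem_mv.1 (hR.2 _ (h.snoc hadj hx hy hX).reachable) with h4 | h4
      · exact hadj.ne h4
      · exact h4.1 rfl
    have hyR : y ∈ (rigidSet G k I)ᶜ := fun hR => hy (hR.2 _ h.reachable)
    have hadj' : (removeVerts G (rigidSet G k I)).Adj ⟨x, hxR⟩ ⟨y, hyR⟩ := hadj
    have hD : (⟨x, hxR⟩ : ↥(rigidSet G k I)ᶜ) ∈ D.supp ↔ ⟨y, hyR⟩ ∈ D.supp :=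
      SimpleGraph.ConnectedComponent.mem_supp_congr_adj D hadj'
    unfold tokensIn
    by_cases hxD : (⟨x, hxR⟩ : ↥(rigidSet G k I)ᶜ) ∈ D.supp
    · rw [← Set.ncard_exchange (s := {v : ↥(rigidSet G k I)ᶜ | v ∈ D.supp ∧ (v : V) ∈ X})
        (a := ⟨y, hyR⟩) (b := ⟨x, hxR⟩) (fun h => hy h.2) ⟨hxD, hx⟩]
      congr 1
      ext v
      have e1 : v = ⟨y, hyR⟩ ↔ (v : V) = y := Subtype.ext_iff
      have e2 : v = ⟨x, hxR⟩ ↔ (v : V) = x := Subtype.ext_iff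
      simp only [Set.mem_insert_iff, Set.mem_sdiff, Set.mem_ofPred_eq, Set.mem_singleton_iff,
        mem_mv, e1, e2]
      constructor
      · tauto
      · rintro (h1 | h1)
        · refine ⟨?_, Or.inl h1⟩
          rw [e1.2 h1]; exact hD.1 hxD
        · tauto
    · congr 1
      ext v
      have e1 : v = ⟨y, hyR⟩ ↔ (v : V) = y := Subtype.ext_iff
      have e2 : v = ⟨x, hxR⟩ ↔ (v : V) = x := Subtype.ext_iff
      simp only [Set.mem_ofPred_eq, mem_mv]
      constructor
      · rintro ⟨h1, h2 | h2⟩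
        · rw [e1.2 h2] at h1; exact absurd (hD.2 h1) hxD
        · exact ⟨h1, h2.2⟩
      · rintro ⟨h1, h2⟩
        refine ⟨h1, Or.inr ⟨?_, h2⟩⟩
        intro h3
        rw [e2.2 h3] at h1; exact hxD h1

namespace Spine

variable (C : Spine G)

/-- Without `s f` its leaves are isolated and the stars before it are separated from those behind
it. -/
theorem below_eq_of_log {I X : Finset V} {l : List (V × V)} (h : Log G k I l X) {f : ℕ}
    (hu : ∀ p ∈ l, p.1 ≠ C.s f ∧ p.2 ≠ C.s f) :
    C.below X f = C.below I f := by
  induction h with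
  | nil _ => rfl
  | @snoc l X x y h hadj hx hy hX ih =>
    rw [← ih fun p hp => hu p (by simp [hp])]
    have hxy := hu (x, y) (by simp)
    refine C.below_mv hx hy ?_
    have := C.o_of_adj hadj
    have hspine : ∀ v, C.o v = f → v ≠ C.s f → C.ow v ≠ v := by
      intro v h4 h5 h6; apply h5; rw [← h6, ow, h4]
    have hox : C.o x ≠ f := by
      intro h4
      have := (C.adj_leaf_iff (hspine x h4 hxy.1)).1 hadj
      rw [ow, h4] at this; exact hxy.2 this
    have hoy : C.o y ≠ f := by
      intro h4
      have := (C.adj_leaf_iff (hspine y h4 hxy.2)).1 hadj.symm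
      rw [ow, h4] at this; exact hxy.1 this
    omega

/-! ### Moving tokens to the right -/

/-- The weight of a vertex: it drops along every move of the procedure below. -/
def wt (N : ℕ) (v : V) : ℕ := if C.ow v = v then 2 * (C.m - C.o v) else 4 * N

def pot (N : ℕ) (X : Finset V) : ℕ := ∑ v ∈ X, C.wt N v

theorem pot_mv {N : ℕ} {X : Finset V} {x y : V} (hx : x ∈ X) (hy : y ∉ X) :
    C.pot N (mv X x y) + C.wt N x = C.pot N X + C.wt N y := by
  unfold pot mv
  rw [Finset.sum_insert (fun h => hy (Finset.mem_of_mem_erase h)),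
    ← Finset.add_sum_erase X _ hx]
  ring

theorem wt_s {N i : ℕ} (hi : i < C.m) : C.wt N (C.s i) = 2 * (C.m - i) := by
  rw [wt, if_pos (C.ow_s hi), C.o_s i hi]

theorem wt_leaf {N : ℕ} {v : V} (hv : C.ow v ≠ v) : C.wt N v = 4 * N := by
  rw [wt, if_neg hv]

/-- Either the number of leaf tokens has dropped, or no leaf token and none of the accompanying
tokens has moved. -/
def Prog (X X' : Finset V) : Prop :=
  (C.leafTok X').card < (C.leafTok X).card ∨
    (C.leafTok X' = C.leafTok X ∧ ∀ v ∈ C.leafTok X, C.below X' (C.o v) = C.below X (C.o v))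

theorem Prog.refl (X : Finset V) : C.Prog X X := Or.inr ⟨rfl, fun _ _ => rfl⟩

theorem Prog.card_le {C : Spine G} {X Y : Finset V} (h : C.Prog X Y) :
    (C.leafTok Y).card ≤ (C.leafTok X).card := by
  rcases h with h | h
  · exact h.le
  · rw [h.1]

theorem Prog.trans {C : Spine G} {X Y Z : Finset V} (h : C.Prog X Y) (h' : C.Prog Y Z) :
    C.Prog X Z := by
  rcases h with h | h
  · exact Or.inl (lt_of_le_of_lt h'.card_le h)
  · rcases h' with h' | h'
    · exact Or.inl (by rwa [h.1] at h')
    · refine Or.inr ⟨h'.1.trans h.1, fun v hv => ?_⟩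
      rw [h'.2 v (by rwa [h.1]), h.2 v hv]

section Step

variable {X : Finset V} {i : ℕ}

theorem pot_light {N : ℕ} (hi : i + 1 < C.m) (h1 : C.s i ∈ X) (h2 : C.s (i + 1) ∉ X) :
    C.pot N (mv X (C.s i) (C.s (i + 1))) + 2 = C.pot N X := by
  have := C.pot_mv (N := N) h1 h2
  rw [C.wt_s (by omega), C.wt_s hi] at this
  omega

theorem norm_light (hN : C.Norm X) (hi : i + 1 < C.m) (hno : ∀ v ∈ C.leafTok X, C.o v ≠ i) :
    C.Norm (mv X (C.s i) (C.s (i + 1))) := by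
  intro v hv
  rcases mem_mv.1 hv with rfl | h
  · rw [C.ow_s hi]; exact hv
  · refine mem_mv.2 (Or.inr ⟨?_, hN v h.2⟩)
    intro h3
    have ho : C.o v = i := by rw [← C.o_ow v, h3, C.o_s i (by omega)]
    exact hno v (C.mem_leafTok.2 ⟨h.2, fun h4 => h.1 (h4.symm.trans h3)⟩) ho

theorem leafTok_mv_spine {j : ℕ} (hi : i < C.m) (hj : j < C.m) :
    C.leafTok (mv X (C.s i) (C.s j)) = C.leafTok X := by
  ext v
  simp only [mem_leafTok, mem_mv]
  constructor
  · rintro ⟨rfl | h, h'⟩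
    · exact absurd (C.ow_s hj) h'
    · exact ⟨h.2, h'⟩
  · rintro ⟨h, h'⟩
    exact ⟨Or.inr ⟨(C.leaf_ne_s h' hi).symm, h⟩, h'⟩

/-- By normality the owners of leaf tokens are occupied, so the vacant target is none of them; the
start is none of them by `hno`. Hence the slide crosses no such owner. -/
theorem prog_light (hN : C.Norm X) (hi : i + 1 < C.m) (h1 : C.s i ∈ X) (h2 : C.s (i + 1) ∉ X)
    (hno : ∀ v ∈ C.leafTok X, C.o v ≠ i) : C.Prog X (mv X (C.s i) (C.s (i + 1))) := by
  refine Or.inr ⟨C.leafTok_mv_spine (by omega) hi, fun v hv => C.below_mv h1 h2 ?_⟩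
  rw [C.o_s i (by omega), C.o_s _ hi]
  have := hno v hv
  have : i + 1 ≠ C.o v := by
    intro h
    apply h2; rw [h]; exact hN v (C.mem_leafTok.1 hv).1
  omega

/-- The state after the leaf token on `z` has replaced the token that moved to the right. -/
def release (X : Finset V) (i : ℕ) (z : V) : Finset V :=
  mv (mv X (C.s i) (C.s (i + 1))) z (C.s i)

theorem mem_release {z v : V} (h1 : C.s i ∈ X) (hi : i + 1 < C.m) (hz : z ∈ C.leafTok X) :
    v ∈ C.release X i z ↔ v = C.s (i + 1) ∨ (v ∈ X ∧ v ≠ z) := by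
  have hz' := C.mem_leafTok.1 hz
  have n1 := C.leaf_ne_s hz'.2 (i := i) (by omega)
  have n2 := C.leaf_ne_s hz'.2 hi
  unfold release
  simp only [mem_mv]
  constructor
  · rintro (rfl | ⟨h3, h4 | h4⟩)
    · exact Or.inr ⟨h1, n1⟩
    · exact Or.inl h4
    · exact Or.inr ⟨h4.2, h3⟩
  · rintro (rfl | h)
    · exact Or.inr ⟨n2, Or.inl rfl⟩
    · by_cases hv : v = C.s i
      · exact Or.inl hv
      · exact Or.inr ⟨h.2, Or.inr ⟨hv, h.1⟩⟩

theorem leafTok_release {z : V} (h1 : C.s i ∈ X) (hi : i + 1 < C.m) (hz : z ∈ C.leafTok X) :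
    C.leafTok (C.release X i z) = (C.leafTok X).erase z := by
  ext v
  rw [C.mem_leafTok, C.mem_release h1 hi hz, Finset.mem_erase, C.mem_leafTok]
  constructor
  · rintro ⟨rfl | h, h'⟩
    · exact absurd (C.ow_s hi) h'
    · exact ⟨h.2, h.1, h'⟩
  · rintro ⟨h, h', h''⟩
    exact ⟨Or.inr ⟨h', h⟩, h''⟩

theorem norm_release (hN : C.Norm X) {z : V} (h1 : C.s i ∈ X) (hi : i + 1 < C.m)
    (hz : z ∈ C.leafTok X) : C.Norm (C.release X i z) := by
  intro v hv
  rcases (C.mem_release h1 hi hz).1 hv with rfl | h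
  · rw [C.ow_s hi]; exact hv
  · refine (C.mem_release h1 hi hz).2 (Or.inr ⟨hN v h.1, ?_⟩)
    exact C.leaf_ne_s (C.mem_leafTok.1 hz).2 (C.o_lt v)

theorem prog_release {z : V} (h1 : C.s i ∈ X) (hi : i + 1 < C.m)
    (hz : z ∈ C.leafTok X) : C.Prog X (C.release X i z) := by
  left
  rw [C.leafTok_release h1 hi hz, Finset.card_erase_of_mem hz]
  have := Finset.card_pos.2 ⟨z, hz⟩
  omega

/-- If `C.m ≤ N`, the potential drops by at least `2 * N`. This is the reason for the large weight
of leaves: the drop pays for a linear search for the leaf `z`. -/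
theorem pot_release {N : ℕ} {z : V} (h1 : C.s i ∈ X) (h2 : C.s (i + 1) ∉ X) (hi : i + 1 < C.m)
    (hz : z ∈ C.leafTok X) : C.pot N (C.release X i z) + 4 * N =
      C.pot N X + 2 * (C.m - (i + 1)) := by
  have hz' := C.mem_leafTok.1 hz
  have n1 := C.leaf_ne_s hz'.2 (i := i) (by omega)
  have hne : C.s i ≠ C.s (i + 1) := fun h => by
    have := C.s_inj (by omega) hi h; omega
  have e1 := C.pot_mv (N := N) h1 h2
  have e2 := C.pot_mv (N := N) (X := mv X (C.s i) (C.s (i + 1))) (x := z) (y := C.s i)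
    (mem_mv.2 (Or.inr ⟨n1.symm, hz'.1⟩)) (by rw [mem_mv]; push Not; exact ⟨hne, fun h => absurd rfl h⟩)
  rw [C.wt_s (by omega), C.wt_s hi] at e1
  rw [C.wt_s (by omega), C.wt_leaf hz'.2] at e2
  unfold release
  omega

theorem log_light (hX : IsPVC G k X) (hi : i + 1 < C.m) (h1 : C.s i ∈ X) (h2 : C.s (i + 1) ∉ X)
    (hX' : IsPVC G k (mv X (C.s i) (C.s (i + 1)))) :
    Log G k X [(C.s i, C.s (i + 1))] (mv X (C.s i) (C.s (i + 1))) :=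
  Log.single hX (C.adj_succ hi) h1 h2 hX'

theorem log_release (hk : 4 ≤ k) (hX : IsPVC G k X) (hi : i + 1 < C.m) (h1 : C.s i ∈ X)
    (h2 : C.s (i + 1) ∉ X) (hX' : IsPVC G k (mv X (C.s i) (C.s (i + 1)))) {z : V}
    (hz : z ∈ C.leafTok X) (hzi : C.o z = i) :
    Log G k X [(C.s i, C.s (i + 1)), (z, C.s i)] (C.release X i z) := by
  have hz' := C.mem_leafTok.1 hz
  have n1 := C.leaf_ne_s hz'.2 (i := i) (by omega)
  have hne : C.s i ≠ C.s (i + 1) := fun h => by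
    have := C.s_inj (by omega) hi h; omega
  have how : C.ow z = C.s i := by rw [ow, hzi]
  refine (C.log_light hX hi h1 h2 hX').snoc ?_ (mem_mv.2 (Or.inr ⟨n1.symm, hz'.1⟩))
    (by rw [mem_mv]; push Not; exact ⟨hne, fun h => absurd rfl h⟩) ?_
  · rw [← how]; exact C.adj_ow hz'.2
  · rw [C.isPVC_iff_ok hk] at hX' ⊢
    rw [← how]
    rw [← how] at hX'
    exact C.ok_lift hX' hz'.2

end Step

/-- Perform legal slides to the right in any order, with a release whenever the star left behind has
a leaf token. The potential drops each time, and normality and `Prog` survive each step. -/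
theorem exists_phase (hk : 4 ≤ k) (X : Finset V) (hX : IsPVC G k X) (hN : C.Norm X) :
    ∃ l X', Log G k X l X' ∧ C.Norm X' ∧ C.RightFixed k X' ∧ C.Prog X X' := by
  induction h : C.pot C.m X using Nat.strong_induction_on generalizing X with
  | _ p ih =>
    by_cases hR : C.RightFixed k X
    · exact ⟨[], X, .nil hX, hN, hR, Prog.refl C X⟩
    · unfold RightFixed at hR
      push Not at hR
      obtain ⟨i, hi, h1, h2, h3⟩ := hR
      obtain ⟨l, Y, hl, hYN, hYP, hYp⟩ : ∃ l Y, Log G k X l Y ∧ C.Norm Y ∧ C.Prog X Y ∧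
          C.pot C.m Y < p := by
        by_cases hz : ∃ z ∈ C.leafTok X, C.o z = i
        · obtain ⟨z, hz, hzi⟩ := hz
          refine ⟨_, _, C.log_release hk hX hi h1 h2 h3 hz hzi, C.norm_release hN h1 hi hz,
            C.prog_release h1 hi hz, ?_⟩
          have := C.pot_release (N := C.m) h1 h2 hi hz
          omega
        · push Not at hz
          refine ⟨_, _, C.log_light hX hi h1 h2 h3, C.norm_light hN hi hz,
            C.prog_light hN hi h1 h2 hz, ?_⟩
          have := C.pot_light (N := C.m) hi h1 h2
          omega
      obtain ⟨l', X', h4, h5, h6, h7⟩ := ih _ hYp Y hl.isPVC_right hYN rfl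
      exact ⟨_, X', hl.append h4, h5, h6, hYP.trans h7⟩

/-! ### Terminal states -/

/-- `Z` is reached from `I` by the slides in `l`, at the end of which tokens have been moved to the
right as far as possible and then to the left as far as possible, without a change of the leaf
tokens. -/
def Terminal (k : ℕ) (I : Finset V) (l : List (V × V)) (Z : Finset V) : Prop :=
  ∃ X l₁ l₂, l = l₁ ++ l₂ ∧ Log G k I l₁ X ∧ Log G k X l₂ Z ∧ C.Norm X ∧ C.Norm Z ∧
    C.RightFixed k X ∧ C.mirror.RightFixed k Z ∧ C.leafTok X = C.leafTok Z ∧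
    ∀ v ∈ C.leafTok X, C.below X (C.o v) = C.below Z (C.o v)

/-- The left phase is a right phase on the mirrored spine, so its `Prog` counts tokens from the
other end. The stars of leaf tokens look the same in `X` and `Z`, hence `below_mirror` turns these
counts around. -/
theorem terminal_of_phases {I X Z : Finset V} {l₁ l₂ : List (V × V)} (h1 : Log G k I l₁ X)
    (h2 : Log G k X l₂ Z) (hX : C.Norm X) (hZ : C.Norm Z) (hXR : C.RightFixed k X)
    (hZR : C.mirror.RightFixed k Z) (hP : C.mirror.Prog X Z)
    (hc : (C.leafTok X).card ≤ (C.leafTok Z).card) : C.Terminal k I (l₁ ++ l₂) Z := by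
  rcases hP with h | ⟨h, h'⟩
  · rw [leafTok_mirror, leafTok_mirror] at h; omega
  · rw [leafTok_mirror, leafTok_mirror] at h
    rw [leafTok_mirror] at h'
    refine ⟨X, l₁, l₂, rfl, h1, h2, hX, hZ, hXR, hZR, h.symm, fun v hv => ?_⟩
    have e1 := h' v hv
    rw [mirror_o] at e1
    have e2 := C.below_mirror X (C.o_lt v)
    have e3 := C.below_mirror Z (C.o_lt v)
    have e4 := h2.card_eq
    have e5 : (X.filter fun w => C.o w = C.o v).card = (Z.filter fun w => C.o w = C.o v).card := by
      congr 1; ext w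
      simp only [Finset.mem_filter]
      have a1 : C.ow v ∈ X := hX v (C.mem_leafTok.1 hv).1
      have a2 : C.ow v ∈ Z := hZ v (C.mem_leafTok.1 (by rw [h]; exact hv)).1
      refine and_congr_left fun hw => ?_
      by_cases hwl : C.ow w = w
      · have : w = C.ow v := by rw [← hwl, ow, hw]; rfl
        subst this; simp [a1, a2]
      · have b1 := C.mem_leafTok (X := X) (v := w)
        have b2 := C.mem_leafTok (X := Z) (v := w)
        rw [h] at b2
        tauto
    omega

theorem exists_norm (hk : 4 ≤ k) (I : Finset V) (hI : IsPVC G k I) :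
    ∃ l X, Log G k I l X ∧ C.Norm X := by
  induction h : (C.leafTok I).card using Nat.strong_induction_on generalizing I with
  | _ p ih =>
    by_cases hN : C.Norm I
    · exact ⟨[], I, .nil hI, hN⟩
    · unfold Norm at hN
      push Not at hN
      obtain ⟨v, hv, hov⟩ := hN
      have hvl : C.ow v ≠ v := fun h => hov (by rwa [h])
      have hlog := Log.single hI (C.adj_ow hvl) hv hov (by
        rw [C.isPVC_iff_ok hk] at hI ⊢
        exact C.ok_lift hI hvl)
      have hlt : (C.leafTok (mv I v (C.ow v))).card < p := by
        rw [← h]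
        apply Finset.card_lt_card
        rw [Finset.ssubset_iff_of_subset]
        · refine ⟨v, C.mem_leafTok.2 ⟨hv, hvl⟩, ?_⟩
          rw [C.mem_leafTok, mem_mv]
          rintro ⟨h1 | h1, -⟩
          · exact hvl h1.symm
          · exact h1.1 rfl
        · intro w hw
          rw [C.mem_leafTok, mem_mv] at hw
          rcases hw with ⟨rfl | h1, h2⟩
          · exact absurd (C.ow_ow v) h2
          · exact C.mem_leafTok.2 ⟨h1.2, h2⟩
      obtain ⟨l, X, h1, h2⟩ := ih _ hlt _ hlog.isPVC_right rfl
      exact ⟨_, X, hlog.append h1, h2⟩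

/-- A pair of phases that does not end in a terminal position has lost a leaf token. -/
theorem exists_terminal (hk : 4 ≤ k) (I : Finset V) (hI : IsPVC G k I) :
    ∃ l Z, C.Terminal k I l Z := by
  obtain ⟨l, X, hl, hX⟩ := C.exists_norm hk I hI
  clear hI
  induction h : (C.leafTok X).card using Nat.strong_induction_on generalizing X l with
  | _ p ih =>
    obtain ⟨l₁, X₁, a1, a2, a3, a4⟩ := C.exists_phase hk X hl.isPVC_right hX
    obtain ⟨l₂, X₂, b1, b2, b3, b4⟩ := C.mirror.exists_phase hk X₁ a1.isPVC_right
      (C.norm_mirror.2 a2)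
    have a5 := a4.card_le
    rw [norm_mirror] at b2
    by_cases hc : (C.leafTok X₁).card ≤ (C.leafTok X₂).card
    · exact ⟨_, X₂, C.terminal_of_phases (hl.append a1) b1 a2 b2 a3 b3 b4 hc⟩
    · exact ih _ (by omega) _ X₂ ((hl.append a1).append b1) b2 rfl

theorem Terminal.log {C : Spine G} {I Z : Finset V} {l : List (V × V)} (h : C.Terminal k I l Z) :
    Log G k I l Z := by
  obtain ⟨X, l₁, l₂, rfl, h1, h2, -⟩ := h
  exact h1.append h2

/-- A rigid token is never touched. Conversely, an untouched token on the spine is in both `X` and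
`Z`, and no token has crossed it, so the counts before it agree and `star_fixed` applies. For a leaf
token the conditions at its owner are part of `Terminal`. -/
theorem Terminal.rigidSet_eq {C : Spine G} (hk : 4 ≤ k) {I Z : Finset V} {l : List (V × V)}
    (h : C.Terminal k I l Z) (hfull : ¬ C.Full Z) :
    rigidSet G k I = {u | u ∈ Z ∧ ∀ p ∈ l, p.1 ≠ u ∧ p.2 ≠ u} := by
  have hlog := h.log
  obtain ⟨X, l₁, l₂, rfl, h1, h2, hX, hZ, hXR, hZR, hE, hb⟩ := h
  ext u
  constructor
  · intro hu
    exact ⟨hu.2 _ hlog.reachable, hlog.notMem_of_mem_rigidSet hu⟩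
  · rintro ⟨huZ, hu⟩
    have hfullX : ¬ C.Full X := by
      rw [full_iff_cnt, C.cnt_m_eq hE h2.card_eq.symm, ← full_iff_cnt]; exact hfull
    have key := fun Y l' (hl' : Log G k X l' Y) => C.star_fixed hk h2.isPVC_right hX hZ hXR hZR hE
      hb h2.card_eq.symm hfullX hl'
    have huX : u ∈ X := (h2.mem_iff fun p hp => hu p (List.mem_append.2 (Or.inr hp))).1 huZ
    refine ⟨(hlog.mem_iff hu).1 huZ, fun J hJ => ?_⟩
    obtain ⟨l', hl'⟩ := reachable_iff_log.1 (h1.reachable.symm.trans hJ)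
    by_cases hul : C.ow u = u
    · have hus : u = C.s (C.o u) := hul.symm
      refine ((key J l' hl' (C.o u) (C.o_lt u) (by rwa [← hus]) (by rwa [← hus]) ?_).1 u rfl).2 huX
      refine (C.below_eq_of_log h2 ?_).symm
      rw [← hus]
      exact fun p hp => hu p (List.mem_append.2 (Or.inr hp))
    · exact ((key J l' hl' (C.o u) (C.o_lt u) (hX u huX) (hZ u huZ)
        (hb u (C.mem_leafTok.2 ⟨huX, hul⟩))).1 u rfl).2 huX

theorem Terminal.leafTok_subset_rigidSet {C : Spine G} (hk : 4 ≤ k) {I Z : Finset V}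
    {l : List (V × V)} (h : C.Terminal k I l Z) (hfull : ¬ C.Full Z) {v : V}
    (hv : v ∈ C.leafTok Z) : v ∈ rigidSet G k I := by
  have hlog := h.log
  rw [hlog.reachable.rigidSet_eq]
  obtain ⟨X, l₁, l₂, rfl, h1, h2, hX, hZ, hXR, hZR, hE, hb⟩ := h
  have hfullX : ¬ C.Full X := by
    rw [full_iff_cnt, C.cnt_m_eq hE h2.card_eq.symm, ← full_iff_cnt]; exact hfull
  have hvX := hv
  rw [← hE] at hvX
  refine ⟨(C.mem_leafTok.1 hv).1, fun J hJ => ?_⟩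
  obtain ⟨l', hl'⟩ := reachable_iff_log.1 (h2.reachable.trans hJ)
  exact ((C.star_fixed hk h2.isPVC_right hX hZ hXR hZR hE hb h2.card_eq.symm hfullX hl' _ (C.o_lt v)
    (hX v (C.mem_leafTok.1 hvX).1) (hZ v (C.mem_leafTok.1 hv).1) (hb v hvX)).1 v rfl).2
    (C.mem_leafTok.1 hvX).1

/-- In a normal position every star with a token has its spine vertex occupied, so the spine tokens
of `Y` meet all `Bad` windows and the counting lemma applies. -/
theorem cnt_le_of_rightFixed (hk : 4 ≤ k) {X Y : Finset V} (hX : IsPVC G k X) (hY : IsPVC G k Y)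
    (hYN : C.Norm Y) (hR : C.RightFixed k X) (hc : C.cnt X C.m = C.cnt Y C.m) :
    ∀ i, i ≤ C.m → C.cnt X i ≤ C.cnt Y i := by
  refine count_le_count_of_fixed (C.Bad k) ?_ ?_ hc
  · intro a b hb hbad
    obtain ⟨i, h1, h2, v, hv, rfl⟩ := C.exists_of_bad ((C.isPVC_iff_ok hk).1 hY) hbad
    exact ⟨_, h1, h2, hYN v hv⟩
  · intro i hi h1 h2
    exact C.rightFixed_window hk hX hR hi h1 h2

/-- Two extremal positions bound each other's prefix counts, hence they have the same spine tokens.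
-/
theorem eq_of_rightFixed (hk : 4 ≤ k) {X Y : Finset V} (hX : IsPVC G k X) (hY : IsPVC G k Y)
    (hXN : C.Norm X) (hYN : C.Norm Y) (hXR : C.RightFixed k X) (hYR : C.RightFixed k Y)
    (hE : C.leafTok X = C.leafTok Y) (hc : X.card = Y.card) : X = Y := by
  have hm := C.cnt_m_eq hE hc
  have h1 := C.cnt_le_of_rightFixed hk hX hY hYN hXR hm
  have h2 := C.cnt_le_of_rightFixed hk hY hX hXN hYR hm.symm
  ext v
  by_cases hvl : C.ow v = v
  · have hvs : v = C.s (C.o v) := hvl.symm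
    have hv := C.o_lt v
    have e1 := le_antisymm (h1 (C.o v) hv.le) (h2 (C.o v) hv.le)
    have e2 := le_antisymm (h1 (C.o v + 1) hv) (h2 (C.o v + 1) hv)
    simp only [cnt, Nat.count_succ] at e1 e2
    rw [hvs]
    by_cases a1 : C.s (C.o v) ∈ X <;> by_cases a2 : C.s (C.o v) ∈ Y <;>
      simp only [a1, a2, if_true, if_false] at e2 ⊢ <;> omega
  · have b1 := C.mem_leafTok (X := X) (v := v)
    have b2 := C.mem_leafTok (X := Y) (v := v)
    rw [hE] at b1
    tauto

/-! ### States with a full spine -/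

theorem isPVC_of_hole (hk : 4 ≤ k) {X : Finset V} (hX : C.Full X) {i : ℕ} (hi : i < C.m) (y : V) :
    IsPVC G k (mv X (C.s i) y) := by
  rw [C.isPVC_iff_ok hk]
  refine C.ok_of_single_hole (i := i) fun j hj hne => mem_mv.2 (Or.inr ⟨?_, hX j hj⟩)
  exact fun h => hne (C.s_inj hj hi h)

theorem Full.isPVC {C : Spine G} (hk : 4 ≤ k) {X : Finset V} (hX : C.Full X) : IsPVC G k X := by
  rw [C.isPVC_iff_ok hk]
  exact C.ok_of_single_hole (i := 0) fun j hj _ => hX j hj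

theorem Full.leaf {C : Spine G} {X : Finset V} (hX : C.Full X) {y : V} (hy : y ∉ X) :
    C.ow y ≠ y := fun h => hy (h ▸ hX _ (C.o_lt y))

theorem mv_hole {X : Finset V} (hX : C.Full X) {y : V} (hy : y ∉ X) {i j : ℕ} (hi : i < C.m)
    (hj : j < C.m) (hij : i ≠ j) : mv (mv X (C.s i) y) (C.s j) (C.s i) = mv X (C.s j) y := by
  have hyl := hX.leaf hy
  have n1 := C.leaf_ne_s hyl hi
  have n2 := C.leaf_ne_s hyl hj
  ext v
  simp only [mem_mv]
  by_cases a1 : v = C.s i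
  · subst a1
    have a2 : C.s i ≠ C.s j := fun h => hij (C.s_inj hi hj h)
    simp [a2, hX i hi]
  · by_cases a2 : v = y
    · subst a2; simp [n2.symm]
    · simp [a1, a2]

theorem log_hole_start (hk : 4 ≤ k) {X : Finset V} (hX : C.Full X) {y : V} (hy : y ∉ X) :
    Log G k X [(C.ow y, y)] (mv X (C.ow y) y) :=
  Log.single (hX.isPVC hk) (C.adj_ow (hX.leaf hy)).symm (hX _ (C.o_lt y)) hy
    (C.isPVC_of_hole hk hX (C.o_lt y) y)

theorem log_hole_step (hk : 4 ≤ k) {X : Finset V} (hX : C.Full X) {y : V} (hy : y ∉ X) {i j : ℕ}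
    (hi : i < C.m) (hj : j < C.m) (hij : i + 1 = j ∨ j + 1 = i) :
    Log G k (mv X (C.s i) y) [(C.s j, C.s i)] (mv X (C.s j) y) := by
  have hyl := hX.leaf hy
  have hne : C.s j ≠ C.s i := fun h => by have := C.s_inj hj hi h; omega
  have n1 := C.leaf_ne_s hyl hi
  have := Log.single (k := k) (X := mv X (C.s i) y) (x := C.s j) (y := C.s i)
    (C.isPVC_of_hole hk hX hi y)
    (by
      rcases hij with rfl | rfl
      · exact (C.adj_succ hj).symm
      · exact C.adj_succ hi)
    (mem_mv.2 (Or.inr ⟨hne, hX j hj⟩))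
    (by rw [mem_mv]; push Not; exact ⟨n1, fun h => absurd rfl h⟩)
    (by rw [C.mv_hole hX hy hi hj (by omega)]; exact C.isPVC_of_hole hk hX hj y)
  rwa [C.mv_hole hX hy hi hj (by omega)] at this

theorem full_mv_leaf {X : Finset V} (hX : C.Full X) {x y : V} (hx : C.ow x ≠ x) :
    C.Full (mv X x y) := fun i hi =>
  mem_mv.2 (Or.inr ⟨C.leaf_ne_s hx hi, hX i hi⟩)

theorem log_hole_end (hk : 4 ≤ k) {X : Finset V} (hX : C.Full X) {x y : V} (hy : y ∉ X)
    (hx : x ∈ C.leafTok X) : Log G k (mv X (C.ow x) y) [(x, C.ow x)] (mv X x y) := by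
  have hyl := hX.leaf hy
  have hx' := C.mem_leafTok.1 hx
  have n1 := C.leaf_ne_s hyl (C.o_lt x)
  have hxy : x ≠ y := by rintro rfl; exact hy hx'.1
  have e : mv (mv X (C.ow x) y) x (C.ow x) = mv X x y := by
    ext v
    simp only [mem_mv]
    have : C.ow x ∈ X := hX _ (C.o_lt x)
    by_cases a1 : v = C.ow x
    · subst a1; simp [hx'.2, this]
    · by_cases a2 : v = y
      · subst a2; simp [hxy.symm]
      · simp [a1, a2]
  have := Log.single (k := k) (X := mv X (C.ow x) y) (x := x) (y := C.ow x)
    (C.isPVC_of_hole hk hX (C.o_lt x) y) (C.adj_ow hx'.2)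
    (mem_mv.2 (Or.inr ⟨hx'.2.symm, hx'.1⟩))
    (by rw [mem_mv]; push Not; exact ⟨n1, fun h => absurd rfl h⟩)
    (by rw [e]; exact (C.full_mv_leaf hX hx'.2).isPVC hk)
  rwa [e] at this

/-- The token at the owner of `y` steps onto `y`, which opens a hole on the spine; the hole then
moves one vertex at a time to `s i`. -/
theorem reachable_hole (hk : 4 ≤ k) {X : Finset V} (hX : C.Full X) {y : V} (hy : y ∉ X) {i : ℕ}
    (hi : i < C.m) : Reachable G k X (mv X (C.s i) y) := by
  have h0 := (C.log_hole_start hk hX hy).reachable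
  have hup : ∀ d, C.o y + d < C.m → Reachable G k X (mv X (C.s (C.o y + d)) y) := by
    intro d
    induction d with
    | zero => intro _; exact h0
    | succ d ih =>
      intro h
      exact (ih (by omega)).trans
        (C.log_hole_step hk hX hy (i := C.o y + d) (by omega) h (Or.inl rfl)).reachable
  have hdown : ∀ d, d ≤ C.o y → Reachable G k X (mv X (C.s (C.o y - d)) y) := by
    intro d
    have := C.o_lt y
    induction d with
    | zero => intro _; exact h0
    | succ d ih =>
      intro h
      exact (ih (by omega)).trans
        (C.log_hole_step hk hX hy (i := C.o y - d) (by omega) (by omega)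
          (Or.inr (by omega))).reachable
  rcases le_total (C.o y) i with h | h
  · have := hup (i - C.o y) (by omega)
    rwa [show C.o y + (i - C.o y) = i by omega] at this
  · have := hdown (C.o y - i) (by omega)
    rwa [show C.o y - (C.o y - i) = i by omega] at this

theorem reachable_full_mv (hk : 4 ≤ k) {X : Finset V} (hX : C.Full X) {x y : V} (hy : y ∉ X)
    (hx : x ∈ C.leafTok X) : Reachable G k X (mv X x y) :=
  (C.reachable_hole hk hX hy (C.o_lt x)).trans (C.log_hole_end hk hX hy hx).reachable

/-- A spine token is displaced by moving the hole to its place, a leaf token by exchanging it for a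
token at `y`. -/
theorem Full.rigidSet_eq_empty {C : Spine G} (hk : 4 ≤ k) {X : Finset V} (hX : C.Full X) {y : V}
    (hy : y ∉ X) : rigidSet G k X = ∅ := by
  ext u
  simp only [Set.mem_empty_iff_false, iff_false]
  intro hu
  have huy : u ≠ y := by rintro rfl; exact hy hu.1
  by_cases hul : C.ow u = u
  · have hus : u = C.s (C.o u) := hul.symm
    have := hu.2 _ (C.reachable_hole hk hX hy (C.o_lt u))
    rw [← hus, mem_mv] at this
    rcases this with h | h
    · exact huy h
    · exact h.1 rfl
  · have := hu.2 _ (C.reachable_full_mv hk hX hy (C.mem_leafTok.2 ⟨hu.1, hul⟩))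
    rw [mem_mv] at this
    rcases this with h | h
    · exact huy h
    · exact h.1 rfl

/-- Exchange a token outside `Y` for one at a vertex of `Y`. Both vertices are leaves because the
spines are full, and the difference shrinks each time. -/
theorem Full.reachable {C : Spine G} (hk : 4 ≤ k) {X Y : Finset V} (hX : C.Full X) (hY : C.Full Y)
    (hc : X.card = Y.card) : Reachable G k X Y := by
  induction h : (X \ Y).card using Nat.strong_induction_on generalizing X with
  | _ p ih =>
    by_cases hXY : X ⊆ Y
    · rw [Finset.eq_of_subset_of_card_le hXY hc.ge]
      exact (Log.nil (hY.isPVC hk)).reachable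
    · obtain ⟨x, hx, hxY⟩ := Finset.not_subset.1 hXY
      have hYX : ¬ Y ⊆ X := fun h => hXY (Finset.eq_of_subset_of_card_le h hc.le).ge
      obtain ⟨y, hy, hyX⟩ := Finset.not_subset.1 hYX
      have hxl := hY.leaf hxY
      have h1 := C.reachable_full_mv hk hX hyX (C.mem_leafTok.2 ⟨hx, hxl⟩)
      refine h1.trans (ih _ ?_ (C.full_mv_leaf hX hxl) (by rw [card_mv hx hyX, hc]) rfl)
      rw [← h]
      apply Finset.card_lt_card
      rw [Finset.ssubset_iff_of_subset]
      · refine ⟨x, Finset.mem_sdiff.2 ⟨hx, hxY⟩, ?_⟩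
        rw [Finset.mem_sdiff, mem_mv]
        rintro ⟨h1 | h1, -⟩
        · subst h1; exact hxY hy
        · exact h1.1 rfl
      · intro v hv
        rw [Finset.mem_sdiff, mem_mv] at hv
        rcases hv with ⟨rfl | h1, h2⟩
        · exact absurd hy h2
        · exact Finset.mem_sdiff.2 ⟨h1.2, h2⟩

/-- If neither spine is full, the leaf tokens are rigid and can be recovered from the rigid set as
its leaves. So they agree, and left-fixed positions with equal leaf tokens and equal size coincide.
-/
theorem Terminal.eq_or_full {C : Spine G} [Fintype V] (hk : 4 ≤ k) {I J Z W : Finset V}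
    {l l' : List (V × V)} (hZ : C.Terminal k I l Z) (hW : C.Terminal k J l' W)
    (hc : I.card = J.card) (hR : rigidSet G k I = rigidSet G k J) :
    Z = W ∨ (C.Full Z ∧ C.Full W) := by
  have hc' : Z.card = W.card := by rw [hZ.log.card_eq, hW.log.card_eq, hc]
  -- With fewer spine tokens than the full `Z`, the position `W` must have a leaf token, and this
  -- token is rigid. But a full position has rigid tokens only if no vertex is vacant, and then `W`
  -- is everything as well.
  have key : ∀ {I J Z W : Finset V} {l l' : List (V × V)}, C.Terminal k I l Z →
      C.Terminal k J l' W → Z.card = W.card → rigidSet G k I = rigidSet G k J → C.Full Z →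
      C.Full W := by
    intro I J Z W l l' hZ hW hc' hR hZf
    by_contra hWf
    have e1 := C.card_eq Z
    have e2 := C.card_eq W
    rw [C.full_iff_cnt] at hZf hWf
    have e3 : C.cnt W C.m ≤ C.m := Nat.count_le _
    obtain ⟨v, hv⟩ := Finset.card_pos.1 (show 0 < (C.leafTok W).card by omega)
    rw [← C.full_iff_cnt] at hZf hWf
    have hvR := hW.leafTok_subset_rigidSet hk hWf hv
    rw [← hR, hZ.log.reachable.rigidSet_eq] at hvR
    by_cases huniv : ∃ y, y ∉ Z
    · obtain ⟨y, hy⟩ := huniv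
      rw [hZf.rigidSet_eq_empty hk hy] at hvR
      exact hvR
    · push Not at huniv
      have : Z = Finset.univ := Finset.eq_univ_iff_forall.2 huniv
      rw [this, Finset.card_univ] at hc'
      have : W = Finset.univ := (Finset.card_eq_iff_eq_univ W).1 hc'.symm
      exact hWf fun i _ => by rw [this]; exact Finset.mem_univ _
  by_cases hZf : C.Full Z
  · exact Or.inr ⟨hZf, key hZ hW hc' hR hZf⟩
  · left
    have hWf : ¬ C.Full W := fun h => hZf (key hW hZ hc'.symm hR.symm h)
    have hE : C.leafTok Z = C.leafTok W := by
      ext v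
      constructor
      · intro hv
        have := hZ.leafTok_subset_rigidSet hk hZf hv
        rw [hR] at this
        exact C.mem_leafTok.2 ⟨this.2 _ hW.log.reachable, (C.mem_leafTok.1 hv).2⟩
      · intro hv
        have := hW.leafTok_subset_rigidSet hk hWf hv
        rw [← hR] at this
        exact C.mem_leafTok.2 ⟨this.2 _ hZ.log.reachable, (C.mem_leafTok.1 hv).2⟩
    have p1 := hZ.log.isPVC_right
    have p2 := hW.log.isPVC_right
    obtain ⟨_, _, _, _, _, _, _, a1, _, a2, _, _⟩ := hZ
    obtain ⟨_, _, _, _, _, _, _, b1, _, b2, _, _⟩ := hW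
    exact C.mirror.eq_of_rightFixed hk p1 p2 (C.norm_mirror.2 a1) (C.norm_mirror.2 b1) a2 b2
      (by rw [leafTok_mirror, leafTok_mirror, hE]) hc'

/-- The criterion that the decision program evaluates and that tells the construction how to join
two terminal positions. -/
theorem Terminal.reachable_iff {C : Spine G} [Fintype V] (hk : 4 ≤ k) {I J Z W : Finset V}
    {l l' : List (V × V)} (hZ : C.Terminal k I l Z) (hW : C.Terminal k J l' W) :
    Reachable G k I J ↔ Z = W ∨ (C.Full Z ∧ C.Full W ∧ Z.card = W.card) := by
  have e1 := hZ.log.reachable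
  have e2 := hW.log.reachable
  constructor
  · intro h
    rcases hZ.eq_or_full hk hW h.card_eq.symm h.rigidSet_eq with h1 | h1
    · exact Or.inl h1
    · exact Or.inr ⟨h1.1, h1.2, by rw [e1.card_eq, e2.card_eq, h.card_eq]⟩
  · rintro (rfl | ⟨h1, h2, h3⟩)
    · exact e1.trans e2.symm
    · exact (e1.trans (h1.reachable hk h2 h3)).trans e2.symm

end Spine

theorem reachable_iff [Fintype V] (hk : 4 ≤ k) (hG : IsCaterpillar G) {I J : Finset V}
    (hI : IsPVC G k I) (hJ : IsPVC G k J) :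
    Reachable G k I J ↔ I.card = J.card ∧ rigidSet G k I = rigidSet G k J ∧
      ∀ D : (removeVerts G (rigidSet G k I)).ConnectedComponent, tokensIn I D = tokensIn J D := by
  constructor
  · intro h
    obtain ⟨l, hl⟩ := reachable_iff_log.1 h
    exact ⟨h.card_eq.symm, h.rigidSet_eq, fun D => (hl.tokensIn_eq D).symm⟩
  · rintro ⟨h1, h2, -⟩
    obtain ⟨C⟩ := hG.exists_spine
    obtain ⟨l, Z, hZ⟩ := C.exists_terminal hk I hI
    obtain ⟨l', W, hW⟩ := C.exists_terminal hk J hJ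
    refine (hZ.reachable_iff hk hW).2 ?_
    rcases hZ.eq_or_full hk hW h1 h2 with h3 | h3
    · exact Or.inl h3
    · exact Or.inr ⟨h3.1, h3.2, by rw [hZ.log.card_eq, hW.log.card_eq, h1]⟩

end Reachability

/-! ### Runs without word bound, and programs whose values grow slowly -/

/-- Runs of a program on a machine with unbounded words. -/
inductive Run : Cmd → State → ℕ → State → Prop
  | skip (σ : State) : Run .skip σ 1 σ
  | assign (σ : State) (r : ℕ) (e : AExp) : Run (.assign r e) σ (e.cost + 1)
      { regs := Function.update σ.regs r (e.eval σ), mem := σ.mem }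
  | store (σ : State) (a e : AExp) : Run (.store a e) σ (a.cost + e.cost + 1)
      { regs := σ.regs, mem := Function.update σ.mem (a.eval σ) (e.eval σ) }
  | seq {c₁ c₂ : Cmd} {σ τ ρ : State} {t₁ t₂ : ℕ} (h₁ : Run c₁ σ t₁ τ) (h₂ : Run c₂ τ t₂ ρ) :
      Run (.seq c₁ c₂) σ (t₁ + t₂) ρ
  | condTrue {e : AExp} {c₁ c₂ : Cmd} {σ τ : State} {t : ℕ} (hv : e.eval σ ≠ 0)
      (h : Run c₁ σ t τ) : Run (.cond e c₁ c₂) σ (e.cost + 1 + t) τ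
  | condFalse {e : AExp} {c₁ c₂ : Cmd} {σ τ : State} {t : ℕ} (hv : e.eval σ = 0)
      (h : Run c₂ σ t τ) : Run (.cond e c₁ c₂) σ (e.cost + 1 + t) τ
  | loopDone {e : AExp} {c : Cmd} {σ : State} (hv : e.eval σ = 0) :
      Run (.loop e c) σ (e.cost + 1) σ
  | loopStep {e : AExp} {c : Cmd} {σ τ ρ : State} {t₁ t₂ : ℕ} (hv : e.eval σ ≠ 0)
      (h₁ : Run c σ t₁ τ) (h₂ : Run (.loop e c) τ t₂ ρ) :
      Run (.loop e c) σ (e.cost + 1 + t₁ + t₂) ρ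

/-- All values in the state are at most `M`. -/
def State.Le (σ : State) (M : ℕ) : Prop := (∀ r, σ.regs r ≤ M) ∧ ∀ a, σ.mem a ≤ M

namespace AExp

/-- The value is at most `coef * M + off` in a state with values at most `M`. -/
def coef : AExp → ℕ
  | .const _ => 0
  | .reg _ => 1
  | .load _ => 1
  | .add a b => a.coef + b.coef
  | .sub a _ => a.coef
  | .mul _ _ => 0
  | .lt _ _ => 0
  | .eq _ _ => 0

def off : AExp → ℕ
  | .const c => c
  | .reg _ => 0
  | .load _ => 0
  | .add a b => a.off + b.off
  | .sub a _ => a.off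
  | .mul a b => a.off * b.off
  | .lt _ _ => 1
  | .eq _ _ => 1

/-- Only products need care: both factors must have a bound that does not depend on the state. The
test is Boolean and built on `Nat.beq`, so that it is settled for concrete programs by evaluation.
-/
def tame : AExp → Bool
  | .const _ => true
  | .reg _ => true
  | .load _ => true
  | .add a b => a.tame && b.tame
  | .sub a _ => a.tame
  | .mul a b => a.tame && b.tame && Nat.beq a.coef 0 && Nat.beq b.coef 0
  | .lt _ _ => true
  | .eq _ _ => true

theorem eval_le_of_tame {σ : State} {M : ℕ} (hσ : σ.Le M) (e : AExp) (he : e.tame = true) :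
    e.eval σ ≤ e.coef * M + e.off := by
  induction e with
  | const c => simp [eval, coef, off]
  | reg r => simpa [eval, coef, off] using hσ.1 r
  | load a _ => simpa [eval, coef, off] using hσ.2 _
  | add a b iha ihb =>
    simp only [tame, Bool.and_eq_true] at he
    have := iha he.1
    have := ihb he.2
    simp only [eval, coef, off, add_mul]
    omega
  | sub a b iha _ =>
    have := iha he
    simp only [eval, coef, off]
    omega
  | mul a b iha ihb =>
    simp only [tame, Bool.and_eq_true] at he
    have h1 := iha he.1.1.1
    have h2 := ihb he.1.1.2
    rw [Nat.eq_of_beq_eq_true he.1.2] at h1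
    rw [Nat.eq_of_beq_eq_true he.2] at h2
    simp only [eval, coef, off]
    rw [zero_mul, zero_add] at h1 h2 ⊢
    exact Nat.mul_le_mul h1 h2
  | lt a b _ _ => simp only [eval, coef, off]; split_ifs <;> omega
  | eq a b _ _ => simp only [eval, coef, off]; split_ifs <;> omega

/-- A bound on all values met in the evaluation of an expression in a state with values at
most `M`. -/
def vb (M : ℕ) : AExp → ℕ
  | .const c => c
  | .reg _ => M
  | .load a => a.vb M + M
  | .add a b => a.vb M + b.vb M
  | .sub a b => a.vb M + b.vb M
  | .mul a b => a.vb M * b.vb M + a.vb M + b.vb M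
  | .lt a b => a.vb M + b.vb M + 1
  | .eq a b => a.vb M + b.vb M + 1

theorem eval_le_vb {σ : State} {M : ℕ} (hσ : σ.Le M) (e : AExp) : e.eval σ ≤ e.vb M := by
  induction e with
  | const c => simp [eval, vb]
  | reg r => exact hσ.1 r
  | load a _ => exact (hσ.2 _).trans (Nat.le_add_left _ _)
  | add a b iha ihb => exact Nat.add_le_add iha ihb
  | sub a b iha _ => simp only [eval, vb]; omega
  | mul a b iha ihb =>
    have := Nat.mul_le_mul iha ihb
    simp only [eval, vb]; omega
  | lt a b _ _ => simp only [eval, vb]; split_ifs <;> omega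
  | eq a b _ _ => simp only [eval, vb]; split_ifs <;> omega

theorem fits_of_vb {σ : State} {M W : ℕ} (hσ : σ.Le M) (e : AExp) (h : e.vb M ≤ W) :
    e.Fits W σ := by
  have hev := eval_le_vb hσ
  induction e with
  | const c => exact h
  | reg r => exact (hσ.1 r).trans h
  | load a ih =>
    simp only [vb] at h
    exact ⟨ih (by omega), (hσ.2 _).trans (by omega)⟩
  | add a b iha ihb =>
    have := hev a
    have := hev b
    simp only [vb] at h
    exact ⟨iha (by omega), ihb (by omega), by omega⟩
  | sub a b iha ihb =>
    simp only [vb] at h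
    exact ⟨iha (by omega), ihb (by omega)⟩
  | mul a b iha ihb =>
    have := Nat.mul_le_mul (hev a) (hev b)
    simp only [vb] at h
    exact ⟨iha (by omega), ihb (by omega), by omega⟩
  | lt a b iha ihb =>
    simp only [vb] at h
    exact ⟨iha (by omega), ihb (by omega)⟩
  | eq a b iha ihb =>
    simp only [vb] at h
    exact ⟨iha (by omega), ihb (by omega)⟩

theorem vb_mono {M N : ℕ} (h : M ≤ N) (e : AExp) : e.vb M ≤ e.vb N := by
  induction e with
  | const c => exact le_rfl
  | reg r => exact h
  | load a ih => exact Nat.add_le_add ih h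
  | add a b iha ihb => exact Nat.add_le_add iha ihb
  | sub a b iha ihb => exact Nat.add_le_add iha ihb
  | mul a b iha ihb =>
    exact Nat.add_le_add (Nat.add_le_add (Nat.mul_le_mul iha ihb) iha) ihb
  | lt a b iha ihb => exact Nat.add_le_add_right (Nat.add_le_add iha ihb) _
  | eq a b iha ihb => exact Nat.add_le_add_right (Nat.add_le_add iha ihb) _

end AExp

/-- Functions bounded by a polynomial in `n ≥ 1` when their argument is. -/
def PolyBounded (g : ℕ → ℕ) : Prop :=
  ∀ A p, ∃ B q, ∀ n M, 1 ≤ n → M ≤ A * n ^ p → g M ≤ B * n ^ q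

theorem PolyBounded.const (c : ℕ) : PolyBounded fun _ => c :=
  fun _ _ => ⟨c, 0, fun n M _ _ => by simp⟩

theorem PolyBounded.id : PolyBounded fun M => M := fun A p => ⟨A, p, fun _ _ _ h => h⟩

theorem PolyBounded.add {g h : ℕ → ℕ} (hg : PolyBounded g) (hh : PolyBounded h) :
    PolyBounded fun M => g M + h M := by
  intro A p
  obtain ⟨B, q, h1⟩ := hg A p
  obtain ⟨B', q', h2⟩ := hh A p
  refine ⟨B + B', q + q', fun n M hn hM => ?_⟩
  rw [add_mul]
  refine Nat.add_le_add ((h1 n M hn hM).trans ?_) ((h2 n M hn hM).trans ?_)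
  · exact Nat.mul_le_mul_left _ (Nat.pow_le_pow_right hn (by omega))
  · exact Nat.mul_le_mul_left _ (Nat.pow_le_pow_right hn (by omega))

theorem PolyBounded.mul {g h : ℕ → ℕ} (hg : PolyBounded g) (hh : PolyBounded h) :
    PolyBounded fun M => g M * h M := by
  intro A p
  obtain ⟨B, q, h1⟩ := hg A p
  obtain ⟨B', q', h2⟩ := hh A p
  refine ⟨B * B', q + q', fun n M hn hM => ?_⟩
  refine (Nat.mul_le_mul (h1 n M hn hM) (h2 n M hn hM)).trans (le_of_eq ?_)
  rw [pow_add]; ring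

theorem AExp.polyBounded_vb (e : AExp) : PolyBounded fun M => e.vb M := by
  induction e with
  | const c => exact .const c
  | reg r => exact .id
  | load a ih => exact ih.add .id
  | add a b iha ihb => exact iha.add ihb
  | sub a b iha ihb => exact iha.add ihb
  | mul a b iha ihb => exact ((iha.mul ihb).add iha).add ihb
  | lt a b iha ihb => exact (iha.add ihb).add (.const 1)
  | eq a b iha ihb => exact (iha.add ihb).add (.const 1)

namespace Cmd

/-- Values assigned or stored exceed the current values by at most `2`. -/
def tame : Cmd → Bool
  | .skip => true
  | .assign _ e => e.tame && Nat.ble e.coef 1 && Nat.ble e.off 2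
  | .store _ e => e.tame && Nat.ble e.coef 1 && Nat.ble e.off 2
  | .seq c d => c.tame && d.tame
  | .cond _ c d => c.tame && d.tame
  | .loop _ c => c.tame

def vb (M : ℕ) : Cmd → ℕ
  | .skip => 0
  | .assign _ e => e.vb M
  | .store a e => a.vb M + e.vb M
  | .seq c d => c.vb M + d.vb M
  | .cond e c d => e.vb M + c.vb M + d.vb M
  | .loop e c => e.vb M + c.vb M

theorem vb_mono {M N : ℕ} (h : M ≤ N) (c : Cmd) : c.vb M ≤ c.vb N := by
  induction c with
  | skip => exact le_rfl
  | assign r e => exact e.vb_mono h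
  | store a e => exact Nat.add_le_add (a.vb_mono h) (e.vb_mono h)
  | seq c d ihc ihd => exact Nat.add_le_add ihc ihd
  | cond e c d ihc ihd => exact Nat.add_le_add (Nat.add_le_add (e.vb_mono h) ihc) ihd
  | loop e c ih => exact Nat.add_le_add (e.vb_mono h) ih

theorem polyBounded_vb (c : Cmd) : PolyBounded fun M => c.vb M := by
  induction c with
  | skip => exact .const 0
  | assign r e => exact e.polyBounded_vb
  | store a e => exact a.polyBounded_vb.add e.polyBounded_vb
  | seq c d ihc ihd => exact ihc.add ihd
  | cond e c d ihc ihd => exact (e.polyBounded_vb.add ihc).add ihd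
  | loop e c ih => exact e.polyBounded_vb.add ih

end Cmd

theorem AExp.one_le_cost (e : AExp) : 1 ≤ e.cost := by cases e <;> simp [AExp.cost]

theorem eval_le_of_tame_bounds {σ : State} {M : ℕ} (hσ : σ.Le M) {e : AExp}
    (he : (e.tame && Nat.ble e.coef 1 && Nat.ble e.off 2) = true) : e.eval σ ≤ M + 2 := by
  simp only [Bool.and_eq_true, Nat.ble_eq] at he
  have := AExp.eval_le_of_tame hσ e he.1.1
  have : e.coef * M ≤ 1 * M := Nat.mul_le_mul_right _ he.1.2
  omega

theorem State.Le.mono {σ : State} {M N : ℕ} (h : σ.Le M) (hMN : M ≤ N) : σ.Le N :=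
  ⟨fun r => (h.1 r).trans hMN, fun a => (h.2 a).trans hMN⟩

/-- An assignment or a store exceeds the current maximum by at most 2 and costs at least one unit,
so after time `t` all values are at most `M + 2 * t`. At this bound `vb` covers all intermediate
values and addresses, hence nothing overflows. -/
theorem Run.exec {c : Cmd} {σ τ : State} {t M W : ℕ} (h : Run c σ t τ) (hc : c.tame = true)
    (hσ : σ.Le M) (hW : c.vb (M + 2 * t) ≤ W) : Exec W c σ t τ ∧ τ.Le (M + 2 * t) := by
  induction h generalizing M with
  | skip σ => exact ⟨.skip σ, hσ.mono (by omega)⟩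
  | assign σ r e =>
    have h1 := eval_le_of_tame_bounds hσ hc
    have h2 := e.one_le_cost
    refine ⟨.assign σ r e (AExp.fits_of_vb hσ e ((e.vb_mono (by omega)).trans hW)), ?_, ?_⟩
    · intro r'
      simp only [Function.update_apply]
      have := hσ.1 r'
      split_ifs <;> omega
    · intro a
      have := hσ.2 a
      simp only; omega
  | store σ a e =>
    have h1 := eval_le_of_tame_bounds hσ hc
    have h2 := e.one_le_cost
    have h3 := a.vb_mono (show M ≤ M + 2 * (a.cost + e.cost + 1) by omega)
    have h4 := e.vb_mono (show M ≤ M + 2 * (a.cost + e.cost + 1) by omega)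
    simp only [Cmd.vb] at hW
    refine ⟨.store σ a e (AExp.fits_of_vb hσ a (by omega)) (AExp.fits_of_vb hσ e (by omega)), ?_, ?_⟩
    · intro r'
      have := hσ.1 r'
      simp only; omega
    · intro b
      simp only [Function.update_apply]
      have := hσ.2 b
      split_ifs <;> omega
  | @seq c₁ c₂ σ τ ρ t₁ t₂ h₁ h₂ ih₁ ih₂ =>
    simp only [Cmd.tame, Bool.and_eq_true] at hc
    simp only [Cmd.vb] at hW
    have m1 := c₁.vb_mono (show M + 2 * t₁ ≤ M + 2 * (t₁ + t₂) by omega)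
    obtain ⟨e1, l1⟩ := ih₁ hc.1 hσ (by omega)
    obtain ⟨e2, l2⟩ := ih₂ hc.2 l1 (by
      rw [show M + 2 * t₁ + 2 * t₂ = M + 2 * (t₁ + t₂) by ring]; omega)
    exact ⟨.seq e1 e2, l2.mono (by omega)⟩
  | @condTrue e c₁ c₂ σ τ t hv h ih =>
    simp only [Cmd.tame, Bool.and_eq_true] at hc
    simp only [Cmd.vb] at hW
    have m1 := c₁.vb_mono (show M + 2 * t ≤ M + 2 * (e.cost + 1 + t) by omega)
    have m2 := e.vb_mono (show M ≤ M + 2 * (e.cost + 1 + t) by omega)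
    obtain ⟨e1, l1⟩ := ih hc.1 hσ (by omega)
    exact ⟨.condTrue (AExp.fits_of_vb hσ e (by omega)) hv e1, l1.mono (by omega)⟩
  | @condFalse e c₁ c₂ σ τ t hv h ih =>
    simp only [Cmd.tame, Bool.and_eq_true] at hc
    simp only [Cmd.vb] at hW
    have m1 := c₂.vb_mono (show M + 2 * t ≤ M + 2 * (e.cost + 1 + t) by omega)
    have m2 := e.vb_mono (show M ≤ M + 2 * (e.cost + 1 + t) by omega)
    obtain ⟨e1, l1⟩ := ih hc.2 hσ (by omega)
    exact ⟨.condFalse (AExp.fits_of_vb hσ e (by omega)) hv e1, l1.mono (by omega)⟩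
  | @loopDone e c σ hv =>
    simp only [Cmd.vb] at hW
    have m2 := e.vb_mono (show M ≤ M + 2 * (e.cost + 1) by omega)
    exact ⟨.loopDone (AExp.fits_of_vb hσ e (by omega)) hv, hσ.mono (by omega)⟩
  | @loopStep e c σ τ ρ t₁ t₂ hv h₁ h₂ ih₁ ih₂ =>
    have hc' : c.tame = true := hc
    have hW' := hW
    simp only [Cmd.vb] at hW
    have m1 := c.vb_mono (show M + 2 * t₁ ≤ M + 2 * (e.cost + 1 + t₁ + t₂) by omega)
    have m2 := e.vb_mono (show M ≤ M + 2 * (e.cost + 1 + t₁ + t₂) by omega)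
    obtain ⟨e1, l1⟩ := ih₁ hc' hσ (by omega)
    obtain ⟨e2, l2⟩ := ih₂ hc l1
      ((Cmd.vb_mono (by omega) _).trans hW')
    exact ⟨.loopStep (AExp.fits_of_vb hσ e (by omega)) hv e1 e2, l2.mono (by omega)⟩

/-- In polynomial time a tame program only produces values of polynomial size. -/
theorem exists_wordBound {P : Cmd} (hP : P.tame = true) (A p : ℕ) :
    ∃ B q, ∀ n t σ τ, 1 ≤ n → σ.Le n → t ≤ A * n ^ p → Run P σ t τ →
      ∀ W, B * n ^ q ≤ W → Exec W P σ t τ := by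
  obtain ⟨B, q, h⟩ := P.polyBounded_vb (1 + 2 * A) (p + 1)
  refine ⟨B, q, fun n t σ τ hn hσ ht hr W hW => (hr.exec hP hσ ((h n _ hn ?_).trans hW)).1⟩
  have h1 : n ^ p ≤ n ^ (p + 1) := Nat.pow_le_pow_right hn (by omega)
  have h2 : n ≤ n ^ (p + 1) := Nat.le_self_pow (by omega) n
  have h3 : A * n ^ p ≤ A * n ^ (p + 1) := Nat.mul_le_mul_left _ h1
  nlinarith

/-! ### Records in the memory behind the input

The memory behind the input is used as a sequence of records with sixteen fields each. -/

infixr:60 " ;; " => Cmd.seq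

/-- Contents of the registers and of the fields of the records. -/
structure Rec where
  r : ℕ → ℕ
  f : ℕ → ℕ → ℕ

/-- The first address behind the input. -/
def baseAddr (I : ℕ → ℕ) : ℕ := 1 + I 0 * I 0 + (I 0 + I 0)

/-- The machine state with the input `I` and the records `s`. -/
def conc (I : ℕ → ℕ) (s : Rec) : State where
  regs := s.r
  mem a := if a < baseAddr I then I a else s.f ((a - baseAddr I) % 16) ((a - baseAddr I) / 16)

namespace Rec

def setr (s : Rec) (a v : ℕ) : Rec := ⟨fun b => if b = a then v else s.r b, s.f⟩

def setf (s : Rec) (j i v : ℕ) : Rec :=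
  ⟨s.r, fun j' i' => if j' = j ∧ i' = i then v else s.f j' i'⟩

@[simp] theorem setr_r (s : Rec) (a v b : ℕ) : (s.setr a v).r b = if b = a then v else s.r b := rfl
@[simp] theorem setr_f (s : Rec) (a v : ℕ) : (s.setr a v).f = s.f := rfl
@[simp] theorem setf_r (s : Rec) (j i v : ℕ) : (s.setf j i v).r = s.r := rfl
@[simp] theorem setf_f (s : Rec) (j i v j' i' : ℕ) :
    (s.setf j i v).f j' i' = if j' = j ∧ i' = i then v else s.f j' i' := rfl

end Rec

/-- The number of vertices, read from the input. -/
def nE : AExp := .load (.const 0)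

/-- Evaluates to `baseAddr`, which leaves room for two characteristic vectors whether the input has
one or two. Recomputing it at each access costs a constant. -/
def baseE : AExp := .add (.add (.const 1) (.mul nE nE)) (.add nE nE)

/-- The address of field `j` of record `e`. -/
def adr (j : ℕ) (e : AExp) : AExp := .add (.add baseE (.const j)) (.mul (.const 16) e)

/-- The content of field `j` of record `e`. -/
def fd (j : ℕ) (e : AExp) : AExp := .load (adr j e)

def st (j : ℕ) (i e : AExp) : Cmd := .store (adr j i) e

/-- The entry of the adjacency matrix. -/
def adjE (u v : AExp) : AExp := .load (.add (.const 1) (.add (.mul u nE) v))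

/-- The entry of the `t`-th characteristic vector in the input. -/
def setE (t : ℕ) (v : AExp) : AExp :=
  .load (.add (.add (.const 1) (.mul nE nE)) (.add (.mul (.const t) nE) v))

/-- The value of an expression. -/
def ev (I : ℕ → ℕ) (s : Rec) (e : AExp) : ℕ := e.eval (conc I s)

section Eval

variable (I : ℕ → ℕ) (s : Rec)

theorem baseAddr_pos : 0 < baseAddr I := by unfold baseAddr; omega

@[simp] theorem ev_const (c : ℕ) : ev I s (.const c) = c := rfl
@[simp] theorem ev_reg (a : ℕ) : ev I s (.reg a) = s.r a := rfl
@[simp] theorem ev_add (a b : AExp) : ev I s (.add a b) = ev I s a + ev I s b := rfl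
@[simp] theorem ev_sub (a b : AExp) : ev I s (.sub a b) = ev I s a - ev I s b := rfl
@[simp] theorem ev_mul (a b : AExp) : ev I s (.mul a b) = ev I s a * ev I s b := rfl
@[simp] theorem ev_lt (a b : AExp) :
    ev I s (.lt a b) = if ev I s a < ev I s b then 1 else 0 := rfl
@[simp] theorem ev_eq (a b : AExp) :
    ev I s (.eq a b) = if ev I s a = ev I s b then 1 else 0 := rfl

@[simp] theorem ev_nE : ev I s nE = I 0 := if_pos (baseAddr_pos I)

@[simp] theorem ev_baseE : ev I s baseE = baseAddr I := by
  simp [baseE, baseAddr]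

theorem ev_adr (j : ℕ) (e : AExp) : ev I s (adr j e) = baseAddr I + j + 16 * ev I s e := by
  simp [adr]

@[simp] theorem ev_fd {j : ℕ} (hj : j < 16) (e : AExp) : ev I s (fd j e) = s.f j (ev I s e) := by
  have h : ev I s (fd j e) = (conc I s).mem (ev I s (adr j e)) := rfl
  rw [h, ev_adr]
  simp only [conc]
  rw [if_neg (by omega)]
  congr 1 <;> omega

theorem ev_adjE (u v : AExp) : ev I s (adjE u v) =
    (conc I s).mem (1 + (ev I s u * I 0 + ev I s v)) := by
  rw [← ev_nE I s]; rfl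

theorem ev_setE (t : ℕ) (v : AExp) : ev I s (setE t v) =
    (conc I s).mem (1 + I 0 * I 0 + (t * I 0 + ev I s v)) := by
  rw [← ev_nE I s]; rfl

@[simp] theorem cost_nE : nE.cost = 2 := rfl
@[simp] theorem cost_fd (j : ℕ) (e : AExp) : (fd j e).cost = e.cost + 19 := by
  simp only [fd, adr, baseE, AExp.cost, cost_nE]; omega
@[simp] theorem cost_adr (j : ℕ) (e : AExp) : (adr j e).cost = e.cost + 18 := by
  simp only [adr, baseE, AExp.cost, cost_nE]; omega
@[simp] theorem cost_adjE (u v : AExp) : (adjE u v).cost = u.cost + v.cost + 7 := by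
  simp only [adjE, AExp.cost, cost_nE]; omega
@[simp] theorem cost_setE (t : ℕ) (v : AExp) : (setE t v).cost = v.cost + 14 := by
  simp only [setE, AExp.cost, cost_nE]; omega

end Eval

theorem conc_setf {I : ℕ → ℕ} {s : Rec} {j : ℕ} (hj : j < 16) (i : AExp) (v : ℕ) :
    (⟨(conc I s).regs, Function.update (conc I s).mem ((adr j i).eval (conc I s)) v⟩ : State) =
      conc I (s.setf j (ev I s i) v) := by
  unfold conc Rec.setf
  congr 1
  funext b
  have h1 : (adr j i).eval (conc I s) = baseAddr I + j + 16 * ev I s i := ev_adr I s j i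
  rw [Function.update_apply]
  change (if b = (adr j i).eval (conc I s) then v else _) = _
  rw [h1]
  by_cases hb : b < baseAddr I
  · rw [if_pos hb, if_neg (by omega)]
    simp [hb]
  · rw [if_neg hb]
    simp only [if_neg hb]
    by_cases hb2 : b = baseAddr I + j + 16 * ev I s i
    · rw [if_pos hb2, if_pos ⟨by omega, by omega⟩]
    · rw [if_neg hb2, if_neg (by omega)]

/-- Started with the records `s`, the program `c` halts after time `t` with records `s'` such that
`Q t s'` holds. -/
def Wp (I : ℕ → ℕ) (c : Cmd) (Q : ℕ → Rec → Prop) (s : Rec) : Prop :=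
  ∃ t s', Run c (conc I s) t (conc I s') ∧ Q t s'

/-! ### Rules for total correctness with running times -/

section Wp

variable {I : ℕ → ℕ} {s : Rec} {Q : ℕ → Rec → Prop}

theorem Wp.mono {c : Cmd} {Q' : ℕ → Rec → Prop} (h : Wp I c Q s) (hQ : ∀ t s', Q t s' → Q' t s') :
    Wp I c Q' s := by
  obtain ⟨t, s', h1, h2⟩ := h
  exact ⟨t, s', h1, hQ _ _ h2⟩

theorem wp_skip (h : Q 1 s) : Wp I .skip Q s := ⟨1, s, .skip _, h⟩

theorem wp_assign {a : ℕ} {e : AExp} (h : Q (e.cost + 1) (s.setr a (ev I s e))) :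
    Wp I (.assign a e) Q s := by
  refine ⟨_, _, ?_, h⟩
  have := Run.assign (conc I s) a e
  convert this using 1
  unfold conc Rec.setr ev
  congr 1
  funext b
  rw [Function.update_apply]; rfl

theorem wp_st {j : ℕ} (hj : j < 16) {i e : AExp}
    (h : Q (i.cost + e.cost + 19) (s.setf j (ev I s i) (ev I s e))) : Wp I (st j i e) Q s := by
  refine ⟨_, _, ?_, h⟩
  have := Run.store (conc I s) (adr j i) e
  rw [cost_adr, show i.cost + 18 + e.cost + 1 = i.cost + e.cost + 19 by omega,
    conc_setf hj] at this
  exact this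

theorem wp_seq {c d : Cmd}
    (h : Wp I c (fun t₁ s₁ => Wp I d (fun t₂ s₂ => Q (t₁ + t₂) s₂) s₁) s) : Wp I (c ;; d) Q s := by
  obtain ⟨t₁, s₁, h1, t₂, s₂, h2, h3⟩ := h
  exact ⟨_, _, .seq h1 h2, h3⟩

theorem wp_cond {e : AExp} {c d : Cmd}
    (h₁ : ev I s e ≠ 0 → Wp I c (fun t s' => Q (e.cost + 1 + t) s') s)
    (h₂ : ev I s e = 0 → Wp I d (fun t s' => Q (e.cost + 1 + t) s') s) :
    Wp I (.cond e c d) Q s := by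
  by_cases h : ev I s e = 0
  · obtain ⟨t, s', h3, h4⟩ := h₂ h
    exact ⟨_, _, .condFalse h h3, h4⟩
  · obtain ⟨t, s', h3, h4⟩ := h₁ h
    exact ⟨_, _, .condTrue h h3, h4⟩

/-- The ghost value `g` describes the current state, and `μ g` bounds the time still to be spent.
Each round has to be paid for, guard included, by a decrease of `μ`; this proves termination and
allows amortised bounds. -/
theorem wp_loop {γ : Type*} (Inv : γ → Rec → Prop) (μ : γ → ℕ) {e : AExp} {c : Cmd}
    (hstep : ∀ g s, Inv g s → ev I s e ≠ 0 →
      Wp I c (fun t s' => ∃ g', Inv g' s' ∧ t + e.cost + 1 + μ g' ≤ μ g) s)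
    (g : γ) (hg : Inv g s)
    (hQ : ∀ t s' g', Inv g' s' → ev I s' e = 0 → t + μ g' ≤ μ g + e.cost + 1 → Q t s') :
    Wp I (.loop e c) Q s := by
  suffices h : ∀ N g s, μ g ≤ N → Inv g s → Wp I (.loop e c)
      (fun t s' => ∃ g', Inv g' s' ∧ ev I s' e = 0 ∧ t + μ g' ≤ μ g + e.cost + 1) s by
    refine (h _ g s le_rfl hg).mono fun t s' h => ?_
    obtain ⟨g', h1, h2, h3⟩ := h
    exact hQ t s' g' h1 h2 h3
  intro N
  induction N with
  | zero =>
    intro g s hμ hi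
    by_cases he : ev I s e = 0
    · exact ⟨_, s, .loopDone he, g, hi, he, by omega⟩
    · obtain ⟨t, s', h1, g', h2, h3⟩ := hstep g s hi he
      omega
  | succ N ih =>
    intro g s hμ hi
    by_cases he : ev I s e = 0
    · exact ⟨_, s, .loopDone he, g, hi, he, by omega⟩
    · obtain ⟨t, s', h1, g', h2, h3⟩ := hstep g s hi he
      obtain ⟨t', s'', h4, g'', h5, h6, h7⟩ := ih g' s' (by omega) h2
      exact ⟨_, s'', .loopStep he h1 h4, g'', h5, h6, by omega⟩

/-- `for a in 0, …, b - 1 do c` -/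
def forN (a : ℕ) (b : AExp) (c : Cmd) : Cmd :=
  .assign a (.const 0) ;; .loop (.lt (.reg a) b) (c ;; .assign a (.add (.reg a) (.const 1)))

theorem wp_for (Inv : ℕ → Rec → Prop) (N T : ℕ) {a : ℕ} {b : AExp} {c : Cmd}
    (hb : ∀ i s, i ≤ N → Inv i s → s.r a = i → ev I s b = N)
    (hstep : ∀ i s, i < N → Inv i s → s.r a = i →
      Wp I c (fun t s' => t ≤ T ∧ s'.r a = i ∧ Inv (i + 1) (s'.setr a (i + 1))) s)
    (h0 : Inv 0 (s.setr a 0))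
    (hQ : ∀ t s', t ≤ N * (T + b.cost + 7) + b.cost + 5 → s'.r a = N → Inv N s' → Q t s') :
    Wp I (forN a b c) Q s := by
  refine wp_seq (wp_assign ?_)
  refine wp_loop (fun i s => i ≤ N ∧ Inv i s ∧ s.r a = i) (fun i => (N - i) * (T + b.cost + 7))
    ?_ 0 ⟨Nat.zero_le _, h0, by simp⟩ ?_
  · rintro i s ⟨h1, h2, h3⟩ he
    have hlt : i < N := by
      by_contra h
      apply he
      rw [ev_lt, ev_reg, hb i s h1 h2 h3, if_neg (by omega)]
    refine wp_seq ((hstep i s hlt h2 h3).mono ?_)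
    rintro t s' ⟨h4, h5, h6⟩
    refine wp_assign ⟨i + 1, ⟨hlt, ?_, ?_⟩, ?_⟩
    · simpa [h5] using h6
    · simp [h5]
    · simp only [AExp.cost]
      have : (N - i) * (T + b.cost + 7) = (N - (i + 1)) * (T + b.cost + 7) + (T + b.cost + 7) := by
        rw [show N - i = N - (i + 1) + 1 by omega]; ring
      omega
  · rintro t s' i ⟨h1, h2, h3⟩ he ht
    have hi : i = N := by
      rw [ev_lt, ev_reg, hb i s' h1 h2 h3, h3] at he
      by_contra hne
      rw [if_pos (by omega)] at he
      omega
    subst hi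
    refine hQ _ s' ?_ h3 h2
    simp only [AExp.cost, Nat.sub_zero] at ht ⊢
    omega

end Wp

/-! ### The input -/

section Input

theorem getD_flatMap {α : Type*} (F : α → List ℕ) (n : ℕ) (L : List α)
    (hF : ∀ a, (F a).length = n) (t j : ℕ) (ht : t < L.length) (hj : j < n) (R : List ℕ) :
    (L.flatMap F ++ R).getD (t * n + j) 0 = (F L[t]).getD j 0 := by
  induction L generalizing t with
  | nil => simp at ht
  | cons a L ih =>
    rcases t with _ | t
    · simp only [List.flatMap_cons, zero_mul, zero_add, List.getElem_cons_zero, List.append_assoc]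
      rw [List.getD_append _ _ _ _ (by rw [hF]; exact hj)]
    · simp only [List.flatMap_cons, List.getElem_cons_succ, List.append_assoc]
      rw [List.getD_append_right _ _ _ _ (by rw [hF]; nlinarith), hF,
        show (t + 1) * n + j - n = t * n + j by rw [add_mul, one_mul]; omega]
      exact ih t (by simpa using ht)

theorem length_flatMap {α : Type*} (F : α → List ℕ) (n : ℕ) (L : List α)
    (hF : ∀ a, (F a).length = n) : (L.flatMap F).length = L.length * n := by
  induction L with
  | nil => simp
  | cons a L ih => simp [ih, hF]; ring

variable {n : ℕ} (G : SimpleGraph (Fin n)) (sets : List (Finset (Fin n)))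

/-- The input as a function of the address. -/
noncomputable def inp (a : ℕ) : ℕ := (inputList G sets).getD a 0

theorem inp_zero : inp G sets 0 = n := by simp [inp, inputList]

open Classical in
theorem inp_adj (u v : Fin n) : inp G sets (1 + (u * n + v)) = if G.Adj u v then 1 else 0 := by
  unfold inp inputList
  rw [List.append_assoc, List.getD_append_right _ _ _ _ (by simp)]
  simp only [List.length_singleton, Nat.add_sub_cancel_left]
  rw [getD_flatMap _ n _ (by simp) u v (by simp) v.2]
  simp

open Classical in
theorem inp_set (t : ℕ) (ht : t < sets.length) (v : Fin n) :
    inp G sets (1 + n * n + (t * n + v)) = if v ∈ sets[t] then 1 else 0 := by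
  unfold inp inputList
  rw [List.getD_append_right _ _ _ _ (by
    rw [List.length_append, length_flatMap _ n _ (by simp)]; simp)]
  rw [List.length_append, length_flatMap _ n _ (by simp)]
  simp only [List.length_singleton, List.length_finRange, Nat.add_sub_cancel_left]
  rw [← List.append_nil (List.flatMap _ sets)]
  rw [getD_flatMap _ n _ (by simp) t v ht v.2]
  simp

theorem inp_le (hn : 1 ≤ n) (a : ℕ) : inp G sets a ≤ n := by
  unfold inp
  rcases lt_or_ge a (inputList G sets).length with h | h
  · rw [List.getD_eq_getElem _ _ h]
    have hm := List.getElem_mem h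
    generalize (inputList G sets)[a] = b at hm
    simp only [inputList, List.mem_append, List.mem_singleton, List.mem_flatMap, List.mem_map,
      List.mem_finRange, true_and] at hm
    rcases hm with (rfl | ⟨i, j, rfl⟩) | ⟨J, -, i, rfl⟩
    · exact le_rfl
    · split_ifs <;> omega
    · split_ifs <;> omega
  · rw [List.getD_eq_default _ _ h]; omega

/-- The records in the initial state. -/
noncomputable def rec0 : Rec where
  r _ := 0
  f j i := inp G sets (baseAddr (inp G sets) + j + 16 * i)

theorem inputState_eq : inputState G sets = conc (inp G sets) (rec0 G sets) := by
  unfold inputState conc rec0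
  congr 1
  funext a
  change inp G sets a = _
  split_ifs with h
  · rfl
  · simp only
    congr 1
    omega

theorem inputState_le (hn : 1 ≤ n) : (inputState G sets).Le n :=
  ⟨fun _ => Nat.zero_le _, inp_le G sets hn⟩

variable {G sets}

theorem lt_baseAddr {a : ℕ} (h : a < 1 + n * n + (n + n)) : a < baseAddr (inp G sets) := by
  unfold baseAddr; rwa [inp_zero]

open Classical in
theorem ev_adjE_inp {s : Rec} {a b : AExp} {u v : Fin n} (hu : ev (inp G sets) s a = u)
    (hv : ev (inp G sets) s b = v) :
    ev (inp G sets) s (adjE a b) = if G.Adj u v then 1 else 0 := by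
  rw [ev_adjE, hu, hv, inp_zero, ← inp_adj G sets]
  refine if_pos (lt_baseAddr ?_)
  have h1 : (u : ℕ) * n + v < n * n := by
    have : ((u : ℕ) + 1) * n ≤ n * n := Nat.mul_le_mul_right _ u.2
    have := v.2
    rw [add_mul] at *
    omega
  omega

open Classical in
theorem ev_setE_inp {s : Rec} {t : ℕ} (ht : t < sets.length) (ht' : t < 2) {a : AExp} {v : Fin n}
    (hv : ev (inp G sets) s a = v) :
    ev (inp G sets) s (setE t a) = if v ∈ sets[t] then 1 else 0 := by
  rw [ev_setE, hv, inp_zero, ← inp_set G sets t ht]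
  refine if_pos (lt_baseAddr ?_)
  have := v.2
  have : t * n ≤ 1 * n := Nat.mul_le_mul_right _ (by omega)
  omega

end Input

/-! ### The canonical spine -/

namespace Spine

variable {V : Type u} {G : SimpleGraph V} (C : Spine G)

/-- The spine without its first vertex, which becomes a leaf. -/
def trim (hm : 2 ≤ C.m) (h0 : ∀ v, C.o v = 0 → C.ow v = v) : Spine G where
  m := C.m - 1
  s i := C.s (i + 1)
  o v := C.o v - 1
  o_lt v := by have := C.o_lt v; omega
  o_s i hi := by rw [C.o_s _ (by omega)]; omega
  adj_iff u v := by
    have key : ∀ w, w = C.s (C.o w - 1 + 1) ↔ 1 ≤ C.o w ∧ w = C.s (C.o w) := by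
      intro w
      rcases Nat.eq_zero_or_pos (C.o w) with h | h
      · rw [h]
        constructor
        · intro h1
          rw [h1, C.o_s _ (by omega)] at h; omega
        · rintro ⟨h1, -⟩; omega
      · rw [show C.o w - 1 + 1 = C.o w by omega]
        exact ⟨fun h1 => ⟨h, h1⟩, fun h1 => h1.2⟩
    have hz : ∀ w, C.o w = 0 → w = C.s (C.o w) := fun w hw => (h0 w hw).symm
    have hz' : C.o u = 0 → C.o v = 0 → u = v := by
      intro h1 h2
      rw [hz u h1, hz v h2, h1, h2]
    have h1v : ∀ w, w = C.s (C.o w) → C.o w = 1 → w = C.s 1 := by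
      intro w h1 h2; rw [← h2]; exact h1
    have hzu := hz u
    have hzv := hz v
    rw [C.adj_iff, key u, key v]
    have hne : C.o u ≠ C.o v → u ≠ v := fun h h' => h (by rw [h'])
    by_cases a1 : C.o u = 0 <;> by_cases a2 : C.o v = 0
    · have := hz' a1 a2
      subst this
      simp
    · have h3 := hzu a1
      have h4 := hne (by omega)
      by_cases a3 : v = C.s (C.o v)
      · simp only [eq_true h3, eq_true a3, ne_eq, h4, not_false_eq_true, true_and, and_true, true_or,
          or_true, false_and, and_false, or_false, false_or]
        omega
      · simp only [eq_true h3, eq_false a3, ne_eq, h4, not_false_eq_true, true_and, and_true, true_or,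
          or_true, false_and, and_false, or_false, false_or]
        omega
    · have h3 := hzv a2
      have h4 := hne (by omega)
      by_cases a3 : u = C.s (C.o u)
      · simp only [eq_true h3, eq_true a3, ne_eq, h4, not_false_eq_true, true_and, and_true, true_or,
          or_true, false_and, and_false, or_false, false_or]
        omega
      · simp only [eq_true h3, eq_false a3, ne_eq, h4, not_false_eq_true, true_and, and_true, true_or,
          or_true, false_and, and_false, or_false, false_or]
        omega
    · rw [show (C.o u - 1 + 1 = C.o v - 1 ∨ C.o v - 1 + 1 = C.o u - 1) ↔
          (C.o u + 1 = C.o v ∨ C.o v + 1 = C.o u) by omega,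
        show C.o u - 1 = C.o v - 1 ↔ C.o u = C.o v by omega]
      have : 1 ≤ C.o u := by omega
      have : 1 ≤ C.o v := by omega
      simp [*]

/-- A spine of minimal length cannot be trimmed at either end, so both of its end vertices carry
leaves. -/
theorem exists_ends (h : Nonempty (Spine G)) : ∃ C : Spine G, 2 ≤ C.m →
    (∃ v, C.o v = 0 ∧ C.ow v ≠ v) ∧ ∃ v, C.o v = C.m - 1 ∧ C.ow v ≠ v := by
  classical
  have hex : ∃ m, ∃ C : Spine G, C.m = m := by
    obtain ⟨C⟩ := h
    exact ⟨_, C, rfl⟩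
  obtain ⟨C, hC⟩ := Nat.find_spec hex
  have hmin : ∀ D : Spine G, C.m ≤ D.m := fun D => by
    rw [hC]; exact Nat.find_min' hex ⟨D, rfl⟩
  refine ⟨C, fun hm => ⟨?_, ?_⟩⟩
  · by_contra! hno
    have := hmin (C.trim hm hno)
    simp only [trim] at this
    omega
  · by_contra! hno
    have := hmin (C.mirror.trim hm (by
      intro v hv
      have := C.o_lt v
      rw [mirror_o] at hv
      rw [mirror_ow]
      exact hno v (by omega)))
    simp only [trim, mirror_m] at this
    omega

end Spine

section Degrees

variable {n : ℕ} (G : SimpleGraph (Fin n))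

open Classical in
noncomputable def deg (v : Fin n) : ℕ := ∑ u : Fin n, if G.Adj v u then 1 else 0

open Classical in
/-- The number of neighbours that are not leaves. -/
noncomputable def innerDeg (v : Fin n) : ℕ :=
  ∑ u : Fin n, if G.Adj v u then (if 1 < deg G u then 1 else 0) else 0

theorem one_lt_deg {v : Fin n} : 1 < deg G v ↔ ∃ u w, u ≠ w ∧ G.Adj v u ∧ G.Adj v w := by
  classical
  unfold deg
  rw [← Finset.card_filter, Finset.one_lt_card]
  simp only [Finset.mem_filter, Finset.mem_univ, true_and]
  constructor
  · rintro ⟨a, ha, b, hb, hab⟩; exact ⟨a, b, hab, ha, hb⟩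
  · rintro ⟨a, b, hab, ha, hb⟩; exact ⟨a, ha, b, hb, hab⟩

theorem one_lt_innerDeg {v : Fin n} : 1 < innerDeg G v ↔
    ∃ u w, u ≠ w ∧ (G.Adj v u ∧ 1 < deg G u) ∧ (G.Adj v w ∧ 1 < deg G w) := by
  classical
  unfold innerDeg
  have : ∀ u, (if G.Adj v u then (if 1 < deg G u then 1 else 0) else 0) =
      if G.Adj v u ∧ 1 < deg G u then 1 else 0 := by
    intro u; split_ifs <;> tauto
  simp only [this]
  rw [← Finset.card_filter, Finset.one_lt_card]
  simp only [Finset.mem_filter, Finset.mem_univ, true_and]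
  constructor
  · rintro ⟨a, ha, b, hb, hab⟩; exact ⟨a, b, hab, ha, hb⟩
  · rintro ⟨a, b, hab, ha, hb⟩; exact ⟨a, ha, b, hb, hab⟩

theorem Spine.not_one_lt_deg {G : SimpleGraph (Fin n)} (C : Spine G) {v : Fin n}
    (h : C.ow v ≠ v) : ¬ 1 < deg G v := by
  rw [one_lt_deg]
  rintro ⟨u, w, huw, h1, h2⟩
  rw [C.adj_leaf_iff h] at h1 h2
  exact huw (h1.trans h2.symm)

/-- With leaves at both ends, a spine of at least two vertices consists exactly of the vertices of
degree at least two, and its ends are those among them with at most one such neighbour. A single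
star is treated separately: in the trees on one or two vertices there is no vertex of degree two,
the search falls back on vertex 0, and for this reason `s 0` is exempt from the degree condition. -/
theorem exists_spine_from (hG : IsCaterpillar G) {x : Fin n}
    (hx : (1 < deg G x ∧ ¬ 1 < innerDeg G x) ∨
      ((∀ v, ¬ (1 < deg G v ∧ ¬ 1 < innerDeg G v)) ∧ (x : ℕ) = 0)) :
    ∃ C : Spine G, C.s 0 = x ∧ ∀ u, u ≠ C.s 0 → (1 < deg G u ↔ C.ow u = u) := by
  obtain ⟨C, hC⟩ := Spine.exists_ends hG.exists_spine
  have hm := C.m_pos x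
  by_cases hm2 : 2 ≤ C.m
  · obtain ⟨⟨a, ha, ha'⟩, b, hb, hb'⟩ := hC hm2
    have hadj_a : G.Adj (C.s 0) a := by
      have := (C.adj_ow ha').symm
      rwa [Spine.ow, ha] at this
    have hadj_b : G.Adj (C.s (C.m - 1)) b := by
      have := (C.adj_ow hb').symm
      rwa [Spine.ow, hb] at this
    have hdeg : ∀ i, i < C.m → 1 < deg G (C.s i) := by
      intro i hi
      rw [one_lt_deg]
      by_cases h0 : i = 0
      · subst h0
        refine ⟨a, C.s (0 + 1), (C.leaf_ne_s ha' (by omega)).symm, hadj_a, C.adj_succ (by omega)⟩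
      · have hprev := C.adj_succ (i := i - 1) (by omega)
        rw [show i - 1 + 1 = i by omega] at hprev
        by_cases h1 : i + 1 < C.m
        · refine ⟨C.s (i - 1), C.s (i + 1), fun h => ?_, hprev.symm, C.adj_succ h1⟩
          have := C.s_inj (by omega) h1 h
          omega
        · refine ⟨b, C.s (i - 1), (C.leaf_ne_s hb' (by omega)).symm, ?_, hprev.symm⟩
          rw [show i = C.m - 1 by omega]; exact hadj_b
    have hiff : ∀ u, 1 < deg G u ↔ C.ow u = u := by
      intro u
      constructor
      · intro h; by_contra h'; exact C.not_one_lt_deg h' h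
      · intro h; rw [← h]; exact hdeg _ (C.o_lt u)
    have hinner0 : ¬ 1 < innerDeg G (C.s 0) := by
      rw [one_lt_innerDeg]
      rintro ⟨u, w, huw, ⟨h1, h2⟩, h3, h4⟩
      rw [hiff] at h2 h4
      have : ∀ u, G.Adj (C.s 0) u → C.ow u = u → u = C.s 1 := by
        intro u h1 h2
        rcases (C.adj_iff _ _).1 h1 with h | h
        · rw [C.o_s 0 hm] at h
          rw [← h2, Spine.ow]; congr 1; omega
        · exfalso
          rw [C.o_s 0 hm] at h
          apply h.2.1; rw [← h2, Spine.ow, ← h.1]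
      exact huw ((this u h1 h2).trans (this w h3 h4).symm)
    rcases hx with ⟨hx1, hx2⟩ | ⟨hx, -⟩
    · have hxs := (hiff x).1 hx1
      -- A spine vertex that is not an end has two spine neighbours, both of degree at least two.
      have hend : C.o x = 0 ∨ C.o x = C.m - 1 := by
        by_contra hno
        apply hx2
        rw [one_lt_innerDeg]
        have hlt := C.o_lt x
        have hprev := C.adj_succ (i := C.o x - 1) (by omega)
        have hnext := C.adj_succ (i := C.o x) (by omega)
        rw [show C.o x - 1 + 1 = C.o x by omega] at hprev
        rw [show C.s (C.o x) = x from hxs] at hprev hnext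
        refine ⟨C.s (C.o x - 1), C.s (C.o x + 1), fun h => ?_, ⟨hprev.symm, hdeg _ (by omega)⟩,
          hnext, hdeg _ (by omega)⟩
        have := C.s_inj (by omega) (by omega) h
        omega
      rcases hend with h | h
      · exact ⟨C, by rw [← h]; exact hxs, fun u _ => hiff u⟩
      · refine ⟨C.mirror, ?_, fun u _ => by rw [C.mirror_ow]; exact hiff u⟩
        rw [Spine.mirror_s, Nat.sub_zero, ← h]; exact hxs
    · exact absurd ⟨hdeg 0 hm, hinner0⟩ (hx _)
  · have ho : ∀ v, C.o v = 0 := fun v => by have := C.o_lt v; omega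
    have how : ∀ v, C.ow v = C.s 0 := fun v => by rw [Spine.ow, ho v]
    by_cases hd : 1 < deg G (C.s 0)
    · have hx0 : C.s 0 = x := by
        rcases hx with ⟨hx1, -⟩ | ⟨hx, -⟩
        · by_contra hne
          exact C.not_one_lt_deg (by rw [how]; exact hne) hx1
        · refine absurd ⟨hd, ?_⟩ (hx (C.s 0))
          rw [one_lt_innerDeg]
          rintro ⟨u, w, huw, ⟨h1, h2⟩, -⟩
          exact C.not_one_lt_deg (by rw [how]; exact h1.ne) h2
      refine ⟨C, hx0, fun u hu => ?_⟩
      rw [how]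
      exact ⟨fun h => absurd h (C.not_one_lt_deg (by rw [how]; exact hu.symm)),
        fun h => absurd h.symm hu⟩
    -- All degrees are at most one, so there are at most two vertices and each of them can serve as
    -- the spine.
    · have hd' : ∀ u, ¬ 1 < deg G u := by
        intro u
        by_cases hu : u = C.s 0
        · rwa [hu]
        · exact C.not_one_lt_deg (by rw [how]; exact fun h => hu h.symm)
      by_cases hx0 : C.s 0 = x
      · refine ⟨C, hx0, fun u hu => ?_⟩
        rw [how]
        exact ⟨fun h => absurd h (hd' u), fun h => absurd h.symm hu⟩
      · have hadj : ∀ v, v ≠ C.s 0 → G.Adj (C.s 0) v := by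
          intro v hv
          have := C.adj_ow (v := v) (by rw [how]; exact hv.symm)
          rw [how] at this; exact this.symm
        have hall : ∀ v, v = C.s 0 ∨ v = x := by
          intro v
          by_contra! hno
          exact hd ((one_lt_deg G).2 ⟨v, x, hno.2, hadj v hno.1, hadj x (Ne.symm hx0)⟩)
        refine ⟨⟨1, fun _ => x, fun _ => 0, fun _ => by omega, fun i hi => by omega, ?_⟩, rfl, ?_⟩
        · intro u v
          have h1 := hadj x (Ne.symm hx0)
          rcases hall u with rfl | rfl <;> rcases hall v with h | h
          · rw [h]; simp
          · subst h; simp [h1, hx0]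
          · subst h; simp [h1.symm, Ne.symm hx0]
          · subst h; simp
        · intro u hu
          exact ⟨fun h => absurd h (hd' u), fun h => absurd h.symm hu⟩

end Degrees

/-! ### Frames -/

/-- The registers outside of `R` and the fields outside of `F` are the same. -/
structure Same (R F : List ℕ) (s s' : Rec) : Prop where
  reg : ∀ a, a ∉ R → s'.r a = s.r a
  fld : ∀ j, j < 16 → j ∉ F → s'.f j = s.f j

theorem Same.refl (R F : List ℕ) (s : Rec) : Same R F s s := ⟨fun _ _ => rfl, fun _ _ _ => rfl⟩

theorem Same.trans {R F : List ℕ} {s s' s'' : Rec} (h : Same R F s s') (h' : Same R F s' s'') :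
    Same R F s s'' :=
  ⟨fun a ha => (h'.reg a ha).trans (h.reg a ha),
    fun j hj hj' => (h'.fld j hj hj').trans (h.fld j hj hj')⟩

theorem Same.mono {R F R' F' : List ℕ} {s s' : Rec} (h : Same R F s s') (hR : R ⊆ R')
    (hF : F ⊆ F') : Same R' F' s s' :=
  ⟨fun a ha => h.reg a fun h' => ha (hR h'), fun j hj hj' => h.fld j hj fun h' => hj' (hF h')⟩

theorem same_setr {R F : List ℕ} {s : Rec} {a v : ℕ} (ha : a ∈ R) : Same R F s (s.setr a v) :=
  ⟨fun b hb => by rw [Rec.setr_r, if_neg]; rintro rfl; exact hb ha, fun _ _ _ => rfl⟩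

theorem same_setf {R F : List ℕ} {s : Rec} {j i v : ℕ} (ha : j ∈ F) : Same R F s (s.setf j i v) :=
  ⟨fun _ _ => rfl, fun b _ hb => by
    funext c; rw [Rec.setf_f, if_neg]; rintro ⟨rfl, -⟩; exact hb ha⟩

/-- The program writes to registers in `R` and fields in `F` only. -/
def Mod (R F : List ℕ) : Cmd → Prop
  | .skip => True
  | .assign a _ => a ∈ R
  | .store a _ => ∃ j i, j < 16 ∧ j ∈ F ∧ a = adr j i
  | .seq c d => Mod R F c ∧ Mod R F d
  | .cond _ c d => Mod R F c ∧ Mod R F d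
  | .loop _ c => Mod R F c

section Mod

variable {R F : List ℕ} {a j : ℕ} {e i : AExp} {c d : Cmd}

@[simp] theorem mod_skip : Mod R F .skip := trivial
@[simp] theorem mod_assign : Mod R F (.assign a e) ↔ a ∈ R := Iff.rfl
@[simp] theorem mod_seq : Mod R F (c ;; d) ↔ Mod R F c ∧ Mod R F d := Iff.rfl
@[simp] theorem mod_cond : Mod R F (.cond e c d) ↔ Mod R F c ∧ Mod R F d := Iff.rfl
@[simp] theorem mod_loop : Mod R F (.loop e c) ↔ Mod R F c := Iff.rfl
@[simp] theorem mod_forN : Mod R F (forN a e c) ↔ a ∈ R ∧ Mod R F c := by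
  unfold forN
  simp only [mod_seq, mod_assign, mod_loop]
  tauto
theorem mod_st (hj : j < 16) (h : j ∈ F) : Mod R F (st j i e) := ⟨j, i, hj, h, rfl⟩

theorem Mod.mono {R' F' : List ℕ} (h : Mod R F c) (hR : R ⊆ R') (hF : F ⊆ F') : Mod R' F' c := by
  induction c with
  | skip => trivial
  | assign => exact hR h
  | store => obtain ⟨j, i, h1, h2, h3⟩ := h; exact ⟨j, i, h1, hF h2, h3⟩
  | seq c d ihc ihd => exact ⟨ihc h.1, ihd h.2⟩
  | cond e c d ihc ihd => exact ⟨ihc h.1, ihd h.2⟩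
  | loop e c ih => exact ih h

theorem conc_inj {I : ℕ → ℕ} {s s' : Rec} (h : conc I s = conc I s') :
    s.r = s'.r ∧ ∀ j < 16, s.f j = s'.f j := by
  have h1 : (conc I s).regs = (conc I s').regs := by rw [h]
  refine ⟨h1, fun j hj => funext fun i => ?_⟩
  have h2 : (conc I s).mem (baseAddr I + j + 16 * i) = (conc I s').mem (baseAddr I + j + 16 * i) := by
    rw [h]
  simp only [conc] at h2
  rw [if_neg (by omega), if_neg (by omega)] at h2
  rwa [show (baseAddr I + j + 16 * i - baseAddr I) % 16 = j by omega,
    show (baseAddr I + j + 16 * i - baseAddr I) / 16 = i by omega] at h2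

theorem Mod.same {I : ℕ → ℕ} {σ τ : State} {t : ℕ} (h : Run c σ t τ) (hm : Mod R F c) :
    ∀ s, σ = conc I s → ∃ s', τ = conc I s' ∧ Same R F s s' := by
  induction h with
  | skip σ => exact fun s hs => ⟨s, hs, Same.refl ..⟩
  | assign σ r e =>
    intro s hs
    refine ⟨s.setr r (e.eval σ), ?_, same_setr hm⟩
    subst hs
    unfold conc Rec.setr
    congr 1
    funext b
    rw [Function.update_apply]
  | store σ a e =>
    intro s hs
    obtain ⟨j, i, hj, hjF, rfl⟩ := hm
    refine ⟨s.setf j (ev I s i) (e.eval σ), ?_, same_setf hjF⟩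
    subst hs
    exact conc_setf hj i _
  | seq h1 h2 ih1 ih2 =>
    intro s hs
    obtain ⟨s', h3, h4⟩ := ih1 hm.1 s hs
    obtain ⟨s'', h5, h6⟩ := ih2 hm.2 s' h3
    exact ⟨s'', h5, h4.trans h6⟩
  | condTrue _ _ ih => exact ih hm.1
  | condFalse _ _ ih => exact ih hm.2
  | loopDone => exact fun s hs => ⟨s, hs, Same.refl ..⟩
  | loopStep _ h1 h2 ih1 ih2 =>
    intro s hs
    obtain ⟨s', h3, h4⟩ := ih1 hm s hs
    obtain ⟨s'', h5, h6⟩ := ih2 hm s' h3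
    exact ⟨s'', h5, h4.trans h6⟩

/-- What a program does not write is preserved for syntactic reasons, so specifications need to
mention only what changes. -/
theorem Wp.frame {I : ℕ → ℕ} {Q : ℕ → Rec → Prop} {s : Rec} (hm : Mod R F c) (h : Wp I c Q s) :
    Wp I c (fun t s' => Q t s' ∧ Same R F s s') s := by
  obtain ⟨t, s', h1, h2⟩ := h
  obtain ⟨s'', h3, h4⟩ := hm.same h1 s rfl
  obtain ⟨h5, h6⟩ := conc_inj h3
  exact ⟨t, s', h1, h2, fun a ha => by rw [h5]; exact h4.reg a ha,
    fun j hj hj' => by rw [h6 j hj]; exact h4.fld j hj hj'⟩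

theorem wp_for_frame (R F : List ℕ) {I : ℕ → ℕ} {Q : ℕ → Rec → Prop} {s : Rec} {b : AExp}
    (Inv : ℕ → Rec → Prop) (N T : ℕ) (hm : Mod R F c) (ha : a ∈ R)
    (hb : ∀ s', Same R F s s' → ev I s' b = N)
    (hstep : ∀ i s', i < N → Same R F s s' → Inv i s' → s'.r a = i →
      Wp I c (fun t s'' => t ≤ T ∧ s''.r a = i ∧ Inv (i + 1) (s''.setr a (i + 1))) s')
    (h0 : Inv 0 (s.setr a 0))
    (hQ : ∀ t s', t ≤ N * (T + b.cost + 7) + b.cost + 5 → s'.r a = N → Same R F s s' → Inv N s' →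
      Q t s') :
    Wp I (forN a b c) Q s := by
  refine wp_for (fun i s' => Inv i s' ∧ Same R F s s') N T (fun i s' _ h _ => hb s' h.2) ?_
    ⟨h0, same_setr ha⟩ (fun t s' h1 h2 h3 => hQ t s' h1 h2 h3.2 h3.1)
  rintro i s' hi ⟨h1, h2⟩ h3
  refine ((hstep i s' hi h2 h1 h3).frame hm).mono ?_
  rintro t s'' ⟨⟨h4, h5, h6⟩, h7⟩
  exact ⟨h4, h5, h6, (h2.trans h7).trans (same_setr ha)⟩

end Mod

/-! ### Degrees -/

section PartialSum

variable {n : ℕ}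

/-- The sum over the vertices with numbers less than `i`. -/
def psum (i : ℕ) (F : Fin n → ℕ) : ℕ := ∑ u : Fin n, if u.val < i then F u else 0

theorem psum_zero (F : Fin n → ℕ) : psum 0 F = 0 := by simp [psum]

theorem psum_succ {i : ℕ} (hi : i < n) (F : Fin n → ℕ) :
    psum (i + 1) F = psum i F + F ⟨i, hi⟩ := by
  unfold psum
  have h1 : F ⟨i, hi⟩ = ∑ u : Fin n, if u = ⟨i, hi⟩ then F u else 0 := by simp
  rw [h1, ← Finset.sum_add_distrib]
  refine Finset.sum_congr rfl fun u _ => ?_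
  by_cases h : u = ⟨i, hi⟩
  · subst h; simp
  · have h2 : u.val ≠ i := fun h' => h (Fin.ext h')
    rw [if_neg h]
    by_cases h3 : u.val < i
    · rw [if_pos h3, if_pos (by omega), add_zero]
    · rw [if_neg h3, if_neg (by omega)]

theorem psum_self (F : Fin n → ℕ) : psum n F = ∑ u, F u := by simp [psum]

theorem time_bound (hn : 1 ≤ n) (a b c : ℕ) : n * (n * a + b) + c ≤ (a + b + c) * (n * n) := by
  have h1 : n ≤ n * n := Nat.le_mul_of_pos_left n hn
  have h2 := Nat.mul_le_mul_left b h1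
  have h3 := Nat.mul_le_mul_left c (hn.trans h1)
  nlinarith

end PartialSum

def inc (a : ℕ) : Cmd := .assign a (.add (.reg a) (.const 1))

section Setup

variable {n : ℕ} {G : SimpleGraph (Fin n)} {sets : List (Finset (Fin n))}

theorem ev_nE_inp (s : Rec) : ev (inp G sets) s nE = n := by rw [ev_nE, inp_zero]

/-- For each vertex, the sum of the values of `w` over its neighbours. -/
def countAdj (o : ℕ) (w : AExp) : Cmd :=
  forN 10 nE (.assign 12 (.const 0) ;;
    -- The comparison with 0 leaves the 0/1 entry unchanged, but it makes the factor bounded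
    -- independently of the state, as `tame` demands of products.
    forN 11 nE (.assign 12 (.add (.reg 12)
      (.mul (.lt (.const 0) (adjE (.reg 10) (.reg 11))) w))) ;;
    st o (.reg 10) (.reg 12))

open Classical in
theorem wp_countAdj {o : ℕ} (ho : o < 16) {w : AExp} (W : Fin n → ℕ) {s : Rec}
    (hw : ∀ s', Same [10, 11, 12] [o] s s' → ∀ u : Fin n, s'.r 11 = u →
      ev (inp G sets) s' w = W u) :
    Wp (inp G sets) (countAdj o w) (fun t s' => t ≤ n * (n * (w.cost + 30) + 60) + 60 ∧
      Same [10, 11, 12] [o] s s' ∧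
      ∀ v : Fin n, s'.f o v = ∑ u : Fin n, if G.Adj v u then W u else 0) s := by
  have hm : Mod [10, 11, 12] [o] (.assign 12 (.const 0) ;;
      forN 11 nE (.assign 12 (.add (.reg 12)
      (.mul (.lt (.const 0) (adjE (.reg 10) (.reg 11))) w))) ;; st o (.reg 10) (.reg 12)) := by
    simp [mod_st ho]
  refine wp_for_frame [10, 11, 12] [o] (fun i s' => ∀ v : Fin n, v.val < i → s'.f o v =
    ∑ u : Fin n, if G.Adj v u then W u else 0) n (n * (w.cost + 30) + 40) hm (by simp)
    (fun s' _ => ev_nE_inp s') ?_ (by simp) ?_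
  · intro i s1 hi h1 h2 h3
    refine wp_seq (wp_assign (wp_seq (wp_for_frame [11, 12] []
      (fun j s' => s'.r 12 = psum j fun u : Fin n => if G.Adj ⟨i, hi⟩ u then W u else 0) n
      (w.cost + 18) (by simp) (by simp) (fun s' _ => ev_nE_inp s') ?_ (by simp [psum_zero]) ?_)))
    · intro j s2 hj h4 h5 h6
      have h7 : s2.r 10 = i := by rw [h4.reg 10 (by decide)]; simpa using h3
      refine wp_assign ⟨by simp only [AExp.cost, cost_adjE]; omega, by simpa using h6, ?_⟩
      have h8 : Same [10, 11, 12] [o] s s2 :=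
        (h1.trans (same_setr (by simp))).trans (h4.mono (by simp) (by simp))
      rw [psum_succ hj]
      have h9 := ev_adjE_inp (sets := sets) (G := G) (s := s2) (a := .reg 10) (b := .reg 11)
        (u := ⟨i, hi⟩) (v := ⟨j, hj⟩) h7 h6
      simp only [Rec.setr_r, ev_add, ev_mul, ev_lt, ev_const, ev_reg, h9, hw s2 h8 ⟨j, hj⟩ h6, h5]
      simp only [show (12 : ℕ) ≠ 11 by decide, if_false, if_true]
      by_cases hadj : G.Adj ⟨i, hi⟩ ⟨j, hj⟩ <;> simp [hadj]
    · intro t s2 h4 h5 h6 h7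
      refine wp_st ho ⟨?_, ?_, ?_⟩
      · simp only [AExp.cost, cost_nE] at h4 ⊢
        have : n * (w.cost + 18 + 2 + 7) ≤ n * (w.cost + 30) := Nat.mul_le_mul_left _ (by omega)
        omega
      · rw [Rec.setf_r, h6.reg 10 (by decide)]; simpa using h3
      · intro v hv
        have h8 : s2.r 10 = i := by rw [h6.reg 10 (by decide)]; simpa using h3
        have h9 : s2.f o = s1.f o := by rw [h6.fld o ho (by simp)]; simp
        rw [psum_self] at h7
        simp only [Rec.setr_f, Rec.setf_f, ev_reg, h8, true_and, h9]
        split_ifs with h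
        · rw [h7]
          have : v = ⟨i, hi⟩ := Fin.ext h
          rw [this]
        · exact h2 v (by omega)
  · intro t s1 h1 h2 h3 h4
    refine ⟨?_, h3, fun v => h4 v v.2⟩
    simp only [cost_nE] at h1
    have : n * (n * (w.cost + 30) + 40 + 2 + 7) ≤ n * (n * (w.cost + 30) + 60) :=
      Nat.mul_le_mul_left _ (by omega)
    omega

end Setup

/-! ### Finding a spine -/

theorem wp_loop_frame (R F : List ℕ) {I : ℕ → ℕ} {s : Rec} {Q : ℕ → Rec → Prop} {γ : Type*}
    (Inv : γ → Rec → Prop) (μ : γ → ℕ) {e : AExp} {c : Cmd} (hm : Mod R F c)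
    (hstep : ∀ g s', Same R F s s' → Inv g s' → ev I s' e ≠ 0 →
      Wp I c (fun t s'' => ∃ g', Inv g' s'' ∧ t + e.cost + 1 + μ g' ≤ μ g) s')
    (g : γ) (hg : Inv g s)
    (hQ : ∀ t s' g', Same R F s s' → Inv g' s' → ev I s' e = 0 →
      t + μ g' ≤ μ g + e.cost + 1 → Q t s') :
    Wp I (.loop e c) Q s := by
  refine wp_loop (fun g s' => Inv g s' ∧ Same R F s s') μ ?_ g ⟨hg, Same.refl ..⟩
    (fun t s' g' h => hQ t s' g' h.2 h.1)
  rintro g s' ⟨h1, h2⟩ he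
  refine ((hstep g s' h2 h1 he).frame hm).mono ?_
  rintro t s'' ⟨⟨g', h3, h4⟩, h5⟩
  exact ⟨g', ⟨h3, h2.trans h5⟩, h4⟩

theorem Spine.m_le {n : ℕ} {G : SimpleGraph (Fin n)} (C : Spine G) : C.m ≤ n := by
  have := Finset.card_le_card_of_injOn (s := Finset.range C.m) (t := Finset.univ) C.s (by simp) (by
    intro i hi j hj h
    exact C.s_inj (by simpa using hi) (by simpa using hj) h)
  simpa using this

section Setup

variable {n : ℕ} {G : SimpleGraph (Fin n)} {sets : List (Finset (Fin n))}

/-- The degrees are stored in field 2, the numbers of inner neighbours in field 3. -/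
def findStart : Cmd :=
  .assign 5 (.const 0) ;;
  forN 10 nE (.cond (.mul (.lt (.const 1) (fd 2 (.reg 10))) (.lt (fd 3 (.reg 10)) (.const 2)))
    (.assign 5 (.reg 10)) .skip)

theorem wp_findStart (hn : 1 ≤ n) {s : Rec} (h2 : ∀ v : Fin n, s.f 2 v = deg G v)
    (h3 : ∀ v : Fin n, s.f 3 v = innerDeg G v) :
    Wp (inp G sets) findStart (fun t s' => t ≤ n * 80 + 20 ∧ Same [5, 10] [] s s' ∧
      ∃ x : Fin n, s'.r 5 = x ∧ ((1 < deg G x ∧ ¬ 1 < innerDeg G x) ∨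
        ((∀ v, ¬ (1 < deg G v ∧ ¬ 1 < innerDeg G v)) ∧ (x : ℕ) = 0))) s := by
  refine wp_seq (wp_assign (wp_for_frame [5, 10] [] (fun i s' =>
    (∃ x : Fin n, s'.r 5 = x ∧ (1 < deg G x ∧ ¬ 1 < innerDeg G x)) ∨
      ((∀ v : Fin n, v.val < i → ¬ (1 < deg G v ∧ ¬ 1 < innerDeg G v)) ∧ s'.r 5 = 0)) n 60
      (by simp) (by simp) (fun s' _ => ev_nE_inp s') ?_ (by simp) ?_))
  · intro i s1 hi a1 a2 a3
    have b2 : s1.f 2 i = deg G ⟨i, hi⟩ := by rw [a1.fld 2 (by decide) (by decide)]; exact h2 ⟨i, hi⟩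
    have b3 : s1.f 3 i = innerDeg G ⟨i, hi⟩ := by
      rw [a1.fld 3 (by decide) (by decide)]; exact h3 ⟨i, hi⟩
    refine wp_cond (fun he => wp_assign ⟨?_, by simpa using a3, Or.inl ⟨⟨i, hi⟩, ?_, ?_⟩⟩)
      (fun he => wp_skip ⟨?_, a3, ?_⟩)
    · simp [AExp.cost]
    · simpa using a3
    · simp only [ev_mul, ev_lt, ev_const, ev_fd _ _ (show 2 < 16 by decide),
        ev_fd _ _ (show 3 < 16 by decide), ev_reg, a3, b2, b3] at he
      by_contra hno
      apply he
      by_cases c1 : 1 < deg G ⟨i, hi⟩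
      · rw [if_neg (c := innerDeg G ⟨i, hi⟩ < 2) (by omega), mul_zero]
      · rw [if_neg c1, zero_mul]
    · simp [AExp.cost]
    · simp only [ev_mul, ev_lt, ev_const, ev_fd _ _ (show 2 < 16 by decide),
        ev_fd _ _ (show 3 < 16 by decide), ev_reg, a3, b2, b3] at he
      rcases a2 with ⟨x, a4, a5⟩ | ⟨a4, a5⟩
      · exact Or.inl ⟨x, by simpa using a4, a5⟩
      · refine Or.inr ⟨fun v hv => ?_, by simpa using a5⟩
        by_cases hvi : v.val = i
        · obtain rfl : v = ⟨i, hi⟩ := Fin.ext hvi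
          rintro ⟨c1, c2⟩
          rw [if_pos c1, if_pos (by omega)] at he
          omega
        · exact a4 v (by omega)
  · intro t s1 a1 a2 a3 a4
    refine ⟨?_, (same_setr (by simp)).trans a3, ?_⟩
    · simp only [AExp.cost, cost_nE] at a1 ⊢; omega
    · rcases a4 with ⟨x, a4, a5⟩ | ⟨a4, a5⟩
      · exact ⟨x, a4, Or.inl a5⟩
      · exact ⟨⟨0, hn⟩, a5, Or.inr ⟨fun v => a4 v v.2, rfl⟩⟩

/-- The part of the body of the loop of `walk` that looks for the next spine vertex. -/
def findNext : Cmd :=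
  .assign 13 (.const 0) ;;
  forN 10 nE (.cond (.mul (.mul (adjE (.reg 5) (.reg 10)) (.lt (.const 1) (fd 2 (.reg 10))))
    (.eq (fd 4 (.reg 10)) (.const 0))) (.assign 13 (.const 1) ;; .assign 14 (.reg 10)) .skip) ;;
  .cond (.reg 13) (.assign 5 (.reg 14)) .skip

/-- Field 4 marks the visited vertices. -/
def walk : Cmd :=
  .assign 2 (.const 0) ;; .assign 13 (.const 1) ;; forN 10 nE (st 4 (.reg 10) (.const 0)) ;;
  .loop (.reg 13) (st 4 (.reg 5) (.const 1) ;; st 0 (.reg 2) (.reg 5) ;; inc 2 ;; findNext)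

/-- The neighbours of `s i` of degree at least two are its spine neighbours, and the previous one is
marked already. The start, whose degree may be one, is marked as well. -/
theorem Spine.next_iff (C : Spine G) (hC : ∀ u, u ≠ C.s 0 → (1 < deg G u ↔ C.ow u = u)) {i : ℕ}
    (hi : i < C.m) (u : Fin n) :
    (G.Adj (C.s i) u ∧ 1 < deg G u ∧ ¬ (C.ow u = u ∧ C.o u < i + 1)) ↔
      i + 1 < C.m ∧ u = C.s (i + 1) := by
  constructor
  · rintro ⟨h1, h2, h3⟩
    have h0 : u ≠ C.s 0 := by
      rintro rfl
      exact h3 ⟨C.ow_s (by omega), by rw [C.o_s _ (by omega)]; omega⟩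
    have h4 := (hC u h0).1 h2
    have h5 := C.o_of_adj h1
    rw [C.o_s i hi] at h5
    have h6 := C.o_lt u
    have h7 : C.o u = i + 1 := by
      by_contra h7
      exact h3 ⟨h4, by omega⟩
    exact ⟨by omega, by rw [← h7]; exact h4.symm⟩
  · rintro ⟨h1, rfl⟩
    refine ⟨C.adj_succ h1, (hC _ fun h => ?_).2 (C.ow_s h1), fun h => ?_⟩
    · have := C.s_inj h1 (by omega) h; omega
    · rw [C.o_s _ h1] at h; omega

open Classical in
theorem wp_findNext (C : Spine G) (hC : ∀ u, u ≠ C.s 0 → (1 < deg G u ↔ C.ow u = u)) {s : Rec}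
    (h2 : ∀ v : Fin n, s.f 2 v = deg G v) {i : ℕ} (hi : i < C.m) (h5 : s.r 5 = C.s i)
    (h4 : ∀ v : Fin n, s.f 4 v = if C.ow v = v ∧ C.o v < i + 1 then 1 else 0) :
    Wp (inp G sets) findNext (fun t s' => t ≤ n * 80 + 20 ∧ Same [5, 10, 13, 14] [] s s' ∧
      ((s'.r 13 = 1 ∧ i + 1 < C.m ∧ s'.r 5 = C.s (i + 1)) ∨ (s'.r 13 = 0 ∧ i + 1 = C.m))) s := by
  refine wp_seq (wp_assign (wp_seq (wp_for_frame [10, 13, 14] [] (fun j s' =>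
    (s'.r 13 = 1 ∧ i + 1 < C.m ∧ s'.r 14 = C.s (i + 1)) ∨
      (s'.r 13 = 0 ∧ (i + 1 < C.m → j ≤ (C.s (i + 1)).val))) n 69
      (by simp) (by simp) (fun s' _ => ev_nE_inp s') ?_ (by simp) ?_)))
  · intro j s1 hj a1 a2 a3
    have b5 : s1.r 5 = C.s i := by rw [a1.reg 5 (by decide)]; simpa using h5
    have b2 : s1.f 2 j = deg G ⟨j, hj⟩ := by rw [a1.fld 2 (by decide) (by decide)]; exact h2 ⟨j, hj⟩
    have b4 := h4 ⟨j, hj⟩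
    rw [show s.f 4 = s1.f 4 from (a1.fld 4 (by decide) (by decide)).symm] at b4
    simp only at b4
    have key := C.next_iff hC hi ⟨j, hj⟩
    have b9 := ev_adjE_inp (sets := sets) (G := G) (s := s1) (a := .reg 5) (b := .reg 10)
        (u := C.s i) (v := ⟨j, hj⟩) b5 a3
    have he : (ev (inp G sets) s1 (.mul (.mul (adjE (.reg 5) (.reg 10))
        (.lt (.const 1) (fd 2 (.reg 10)))) (.eq (fd 4 (.reg 10)) (.const 0))) ≠ 0) ↔
        i + 1 < C.m ∧ (⟨j, hj⟩ : Fin n) = C.s (i + 1) := by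
      rw [← key]
      simp only [ev_mul, ev_lt, ev_eq, ev_const, ev_fd _ _ (show 2 < 16 by decide),
        ev_fd _ _ (show 4 < 16 by decide), b9, ev_reg, a3, b2, b4]
      by_cases c1 : G.Adj (C.s i) ⟨j, hj⟩ <;> by_cases c2 : 1 < deg G ⟨j, hj⟩ <;>
        by_cases c3 : C.ow ⟨j, hj⟩ = ⟨j, hj⟩ ∧ C.o ⟨j, hj⟩ < i + 1 <;> simp [c1, c2, c3]
    refine wp_cond (fun h => ?_) (fun h => wp_skip ⟨?_, a3, ?_⟩)
    · obtain ⟨c1, c2⟩ := he.1 h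
      refine wp_seq (wp_assign (wp_assign ⟨?_, by simpa using a3, Or.inl ⟨by simp, c1, ?_⟩⟩))
      · simp [AExp.cost]
      · rw [← c2]; simpa using a3
    · simp [AExp.cost]
    · have h' := fun h'' => (he.2 h'') h
      rcases a2 with ⟨d1, d2, d3⟩ | ⟨d1, d2⟩
      · exact Or.inl ⟨by simpa using d1, d2, by simpa using d3⟩
      · refine Or.inr ⟨by simpa using d1, fun d3 => ?_⟩
        have := d2 d3
        rcases Nat.lt_or_ge j (C.s (i + 1)).val with d4 | d4
        · exact d4
        · exact absurd ⟨d3, Fin.ext (by simp only; omega)⟩ h'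
  · intro t s1 a1 a2 a3 a4
    have a5 : Same [5, 10, 13, 14] [] s s1 := (same_setr (by simp)).trans (a3.mono (by simp) (by simp))
    simp only [cost_nE] at a1
    refine wp_cond (fun h => wp_assign ⟨?_, a5.trans (same_setr (by simp)), ?_⟩)
      (fun h => wp_skip ⟨?_, a5, ?_⟩)
    · simp only [AExp.cost]; omega
    · rcases a4 with ⟨d1, d2, d3⟩ | ⟨d1, d2⟩
      · exact Or.inl ⟨by simpa using d1, d2, by simpa using d3⟩
      · exact absurd d1 h
    · simp only [AExp.cost]; omega
    · rw [ev_reg] at h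
      rcases a4 with ⟨d1, d2, d3⟩ | ⟨d1, d2⟩
      · omega
      · refine Or.inr ⟨h, ?_⟩
        by_contra hne
        have := d2 (by omega)
        have := (C.s (i + 1)).2
        omega

open Classical in
theorem wp_walk (C : Spine G) (hC : ∀ u, u ≠ C.s 0 → (1 < deg G u ↔ C.ow u = u)) {s : Rec}
    (h2 : ∀ v : Fin n, s.f 2 v = deg G v) (h5 : s.r 5 = C.s 0) (hm : 0 < C.m) :
    Wp (inp G sets) walk (fun t s' => t ≤ n * (n * 80 + 200) + 20 ∧
      Same [2, 5, 10, 13, 14] [0, 4] s s' ∧ s'.r 2 = C.m ∧ (∀ i, i < C.m → s'.f 0 i = C.s i) ∧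
      ∀ v : Fin n, s'.f 4 v = if C.ow v = v then 1 else 0) s := by
  refine wp_seq (wp_assign (wp_seq (wp_assign (wp_seq (wp_for_frame [10] [4] (fun i s' =>
    ∀ v : Fin n, v.val < i → s'.f 4 v = 0) n 21 (by simp [mod_st]) (by simp)
    (fun s' _ => ev_nE_inp s') ?_ (by simp) ?_)))))
  · intro i s1 hi a1 a2 a3
    refine wp_st (by decide) ⟨by simp [AExp.cost], by simpa using a3, ?_⟩
    intro v hv
    simp only [Rec.setr_f, Rec.setf_f, ev_reg, a3, true_and, ev_const]
    split_ifs with h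
    · rfl
    · exact a2 v (by omega)
  intro t s1 a1 a2 a3 a4
  have a5 : Same [2, 5, 10, 13, 14] [0, 4] s s1 :=
    ((same_setr (by simp)).trans (same_setr (by simp))).trans (a3.mono (by simp) (by simp))
  have hmod : Mod [2, 5, 10, 13, 14] [0, 4]
      (st 4 (.reg 5) (.const 1) ;; st 0 (.reg 2) (.reg 5) ;; inc 2 ;; findNext) := by
    simp [mod_st, inc, findNext]
  refine wp_loop_frame [2, 5, 10, 13, 14] [0, 4] (fun (i : ℕ) s' => s'.r 2 = i ∧
    (∀ j, j < i → s'.f 0 j = C.s j) ∧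
    (∀ v : Fin n, s'.f 4 v = if C.ow v = v ∧ C.o v < i then 1 else 0) ∧
    ((s'.r 13 = 1 ∧ i < C.m ∧ s'.r 5 = C.s i) ∨ (s'.r 13 = 0 ∧ i = C.m)))
    (fun i => (C.m - i) * (n * 80 + 130)) hmod ?_ 0 ?_ ?_
  · rintro i s2 b1 ⟨b2, b3, b4, b5⟩ he
    rw [ev_reg] at he
    obtain ⟨-, hi, b5⟩ := b5.resolve_right fun h => he h.1
    refine wp_seq (wp_st (by decide) (wp_seq (wp_st (by decide) (wp_seq (wp_assign
      ((wp_findNext C hC (i := i) ?_ hi ?_ ?_).mono ?_))))))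
    · intro v
      simp only [Rec.setr_f, Rec.setf_f, show (2 : ℕ) ≠ 0 by decide, show (2 : ℕ) ≠ 4 by decide,
        false_and, if_false]
      rw [b1.fld 2 (by decide) (by decide), a5.fld 2 (by decide) (by decide)]
      exact h2 v
    · simpa using b5
    · intro v
      simp only [Rec.setr_f, Rec.setf_f, show (4 : ℕ) ≠ 0 by decide, false_and, if_false, true_and,
        ev_reg, b5, ev_const, b4]
      by_cases hv : v = C.s i
      · subst hv
        rw [if_pos rfl, if_pos ⟨C.ow_s hi, by rw [C.o_s i hi]; omega⟩]
      · rw [if_neg (fun h => hv (Fin.ext h))]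
        congr 1
        refine propext (and_congr_right fun h => ⟨fun h' => by omega, fun h' => ?_⟩)
        by_contra h''
        exact hv (by rw [← h, Spine.ow]; congr 1; omega)
    · rintro t' s3 ⟨c1, c2, c3⟩
      refine ⟨i + 1, ⟨?_, ?_, ?_, ?_⟩, ?_⟩
      · rw [c2.reg 2 (by decide)]; simp [b2]
      · intro j hj
        rw [c2.fld 0 (by decide) (by decide)]
        simp only [Rec.setr_f, Rec.setf_f, ev_reg, b2, show (0 : ℕ) ≠ 4 by decide, false_and,
          if_false, true_and, Rec.setf_r, b5]
        by_cases hji : j = i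
        · rw [if_pos hji, hji]
        · rw [if_neg hji]; exact b3 j (by omega)
      · intro v
        rw [c2.fld 4 (by decide) (by decide)]
        simp only [Rec.setr_f, Rec.setf_f, show (4 : ℕ) ≠ 0 by decide, false_and, if_false, true_and,
          ev_reg, b5, ev_const, b4]
        by_cases hv : v = C.s i
        · subst hv
          rw [if_pos rfl, if_pos ⟨C.ow_s hi, by rw [C.o_s i hi]; omega⟩]
        · rw [if_neg (fun h => hv (Fin.ext h))]
          congr 1
          refine propext (and_congr_right fun h => ⟨fun h' => by omega, fun h' => ?_⟩)
          by_contra h''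
          exact hv (by rw [← h, Spine.ow]; congr 1; omega)
      · exact c3
      · simp only [AExp.cost]
        have : (C.m - i) * (n * 80 + 130) = (C.m - (i + 1)) * (n * 80 + 130) + (n * 80 + 130) := by
          rw [show C.m - i = C.m - (i + 1) + 1 by omega]; ring
        omega
  · refine ⟨?_, by simp, fun v => ?_, Or.inl ⟨?_, hm, ?_⟩⟩
    · rw [a3.reg 2 (by decide)]; simp
    · simpa using a4 v v.2
    · rw [a3.reg 13 (by decide)]; simp
    · rw [a3.reg 5 (by decide)]; simpa using h5
  · rintro t' s2 i b1 ⟨b2, b3, b4, b5⟩ he ht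
    rw [ev_reg] at he
    obtain ⟨-, rfl⟩ := b5.resolve_left fun h => by omega
    refine ⟨?_, a5.trans b1, b2, b3, fun v => ?_⟩
    · have := Nat.mul_le_mul_right (n * 80 + 130) C.m_le
      have h9 : n * (n * 80 + 200) = n * (n * 80 + 130) + n * 70 := by ring
      simp only [AExp.cost, cost_nE, Nat.sub_zero] at ht a1 ⊢
      omega
    · rw [b4 v]; simp [C.o_lt v]

/-- Field 1 receives the owners of the vertices. -/
def owners : Cmd :=
  forN 10 nE (.cond (fd 4 (.reg 10)) (st 1 (.reg 10) (.reg 10))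
    (forN 11 nE (.cond (adjE (.reg 10) (.reg 11)) (st 1 (.reg 10) (.reg 11)) .skip)))

open Classical in
-- A leaf has exactly one neighbour, so the scan of its row of the adjacency matrix writes its owner
-- and nothing else.
theorem wp_owners (C : Spine G) {s : Rec}
    (h4 : ∀ v : Fin n, s.f 4 v = if C.ow v = v then 1 else 0) :
    Wp (inp G sets) owners (fun t s' => t ≤ n * (n * 45 + 60) + 20 ∧ Same [10, 11] [1] s s' ∧
      ∀ v : Fin n, s'.f 1 v = C.ow v) s := by
  refine wp_for_frame [10, 11] [1] (fun i s' => ∀ v : Fin n, v.val < i → s'.f 1 v = C.ow v) n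
    (n * 45 + 45) (by simp [mod_st]) (by simp) (fun s' _ => ev_nE_inp s') ?_ (by simp) ?_
  · intro i s1 hi a1 a2 a3
    have b4 := h4 ⟨i, hi⟩
    rw [show s.f 4 = s1.f 4 from (a1.fld 4 (by decide) (by decide)).symm] at b4
    simp only at b4
    refine wp_cond (fun h => wp_st (by decide) ⟨?_, by simpa using a3, ?_⟩)
      (fun h => wp_for_frame [11] [1] (fun j s' => (∀ v : Fin n, v.val < i → s'.f 1 v = C.ow v) ∧
        ((C.ow ⟨i, hi⟩).val < j → s'.f 1 i = C.ow ⟨i, hi⟩)) n 32 (by simp [mod_st]) (by simp)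
        (fun s' _ => ev_nE_inp s') ?_ ?_ ?_)
    · simp [AExp.cost]
    · rw [ev_fd _ _ (by decide), ev_reg, a3, b4] at h
      have how : C.ow ⟨i, hi⟩ = ⟨i, hi⟩ := by by_contra h'; simp [h'] at h
      intro v hv
      simp only [Rec.setr_f, Rec.setf_f, ev_reg, a3, true_and]
      split_ifs with hvi
      · rw [show v = ⟨i, hi⟩ from Fin.ext hvi, how]
      · exact a2 v (by omega)
    · rw [ev_fd _ _ (by decide), ev_reg, a3, b4] at h
      have how : C.ow ⟨i, hi⟩ ≠ ⟨i, hi⟩ := by intro h'; simp [h'] at h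
      intro j s2 hj c1 c2 c3
      have b10 : s2.r 10 = i := by rw [c1.reg 10 (by decide)]; exact a3
      have b9 := ev_adjE_inp (sets := sets) (G := G) (s := s2) (a := .reg 10) (b := .reg 11)
        (u := ⟨i, hi⟩) (v := ⟨j, hj⟩) b10 c3
      rw [C.adj_leaf_iff how] at b9
      refine wp_cond (fun h => wp_st (by decide) ⟨?_, by simpa using c3, ?_, ?_⟩)
        (fun h => wp_skip ⟨?_, c3, ?_, ?_⟩)
      · simp [AExp.cost]
      · intro v hv
        simp only [Rec.setr_f, Rec.setf_f, ev_reg, b10, true_and]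
        rw [if_neg (by omega)]
        exact c2.1 v hv
      · intro _
        have hj' : (⟨j, hj⟩ : Fin n) = C.ow ⟨i, hi⟩ := by by_contra h'; simp [b9, h'] at h
        simp only [Rec.setr_f, Rec.setf_f, ev_reg, b10, true_and, if_true, c3]
        rw [← hj']
      · simp [AExp.cost]
      · simpa using c2.1
      · intro hlt
        refine c2.2 ?_
        have hj' : (⟨j, hj⟩ : Fin n) ≠ C.ow ⟨i, hi⟩ := by intro h'; simp [b9, h'] at h
        have : (C.ow ⟨i, hi⟩).val ≠ j := fun h' => hj' (Fin.ext h'.symm)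
        omega
    · exact ⟨by simpa using a2, by simp⟩
    · intro t s2 c1 c2 c3 c4
      refine ⟨?_, ?_, ?_⟩
      · simp only [cost_nE, AExp.cost, cost_fd] at c1 ⊢; omega
      · rw [c3.reg 10 (by decide)]; exact a3
      · intro v hv
        rw [Rec.setr_f]
        by_cases hvi : v.val = i
        · have := c4.2 (C.ow ⟨i, hi⟩).2
          rw [show v = ⟨i, hi⟩ from Fin.ext hvi]
          exact this
        · exact c4.1 v (by omega)
  · intro t s1 a1 a2 a3 a4
    refine ⟨?_, a3, fun v => a4 v v.2⟩
    simp only [cost_nE] at a1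
    have : n * (n * 45 + 45 + 2 + 7) ≤ n * (n * 45 + 60) := Nat.mul_le_mul_left _ (by omega)
    omega

/-- The spine is stored in register 2 and field 0, the owners of the vertices in field 1. -/
structure Stored (C : Spine G) (s : Rec) : Prop where
  m : s.r 2 = C.m
  sp : ∀ i, i < C.m → s.f 0 i = C.s i
  own : ∀ v : Fin n, s.f 1 v = C.ow v

theorem Stored.same {C : Spine G} {s s' : Rec} (h : Stored C s) {R F : List ℕ}
    (hs : Same R F s s') (h2 : 2 ∉ R) (h0 : 0 ∉ F) (h1 : 1 ∉ F) : Stored C s' := by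
  refine ⟨?_, ?_, ?_⟩
  · rw [hs.reg 2 h2]; exact h.m
  · rw [hs.fld 0 (by decide) h0]; exact h.sp
  · rw [hs.fld 1 (by decide) h1]; exact h.own

def setup : Cmd :=
  countAdj 2 (.const 1) ;; countAdj 3 (.lt (.const 1) (fd 2 (.reg 11))) ;; findStart ;; walk ;;
  owners

theorem wp_setup (hn : 1 ≤ n) (hG : IsCaterpillar G) (s : Rec) :
    Wp (inp G sets) setup (fun t s' => t ≤ 1000 * (n * n) ∧ ∃ C : Spine G, Stored C s') s := by
  refine wp_seq ((wp_countAdj (by decide) (fun _ => 1) fun _ _ _ _ => rfl).mono ?_)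
  rintro t1 s1 ⟨a1, a2, a3⟩
  refine wp_seq ((wp_countAdj (by decide) (fun u => if 1 < deg G u then 1 else 0) ?_).mono ?_)
  · intro s' h u hu
    simp only [ev_lt, ev_const, ev_fd _ _ (show 2 < 16 by decide), ev_reg, hu]
    rw [h.fld 2 (by decide) (by decide), a3 u]
    rfl
  rintro t2 s2 ⟨b1, b2, b3⟩
  refine wp_seq ((wp_findStart hn (G := G) ?_ b3).mono ?_)
  · intro v
    rw [b2.fld 2 (by decide) (by decide), a3 v]
    rfl
  rintro t3 s3 ⟨c1, c2, x, c3, c4⟩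
  obtain ⟨C, hC0, hC⟩ := exists_spine_from G hG c4
  refine wp_seq ((wp_walk C hC ?_ (by rw [hC0]; exact c3) (C.m_pos x)).mono ?_)
  · intro v
    rw [c2.fld 2 (by decide) (by decide), b2.fld 2 (by decide) (by decide), a3 v]
    rfl
  rintro t4 s4 ⟨d1, d2, d3, d4, d5⟩
  refine (wp_owners C d5).mono ?_
  rintro t5 s5 ⟨e1, e2, e3⟩
  refine ⟨?_, C, ?_, ?_, e3⟩
  · simp only [AExp.cost, cost_fd] at a1 b1
    have h1 := a1.trans (time_bound hn _ _ _)
    have h2 := b1.trans (time_bound hn _ _ _)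
    have h3 := c1.trans (show n * 80 + 20 ≤ n * (n * 0 + 80) + 20 by omega)
    have h3 := h3.trans (time_bound hn _ _ _)
    have h4 := d1.trans (time_bound hn _ _ _)
    have h5 := e1.trans (time_bound hn _ _ _)
    omega
  · rw [e2.reg 2 (by decide)]; exact d3
  · intro i hi
    rw [e2.fld 0 (by decide) (by decide)]; exact d4 i hi

end Setup

/-! ### Local conditions for slides on the spine, and counts of leaves -/

namespace Spine

variable {V : Type u} [DecidableEq V] {G : SimpleGraph V} {k : ℕ} (C : Spine G)

/-- The slide does not affect leaves. A window that was not one before contains the abandoned vertex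
`i`, and it ends there because `i + 1` is now occupied. -/
theorem isPVC_slide_iff (hk : 4 ≤ k) {X : Finset V} (hX : IsPVC G k X) {i : ℕ} (hi : i + 1 < C.m)
    (h1 : C.s i ∈ X) (h2 : C.s (i + 1) ∉ X) :
    IsPVC G k (mv X (C.s i) (C.s (i + 1))) ↔
      ∀ a, a < i → (∀ j, a ≤ j → j < i → C.s j ∉ X) → (i - a + 1) + C.vac X a + C.vac X i < k := by
  have hvac : ∀ j, C.vac (mv X (C.s i) (C.s (i + 1))) j = C.vac X j := by
    intro j
    refine le_antisymm (C.vac_le_vac fun v h3 h4 h5 => ⟨v, h3, h4, fun h6 => h5 ?_⟩)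
      (C.vac_le_vac fun v h3 h4 h5 => ⟨v, h3, h4, fun h6 => h5 ?_⟩)
    · exact mem_mv.2 (Or.inr ⟨(C.leaf_ne_s h4 (by omega)).symm, h6⟩)
    · rcases mem_mv.1 h6 with h | h
      · exact absurd h (C.leaf_ne_s h4 hi).symm
      · exact h.2
  have hmem : ∀ j, j < C.m → (C.s j ∈ mv X (C.s i) (C.s (i + 1)) ↔
      j = i + 1 ∨ (j ≠ i ∧ C.s j ∈ X)) := by
    intro j hj
    rw [mem_mv]
    refine or_congr ⟨fun h => C.s_inj hj hi h, fun h => by rw [h]⟩ (and_congr_left fun _ =>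
      not_congr ⟨fun h => C.s_inj hj (by omega) h, fun h => by rw [h]⟩)
  rw [C.isPVC_iff_ok hk] at hX ⊢
  constructor
  · intro h a ha hemp
    have := h a i ha (by omega) (fun j h3 h4 => by
      rw [hmem j (by omega)]
      rintro (h5 | ⟨h5, h6⟩)
      · omega
      · exact hemp j h3 (by omega) h6)
    rwa [hvac, hvac] at this
  · intro h a b hab hb hemp
    rw [hvac, hvac]
    have hemp' : ∀ j, a ≤ j → j ≤ b → j ≠ i + 1 ∧ (j ≠ i → C.s j ∉ X) := by
      intro j h3 h4
      have := hemp j h3 h4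
      rw [hmem j (by omega)] at this
      tauto
    by_cases hin : a ≤ i ∧ i ≤ b
    · have hbi : b = i := by
        by_contra hne
        exact (hemp' (i + 1) (by omega) (by omega)).1 rfl
      subst hbi
      exact h a hab fun j h3 h4 => (hemp' j h3 (by omega)).2 (by omega)
    · exact hX a b hab hb fun j h3 h4 => (hemp' j h3 h4).2 (by rintro rfl; exact hin ⟨h3, h4⟩)

/-- The condition for a slide, read off from the left end `a` of the run of empty vertices. -/
theorem isPVC_slide_iff_run (hk : 4 ≤ k) {X : Finset V} (hX : IsPVC G k X) {i a : ℕ}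
    (hi : i + 1 < C.m) (h1 : C.s i ∈ X) (h2 : C.s (i + 1) ∉ X) (hai : a ≤ i)
    (hemp : ∀ j, a ≤ j → j < i → C.s j ∉ X) (ha : a = 0 ∨ C.s (a - 1) ∈ X) :
    IsPVC G k (mv X (C.s i) (C.s (i + 1))) ↔
      a = i ∨ (i - a + 1) + C.vac X a + C.vac X i < k := by
  rw [C.isPVC_slide_iff hk hX hi h1 h2]
  constructor
  · intro h
    by_cases hai' : a = i
    · exact Or.inl hai'
    · exact Or.inr (h a (by omega) hemp)
  · intro h b hb hb'
    have hab : a ≤ b := by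
      by_contra hlt
      rcases ha with ha | ha
      · omega
      · exact hb' (a - 1) (by omega) (by omega) ha
    rcases h with h | h
    · omega
    -- A shorter window loses at least one spine vertex and gains at most one vacant leaf, so the
    -- longest window decides.
    · by_cases hab' : a = b
      · subst hab'; exact h
      · have := C.vac_le_one X b
        omega

/-- The condition for a slide from `i` involves only the stars up to `i + 1`. -/
theorem isPVC_slide_congr (hk : 4 ≤ k) {X Y : Finset V} (hX : IsPVC G k X) (hY : IsPVC G k Y)
    {i : ℕ} (hi : i + 1 < C.m) (h1 : C.s i ∈ X) (h2 : C.s (i + 1) ∉ X)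
    (hXY : ∀ v, C.o v ≤ i + 1 → (v ∈ X ↔ v ∈ Y))
    (h : IsPVC G k (mv X (C.s i) (C.s (i + 1)))) : IsPVC G k (mv Y (C.s i) (C.s (i + 1))) := by
  have hs : ∀ j, j ≤ i + 1 → (C.s j ∈ X ↔ C.s j ∈ Y) := fun j hj =>
    hXY _ (by rw [C.o_s j (by omega)]; omega)
  have hvac : ∀ j, j ≤ i → C.vac Y j ≤ C.vac X j := fun j hj =>
    C.vac_le_vac fun v h3 h4 h5 => ⟨v, h3, h4, fun h6 => h5 ((hXY v (by omega)).1 h6)⟩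
  rw [C.isPVC_slide_iff hk hX hi h1 h2] at h
  rw [C.isPVC_slide_iff hk hY hi ((hs _ (by omega)).1 h1) (fun h' => h2 ((hs _ le_rfl).2 h'))]
  intro a ha hemp
  have := h a ha fun j h3 h4 h5 => hemp j h3 h4 ((hs j (by omega)).1 h5)
  have := hvac a (by omega)
  have := hvac i le_rfl
  omega

/-- No slide to the right is possible from the first `i` spine vertices. -/
def FixedBelow (k : ℕ) (X : Finset V) (i : ℕ) : Prop :=
  ∀ j, j < i → j + 1 < C.m → C.s j ∈ X → C.s (j + 1) ∉ X →
    ¬ IsPVC G k (mv X (C.s j) (C.s (j + 1)))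

/-- A push at `i` leaves the stars before `i` alone, so slides from vertices before `i - 1` remain
blocked. This is why the sweep has to step back by one vertex only. -/
theorem FixedBelow.of_agree {C : Spine G} (hk : 4 ≤ k) {X Y : Finset V} (hX : IsPVC G k X)
    (hY : IsPVC G k Y) {i : ℕ} (h : C.FixedBelow k X i) (hXY : ∀ v, C.o v < i → (v ∈ Y ↔ v ∈ X)) :
    C.FixedBelow k Y (i - 1) := by
  intro j hj hm h1 h2 h3
  have e1 := hXY (C.s j) (by rw [C.o_s j (by omega)]; omega)
  have e2 := hXY (C.s (j + 1)) (by rw [C.o_s _ (by omega)]; omega)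
  exact h j (by omega) hm (e1.1 h1) (fun h' => h2 (e2.2 h'))
    (C.isPVC_slide_congr hk hY hX hm h1 h2 (fun v hv => hXY v (by omega)) h3)

/-- Bounds the scan for the left end of a run by a number of steps that depends only on `k`. -/
theorem run_length_lt (hk : 4 ≤ k) {X : Finset V} (hX : IsPVC G k X) {i a : ℕ} (hi : i < C.m)
    (hai : a ≤ i) (hemp : ∀ j, a ≤ j → j < i → C.s j ∉ X) : i - a < k := by
  rw [C.isPVC_iff_ok hk] at hX
  by_contra hge
  have := hX a (i - 1) (by omega) (by omega) (fun j h1 h2 => hemp j h1 (by omega))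
  omega

theorem agree_light {X : Finset V} {i : ℕ} (hi : i + 1 < C.m) {v : V} (hv : C.o v < i) :
    v ∈ mv X (C.s i) (C.s (i + 1)) ↔ v ∈ X := by
  have h1 : v ≠ C.s i := by rintro rfl; rw [C.o_s i (by omega)] at hv; omega
  have h2 : v ≠ C.s (i + 1) := by rintro rfl; rw [C.o_s _ (by omega)] at hv; omega
  rw [mem_mv]; tauto

theorem agree_release {X : Finset V} {i : ℕ} {z : V} (h1 : C.s i ∈ X) (hi : i + 1 < C.m)
    (hz : z ∈ C.leafTok X) (hzi : C.o z = i) {v : V} (hv : C.o v < i) :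
    v ∈ C.release X i z ↔ v ∈ X := by
  have h2 : v ≠ C.s (i + 1) := by rintro rfl; rw [C.o_s _ (by omega)] at hv; omega
  have h3 : v ≠ z := by rintro rfl; omega
  rw [C.mem_release h1 hi hz]; tauto

section Counts

variable [Fintype V]

/-- The number of occupied leaves at `v`. -/
def occ (X : Finset V) (v : V) : ℕ := ∑ z, if C.ow z = v ∧ z ≠ v ∧ z ∈ X then 1 else 0

/-- The number of vacant leaves at `v`. -/
def free (X : Finset V) (v : V) : ℕ := ∑ z, if C.ow z = v ∧ z ≠ v ∧ z ∉ X then 1 else 0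

theorem occ_mirror (X : Finset V) (v : V) : C.mirror.occ X v = C.occ X v := by
  simp only [occ, mirror_ow]

theorem free_mirror (X : Finset V) (v : V) : C.mirror.free X v = C.free X v := by
  simp only [free, mirror_ow]

theorem o_eq_iff {i : ℕ} (hi : i < C.m) {z : V} : C.o z = i ↔ C.ow z = C.s i :=
  ⟨fun h => by rw [ow, h], fun h => by
    have := congrArg C.o h
    rwa [C.o_ow, C.o_s i hi] at this⟩

theorem occ_pos_iff {X : Finset V} {i : ℕ} (hi : i < C.m) :
    0 < C.occ X (C.s i) ↔ ∃ z ∈ C.leafTok X, C.o z = i := by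
  rw [occ, ← Finset.card_filter, Finset.card_pos]
  constructor
  · rintro ⟨z, hz⟩
    obtain ⟨-, h1, h2, h3⟩ := Finset.mem_filter.1 hz
    exact ⟨z, C.mem_leafTok.2 ⟨h3, by rw [h1]; exact h2.symm⟩, (C.o_eq_iff hi).2 h1⟩
  · rintro ⟨z, hz, hzi⟩
    obtain ⟨h1, h2⟩ := C.mem_leafTok.1 hz
    rw [C.o_eq_iff hi] at hzi
    exact ⟨z, Finset.mem_filter.2 ⟨Finset.mem_univ _, hzi, by rw [← hzi]; exact h2.symm, h1⟩⟩

theorem vac_eq {X : Finset V} {i : ℕ} (hi : i < C.m) :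
    C.vac X i = if 0 < C.free X (C.s i) then 1 else 0 := by
  unfold vac
  congr 1
  rw [free, ← Finset.card_filter, Finset.card_pos]
  refine propext ⟨?_, ?_⟩
  · rintro ⟨z, h1, h2, h3⟩
    rw [C.o_eq_iff hi] at h1
    exact ⟨z, Finset.mem_filter.2 ⟨Finset.mem_univ _, h1, by rw [← h1]; exact h2.symm, h3⟩⟩
  · rintro ⟨z, hz⟩
    obtain ⟨-, h1, h2, h3⟩ := Finset.mem_filter.1 hz
    exact ⟨z, (C.o_eq_iff hi).2 h1, by rw [h1]; exact h2.symm, h3⟩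

theorem occ_congr {X Y : Finset V} (h : ∀ z, C.ow z ≠ z → (z ∈ X ↔ z ∈ Y)) (v : V) :
    C.occ X v = C.occ Y v := by
  refine Finset.sum_congr rfl fun z _ => ?_
  congr 1
  refine propext (and_congr_right fun h1 => and_congr_right fun h2 => h z ?_)
  rw [h1]; exact h2.symm

theorem free_congr {X Y : Finset V} (h : ∀ z, C.ow z ≠ z → (z ∈ X ↔ z ∈ Y)) (v : V) :
    C.free X v = C.free Y v := by
  refine Finset.sum_congr rfl fun z _ => ?_
  congr 1
  refine propext (and_congr_right fun h1 => and_congr_right fun h2 => not_congr (h z ?_))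
  rw [h1]; exact h2.symm

theorem leaf_mem_light {X : Finset V} {i : ℕ} (hi : i + 1 < C.m) (z : V) (hz : C.ow z ≠ z) :
    z ∈ mv X (C.s i) (C.s (i + 1)) ↔ z ∈ X := by
  have h1 := C.leaf_ne_s hz hi
  have h2 := C.leaf_ne_s hz (show i < C.m by omega)
  rw [mem_mv]; tauto

theorem occ_release {X : Finset V} {i : ℕ} {z : V} (h1 : C.s i ∈ X) (hi : i + 1 < C.m)
    (hz : z ∈ C.leafTok X) (hzi : C.o z = i) (v : V) :
    C.occ (C.release X i z) v + (if v = C.s i then 1 else 0) = C.occ X v := by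
  have h2 := C.mem_leafTok.1 hz
  rw [C.o_eq_iff (by omega)] at hzi
  have : (if v = C.s i then 1 else 0) = ∑ w, if w = z then (if v = C.s i then 1 else 0) else 0 := by
    simp
  rw [this, occ, occ, ← Finset.sum_add_distrib]
  refine Finset.sum_congr rfl fun w _ => ?_
  simp only [C.mem_release h1 hi hz]
  by_cases hw : w = z
  · subst hw
    have h3 := C.leaf_ne_s h2.2 hi
    rw [hzi]
    by_cases hv : v = C.s i
    · subst hv
      have h4 := C.leaf_ne_s h2.2 (show i < C.m by omega)
      simp [h3.symm, h4.symm, h2.1]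
    · simp [hv, Ne.symm hv]
  · rw [if_neg hw, add_zero]
    congr 1
    refine propext (and_congr_right fun h4 => and_congr_right fun h5 => ?_)
    have : w ≠ C.s (i + 1) := by
      rintro rfl; rw [C.ow_s hi] at h4; exact h5 h4
    tauto

theorem free_release {X : Finset V} {i : ℕ} {z : V} (h1 : C.s i ∈ X) (hi : i + 1 < C.m)
    (hz : z ∈ C.leafTok X) (hzi : C.o z = i) (v : V) :
    C.free (C.release X i z) v = C.free X v + (if v = C.s i then 1 else 0) := by
  have h2 := C.mem_leafTok.1 hz
  rw [C.o_eq_iff (by omega)] at hzi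
  have : (if v = C.s i then 1 else 0) = ∑ w, if w = z then (if v = C.s i then 1 else 0) else 0 := by
    simp
  rw [this, free, free, ← Finset.sum_add_distrib]
  refine Finset.sum_congr rfl fun w _ => ?_
  simp only [C.mem_release h1 hi hz]
  by_cases hw : w = z
  · subst hw
    have h3 := C.leaf_ne_s h2.2 hi
    rw [hzi]
    by_cases hv : v = C.s i
    · subst hv
      have h4 := C.leaf_ne_s h2.2 (show i < C.m by omega)
      simp [h3.symm, h4.symm, h2.1]
    · simp [hv, Ne.symm hv]
  · rw [if_neg hw, add_zero]
    congr 1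
    refine propext (and_congr_right fun h4 => and_congr_right fun h5 => ?_)
    have : w ≠ C.s (i + 1) := by
      rintro rfl; rw [C.ow_s hi] at h4; exact h5 h4
    tauto

/-- At most `n` tokens of weight at most `4 * n`; this bounds the total cost of the pushes in a
sweep. -/
theorem pot_le {n : ℕ} {G : SimpleGraph (Fin n)} (C : Spine G) (X : Finset (Fin n)) :
    C.pot n X ≤ 4 * (n * n) := by
  have h1 : ∀ v ∈ X, C.wt n v ≤ 4 * n := by
    intro v _
    have := C.m_le
    unfold wt
    split_ifs <;> omega
  have h2 := Finset.sum_le_card_nsmul X _ _ h1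
  have h3 : X.card ≤ n := by simpa using Finset.card_le_univ X
  have h4 := Nat.mul_le_mul_right (4 * n) h3
  rw [smul_eq_mul] at h2
  unfold pot
  nlinarith

end Counts

end Spine

/-! ### Moving tokens -/

section Moves

variable {n : ℕ} {G : SimpleGraph (Fin n)} {sets : List (Finset (Fin n))} {k : ℕ}

/-- The tokens are marked in field 5, and the slides are recorded in fields 8 and 9. -/
structure Mem (X : Finset (Fin n)) (l : List (Fin n × Fin n)) (s : Rec) : Prop where
  tok : ∀ v : Fin n, s.f 5 v = if v ∈ X then 1 else 0
  len : s.r 7 = l.length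
  fst : ∀ (i : ℕ) (h : i < l.length), s.f 8 i = (l[i]).1
  snd : ∀ (i : ℕ) (h : i < l.length), s.f 9 i = (l[i]).2

theorem Mem.same {X : Finset (Fin n)} {l : List (Fin n × Fin n)} {s s' : Rec} (h : Mem X l s)
    {R F : List ℕ} (hs : Same R F s s') (h7 : 7 ∉ R) (h5 : 5 ∉ F) (h8 : 8 ∉ F) (h9 : 9 ∉ F) :
    Mem X l s' := by
  refine ⟨?_, ?_, ?_, ?_⟩
  · rw [hs.fld 5 (by decide) h5]; exact h.tok
  · rw [hs.reg 7 h7]; exact h.len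
  · rw [hs.fld 8 (by decide) h8]; exact h.fst
  · rw [hs.fld 9 (by decide) h9]; exact h.snd

/-- The numbers of occupied and of vacant leaves are in fields 6 and 7, the number of occupied
leaves is in register 8. -/
structure Counts (C : Spine G) (X : Finset (Fin n)) (s : Rec) : Prop where
  occ : ∀ v : Fin n, s.f 6 v = C.occ X v
  free : ∀ v : Fin n, s.f 7 v = C.free X v
  num : s.r 8 = (C.leafTok X).card

theorem Counts.same {C : Spine G} {X : Finset (Fin n)} {s s' : Rec} (h : Counts C X s)
    {R F : List ℕ} (hs : Same R F s s') (h8 : 8 ∉ R) (h6 : 6 ∉ F) (h7 : 7 ∉ F) :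
    Counts C X s' := by
  refine ⟨?_, ?_, ?_⟩
  · rw [hs.fld 6 (by decide) h6]; exact h.occ
  · rw [hs.fld 7 (by decide) h7]; exact h.free
  · rw [hs.reg 8 h8]; exact h.num

theorem Counts.mirror {C : Spine G} {X : Finset (Fin n)} {s : Rec} (h : Counts C X s) :
    Counts C.mirror X s :=
  ⟨fun v => by rw [C.occ_mirror]; exact h.occ v, fun v => by rw [C.free_mirror]; exact h.free v,
    by rw [C.leafTok_mirror]; exact h.num⟩

/-- Slide the token at the vertex in register `x` to the vertex in register `y`. -/
def slide (x y : ℕ) : Cmd :=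
  st 5 (.reg x) (.const 0) ;; st 5 (.reg y) (.const 1) ;; st 8 (.reg 7) (.reg x) ;;
  st 9 (.reg 7) (.reg y) ;; inc 7

theorem mod_slide {R F : List ℕ} {x y : ℕ} (h7 : 7 ∈ R) (h5 : 5 ∈ F) (h8 : 8 ∈ F) (h9 : 9 ∈ F) :
    Mod R F (slide x y) := by
  simp [slide, mod_st, inc, *]

theorem wp_slide {X : Finset (Fin n)} {l : List (Fin n × Fin n)} {s : Rec} (h : Mem X l s)
    {x y : ℕ} {u v : Fin n} (hu : s.r x = u) (hv : s.r y = v) :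
    Wp (inp G sets) (slide x y) (fun t s' => t ≤ 100 ∧ Same [7] [5, 8, 9] s s' ∧
      Mem (mv X u v) (l ++ [(u, v)]) s') s := by
  refine (Wp.frame (mod_slide (R := [7]) (F := [5, 8, 9]) (by decide) (by decide) (by decide)
    (by decide)) (Q := fun t s' => t ≤ 100 ∧ Mem (mv X u v) (l ++ [(u, v)]) s') ?_).mono
    (fun t s' h => ⟨h.1.1, h.2, h.1.2⟩)
  refine wp_seq (wp_st (by decide) (wp_seq (wp_st (by decide) (wp_seq (wp_st (by decide)
    (wp_seq (wp_st (by decide) (wp_assign ⟨?_, ?_, ?_, ?_, ?_⟩))))))))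
  · simp [AExp.cost]
  · intro w
    simp only [Rec.setr_f, Rec.setf_f, ev_reg, Rec.setf_r, hu, hv, ev_const, true_and,
      show (5 : ℕ) ≠ 9 by decide, show (5 : ℕ) ≠ 8 by decide, false_and, if_false, h.tok w,
      Fin.val_inj]
    by_cases h1 : w = v
    · simp [h1, mem_mv]
    · by_cases h2 : w = u
      · simp [h1, h2, mem_mv]
      · simp [h1, h2, mem_mv]
  · simp [h.len]
  · intro i hi
    simp only [List.length_append, List.length_singleton] at hi
    simp only [Rec.setr_f, Rec.setf_f, ev_reg, Rec.setf_r, hu, hv, true_and, h.len,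
      show (8 : ℕ) ≠ 9 by decide, show (8 : ℕ) ≠ 5 by decide, false_and, if_false]
    by_cases hil : i = l.length
    · simp [hil]
    · rw [if_neg hil, List.getElem_append_left (by omega), h.fst i (by omega)]
  · intro i hi
    simp only [List.length_append, List.length_singleton] at hi
    simp only [Rec.setr_f, Rec.setf_f, ev_reg, Rec.setf_r, hu, hv, true_and, h.len,
      show (9 : ℕ) ≠ 8 by decide, show (9 : ℕ) ≠ 5 by decide, false_and, if_false]
    by_cases hil : i = l.length
    · simp [hil]
    · rw [if_neg hil, List.getElem_append_left (by omega), h.snd i (by omega)]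

/-- Find an occupied leaf at the vertex in register 5. -/
def findLeaf : Cmd :=
  forN 10 nE (.cond (.mul (.mul (fd 5 (.reg 10)) (.eq (fd 1 (.reg 10)) (.reg 5)))
    (.sub (.const 1) (.eq (.reg 10) (.reg 5)))) (.assign 6 (.reg 10)) .skip)

theorem wp_findLeaf {C : Spine G} {X : Finset (Fin n)} {l : List (Fin n × Fin n)} {s : Rec}
    (hC : Stored C s) (h : Mem X l s) {u : Fin n} (hu : s.r 5 = u)
    (hz : ∃ z ∈ X, C.ow z = u ∧ z ≠ u) :
    Wp (inp G sets) findLeaf (fun t s' => t ≤ n * 80 + 10 ∧ Same [6, 10] [] s s' ∧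
      ∃ z ∈ X, s'.r 6 = z ∧ C.ow z = u ∧ z ≠ u) s := by
  refine wp_for_frame [6, 10] [] (fun i s' => (∃ z ∈ X, C.ow z = u ∧ z ≠ u ∧ z.val < i) →
    ∃ z ∈ X, s'.r 6 = z ∧ C.ow z = u ∧ z ≠ u) n 60
    (by simp) (by simp) (fun s' _ => ev_nE_inp s') ?_ (by simp) ?_
  · intro i s1 hi a1 a2 a3
    have b1 := (hC.same a1 (by decide) (by decide) (by decide)).own ⟨i, hi⟩
    have b2 := (h.same a1 (by decide) (by decide) (by decide) (by decide)).tok ⟨i, hi⟩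
    have b5 : s1.r 5 = u := by rw [a1.reg 5 (by decide)]; exact hu
    simp only at b1 b2
    have he : (ev (inp G sets) s1 (.mul (.mul (fd 5 (.reg 10)) (.eq (fd 1 (.reg 10)) (.reg 5)))
        (.sub (.const 1) (.eq (.reg 10) (.reg 5)))) ≠ 0) ↔
        (⟨i, hi⟩ : Fin n) ∈ X ∧ C.ow ⟨i, hi⟩ = u ∧ (⟨i, hi⟩ : Fin n) ≠ u := by
      simp only [ev_mul, ev_sub, ev_eq, ev_const, ev_fd _ _ (show 5 < 16 by decide),
        ev_fd _ _ (show 1 < 16 by decide), ev_reg, a3, b1, b2, b5, Fin.val_inj]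
      by_cases c1 : (⟨i, hi⟩ : Fin n) ∈ X <;> by_cases c2 : C.ow ⟨i, hi⟩ = u <;>
        by_cases c3 : (⟨i, hi⟩ : Fin n) = u
      all_goals
        have c4 : i = u.val ↔ (⟨i, hi⟩ : Fin n) = u := ⟨fun h => Fin.ext h, fun h => by rw [← h]⟩
        simp [c1, c2, c3, c4]
    refine wp_cond (fun hc => wp_assign ⟨?_, by simpa using a3, fun _ => ⟨⟨i, hi⟩, ?_, ?_, ?_⟩⟩)
      (fun hc => wp_skip ⟨?_, a3, ?_⟩)
    · simp [AExp.cost]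
    · exact (he.1 hc).1
    · simpa using a3
    · exact (he.1 hc).2
    · simp [AExp.cost]
    · rintro ⟨z, z1, z2, z3, z4⟩
      have : z.val ≠ i := by
        rintro rfl
        exact he.2 ⟨z1, z2, z3⟩ hc
      simpa using a2 ⟨z, z1, z2, z3, by omega⟩
  · intro t s1 a1 a2 a3 a4
    refine ⟨by simp only [cost_nE] at a1; omega, a3, a4 ?_⟩
    obtain ⟨z, z1, z2, z3⟩ := hz
    exact ⟨z, z1, z2, z3, z.2⟩

/-- Slide an occupied leaf of the vertex in register 5 to that vertex. -/
def releaseLeaf : Cmd :=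
  findLeaf ;; slide 6 5 ;; st 6 (.reg 5) (.sub (fd 6 (.reg 5)) (.const 1)) ;;
  st 7 (.reg 5) (.add (fd 7 (.reg 5)) (.const 1)) ;; .assign 8 (.sub (.reg 8) (.const 1))

theorem mod_releaseLeaf {R F : List ℕ} (hR : [6, 7, 8, 10] ⊆ R) (hF : [5, 6, 7, 8, 9] ⊆ F) :
    Mod R F releaseLeaf :=
  Mod.mono (by simp [releaseLeaf, findLeaf, mod_slide, mod_st]) hR hF

/-- Slide the token from the spine vertex in register 5 to the spine vertex in register 6, and
fill the gap with a leaf, if possible. Step back on the spine. -/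
def push : Cmd :=
  slide 5 6 ;; .cond (.lt (.const 0) (fd 6 (.reg 5))) releaseLeaf .skip ;;
  .assign 3 (.sub (.reg 3) (.const 1))

theorem mod_push {R F : List ℕ} (hR : [3, 6, 7, 8, 10] ⊆ R) (hF : [5, 6, 7, 8, 9] ⊆ F) :
    Mod R F push :=
  Mod.mono (by simp [push, mod_releaseLeaf, mod_slide]) hR hF

/-- The number `d` is the charge for the push: 1 for a plain slide and `n` for a release, which
searches for a leaf. The potential drops by `2 * d`, so that besides the charge one unit is left for
stepping back. -/
theorem wp_push (hk : 4 ≤ k) {C : Spine G} {X : Finset (Fin n)} {l : List (Fin n × Fin n)} {s : Rec}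
    (hC : Stored C s) (hM : Mem X l s) (hT : Counts C X s) {i : ℕ} (hi : i + 1 < C.m)
    (h3 : s.r 3 = i) (h5 : s.r 5 = C.s i) (h6 : s.r 6 = C.s (i + 1)) (h1 : C.s i ∈ X)
    (h2 : C.s (i + 1) ∉ X) (hX : IsPVC G k X) (hX' : IsPVC G k (mv X (C.s i) (C.s (i + 1))))
    (hN : C.Norm X) :
    Wp (inp G sets) push (fun t s' => s'.r 3 = i - 1 ∧ ∃ X' l', Mem X' (l ++ l') s' ∧
      Counts C X' s' ∧ Log G k X l' X' ∧ C.Norm X' ∧ C.Prog X X' ∧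
      (∀ v, C.o v < i → (v ∈ X' ↔ v ∈ X)) ∧
      ∃ d, 1 ≤ d ∧ t ≤ 600 * d ∧ C.pot n X' + 2 * d ≤ C.pot n X) s := by
  have hn : 1 ≤ n := Nat.one_le_of_lt (C.s 0).2
  refine wp_seq ((wp_slide hM h5 h6).mono ?_)
  rintro t1 s1 ⟨a1, a2, a3⟩
  have a5 : s1.r 5 = C.s i := by rw [a2.reg 5 (by decide)]; exact h5
  have a6 : s1.r 3 = i := by rw [a2.reg 3 (by decide)]; exact h3
  have hleaf := C.leaf_mem_light (X := X) hi
  have hocc : s1.f 6 (C.s i) = C.occ X (C.s i) := by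
    rw [a2.fld 6 (by decide) (by decide)]; exact hT.occ _
  refine wp_seq (wp_cond (fun hc => ?_) (fun hc => wp_skip (wp_assign ?_)))
  · have hex : ∃ z ∈ C.leafTok X, C.o z = i := by
      rw [← C.occ_pos_iff (by omega), ← hocc]
      by_contra h
      apply hc
      simp only [ev_lt, ev_const, ev_fd _ _ (show 6 < 16 by decide), ev_reg, a5]
      rw [if_neg h]
    refine wp_seq ((wp_findLeaf (hC.same a2 (by decide) (by decide) (by decide)) a3 a5 ?_).mono ?_)
    · obtain ⟨z, z1, z2⟩ := hex
      rw [C.mem_leafTok] at z1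
      rw [C.o_eq_iff (by omega)] at z2
      exact ⟨z, (hleaf z z1.2).2 z1.1, z2, by rw [← z2]; exact z1.2.symm⟩
    rintro t2 s2 ⟨b1, b2, z, b3, b4, b5, b6⟩
    have hzl : C.ow z ≠ z := by rw [b5]; exact b6.symm
    have hz : z ∈ C.leafTok X := C.mem_leafTok.2 ⟨(hleaf z hzl).1 b3, hzl⟩
    have hzi : C.o z = i := (C.o_eq_iff (by omega)).2 b5
    have b7 : s2.r 5 = C.s i := by rw [b2.reg 5 (by decide)]; exact a5
    refine wp_seq ((wp_slide (a3.same b2 (by decide) (by decide) (by decide) (by decide))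
      b4 b7).mono ?_)
    rintro t3 s3 ⟨c1, c2, c3⟩
    have c7 : s3.r 5 = C.s i := by rw [c2.reg 5 (by decide)]; exact b7
    refine wp_seq (wp_st (by decide) (wp_seq (wp_st (by decide) (wp_assign (wp_assign ?_)))))
    have hsame : Same [6, 7, 10] [5, 8, 9] s s3 :=
      ((a2.mono (by simp) (by simp)).trans (b2.mono (by simp) (by simp))).trans
        (c2.mono (by simp) (by simp))
    have hT3 := hT.same hsame (by decide) (by decide) (by decide)
    have hr3 := hsame.reg 3 (by decide)
    refine ⟨by simp [hr3, h3], C.release X i z, [(C.s i, C.s (i + 1)), (z, C.s i)], ?_,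
      ⟨fun v => ?_, fun v => ?_, ?_⟩,
      C.log_release hk hX hi h1 h2 hX' hz hzi, C.norm_release hN h1 hi hz,
      C.prog_release h1 hi hz, fun v hv => C.agree_release h1 hi hz hzi hv, n, hn, ?_, ?_⟩
    · have := c3
      rw [List.append_assoc] at this
      refine this.same (R := [3, 8]) (F := [6, 7]) ⟨?_, ?_⟩ (by decide) (by decide) (by decide)
        (by decide)
      · intro a ha
        simp only [List.mem_cons, not_or] at ha
        simp [ha]
      · intro j _ hj
        simp only [List.mem_cons, not_or] at hj
        funext b
        simp [hj]
    · have e1 := C.occ_release h1 hi hz hzi v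
      have e2 := C.occ_release h1 hi hz hzi (C.s i)
      rw [if_pos rfl] at e2
      simp only [Rec.setr_f, Rec.setf_f, ev_reg, Rec.setf_r, ev_sub, ev_const, c7, true_and,
        ev_fd _ _ (show 6 < 16 by decide), show (6 : ℕ) ≠ 7 by decide, false_and, if_false, hT3.occ,
        Fin.val_inj]
      split_ifs at e1 ⊢ with hv
      · subst hv; omega
      · omega
    · have e1 := C.free_release h1 hi hz hzi v
      have e2 := C.free_release h1 hi hz hzi (C.s i)
      rw [if_pos rfl] at e2
      simp only [Rec.setr_f, Rec.setf_f, ev_reg, Rec.setf_r, ev_add, ev_const, c7, true_and,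
        ev_fd _ _ (show 7 < 16 by decide), show (7 : ℕ) ≠ 6 by decide, false_and, if_false, hT3.free,
        Fin.val_inj]
      split_ifs at e1 ⊢ with hv
      · subst hv; omega
      · omega
    · rw [C.leafTok_release h1 hi hz, Finset.card_erase_of_mem hz]
      simp [hT3.num]
    · simp only [AExp.cost, cost_fd]; omega
    · have := C.pot_release (N := n) h1 h2 hi hz
      have := C.m_le
      omega
  · have hno : ∀ v ∈ C.leafTok X, C.o v ≠ i := by
      have : ¬ ∃ z ∈ C.leafTok X, C.o z = i := by
        rw [← C.occ_pos_iff (by omega), ← hocc]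
        intro h
        simp only [ev_lt, ev_const, ev_fd _ _ (show 6 < 16 by decide), ev_reg, a5] at hc
        rw [if_pos h] at hc
        exact absurd hc (by decide)
      push Not at this
      exact this
    have hT1 := hT.same a2 (by decide) (by decide) (by decide)
    refine ⟨by simp [a6], mv X (C.s i) (C.s (i + 1)), [(C.s i, C.s (i + 1))],
      a3.same (same_setr (R := [3]) (F := []) (by simp)) (by decide) (by decide) (by decide)
        (by decide), ?_, C.log_light hX hi h1 h2 hX', C.norm_light hN hi hno,
      C.prog_light hN hi h1 h2 hno, fun v hv => C.agree_light hi hv, 1, le_rfl, ?_, ?_⟩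
    · refine ⟨fun v => ?_, fun v => ?_, ?_⟩
      · rw [Rec.setr_f, hT1.occ, C.occ_congr hleaf]
      · rw [Rec.setr_f, hT1.free, C.free_congr hleaf]
      · rw [C.leafTok_mv_spine (by omega) hi, Rec.setr_r, if_neg (by decide), hT1.num]
    · simp only [AExp.cost, cost_fd]; omega
    · have := C.pot_light (N := n) hi h1 h2
      omega

end Moves

/-! ### One sweep over the spine -/

section Sweep

variable {n : ℕ} {G : SimpleGraph (Fin n)} {sets : List (Finset (Fin n))} {k : ℕ}

/-- Register 4 receives the left end of the run of empty spine vertices in front of the one with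
the index in register 3. -/
def runStart : Cmd :=
  .assign 4 (.reg 3) ;;
  .loop (.mul (.lt (.const 0) (.reg 4))
      (.eq (fd 5 (fd 0 (.sub (.reg 4) (.const 1)))) (.const 0)))
    (.assign 4 (.sub (.reg 4) (.const 1)))

theorem wp_runStart (hk : 4 ≤ k) {C : Spine G} {X : Finset (Fin n)} {l : List (Fin n × Fin n)}
    {s : Rec} (hC : Stored C s) (hM : Mem X l s) {i : ℕ} (hi : i < C.m) (h3 : s.r 3 = i)
    (hX : IsPVC G k X) :
    Wp (inp G sets) runStart (fun t s' => t ≤ k * 60 + 60 ∧ Same [4] [] s s' ∧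
      ∃ a, s'.r 4 = a ∧ a ≤ i ∧ (∀ j, a ≤ j → j < i → C.s j ∉ X) ∧
        (a = 0 ∨ C.s (a - 1) ∈ X)) s := by
  have hev : ∀ s', Same [4] [] s s' → ∀ a, s'.r 4 = a → a ≤ i →
      (ev (inp G sets) s' (.mul (.lt (.const 0) (.reg 4))
        (.eq (fd 5 (fd 0 (.sub (.reg 4) (.const 1)))) (.const 0))) = 0 ↔
        (a = 0 ∨ C.s (a - 1) ∈ X)) := by
    intro s' hs a ha hai
    have b1 := (hC.same hs (by decide) (by decide) (by decide)).sp (a - 1) (by omega)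
    have b2 := (hM.same hs (by decide) (by decide) (by decide) (by decide)).tok (C.s (a - 1))
    simp only [ev_mul, ev_sub, ev_eq, ev_lt, ev_const, ev_fd _ _ (show 5 < 16 by decide),
      ev_fd _ _ (show 0 < 16 by decide), ev_reg, ha, b1, b2]
    rcases Nat.eq_zero_or_pos a with h | h
    · simp [h]
    · by_cases h' : C.s (a - 1) ∈ X <;> simp [h, h', h.ne']
  have hframe : ∀ s', Same [4] [] (s.setr 4 (ev (inp G sets) s (.reg 3))) s' → Same [4] [] s s' :=
    fun s' h => (same_setr (by simp)).trans h
  refine wp_seq (wp_assign (wp_loop_frame [4] [] (fun a s' => s'.r 4 = a ∧ a ≤ i ∧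
    -- The run is shorter than `k`, so `k - (i - a)` drops strictly with every step to the left.
    (∀ j, a ≤ j → j < i → C.s j ∉ X)) (fun a => (k - (i - a)) * 60) (by simp) ?_ i ?_ ?_))
  · rintro a s1 a1 ⟨a2, a3, a4⟩ he
    have hs := hframe s1 a1
    have h' : ¬ (a = 0 ∨ C.s (a - 1) ∈ X) := fun h => he ((hev s1 hs a a2 a3).2 h)
    push Not at h'
    have hlen := C.run_length_lt hk hX hi (a := a - 1) (by omega) (fun j h4 h5 => by
      by_cases hj : a ≤ j
      · exact a4 j hj h5
      · rw [show j = a - 1 by omega]; exact h'.2)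
    refine wp_assign ⟨a - 1, ⟨by simp [a2], by omega, fun j h4 h5 => ?_⟩, ?_⟩
    · by_cases hj : a ≤ j
      · exact a4 j hj h5
      · rw [show j = a - 1 by omega]; exact h'.2
    · have h0 := h'.1
      simp only [AExp.cost, cost_fd]
      have : (k - (i - a)) * 60 = (k - (i - (a - 1))) * 60 + 60 := by
        rw [show k - (i - a) = k - (i - (a - 1)) + 1 by omega]; ring
      omega
  · exact ⟨by simp [h3], le_rfl, fun j h4 h5 => by omega⟩
  · rintro t s1 a a1 ⟨a2, a3, a4⟩ he ht
    have hs := hframe s1 a1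
    refine ⟨?_, hs, a, a2, a3, a4, (hev s1 hs a a2 a3).1 he⟩
    simp only [AExp.cost, cost_fd] at ht ⊢
    omega

/-- The condition for a slide. -/
def slideE (k : ℕ) : AExp :=
  .add (.eq (.reg 4) (.reg 3))
    (.lt (.add (.add (.add (.sub (.reg 3) (.reg 4)) (.const 1))
      (.lt (.const 0) (fd 7 (fd 0 (.reg 4))))) (.lt (.const 0) (fd 7 (.reg 5)))) (.const k))

def sweepStep (k : ℕ) : Cmd :=
  .assign 5 (fd 0 (.reg 3)) ;; .assign 6 (fd 0 (.add (.reg 3) (.const 1))) ;;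
  .cond (.mul (fd 5 (.reg 5)) (.eq (fd 5 (.reg 6)) (.const 0)))
    (runStart ;; .cond (slideE k) push (inc 3)) (inc 3)

/-- Move tokens to the right along the spine as long as possible. -/
def sweep (k : ℕ) : Cmd :=
  .assign 3 (.const 0) ;; .loop (.lt (.add (.reg 3) (.const 1)) (.reg 2)) (sweepStep k)

theorem mod_sweepStep {R F : List ℕ} (hR : [3, 4, 5, 6, 7, 8, 10] ⊆ R)
    (hF : [5, 6, 7, 8, 9] ⊆ F) : Mod R F (sweepStep k) :=
  Mod.mono (by simp [sweepStep, runStart, inc, mod_push]) hR hF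

/-- Amortised against `pot + (m - i)`: an advance lowers the second term by one, and a push lowers
the first by `2 * d` while it raises the second by at most one. -/
theorem wp_sweepStep (hk : 4 ≤ k) {C : Spine G} {X : Finset (Fin n)} {l : List (Fin n × Fin n)}
    {s : Rec} (hC : Stored C s) (hM : Mem X l s) (hT : Counts C X s) {i : ℕ} (hi : i + 1 < C.m)
    (h3 : s.r 3 = i) (hX : IsPVC G k X) (hN : C.Norm X) (hF : C.FixedBelow k X i) :
    Wp (inp G sets) (sweepStep k) (fun t s' => ∃ X' l' i', Mem X' (l ++ l') s' ∧
      Counts C X' s' ∧ s'.r 3 = i' ∧ i' < C.m ∧ Log G k X l' X' ∧ C.Norm X' ∧ C.Prog X X' ∧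
      C.FixedBelow k X' i' ∧ t + 10 + (k * 60 + 900) * (C.pot n X' + (C.m - i')) ≤
        (k * 60 + 900) * (C.pot n X + (C.m - i))) s := by
  -- Common end of the cases in which the index advances: there is no token to move, the target is
  -- occupied, or the slide is blocked.
  have hstay : ∀ s1, Same [4, 5, 6] [] s s1 → (C.s i ∈ X → C.s (i + 1) ∉ X →
      ¬ IsPVC G k (mv X (C.s i) (C.s (i + 1)))) → ∀ t, t + 10 ≤ k * 60 + 900 →
      ∃ X' l' i', Mem X' (l ++ l') (s1.setr 3 (ev (inp G sets) s1 (.add (.reg 3) (.const 1)))) ∧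
      Counts C X' (s1.setr 3 (ev (inp G sets) s1 (.add (.reg 3) (.const 1)))) ∧
      (s1.setr 3 (ev (inp G sets) s1 (.add (.reg 3) (.const 1)))).r 3 = i' ∧ i' < C.m ∧
      Log G k X l' X' ∧ C.Norm X' ∧ C.Prog X X' ∧
      C.FixedBelow k X' i' ∧ t + 10 + (k * 60 + 900) * (C.pot n X' + (C.m - i')) ≤
        (k * 60 + 900) * (C.pot n X + (C.m - i)) := by
    intro s1 hs hno t ht
    have hs' : Same [3, 4, 5, 6] [] s (s1.setr 3 (ev (inp G sets) s1 (.add (.reg 3) (.const 1)))) :=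
      (hs.mono (by simp) (by simp)).trans (same_setr (by simp))
    refine ⟨X, [], i + 1, ?_, ?_, ?_, hi, .nil hX, hN, .refl C X, ?_, ?_⟩
    · rw [List.append_nil]
      exact hM.same hs' (by decide) (by decide) (by decide) (by decide)
    · exact hT.same hs' (by decide) (by decide) (by decide)
    · simp [hs.reg 3 (by decide), h3]
    · intro j hj
      by_cases hji : j = i
      · subst hji; exact fun _ h1 h2 => hno h1 h2
      · exact hF j (by omega)
    · have : (k * 60 + 900) * (C.pot n X + (C.m - i)) =
          (k * 60 + 900) * (C.pot n X + (C.m - (i + 1))) + (k * 60 + 900) := by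
        rw [show C.m - i = C.m - (i + 1) + 1 by omega]; ring
      omega
  refine wp_seq (wp_assign (wp_seq (wp_assign ?_)))
  set s1 := (s.setr 5 (ev (inp G sets) s (fd 0 (.reg 3)))).setr 6 (ev (inp G sets)
    (s.setr 5 (ev (inp G sets) s (fd 0 (.reg 3)))) (fd 0 (.add (.reg 3) (.const 1)))) with hs1
  have hs : Same [5, 6] [] s s1 := (same_setr (by simp)).trans (same_setr (by simp))
  have a5 : s1.r 5 = C.s i := by
    simp [hs1, ev_fd _ _ (show 0 < 16 by decide), h3, hC.sp i (by omega)]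
  have a6 : s1.r 6 = C.s (i + 1) := by
    simp [hs1, ev_fd _ _ (show 0 < 16 by decide), h3, hC.sp (i + 1) hi]
  have a3 : s1.r 3 = i := by rw [hs.reg 3 (by decide)]; exact h3
  have hM1 := hM.same hs (by decide) (by decide) (by decide) (by decide)
  have hC1 := hC.same hs (by decide) (by decide) (by decide)
  have hT1 := hT.same hs (by decide) (by decide) (by decide)
  have he : (ev (inp G sets) s1 (.mul (fd 5 (.reg 5)) (.eq (fd 5 (.reg 6)) (.const 0))) = 0) ↔
      ¬ (C.s i ∈ X ∧ C.s (i + 1) ∉ X) := by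
    simp only [ev_mul, ev_eq, ev_const, ev_fd _ _ (show 5 < 16 by decide), ev_reg, a5, a6, hM1.tok]
    by_cases c1 : C.s i ∈ X <;> by_cases c2 : C.s (i + 1) ∈ X <;> simp [c1, c2]
  refine wp_cond (fun hc => ?_) (fun hc => wp_assign (hstay s1 (hs.mono (by simp) (by simp)) ?_ _ ?_))
  · obtain ⟨h1, h2⟩ := not_not.1 (fun h => hc (he.2 h))
    refine wp_seq ((wp_runStart hk hC1 hM1 (by omega) a3 hX).mono ?_)
    rintro t2 s2 ⟨b1, b2, a, b3, b4, b5, b6⟩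
    have hM2 := hM1.same b2 (by decide) (by decide) (by decide) (by decide)
    have hC2 := hC1.same b2 (by decide) (by decide) (by decide)
    have hT2 := hT1.same b2 (by decide) (by decide) (by decide)
    have c3 : s2.r 3 = i := by rw [b2.reg 3 (by decide)]; exact a3
    have c5 : s2.r 5 = C.s i := by rw [b2.reg 5 (by decide)]; exact a5
    have c6 : s2.r 6 = C.s (i + 1) := by rw [b2.reg 6 (by decide)]; exact a6
    have hiff := C.isPVC_slide_iff_run hk hX hi h1 h2 b4 b5 b6
    have he2 : ev (inp G sets) s2 (slideE k) ≠ 0 ↔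
        IsPVC G k (mv X (C.s i) (C.s (i + 1))) := by
      rw [hiff, C.vac_eq (by omega), C.vac_eq (by omega)]
      simp only [slideE, ev_add, ev_eq, ev_lt, ev_sub, ev_const, ev_fd _ _ (show 7 < 16 by decide),
        ev_fd _ _ (show 0 < 16 by decide), ev_reg, b3, c3, c5, hC2.sp a (by omega), hT2.free]
      by_cases d1 : a = i
      · simp [d1]
      · simp [d1]
    refine wp_cond (fun hc2 => ?_) (fun hc2 => wp_assign (hstay s2
      ((hs.mono (by simp) (by simp)).trans (b2.mono (by simp) (by simp))) ?_ _ ?_))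
    · have hX' := he2.1 hc2
      refine (wp_push hk hC2 hM2 hT2 hi c3 c5 c6 h1 h2 hX hX' hN).mono ?_
      rintro t3 s3 ⟨d3, X', l', d4, d5, d6, d7, d8, d9, d, d10, d11, d12⟩
      refine ⟨X', l', i - 1, d4, d5, d3, by omega, d6, d7, d8,
        hF.of_agree hk hX d6.isPVC_right d9, ?_⟩
      simp only [AExp.cost, cost_fd, slideE]
      -- Uses `d + 1 ≤ 2 * d`, where the 1 is for the step back.
      have e1 : C.pot n X' + (C.m - (i - 1)) + d ≤ C.pot n X + (C.m - i) := by omega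
      have e2 := Nat.mul_le_mul_left (k * 60 + 900) e1
      have e3 : (k * 60 + 300) * 1 ≤ (k * 60 + 300) * d := Nat.mul_le_mul_left _ d10
      have e4 : (k * 60 + 900) * (C.pot n X' + (C.m - (i - 1)) + d) =
        (k * 60 + 900) * (C.pot n X' + (C.m - (i - 1))) + (k * 60 + 300) * d + 600 * d := by ring
      omega
    · exact fun _ _ h => he2.2 h hc2
    · simp only [AExp.cost, cost_fd, slideE]; omega
  · exact fun h1 h2 => absurd ⟨h1, h2⟩ (he.1 hc)
  · simp only [AExp.cost, cost_fd]; omega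

theorem mod_sweep {R F : List ℕ} (hR : [3, 4, 5, 6, 7, 8, 10] ⊆ R)
    (hF : [5, 6, 7, 8, 9] ⊆ F) : Mod R F (sweep k) := by
  simp only [sweep, mod_seq, mod_assign, mod_loop]
  exact ⟨hR (by simp), mod_sweepStep hR hF⟩

theorem wp_sweep (hk : 4 ≤ k) {C : Spine G} {X : Finset (Fin n)} {l : List (Fin n × Fin n)}
    {s : Rec} (hC : Stored C s) (hM : Mem X l s) (hT : Counts C X s)
    (hX : IsPVC G k X) (hN : C.Norm X) (hm : 0 < C.m) :
    Wp (inp G sets) (sweep k) (fun t s' => t ≤ (k * 60 + 900) * (6 * (n * n)) ∧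
      Same [3, 4, 5, 6, 7, 8, 10] [5, 6, 7, 8, 9] s s' ∧ ∃ X' l', Mem X' (l ++ l') s' ∧
      Counts C X' s' ∧ Log G k X l' X' ∧ C.Norm X' ∧ C.RightFixed k X' ∧ C.Prog X X') s := by
  have hs0 : Same [3, 4, 5, 6, 7, 8, 10] [5, 6, 7, 8, 9] s
      (s.setr 3 (ev (inp G sets) s (.const 0))) := same_setr (by simp)
  refine wp_seq (wp_assign (wp_loop_frame [3, 4, 5, 6, 7, 8, 10] [5, 6, 7, 8, 9]
    (γ := Finset (Fin n) × List (Fin n × Fin n) × ℕ)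
    (fun g s' => Mem g.1 (l ++ g.2.1) s' ∧ Counts C g.1 s' ∧ s'.r 3 = g.2.2 ∧ g.2.2 < C.m ∧
      Log G k X g.2.1 g.1 ∧ C.Norm g.1 ∧ C.Prog X g.1 ∧ C.FixedBelow k g.1 g.2.2)
    (fun g => (k * 60 + 900) * (C.pot n g.1 + (C.m - g.2.2)))
    (mod_sweepStep (by simp) (by simp)) ?_ (X, [], 0) ?_ ?_))
  · rintro ⟨Y, l₁, i⟩ s1 a0 ⟨a1, a2, a3, a4, a5, a6, a7, a8⟩ he
    have hCs := hC.same (hs0.trans a0) (by decide) (by decide) (by decide)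
    simp only at a1 a2 a3 a4 a5 a6 a7 a8
    have hi : i + 1 < C.m := by
      by_contra h
      apply he
      simp only [ev_lt, ev_add, ev_reg, ev_const, a3, hCs.m]
      rw [if_neg h]
    refine (wp_sweepStep hk hCs a1 a2 hi a3 a5.isPVC_right a6 a8).mono ?_
    rintro t s2 ⟨Y', l₂, i', b1, b2, b3, b4, b5, b6, b7, b8, b9⟩
    refine ⟨(Y', l₁ ++ l₂, i'), ⟨by rw [← List.append_assoc]; exact b1, b2, b3, b4, a5.append b5,
      b6, a7.trans b7, b8⟩, ?_⟩
    simp only [AExp.cost]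
    omega
  · have hs1 : Same [3] [] s (s.setr 3 (ev (inp G sets) s (.const 0))) := same_setr (by simp)
    refine ⟨?_, hT.same hs1 (by decide) (by decide) (by decide), by simp, hm, .nil hX, hN,
      .refl C X, fun j hj => absurd hj (by simp)⟩
    simp only [List.append_nil]
    exact hM.same hs1 (by decide) (by decide) (by decide) (by decide)
  · rintro t s1 ⟨Y, l₁, i⟩ a0 ⟨a1, a2, a3, a4, a5, a6, a7, a8⟩ he ht
    have hCs := hC.same (hs0.trans a0) (by decide) (by decide) (by decide)
    simp only at a1 a2 a3 a4 a5 a6 a7 a8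
    have hi : ¬ i + 1 < C.m := by
      intro h
      simp only [ev_lt, ev_add, ev_reg, ev_const, a3, hCs.m] at he
      rw [if_pos h] at he
      exact absurd he (by decide)
    refine ⟨?_, hs0.trans a0, Y, l₁, a1, a2, a5, a6, fun j hj => a8 j (by omega) hj, a7⟩
    have hn : 1 ≤ n := Nat.one_le_of_lt (C.s 0).2
    have e1 := C.pot_le X
    have e2 := C.m_le
    have e3 : n ≤ n * n := Nat.le_mul_of_pos_left n hn
    -- The factor 6 collects `4 * (n * n)` for the potential, `n` for the length of the spine and 1
    -- for the last test of the loop.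
    have e4 := Nat.mul_le_mul_left (k * 60 + 900)
      (show C.pot n X + (C.m - 0) + 1 ≤ 6 * (n * n) by omega)
    simp only [AExp.cost] at ht ⊢
    rw [mul_add] at e4
    omega

end Sweep

/-! ### Computing a terminal position -/

section Terminal

variable {n : ℕ} {G : SimpleGraph (Fin n)} {sets : List (Finset (Fin n))} {k : ℕ}

def reverseSpine : Cmd :=
  forN 10 (.reg 2) (st 13 (.reg 10) (fd 0 (.sub (.sub (.reg 2) (.const 1)) (.reg 10)))) ;;
  forN 10 (.reg 2) (st 0 (.reg 10) (fd 13 (.reg 10)))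

theorem mod_reverseSpine {R F : List ℕ} (hR : 10 ∈ R) (h0 : 0 ∈ F) (h13 : 13 ∈ F) :
    Mod R F reverseSpine := by
  simp [reverseSpine, mod_st, *]

theorem wp_reverseSpine {s : Rec} {m : ℕ} (hm : s.r 2 = m) :
    Wp (inp G sets) reverseSpine (fun t s' => t ≤ m * 120 + 20 ∧ Same [10] [0, 13] s s' ∧
      ∀ i, i < m → s'.f 0 i = s.f 0 (m - 1 - i)) s := by
  refine wp_seq (wp_for_frame [10] [13] (fun i s' => ∀ j, j < i → s'.f 13 j = s.f 0 (m - 1 - j))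
    m 44 (by simp [mod_st]) (by simp)
    (fun s' hs => by rw [ev_reg, hs.reg 2 (by decide), hm]) ?_ (by simp) ?_)
  · intro i s1 hi a1 a2 a3
    refine wp_st (by decide) ⟨by simp [AExp.cost], by simpa using a3, fun j hj => ?_⟩
    simp only [Rec.setr_f, Rec.setf_f, ev_reg, a3, true_and, ev_fd _ _ (show 0 < 16 by decide),
      ev_sub, ev_const, a1.reg 2 (by decide), hm, a1.fld 0 (by decide) (by decide)]
    split_ifs with h
    · rw [h]
    · exact a2 j (by omega)
  intro t1 s1 a1 a2 a3 a4
  have hm1 : s1.r 2 = m := by rw [a3.reg 2 (by decide), hm]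
  refine wp_for_frame [10] [0] (fun i s' => ∀ j, j < i → s'.f 0 j = s1.f 13 j)
    m 40 (by simp [mod_st]) (by simp)
    (fun s' hs => by rw [ev_reg, hs.reg 2 (by decide), hm1]) ?_ (by simp) ?_
  · intro i s2 hi b1 b2 b3
    refine wp_st (by decide) ⟨by simp [AExp.cost], by simpa using b3, fun j hj => ?_⟩
    simp only [Rec.setr_f, Rec.setf_f, ev_reg, b3, true_and, ev_fd _ _ (show 13 < 16 by decide),
      b1.fld 13 (by decide) (by decide)]
    split_ifs with h
    · rw [h]
    · exact b2 j (by omega)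
  · intro t2 s2 b1 b2 b3 b4
    refine ⟨?_, (a3.mono (by simp) (by simp)).trans (b3.mono (by simp) (by simp)),
      fun i hi => by rw [b4 i hi, a4 i hi]⟩
    simp only [AExp.cost] at a1 b1
    omega

/-- Once the stored spine is reversed, the program for sweeps to the right performs a sweep to the
left. -/
theorem stored_mirror {C : Spine G} {s s' : Rec} (h : Stored C s)
    (hs : Same [10] [0, 13] s s') (hr : ∀ i, i < C.m → s'.f 0 i = s.f 0 (C.m - 1 - i)) :
    Stored C.mirror s' := by
  refine ⟨?_, fun i hi => ?_, fun v => ?_⟩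
  · rw [hs.reg 2 (by decide)]; exact h.m
  · rw [C.mirror_m] at hi
    rw [hr i hi, h.sp _ (by omega), C.mirror_s]
  · rw [hs.fld 1 (by decide) (by decide), C.mirror_ow]; exact h.own v

theorem stored_of_mirror {C : Spine G} {s s' : Rec} (h : Stored C.mirror s)
    (hs : Same [10] [0, 13] s s') (hr : ∀ i, i < C.m → s'.f 0 i = s.f 0 (C.m - 1 - i)) :
    Stored C s' := by
  refine ⟨?_, fun i hi => ?_, fun v => ?_⟩
  · rw [hs.reg 2 (by decide)]; exact h.m
  · rw [hr i hi, h.sp _ (by rw [C.mirror_m]; omega), C.mirror_s]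
    rw [show C.m - 1 - (C.m - 1 - i) = i by omega]
  · rw [hs.fld 1 (by decide) (by decide), ← C.mirror_ow]; exact h.own v

/-- Load the `t`-th vertex set of the input. -/
def loadSet (t : ℕ) : Cmd :=
  forN 10 nE (st 5 (.reg 10) (setE t (.reg 10)) ;; st 6 (.reg 10) (.const 0) ;;
    st 7 (.reg 10) (.const 0)) ;; .assign 7 (.const 0) ;; .assign 8 (.const 0)

theorem wp_loadSet {t : ℕ} (ht : t < sets.length) (ht' : t < 2) (s : Rec) :
    Wp (inp G sets) (loadSet t) (fun T s' => T ≤ n * 100 + 20 ∧ Mem sets[t] [] s' ∧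
      (∀ v : Fin n, s'.f 6 v = 0) ∧ (∀ v : Fin n, s'.f 7 v = 0) ∧ s'.r 8 = 0) s := by
  refine wp_seq (wp_for_frame [10] [5, 6, 7] (fun i s' => ∀ v : Fin n, v.val < i →
    s'.f 5 v = (if v ∈ sets[t] then 1 else 0) ∧ s'.f 6 v = 0 ∧ s'.f 7 v = 0)
    n 80 (by simp [mod_st]) (by simp) (fun s' _ => ev_nE_inp s') ?_ (by simp) ?_)
  · intro i s1 hi a1 a2 a3
    refine wp_seq (wp_st (by decide) (wp_seq (wp_st (by decide) (wp_st (by decide)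
      ⟨by simp [AExp.cost], by simpa using a3, fun v hv => ?_⟩))))
    have e := ev_setE_inp (G := G) (s := s1) ht ht' (a := .reg 10) (v := ⟨i, hi⟩) a3
    simp only [Rec.setr_f, Rec.setf_f, Rec.setf_r, ev_reg, a3, true_and, e, ev_const,
      show (5 : ℕ) ≠ 6 by decide, show (5 : ℕ) ≠ 7 by decide, show (6 : ℕ) ≠ 7 by decide,
      show (6 : ℕ) ≠ 5 by decide, show (7 : ℕ) ≠ 5 by decide, show (7 : ℕ) ≠ 6 by decide,
      false_and, if_false]
    by_cases h : v.val = i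
    · obtain rfl : v = ⟨i, hi⟩ := Fin.ext h
      by_cases hmem : (⟨i, hi⟩ : Fin n) ∈ sets[t] <;> simp [hmem]
    · simp only [h, if_false]
      exact a2 v (by omega)
  · intro t1 s1 a1 a2 a3 a4
    refine wp_seq (wp_assign (wp_assign ⟨?_, ⟨fun v => ?_, ?_, ?_, ?_⟩, fun v => ?_, fun v => ?_, ?_⟩))
    · simp only [AExp.cost, cost_nE] at a1 ⊢; omega
    · simpa using (a4 v v.2).1
    · simp
    · intro i hi; exact absurd hi (by simp)
    · intro i hi; exact absurd hi (by simp)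
    · simpa using (a4 v v.2).2.1
    · simpa using (a4 v v.2).2.2
    · simp

/-- Move tokens from leaves to vacant spine vertices. -/
def normalise : Cmd :=
  forN 10 nE (.assign 5 (.reg 10) ;; .assign 6 (fd 1 (.reg 10)) ;;
    .cond (.mul (.mul (fd 5 (.reg 5)) (.eq (fd 5 (.reg 6)) (.const 0)))
      (.sub (.const 1) (.eq (.reg 5) (.reg 6)))) (slide 5 6) .skip)

/-- One pass suffices: lifting a token vacates a leaf only, so the owners found occupied earlier
remain occupied. -/
theorem wp_normalise (hk : 4 ≤ k) {C : Spine G} {I : Finset (Fin n)} {s : Rec} (hC : Stored C s)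
    (hM : Mem I [] s) (hI : IsPVC G k I) :
    Wp (inp G sets) normalise (fun t s' => t ≤ n * 300 + 20 ∧ Same [5, 6, 7, 10] [5, 8, 9] s s' ∧
      ∃ X l, Mem X l s' ∧ Log G k I l X ∧ C.Norm X) s := by
  refine wp_for_frame [5, 6, 7, 10] [5, 8, 9] (fun i s' => ∃ X l, Mem X l s' ∧ Log G k I l X ∧
    ∀ v ∈ X, v.val < i → C.ow v ∈ X) n 250 (by simp [mod_slide]) (by simp)
    (fun s' _ => ev_nE_inp s') ?_
    ⟨I, [], hM.same (same_setr (R := [10]) (F := []) (by simp)) (by decide) (by decide)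
      (by decide) (by decide), .nil hI, by simp⟩ ?_
  · rintro i s1 hi a1 ⟨X, l, a2, a3, a4⟩ a5
    refine wp_seq (wp_assign (wp_seq (wp_assign ?_)))
    set s2 := (s1.setr 5 (ev (inp G sets) s1 (.reg 10))).setr 6 (ev (inp G sets)
      (s1.setr 5 (ev (inp G sets) s1 (.reg 10))) (fd 1 (.reg 10))) with hs2
    have hs : Same [5, 6] [] s1 s2 := (same_setr (by simp)).trans (same_setr (by simp))
    have hCs := (hC.same a1 (by decide) (by decide) (by decide)).same hs (by decide) (by decide)
      (by decide)
    have b5 : s2.r 5 = (⟨i, hi⟩ : Fin n) := by simp [hs2, a5]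
    have b6 : s2.r 6 = C.ow ⟨i, hi⟩ := by
      have := (hC.same a1 (by decide) (by decide) (by decide)).own ⟨i, hi⟩
      simp only at this
      simp [hs2, a5, ev_fd _ _ (show 1 < 16 by decide), this]
    have hM2 := a2.same hs (by decide) (by decide) (by decide) (by decide)
    have he : ev (inp G sets) s2 (.mul (.mul (fd 5 (.reg 5)) (.eq (fd 5 (.reg 6)) (.const 0)))
        (.sub (.const 1) (.eq (.reg 5) (.reg 6)))) ≠ 0 ↔
        (⟨i, hi⟩ : Fin n) ∈ X ∧ C.ow ⟨i, hi⟩ ∉ X ∧ C.ow ⟨i, hi⟩ ≠ ⟨i, hi⟩ := by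
      generalize (⟨i, hi⟩ : Fin n) = w at b5 b6 ⊢
      simp only [ev_mul, ev_eq, ev_sub, ev_const, ev_fd _ _ (show 5 < 16 by decide), ev_reg, b5, b6,
        hM2.tok, Fin.val_inj, eq_comm (a := w)]
      by_cases c1 : w ∈ X <;> by_cases c2 : C.ow w ∈ X <;>
        by_cases c3 : C.ow w = w <;> simp [c1, c2, c3]
    refine wp_cond (fun hc => ?_) (fun hc => wp_skip ?_)
    · obtain ⟨h1, h2, h3⟩ := he.1 hc
      refine (wp_slide hM2 b5 b6).mono ?_
      rintro t3 s3 ⟨c1, c2, c3⟩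
      refine ⟨?_, ?_, _, _, c3.same (same_setr (R := [10]) (F := []) (by simp)) (by decide) (by decide)
        (by decide) (by decide), a3.append (Log.single a3.isPVC_right (C.adj_ow h3) h1 h2 ?_), ?_⟩
      · simp only [AExp.cost, cost_fd]; omega
      · rw [c2.reg 10 (by decide), hs.reg 10 (by decide)]; exact a5
      · have := a3.isPVC_right
        rw [C.isPVC_iff_ok hk] at this ⊢
        exact C.ok_lift this h3
      · intro v hv hvi
        rw [mem_mv] at hv ⊢
        rcases hv with rfl | ⟨hv1, hv2⟩
        · exact Or.inl (C.ow_ow _)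
        · refine Or.inr ⟨?_, a4 v hv2 ?_⟩
          · intro h; rw [← h, C.ow_ow] at h3; exact h3 rfl
          · have : v.val ≠ i := fun h => hv1 (Fin.ext h)
            omega
    · refine ⟨?_, ?_, X, l, hM2.same (same_setr (R := [10]) (F := []) (by simp)) (by decide)
        (by decide) (by decide) (by decide), a3, fun v hv hvi => ?_⟩
      · simp only [AExp.cost, cost_fd]; omega
      · rw [hs.reg 10 (by decide)]; exact a5
      · by_cases h : v.val = i
        · obtain rfl : v = ⟨i, hi⟩ := Fin.ext h
          by_contra h'
          refine he.2 ⟨hv, h', fun h'' => h' ?_⟩ hc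
          rw [h'']; exact hv
        · exact a4 v hv (by omega)
  · rintro t s1 a1 a2 a3 ⟨X, l, a4, a5, a6⟩
    refine ⟨?_, a3, X, l, a4, a5, fun v hv => a6 v hv v.2⟩
    have e : n * (250 + nE.cost + 7) = n * 259 := rfl
    rw [e, cost_nE] at a1
    linarith

/-- Count the occupied and the vacant leaves. -/
def countLeaves : Cmd :=
  forN 10 nE (.cond (.eq (fd 1 (.reg 10)) (.reg 10)) .skip
    (.cond (fd 5 (.reg 10))
      (st 6 (fd 1 (.reg 10)) (.add (fd 6 (fd 1 (.reg 10))) (.const 1)) ;; inc 8)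
      (st 7 (fd 1 (.reg 10)) (.add (fd 7 (fd 1 (.reg 10))) (.const 1)))))

theorem wp_countLeaves {C : Spine G} {X : Finset (Fin n)} {l : List (Fin n × Fin n)}
    {s : Rec} (hC : Stored C s) (hM : Mem X l s) (h6 : ∀ v : Fin n, s.f 6 v = 0)
    (h7 : ∀ v : Fin n, s.f 7 v = 0) (h8 : s.r 8 = 0) :
    Wp (inp G sets) countLeaves (fun t s' => t ≤ n * 300 + 20 ∧ Same [8, 10] [6, 7] s s' ∧
      Counts C X s') s := by
  refine wp_for_frame [8, 10] [6, 7] (fun i s' =>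
    (∀ v : Fin n, s'.f 6 v = psum i fun z => if C.ow z = v ∧ z ≠ v ∧ z ∈ X then 1 else 0) ∧
    (∀ v : Fin n, s'.f 7 v = psum i fun z => if C.ow z = v ∧ z ≠ v ∧ z ∉ X then 1 else 0) ∧
    s'.r 8 = psum i fun z => if z ∈ X ∧ C.ow z ≠ z then 1 else 0) n 200 (by simp [mod_st, inc])
    (by simp) (fun s' _ => ev_nE_inp s') ?_
    ⟨fun v => by simp [psum_zero, h6], fun v => by simp [psum_zero, h7],
      by simp [psum_zero, h8]⟩ ?_
  · rintro i s1 hi a1 ⟨a2, a3, a4⟩ a5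
    have b1 := (hC.same a1 (by decide) (by decide) (by decide)).own ⟨i, hi⟩
    have b2 := (hM.same a1 (by decide) (by decide) (by decide) (by decide)).tok ⟨i, hi⟩
    simp only at b1 b2
    have hval : ∀ u : Fin n, (u.val = i) = (u = ⟨i, hi⟩) := fun u =>
      propext ⟨fun h => Fin.ext h, fun h => by rw [h]⟩
    refine wp_cond (fun hc => wp_skip ⟨by simp [AExp.cost], a5, ?_, ?_, ?_⟩) (fun hc => wp_cond
      (fun hc2 => wp_seq (wp_st (by decide) (wp_assign ⟨by simp [AExp.cost], by simpa using a5, ?_, ?_, ?_⟩)))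
      (fun hc2 => wp_st (by decide) ⟨by simp [AExp.cost], by simpa using a5, ?_, ?_, ?_⟩))
    all_goals
      simp only [ev_eq, ev_fd _ _ (show 1 < 16 by decide), ev_fd _ _ (show 5 < 16 by decide), ev_reg,
        a5, b1, b2, hval] at hc
      try simp only [ev_eq, ev_fd _ _ (show 1 < 16 by decide), ev_fd _ _ (show 5 < 16 by decide),
        ev_reg, a5, b1, b2, hval] at hc2
      simp only [psum_succ hi]
      simp only [Rec.setr_f, Rec.setf_f, Rec.setf_r, Rec.setr_r, ev_reg, a5, true_and, ev_const,
        ev_fd _ _ (show 1 < 16 by decide), ev_fd _ _ (show 6 < 16 by decide),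
        ev_fd _ _ (show 7 < 16 by decide), b1, ev_add, a2, a3, a4, Fin.val_inj,
        show (6 : ℕ) ≠ 7 by decide, show (7 : ℕ) ≠ 6 by decide, show (8 : ℕ) ≠ 10 by decide,
        false_and, if_false, if_true]
    · intro v
      have h : C.ow ⟨i, hi⟩ = ⟨i, hi⟩ := by by_contra h; simp [h] at hc
      rw [h, if_neg (fun h' => h'.2.1 h'.1), add_zero]
    · intro v
      have h : C.ow ⟨i, hi⟩ = ⟨i, hi⟩ := by by_contra h; simp [h] at hc
      rw [h, if_neg (fun h' => h'.2.1 h'.1), add_zero]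
    · have h : C.ow ⟨i, hi⟩ = ⟨i, hi⟩ := by by_contra h; simp [h] at hc
      simp [h]
    all_goals
      have h : C.ow ⟨i, hi⟩ ≠ ⟨i, hi⟩ := by intro h; simp [h] at hc
    · have h2 : (⟨i, hi⟩ : Fin n) ∈ X := by by_contra h; simp [h] at hc2
      intro v
      by_cases hv : v = C.ow ⟨i, hi⟩
      · simp [hv, h2, h.symm]
      · simp [hv, Ne.symm hv]
    · have h2 : (⟨i, hi⟩ : Fin n) ∈ X := by by_contra h; simp [h] at hc2
      intro v
      simp [h2]
    · have h2 : (⟨i, hi⟩ : Fin n) ∈ X := by by_contra h; simp [h] at hc2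
      simp [h, h2]
    · have h2 : (⟨i, hi⟩ : Fin n) ∉ X := by intro h; simp [h] at hc2
      intro v
      simp [h2]
    · have h2 : (⟨i, hi⟩ : Fin n) ∉ X := by intro h; simp [h] at hc2
      intro v
      by_cases hv : v = C.ow ⟨i, hi⟩
      · simp [hv, h2, h.symm]
      · simp [hv, Ne.symm hv]
    · have h2 : (⟨i, hi⟩ : Fin n) ∉ X := by intro h; simp [h] at hc2
      simp [h2]
  · rintro t s1 a1 a2 a3 ⟨a4, a5, a6⟩
    refine ⟨?_, a3, fun v => ?_, fun v => ?_, ?_⟩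
    · simp only [cost_nE] at a1; omega
    · rw [a4, psum_self]; rfl
    · rw [a5, psum_self]; rfl
    · rw [a6, psum_self, ← Finset.card_filter]
      congr 1
      ext z
      simp [C.mem_leafTok]

/-- Sweep to and fro as long as the number of occupied leaves decreases. -/
def sweeps (k : ℕ) : Cmd :=
  .assign 9 (.add (.reg 8) (.const 1)) ;;
  .loop (.lt (.reg 8) (.reg 9))
    (.assign 9 (.reg 8) ;; sweep k ;; reverseSpine ;; sweep k ;; reverseSpine)

theorem mod_sweeps {R F : List ℕ} (hR : [3, 4, 5, 6, 7, 8, 9, 10] ⊆ R)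
    (hF : [0, 5, 6, 7, 8, 9, 13] ⊆ F) : Mod R F (sweeps k) :=
  Mod.mono (by simp [sweeps, mod_sweep, mod_reverseSpine]) hR hF

/-- Register 9 holds the number of leaf tokens before the latest round, and one more than the
current number at the start, which forces a first round. A round either lowers the number or ends in
a terminal position, so there are linearly many rounds of quadratic cost. -/
theorem wp_sweeps (hk : 4 ≤ k) {C : Spine G} {I X : Finset (Fin n)} {l : List (Fin n × Fin n)}
    {s : Rec} (hC : Stored C s) (hM : Mem X l s) (hT : Counts C X s) (hl : Log G k I l X)
    (hN : C.Norm X) (hm : 0 < C.m) :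
    Wp (inp G sets) (sweeps k) (fun t s' => t ≤ (k * 60 + 900) * 30 * (n * n * n) ∧ Stored C s' ∧
      ∃ Z l', Mem Z l' s' ∧ Counts C Z s' ∧ C.Terminal k I l' Z) s := by
  have hn : 1 ≤ n := Nat.one_le_of_lt (C.s 0).2
  have hnn : n ≤ n * n := Nat.le_mul_of_pos_left n hn
  have hs0 : Same [9] [] s (s.setr 9 (ev (inp G sets) s (.add (.reg 8) (.const 1)))) :=
    same_setr (by simp)
  refine wp_seq (wp_assign (wp_loop
    (γ := Finset (Fin n) × List (Fin n × Fin n) × ℕ)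
    (fun g s' => Stored C s' ∧ Mem g.1 g.2.1 s' ∧ Counts C g.1 s' ∧ s'.r 9 = g.2.2 ∧
      Log G k I g.2.1 g.1 ∧ C.Norm g.1 ∧
      ((C.leafTok g.1).card < g.2.2 ∨ C.Terminal k I g.2.1 g.1))
    (fun g => g.2.2 * ((k * 60 + 900) * (13 * (n * n)))) ?_ (X, l, (C.leafTok X).card + 1) ?_ ?_))
  · rintro ⟨Y, l₀, p⟩ s1 ⟨a1, a2, a3, a4, a5, a6, a7⟩ he
    simp only at a2 a3 a4 a5 a6 a7
    have hlt : (C.leafTok Y).card < p := by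
      by_contra h
      apply he
      simp only [ev_lt, ev_reg, a3.num, a4]
      rw [if_neg h]
    have hs1 : Same [9] [] s1 (s1.setr 9 (ev (inp G sets) s1 (.reg 8))) := same_setr (by simp)
    refine wp_seq (wp_assign (wp_seq ((wp_sweep hk (a1.same hs1 (by decide) (by decide) (by decide))
      (a2.same hs1 (by decide) (by decide) (by decide) (by decide))
      (a3.same hs1 (by decide) (by decide) (by decide)) a5.isPVC_right a6 hm).mono ?_)))
    rintro t2 s2 ⟨b0, b1, X₁, l₁, b2, b3, b4, b5, b6, b7⟩
    have hC2 := (a1.same hs1 (by decide) (by decide) (by decide)).same b1 (by decide) (by decide)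
      (by decide)
    refine wp_seq ((wp_reverseSpine hC2.m).mono ?_)
    rintro t3 s3 ⟨c0, c1, c2⟩
    refine wp_seq ((wp_sweep hk (stored_mirror hC2 c1 c2) (b2.same c1 (by decide) (by decide)
      (by decide) (by decide)) (b3.same c1 (by decide) (by decide) (by decide)).mirror
      b4.isPVC_right (C.norm_mirror.2 b5) hm).mono ?_)
    rintro t4 s4 ⟨d0, d1, X₂, l₂, d2, d3, d4, d5, d6, d7⟩
    have hC4 := (stored_mirror hC2 c1 c2).same d1 (by decide) (by decide) (by decide)
    refine (wp_reverseSpine (m := C.m) hC4.m).mono ?_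
    rintro t5 s5 ⟨e0, e1, e2⟩
    refine ⟨(X₂, l₀ ++ l₁ ++ l₂, (C.leafTok Y).card), ⟨stored_of_mirror hC4 e1 e2,
      d2.same e1 (by decide) (by decide) (by decide) (by decide), ?_, ?_,
      (a5.append b4).append d4, C.norm_mirror.1 d5, ?_⟩, ?_⟩
    · have h := d3.same e1 (by decide) (by decide) (by decide)
      exact ⟨fun v => by rw [h.occ, C.occ_mirror], fun v => by rw [h.free, C.free_mirror],
        by rw [h.num, C.leafTok_mirror]⟩
    · rw [e1.reg 9 (by decide), d1.reg 9 (by decide), c1.reg 9 (by decide), b1.reg 9 (by decide)]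
      simp [a3.num]
    · by_cases hlt2 : (C.leafTok X₂).card < (C.leafTok Y).card
      · exact Or.inl hlt2
      · have := b7.card_le
        have hle : (C.leafTok X₁).card ≤ (C.leafTok X₂).card := by omega
        exact Or.inr (C.terminal_of_phases (a5.append b4) d4 b5 (C.norm_mirror.1 d5) b6 d6 d7 hle)
    · have h1 : (C.leafTok Y).card + 1 ≤ p := hlt
      have h2 := Nat.mul_le_mul_right ((k * 60 + 900) * (13 * (n * n))) h1
      -- Of the 13 units two sweeps take 6 each, and the last one pays for the two reversals and the
      -- bookkeeping.
      have h3 : (k * 60 + 900) * (13 * (n * n)) = (k * 60 + 900) * (6 * (n * n)) +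
        (k * 60 + 900) * (6 * (n * n)) + (k * 60) * (n * n) + 900 * (n * n) := by ring
      have h4 := C.m_le
      simp only [AExp.cost] at *
      rw [add_mul, one_mul] at h2
      omega
  · refine ⟨hC.same hs0 (by decide) (by decide) (by decide),
      hM.same hs0 (by decide) (by decide) (by decide) (by decide),
      hT.same hs0 (by decide) (by decide) (by decide), by simp [hT.num], hl, hN, Or.inl ?_⟩
    simp
  · rintro t s1 ⟨Z, l', p⟩ ⟨a1, a2, a3, a4, a5, a6, a7⟩ he ht
    simp only at a2 a3 a4 a5 a6 a7
    refine ⟨?_, a1, Z, l', a2, a3, a7.resolve_left fun h => ?_⟩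
    · have h1 : (C.leafTok X).card + 1 ≤ 2 * n := by
        have := Finset.card_le_univ (C.leafTok X)
        simp only [Fintype.card_fin] at this
        omega
      have h2 := Nat.mul_le_mul_right ((k * 60 + 900) * (13 * (n * n))) h1
      have h3 : (k * 60 + 900) * 30 * (n * n * n) =
        2 * n * ((k * 60 + 900) * (13 * (n * n))) + (k * 60 * 4) * (n * n * n) +
          3600 * (n * n * n) := by ring
      have h4 : 1 ≤ n * n * n := Nat.mul_pos (Nat.mul_pos hn hn) hn
      simp only [AExp.cost] at ht ⊢
      omega
    · simp only [ev_lt, ev_reg, a3.num, a4] at he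
      rw [if_pos h] at he
      exact absurd he (by decide)

/-- Compute a terminal position that is reachable from the `t`-th vertex set of the input. -/
def toTerminal (k t : ℕ) : Cmd :=
  loadSet t ;; normalise ;; countLeaves ;; sweeps k

theorem mod_toTerminal {t : ℕ} {R F : List ℕ} (hR : [3, 4, 5, 6, 7, 8, 9, 10] ⊆ R)
    (hF : [0, 5, 6, 7, 8, 9, 13] ⊆ F) : Mod R F (toTerminal k t) :=
  Mod.mono (by simp [toTerminal, loadSet, normalise, countLeaves, mod_slide, mod_sweeps, mod_st, inc])
    hR hF

theorem wp_toTerminal (hk : 4 ≤ k) {C : Spine G} {t : ℕ} (ht : t < sets.length) (ht' : t < 2)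
    (hI : IsPVC G k sets[t]) (hm : 0 < C.m) {s : Rec} (hC : Stored C s) :
    Wp (inp G sets) (toTerminal k t) (fun T s' => T ≤ (k * 60 + 1000) * 30 * (n * n * n) ∧
      Same [3, 4, 5, 6, 7, 8, 9, 10] [0, 5, 6, 7, 8, 9, 13] s s' ∧ Stored C s' ∧
      ∃ Z l, Mem Z l s' ∧ Counts C Z s' ∧ C.Terminal k sets[t] l Z) s := by
  have hn : 1 ≤ n := Nat.one_le_of_lt (C.s 0).2
  refine (Wp.frame (mod_toTerminal (List.Subset.refl _) (List.Subset.refl _))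
    (Q := fun T s' => T ≤ (k * 60 + 1000) * 30 * (n * n * n) ∧ Stored C s' ∧
      ∃ Z l, Mem Z l s' ∧ Counts C Z s' ∧ C.Terminal k sets[t] l Z) ?_).mono
    (fun T s' h => ⟨h.1.1, h.2, h.1.2⟩)
  refine wp_seq ((Wp.frame (R := [7, 8, 10]) (F := [5, 6, 7]) (by simp [loadSet, mod_st])
    (wp_loadSet ht ht' s)).mono ?_)
  rintro t1 s1 ⟨⟨a1, a2, a3, a4, a5⟩, a6⟩
  have hC1 := hC.same a6 (by decide) (by decide) (by decide)
  refine wp_seq ((wp_normalise hk hC1 a2 hI).mono ?_)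
  rintro t2 s2 ⟨b1, b2, X, l, b3, b4, b5⟩
  have hC2 := hC1.same b2 (by decide) (by decide) (by decide)
  refine wp_seq ((wp_countLeaves hC2 b3 (by rw [b2.fld 6 (by decide) (by decide)]; exact a3)
    (by rw [b2.fld 7 (by decide) (by decide)]; exact a4)
    (by rw [b2.reg 8 (by decide)]; exact a5)).mono ?_)
  rintro t3 s3 ⟨c1, c2, c3⟩
  refine (wp_sweeps hk (hC2.same c2 (by decide) (by decide) (by decide))
    (b3.same c2 (by decide) (by decide) (by decide) (by decide)) c3 b4 b5 hm).mono ?_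
  rintro t4 s4 ⟨d1, d2⟩
  refine ⟨?_, d2⟩
  have h1 : n ≤ n * n * n := Nat.le_mul_of_pos_left n (Nat.mul_pos hn hn)
  have h2 : (k * 60 + 1000) * 30 * (n * n * n) =
    (k * 60 + 900) * 30 * (n * n * n) + 3000 * (n * n * n) := by ring
  omega

end Terminal

/-! ### Output -/

section Output

theorem conc_mem_fld (I : ℕ → ℕ) (s : Rec) {j : ℕ} (hj : j < 16) (i : ℕ) :
    (conc I s).mem (baseAddr I + j + 16 * i) = s.f j i := by
  simp only [conc]
  rw [if_neg (by omega)]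
  congr 1 <;> omega

/-- Stores at arbitrary addresses behind the input; the output is contiguous and cuts across the
fields of the records. -/
theorem wp_store {I : ℕ → ℕ} {s : Rec} {Q : ℕ → Rec → Prop} {a e : AExp}
    (ha : baseAddr I ≤ ev I s a)
    (h : ∀ s', s'.r = s.r →
      (∀ b, (conc I s').mem b = if b = ev I s a then ev I s e else (conc I s).mem b) →
      Q (a.cost + e.cost + 1) s') : Wp I (.store a e) Q s := by
  obtain ⟨A, hA⟩ : ∃ A, A = ev I s a := ⟨_, rfl⟩
  rw [← hA] at ha h
  have key : (⟨(conc I s).regs, Function.update (conc I s).mem (a.eval (conc I s)) (ev I s e)⟩ :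
      State) = conc I (s.setf ((A - baseAddr I) % 16) ((A - baseAddr I) / 16) (ev I s e)) := by
    unfold conc Rec.setf
    congr 1
    funext b
    rw [Function.update_apply]
    change (if b = ev I s a then ev I s e else _) = _
    rw [← hA]
    by_cases hb : b < baseAddr I
    · rw [if_neg (by omega)]
      simp [hb]
    · simp only [if_neg hb]
      by_cases hb2 : b = A
      · subst hb2; simp
      · rw [if_neg hb2, if_neg (by omega)]
  refine ⟨_, _, ?_, h (s.setf ((A - baseAddr I) % 16) ((A - baseAddr I) / 16) (ev I s e)) rfl ?_⟩
  · rw [← key]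
    exact Run.store _ _ _
  · intro b
    rw [← key]
    simp only [Function.update_apply]
    rw [hA]
    rfl

/-- Copy the first entries of field 13, as many as register 11 says, to the cells from the address
in register 1 on. -/
def emit : Cmd :=
  .assign 1 (.const 0) ;;
  -- The address is counted up in unit steps, because assigning the product directly would not be
  -- `tame`. The output starts behind record `N`, so the entries of field 13 still to be copied are
  -- not overwritten.
  .loop (.lt (.reg 1) (.add baseE (.mul (.const 16) (.add (.reg 11) (.const 1))))) (inc 1) ;;
  forN 10 (.reg 11) (.store (.add (.reg 1) (.reg 10)) (fd 13 (.reg 10)))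

theorem wp_emit {I : ℕ → ℕ} {s : Rec} {N : ℕ} (hN : s.r 11 = N) :
    Wp I emit (fun t s' => t ≤ 40 * (baseAddr I + 16 * (N + 1)) + 40 * N + 40 ∧
      (∀ b, b ≠ 1 → b ≠ 10 → s'.r b = s.r b) ∧
      ∀ i, i < N → (conc I s').mem (s'.r 1 + i) = s.f 13 i) s := by
  refine wp_seq (wp_assign (wp_seq (wp_loop (γ := ℕ) (fun a s' => s'.f = s.f ∧ s'.r 1 = a ∧
    a ≤ baseAddr I + 16 * (N + 1) ∧ ∀ b, b ≠ 1 → s'.r b = s.r b)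
    (fun a => (baseAddr I + 16 * (N + 1) - a) * 40) ?_ 0 ?_ ?_)))
  · rintro a s1 ⟨a1, a2, a3, a4⟩ he
    have hlt : a < baseAddr I + 16 * (N + 1) := by
      by_contra h
      apply he
      simp only [ev_lt, ev_reg, ev_add, ev_baseE, ev_mul, ev_const, a2, a4 11 (by decide), hN]
      rw [if_neg h]
    refine wp_assign ⟨a + 1, ⟨a1, by simp [a2], hlt, fun b hb => ?_⟩, ?_⟩
    · rw [Rec.setr_r, if_neg hb, a4 b hb]
    · simp only [AExp.cost, baseE, cost_nE]; omega
  · exact ⟨rfl, by simp, by simp, fun b hb => by rw [Rec.setr_r, if_neg hb]⟩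
  rintro t1 s1 a ⟨a1, a2, a3, a4⟩ he ht
  have ha : a = baseAddr I + 16 * (N + 1) := by
    by_contra h
    simp only [ev_lt, ev_reg, ev_add, ev_baseE, ev_mul, ev_const, a2, a4 11 (by decide), hN] at he
    rw [if_pos (by omega)] at he
    exact absurd he (by decide)
  refine wp_for (fun i s' => s'.r 1 = a ∧ (∀ b, b ≠ 1 → b ≠ 10 → s'.r b = s.r b) ∧
    (∀ j, j < i → (conc I s').mem (a + j) = s.f 13 j) ∧ ∀ j, j < N → s'.f 13 j = s.f 13 j)
    N 32 (fun i s' _ h _ => by rw [ev_reg, h.2.1 11 (by decide) (by decide), hN]) ?_ ?_ ?_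
  · rintro i s2 hi ⟨b1, b2, b3, b4⟩ b5
    refine wp_store ?_ ?_
    · simp only [ev_add, ev_reg, b1]; omega
    intro s3 c1 c2
    simp only [ev_add, ev_reg, b1, b5, ev_fd _ _ (show 13 < 16 by decide), b4 i hi] at c2
    refine ⟨by simp [AExp.cost], by rw [c1]; exact b5, by simp [c1, b1], fun b hb hb' => ?_, ?_, ?_⟩
    · rw [Rec.setr_r, if_neg hb', c1]; exact b2 b hb hb'
    · intro j hj
      change (conc I s3).mem (a + j) = _
      rw [c2]
      by_cases hji : j = i
      · rw [if_pos (by omega), hji]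
      · rw [if_neg (by omega)]; exact b3 j (by omega)
    · intro j hj
      rw [Rec.setr_f, ← conc_mem_fld I s3 (show 13 < 16 by decide), c2, if_neg (by omega),
        conc_mem_fld I s2 (show 13 < 16 by decide), b4 j hj]
  · refine ⟨by simp [a2], fun b hb hb' => ?_, by simp, fun j _ => by rw [Rec.setr_f, a1]⟩
    rw [Rec.setr_r, if_neg hb']; exact a4 b hb
  · rintro t2 s2 b0 b1 ⟨b2, b3, b4, b5⟩
    refine ⟨?_, b3, fun i hi => by rw [b2]; exact b4 i hi⟩
    simp only [AExp.cost, baseE, cost_nE] at ht b0 ⊢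
    omega

/-- Bounds register contents by the running time. It serves to bound the number of recorded slides,
which is kept in register 7. -/
theorem Wp.le {I : ℕ → ℕ} {c : Cmd} {Q : ℕ → Rec → Prop} {s : Rec} (hc : c.tame = true) {M : ℕ}
    (hs : (conc I s).Le M) (h : Wp I c Q s) :
    Wp I c (fun t s' => Q t s' ∧ (conc I s').Le (M + 2 * t)) s := by
  obtain ⟨t, s', h1, h2⟩ := h
  exact ⟨t, s', h1, h2, (h1.exec hc hs le_rfl).2⟩

end Output

/-! ### Computing the rigid tokens -/

section Answers

variable {n : ℕ} {G : SimpleGraph (Fin n)} {sets : List (Finset (Fin n))} {k : ℕ}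

/-- Count the tokens. -/
def countTokens : Cmd :=
  .assign 12 (.const 0) ;; forN 10 nE (.cond (fd 5 (.reg 10)) (inc 12) .skip)

theorem wp_countTokens {X : Finset (Fin n)} {l : List (Fin n × Fin n)} {s : Rec} (hM : Mem X l s) :
    Wp (inp G sets) countTokens (fun t s' => t ≤ n * 60 + 20 ∧ Same [10, 12] [] s s' ∧
      s'.r 12 = X.card) s := by
  have hs : Same [10, 12] [] s (s.setr 12 (ev (inp G sets) s (.const 0))) := same_setr (by simp)
  refine wp_seq (wp_assign (wp_for_frame [10, 12] [] (fun i s' => s'.r 12 = psum i fun v =>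
    if v ∈ X then 1 else 0) n 40 (by simp [inc]) (by simp) (fun s' _ => ev_nE_inp s') ?_
    (by simp [psum_zero]) ?_))
  · intro i s1 hi a1 a2 a3
    have b2 := (hM.same (hs.trans a1) (by decide) (by decide) (by decide) (by decide)).tok ⟨i, hi⟩
    simp only at b2
    refine wp_cond (fun hc => wp_assign ⟨by simp [AExp.cost], by simpa using a3, ?_⟩)
      (fun hc => wp_skip ⟨by simp [AExp.cost], a3, ?_⟩)
    all_goals
      rw [ev_fd _ _ (by decide), ev_reg, a3, b2] at hc
      rw [psum_succ hi]
    · have h : (⟨i, hi⟩ : Fin n) ∈ X := by by_contra h; simp [h] at hc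
      simp [h, a2]
    · have h : (⟨i, hi⟩ : Fin n) ∉ X := by intro h; simp [h] at hc
      simp [h, a2]
  · intro t s1 a1 a2 a3 a4
    refine ⟨?_, hs.trans a3, ?_⟩
    · simp only [AExp.cost, cost_nE] at a1 ⊢; omega
    · rw [a4, psum_self]; simp

/-- Makes fullness a comparison of three registers: number of tokens, length of the spine, number of
leaf tokens. -/
theorem Spine.full_iff_card (C : Spine G) {X : Finset (Fin n)} :
    C.Full X ↔ X.card = C.m + (C.leafTok X).card := by
  rw [C.full_iff_cnt, C.card_eq]; omega

theorem Log.eq_nil_of_univ {I X : Finset (Fin n)} {l : List (Fin n × Fin n)} (h : Log G k I l X)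
    (hX : X.card = n) : l = [] ∧ I = X := by
  cases h with
  | nil => exact ⟨rfl, rfl⟩
  | @snoc l Y x y h hadj hx hy _ =>
    rw [card_mv hx hy] at hX
    have hY : Y = Finset.univ := (Finset.card_eq_iff_eq_univ _).1 (by simpa using hX)
    exact absurd (hY ▸ Finset.mem_univ _) hy

/-- The set of rigid tokens, read off from a terminal position. -/
theorem Spine.Terminal.mem_rigidSet_iff {C : Spine G} (hk : 4 ≤ k) {I Z : Finset (Fin n)}
    {l : List (Fin n × Fin n)} (h : C.Terminal k I l Z) (u : Fin n) :
    u ∈ rigidSet G k I ↔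
      ¬ (C.Full Z ∧ Z.card < n) ∧ u ∈ Z ∧ ∀ p ∈ l, p.1 ≠ u ∧ p.2 ≠ u := by
  have hlog := h.log
  have hle : Z.card ≤ n := by simpa using Finset.card_le_univ Z
  by_cases hF : C.Full Z
  · by_cases hlt : Z.card < n
    · obtain ⟨y, hy⟩ : ∃ y, y ∉ Z := by
        by_contra! hno
        rw [(Finset.eq_univ_iff_forall).2 hno] at hlt
        simp at hlt
      rw [hlog.reachable.rigidSet_eq, hF.rigidSet_eq_empty hk hy]
      simp [hF, hlt]
    -- Every vertex is occupied: no slide is possible and every token is rigid.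
    · obtain ⟨rfl, rfl⟩ := hlog.eq_nil_of_univ (by omega)
      refine ⟨fun hu => ⟨fun h' => hlt h'.2, hu.1, by simp⟩, fun hu => ⟨hu.2.1, fun J hJ => ?_⟩⟩
      have := hJ.card_eq
      have hJ' : J = Finset.univ := (Finset.card_eq_iff_eq_univ _).1 (by simp; omega)
      rw [hJ']; exact Finset.mem_univ _
  · rw [h.rigidSet_eq hk hF]
    simp [hF]

/-- Field 13 receives the characteristic vector of the set of rigid tokens. -/
def markRigid : Cmd :=
  countTokens ;; forN 10 nE (st 13 (.reg 10) (fd 5 (.reg 10))) ;;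
  forN 10 (.reg 7) (st 13 (fd 8 (.reg 10)) (.const 0) ;; st 13 (fd 9 (.reg 10)) (.const 0)) ;;
  .cond (.mul (.eq (.reg 12) (.add (.reg 2) (.reg 8))) (.lt (.reg 12) nE))
    (forN 10 nE (st 13 (.reg 10) (.const 0))) .skip

open Classical in
theorem wp_markRigid (hk : 4 ≤ k) {C : Spine G} {I Z : Finset (Fin n)}
    {l : List (Fin n × Fin n)} {s : Rec} (hC : Stored C s) (hM : Mem Z l s) (hT : Counts C Z s)
    (hZ : C.Terminal k I l Z) :
    Wp (inp G sets) markRigid (fun t s' => t ≤ n * 300 + l.length * 200 + 200 ∧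
      ∀ v : Fin n, s'.f 13 v = if v ∈ rigidSet G k I then 1 else 0) s := by
  refine wp_seq ((wp_countTokens hM).mono ?_)
  rintro t1 s1 ⟨a0, a1, a2⟩
  have hM1 := hM.same a1 (by decide) (by decide) (by decide) (by decide)
  refine wp_seq (wp_for_frame [10] [13] (fun i s' => ∀ v : Fin n, v.val < i →
    s'.f 13 v = if v ∈ Z then 1 else 0) n 45 (by simp [mod_st]) (by simp)
    (fun s' _ => ev_nE_inp s') ?_ (by simp) ?_)
  · intro i s2 hi b1 b2 b3
    refine wp_st (by decide) ⟨by simp [AExp.cost], by simpa using b3, fun v hv => ?_⟩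
    have b4 := (hM1.same b1 (by decide) (by decide) (by decide) (by decide)).tok ⟨i, hi⟩
    simp only at b4
    simp only [Rec.setr_f, Rec.setf_f, ev_reg, b3, true_and, ev_fd _ _ (show 5 < 16 by decide), b4]
    by_cases h : v.val = i
    · rw [if_pos h, show v = ⟨i, hi⟩ from Fin.ext h]
    · rw [if_neg h]; exact b2 v (by omega)
  intro t2 s2 b0 b1 b2 b3
  have hM2 := hM1.same b2 (by decide) (by decide) (by decide) (by decide)
  refine wp_seq (wp_for_frame [10] [13] (fun i s' => ∀ v : Fin n,
    s'.f 13 v = if v ∈ Z ∧ ∀ j (h : j < l.length), j < i → l[j].1 ≠ v ∧ l[j].2 ≠ v then 1 else 0)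
    l.length 80 (by simp [mod_st]) (by simp)
    (fun s' hs => by rw [ev_reg, hs.reg 7 (by decide), hM2.len]) ?_ ?_ ?_)
  · intro i s3 hi c1 c2 c3
    have hM3 := hM2.same c1 (by decide) (by decide) (by decide) (by decide)
    refine wp_seq (wp_st (by decide) (wp_st (by decide) ⟨by simp [AExp.cost], by simpa using c3,
      fun v => ?_⟩))
    simp only [Rec.setr_f, Rec.setf_f, Rec.setf_r, ev_reg, c3, true_and,
      ev_fd _ _ (show 8 < 16 by decide), ev_fd _ _ (show 9 < 16 by decide), hM3.fst i hi,
      hM3.snd i hi, ev_const, Fin.val_inj, show (9 : ℕ) ≠ 13 by decide, false_and, if_false]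
    by_cases d1 : v = l[i].1
    · have : ¬ (v ∈ Z ∧ ∀ j (h : j < l.length), j < i + 1 → l[j].1 ≠ v ∧ l[j].2 ≠ v) :=
        fun h => (h.2 i hi (by omega)).1 d1.symm
      simp only [d1, if_true, ite_self]
      rw [if_neg (by rw [← d1]; exact this)]
    · by_cases d2 : v = l[i].2
      · have : ¬ (v ∈ Z ∧ ∀ j (h : j < l.length), j < i + 1 → l[j].1 ≠ v ∧ l[j].2 ≠ v) :=
          fun h => (h.2 i hi (by omega)).2 d2.symm
        rw [if_pos d2, if_neg this]
      · rw [if_neg d2, if_neg d1, c2 v]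
        congr 1
        refine propext (and_congr_right fun _ => ⟨fun h j hj hji => ?_, fun h j hj hji =>
          h j hj (by omega)⟩)
        by_cases hj' : j = i
        · subst hj'; exact ⟨Ne.symm d1, Ne.symm d2⟩
        · exact h j hj (by omega)
  · intro v
    rw [Rec.setr_f, b3 v v.2]
    simp
  intro t3 s3 c0 c1 c2 c3
  have hsame : Same [10, 12] [13] s s3 := ((a1.mono (by simp) (by simp)).trans
    (b2.mono (by simp) (by simp))).trans (c2.mono (by simp) (by simp))
  have hval : ∀ v : Fin n, s3.f 13 v = if v ∈ Z ∧ ∀ p ∈ l, p.1 ≠ v ∧ p.2 ≠ v then 1 else 0 := by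
    intro v
    rw [c3 v]
    congr 1
    refine propext (and_congr_right fun _ => ⟨fun h p hp => ?_, fun h j hj _ =>
      h _ (List.getElem_mem hj)⟩)
    obtain ⟨j, hj, rfl⟩ := List.mem_iff_getElem.1 hp
    exact h j hj hj
  have hr12 : s3.r 12 = Z.card := by rw [c2.reg 12 (by decide), b2.reg 12 (by decide), a2]
  have he : ev (inp G sets) s3 (.mul (.eq (.reg 12) (.add (.reg 2) (.reg 8)))
      (.lt (.reg 12) nE)) ≠ 0 ↔ C.Full Z ∧ Z.card < n := by
    rw [C.full_iff_card]
    simp only [ev_mul, ev_eq, ev_lt, ev_add, ev_reg, ev_nE_inp, hr12, hsame.reg 2 (by decide), hC.m,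
      hsame.reg 8 (by decide), hT.num]
    by_cases d1 : Z.card = C.m + (C.leafTok Z).card <;> by_cases d2 : Z.card < n <;>
      simp [d1, d2]
  refine wp_cond (fun hc => wp_for_frame [10] [13] (fun i s' => ∀ v : Fin n, v.val < i →
    s'.f 13 v = 0) n 30 (by simp [mod_st]) (by simp) (fun s' _ => ev_nE_inp s') ?_ (by simp) ?_)
    (fun hc => wp_skip ⟨?_, fun v => ?_⟩)
  · intro i s4 hi d1 d2 d3
    refine wp_st (by decide) ⟨by simp [AExp.cost], by simpa using d3, fun v hv => ?_⟩
    simp only [Rec.setr_f, Rec.setf_f, ev_reg, d3, true_and, ev_const]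
    split_ifs with h
    · rfl
    · exact d2 v (by omega)
  · intro t4 s4 d0 d1 d2 d3
    refine ⟨?_, fun v => ?_⟩
    · simp only [AExp.cost, cost_nE] at *; omega
    · rw [d3 v v.2, if_neg]
      rw [hZ.mem_rigidSet_iff hk]
      exact fun h => h.1 (he.1 hc)
  · simp only [AExp.cost, cost_nE] at *; omega
  · rw [hval v]
    congr 1
    rw [hZ.mem_rigidSet_iff hk, eq_iff_iff]
    exact ⟨fun h => ⟨fun h' => he.2 h' hc, h⟩, fun h => h.2⟩

/-- The program that computes the set of rigid tokens. -/
def rigidProgram (k : ℕ) : Cmd :=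
  (setup ;; toTerminal k 0) ;; markRigid ;; .assign 11 nE ;; emit ;; .assign 0 (.reg 1)

theorem baseAddr_inp_le (hn : 1 ≤ n) : baseAddr (inp G sets) ≤ 4 * (n * n) := by
  unfold baseAddr
  rw [inp_zero]
  nlinarith

/-- The bound on the number of slides comes from tameness: it is the content of register 7, hence at
most `n` plus twice the running time. It keeps later passes over the list within cubic time. -/
theorem wp_start (hk : 4 ≤ k) (hG : IsCaterpillar G) (hn : 1 ≤ n) {t : ℕ} (ht : t < sets.length)
    (ht' : t < 2) (hI : IsPVC G k sets[t]) :
    Wp (inp G sets) (setup ;; toTerminal k t) (fun T s' => T ≤ (k * 1800 + 32000) * (n * n * n) ∧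
      ∃ C : Spine G, Stored C s' ∧ ∃ Z l, Mem Z l s' ∧ Counts C Z s' ∧ C.Terminal k sets[t] l Z ∧
        l.length ≤ (k * 3600 + 65000) * (n * n * n)) (rec0 G sets) := by
  have hle : (conc (inp G sets) (rec0 G sets)).Le n := by
    rw [← inputState_eq]; exact inputState_le G sets hn
  have h1 : n ≤ n * n * n := Nat.le_mul_of_pos_left n (Nat.mul_pos hn hn)
  have h2 : n * n ≤ n * n * n := Nat.le_mul_of_pos_right _ hn
  refine (Wp.le (M := n) rfl hle (Q := fun T s' => T ≤ (k * 1800 + 32000) * (n * n * n) ∧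
      ∃ C : Spine G, Stored C s' ∧ ∃ Z l, Mem Z l s' ∧ Counts C Z s' ∧ C.Terminal k sets[t] l Z)
      ?_).mono ?_
  · refine wp_seq ((wp_setup hn hG _).mono ?_)
    rintro t1 s1 ⟨a1, C, a2⟩
    refine (wp_toTerminal hk ht ht' hI (C.m_pos ⟨0, hn⟩) a2).mono ?_
    rintro t2 s2 ⟨b1, b2, b3, b4⟩
    refine ⟨?_, C, b3, b4⟩
    have h3 : (k * 1800 + 32000) * (n * n * n) = (k * 60 + 1000) * 30 * (n * n * n) +
      2000 * (n * n * n) := by ring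
    omega
  · rintro T s' ⟨⟨a1, C, a2, Z, l, a3, a4, a5⟩, a6⟩
    refine ⟨a1, C, a2, Z, l, a3, a4, a5, ?_⟩
    have h3 := a6.1 7
    rw [show (conc (inp G sets) s').regs 7 = l.length from a3.len] at h3
    have h4 : (k * 3600 + 65000) * (n * n * n) = 2 * ((k * 1800 + 32000) * (n * n * n)) +
      1000 * (n * n * n) := by ring
    omega

theorem wp_rigidProgram (hk : 4 ≤ k) (hG : IsCaterpillar G) (hn : 1 ≤ n) {I : Finset (Fin n)}
    (hI : IsPVC G k I) :
    Wp (inp G [I]) (rigidProgram k) (fun T s' => T ≤ (k * 1000000 + 20000000) * n ^ 3 ∧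
      OutputsSet (rigidSet G k I) (conc (inp G [I]) s')) (rec0 G [I]) := by
  refine wp_seq ((wp_start (sets := [I]) hk hG hn (t := 0) (by simp) (by simp) hI).mono ?_)
  rintro t1 s1 ⟨a1, C, a2, Z, l, a3, a4, a5, a6⟩
  refine wp_seq ((wp_markRigid hk a2 a3 a4 a5).mono ?_)
  rintro t2 s2 ⟨b1, b2⟩
  refine wp_seq (wp_assign (wp_seq ((wp_emit (N := n) (by simp [inp_zero])).mono ?_)))
  rintro t3 s3 ⟨c1, c2, c3⟩
  refine wp_assign ⟨?_, fun v => ?_⟩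
  · have h1 : n ≤ n * n * n := Nat.le_mul_of_pos_left n (Nat.mul_pos hn hn)
    have h2 : n * n ≤ n * n * n := Nat.le_mul_of_pos_right _ hn
    have h3 := baseAddr_inp_le (G := G) (sets := [I]) hn
    have h4 : (k * 1000000 + 20000000) * n ^ 3 = (k * 1800 + 32000) * (n * n * n) +
      (k * 3600 + 65000) * (n * n * n) * 200 + (k * 278200) * (n * n * n) +
        6968000 * (n * n * n) := by ring
    have h5 : 0 ≤ (k * 278200) * (n * n * n) := Nat.zero_le _
    simp only [AExp.cost, cost_nE] at *
    omega
  · have h1 := c3 v v.2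
    rw [Rec.setr_f, b2 v] at h1
    exact h1

end Answers

/-! ### Deciding reachability -/

section Decide

variable {n : ℕ} {G : SimpleGraph (Fin n)} {sets : List (Finset (Fin n))} {k : ℕ}

/-- Copy the tokens to field 10. -/
def saveTokens : Cmd := forN 10 nE (st 10 (.reg 10) (fd 5 (.reg 10)))

theorem wp_saveTokens {X : Finset (Fin n)} {l : List (Fin n × Fin n)} {s : Rec} (hM : Mem X l s) :
    Wp (inp G sets) saveTokens (fun t s' => t ≤ n * 60 + 20 ∧ Same [10] [10] s s' ∧
      ∀ v : Fin n, s'.f 10 v = if v ∈ X then 1 else 0) s := by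
  refine wp_for_frame [10] [10] (fun i s' => ∀ v : Fin n, v.val < i →
    s'.f 10 v = if v ∈ X then 1 else 0) n 45 (by simp [mod_st]) (by simp)
    (fun s' _ => ev_nE_inp s') ?_ (by simp) ?_
  · intro i s2 hi b1 b2 b3
    refine wp_st (by decide) ⟨by simp [AExp.cost], by simpa using b3, fun v hv => ?_⟩
    have b4 := (hM.same b1 (by decide) (by decide) (by decide) (by decide)).tok ⟨i, hi⟩
    simp only at b4
    simp only [Rec.setr_f, Rec.setf_f, ev_reg, b3, true_and, ev_fd _ _ (show 5 < 16 by decide), b4]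
    by_cases h : v.val = i
    · rw [if_pos h, show v = ⟨i, hi⟩ from Fin.ext h]
    · rw [if_neg h]; exact b2 v (by omega)
  · intro t s1 a1 a2 a3 a4
    refine ⟨?_, a3, fun v => a4 v v.2⟩
    simp only [cost_nE] at a1; omega

/-- Compare the tokens with those in field 10. -/
def compareTokens : Cmd :=
  .assign 0 (.const 1) ;;
  forN 10 nE (.cond (.eq (fd 5 (.reg 10)) (fd 10 (.reg 10))) .skip (.assign 0 (.const 0)))

theorem wp_compareTokens {X W : Finset (Fin n)} {l : List (Fin n × Fin n)} {s : Rec}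
    (hM : Mem X l s) (hW : ∀ v : Fin n, s.f 10 v = if v ∈ W then 1 else 0) :
    Wp (inp G sets) compareTokens (fun t s' => t ≤ n * 80 + 20 ∧ Same [0, 10] [] s s' ∧
      s'.r 0 = if X = W then 1 else 0) s := by
  have hs : Same [0, 10] [] s (s.setr 0 (ev (inp G sets) s (.const 1))) := same_setr (by simp)
  refine wp_seq (wp_assign (wp_for_frame [0, 10] [] (fun i s' => (s'.r 0 = 1 ∧
    ∀ v : Fin n, v.val < i → (v ∈ X ↔ v ∈ W)) ∨ (s'.r 0 = 0 ∧ X ≠ W)) n 60 (by simp) (by simp)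
    (fun s' _ => ev_nE_inp s') ?_ (by simp) ?_))
  · intro i s1 hi a1 a2 a3
    have hs1 := hs.trans a1
    have b2 := (hM.same hs1 (by decide) (by decide) (by decide) (by decide)).tok ⟨i, hi⟩
    have b3 := hW ⟨i, hi⟩
    rw [show s.f 10 = s1.f 10 from (hs1.fld 10 (by decide) (by decide)).symm] at b3
    simp only at b2 b3
    refine wp_cond (fun hc => wp_skip ⟨by simp [AExp.cost], a3, ?_⟩)
      (fun hc => wp_assign ⟨by simp [AExp.cost], by simpa using a3, Or.inr ⟨by simp, ?_⟩⟩)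
    all_goals
      simp only [ev_eq, ev_fd _ _ (show 5 < 16 by decide), ev_fd _ _ (show 10 < 16 by decide),
        ev_reg, a3, b2, b3] at hc
    · have h : (⟨i, hi⟩ : Fin n) ∈ X ↔ (⟨i, hi⟩ : Fin n) ∈ W := by
        by_cases h1 : (⟨i, hi⟩ : Fin n) ∈ X <;> by_cases h2 : (⟨i, hi⟩ : Fin n) ∈ W <;>
          simp [h1, h2] at hc ⊢
      rcases a2 with ⟨a4, a5⟩ | ⟨a4, a5⟩
      · refine Or.inl ⟨by simpa using a4, fun v hv => ?_⟩
        by_cases hvi : v.val = i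
        · rw [show v = ⟨i, hi⟩ from Fin.ext hvi]; exact h
        · exact a5 v (by omega)
      · exact Or.inr ⟨by simpa using a4, a5⟩
    · rintro rfl
      simp at hc
  · intro t s1 a1 a2 a3 a4
    refine ⟨?_, hs.trans a3, ?_⟩
    · simp only [AExp.cost, cost_nE] at a1 ⊢; omega
    · rcases a4 with ⟨a4, a5⟩ | ⟨a4, a5⟩
      · rw [a4, if_pos (Finset.ext fun v => a5 v v.2)]
      · rw [a4, if_neg a5]

/-- The program that decides reachability. -/
def reachabilityProgram (k : ℕ) : Cmd :=
  (setup ;; toTerminal k 1) ;; saveTokens ;; countTokens ;; .assign 20 (.reg 12) ;;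
  .assign 21 (.reg 8) ;; toTerminal k 0 ;; countTokens ;; compareTokens ;;
  .cond (.mul (.mul (.eq (.reg 12) (.reg 20)) (.eq (.reg 12) (.add (.reg 2) (.reg 8))))
    (.eq (.reg 20) (.add (.reg 2) (.reg 21)))) (.assign 0 (.const 1)) .skip

open Classical in
theorem wp_reachabilityProgram (hk : 4 ≤ k) (hG : IsCaterpillar G) (hn : 1 ≤ n)
    {I J : Finset (Fin n)} (hI : IsPVC G k I) (hJ : IsPVC G k J) :
    Wp (inp G [I, J]) (reachabilityProgram k) (fun T s' => T ≤ (k * 10000 + 100000) * n ^ 3 ∧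
      Answers (Reachable G k I J) (conc (inp G [I, J]) s')) (rec0 G [I, J]) := by
  refine wp_seq ((wp_start (sets := [I, J]) hk hG hn (t := 1) (by simp) (by simp) hJ).mono ?_)
  rintro t1 s1 ⟨a1, C, a2, W, lW, a3, a4, a5, -⟩
  refine wp_seq ((wp_saveTokens a3).mono ?_)
  rintro t2 s2 ⟨b1, b2, b3⟩
  have hM2 := a3.same b2 (by decide) (by decide) (by decide) (by decide)
  refine wp_seq ((wp_countTokens hM2).mono ?_)
  rintro t3 s3 ⟨c1, c2, c3⟩
  refine wp_seq (wp_assign (wp_seq (wp_assign ?_)))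
  set s4 := (s3.setr 20 (ev (inp G [I, J]) s3 (.reg 12))).setr 21
    (ev (inp G [I, J]) (s3.setr 20 (ev (inp G [I, J]) s3 (.reg 12))) (.reg 8)) with hs4
  have hs : Same [20, 21] [] s3 s4 := (same_setr (by simp)).trans (same_setr (by simp))
  have hC4 := ((a2.same b2 (by decide) (by decide) (by decide)).same c2 (by decide) (by decide)
    (by decide)).same hs (by decide) (by decide) (by decide)
  have hT3 := (a4.same b2 (by decide) (by decide) (by decide)).same c2 (by decide) (by decide)
    (by decide)
  have e20 : s4.r 20 = W.card := by simp [hs4, c3]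
  have e21 : s4.r 21 = (C.leafTok W).card := by simp [hs4, hT3.num]
  refine wp_seq ((wp_toTerminal (sets := [I, J]) hk (t := 0) (by simp) (by simp) hI
    (C.m_pos ⟨0, hn⟩) hC4).mono ?_)
  rintro t5 s5 ⟨d1, d2, d3, Z, lZ, d4, d5, d6⟩
  refine wp_seq ((wp_countTokens d4).mono ?_)
  rintro t6 s6 ⟨f1, f2, f3⟩
  have hM6 := d4.same f2 (by decide) (by decide) (by decide) (by decide)
  refine wp_seq ((wp_compareTokens (W := W) hM6 ?_).mono ?_)
  · rw [f2.fld 10 (by decide) (by decide), d2.fld 10 (by decide) (by decide),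
      hs.fld 10 (by decide) (by decide), c2.fld 10 (by decide) (by decide)]
    exact b3
  rintro t7 s7 ⟨g1, g2, g3⟩
  have h12 : s7.r 12 = Z.card := by rw [g2.reg 12 (by decide), f3]
  have h20 : s7.r 20 = W.card := by
    rw [g2.reg 20 (by decide), f2.reg 20 (by decide), d2.reg 20 (by decide), e20]
  have h21 : s7.r 21 = (C.leafTok W).card := by
    rw [g2.reg 21 (by decide), f2.reg 21 (by decide), d2.reg 21 (by decide), e21]
  have h8 : s7.r 8 = (C.leafTok Z).card := by
    rw [g2.reg 8 (by decide), f2.reg 8 (by decide), d5.num]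
  have h2 : s7.r 2 = C.m := by rw [g2.reg 2 (by decide), f2.reg 2 (by decide), d3.m]
  have he : ev (inp G [I, J]) s7 (.mul (.mul (.eq (.reg 12) (.reg 20))
      (.eq (.reg 12) (.add (.reg 2) (.reg 8)))) (.eq (.reg 20) (.add (.reg 2) (.reg 21)))) ≠ 0 ↔
      C.Full Z ∧ C.Full W ∧ Z.card = W.card := by
    rw [C.full_iff_card, C.full_iff_card]
    simp only [ev_mul, ev_eq, ev_add, ev_reg, h12, h20, h21, h8, h2]
    by_cases q1 : Z.card = C.m + (C.leafTok Z).card <;>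
      by_cases q2 : W.card = C.m + (C.leafTok W).card <;> by_cases q3 : Z.card = W.card
    all_goals simp only [q1, q2, q3, if_true, if_false, mul_one, mul_zero, zero_mul]
    all_goals simp_all
  have hiff := d6.reachable_iff hk a5
  have htime : ∀ t, t ≤ 40 → t1 + (t2 + (t3 + ((AExp.reg 12).cost + 1 + ((AExp.reg 8).cost + 1 +
      (t5 + (t6 + (t7 + t))))))) ≤ (k * 10000 + 100000) * n ^ 3 := by
    intro t ht
    have h1 : n ≤ n * n * n := Nat.le_mul_of_pos_left n (Nat.mul_pos hn hn)
    have h4 : (k * 10000 + 100000) * n ^ 3 = (k * 1800 + 32000) * (n * n * n) +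
      (k * 60 + 1000) * 30 * (n * n * n) + (k * 6400) * (n * n * n) +
        38000 * (n * n * n) := by ring
    simp only [AExp.cost] at *
    omega
  refine wp_cond (fun hc => wp_assign ⟨htime _ (by simp [AExp.cost]), ?_⟩)
    (fun hc => wp_skip ⟨htime _ (by simp [AExp.cost]), ?_⟩)
  · have : Reachable G k I J := hiff.2 (Or.inr (he.1 hc))
    simp [Answers, conc, this]
  · change s7.r 0 = _
    rw [g3]
    congr 1
    refine propext (Iff.trans ?_ hiff.symm)
    exact ⟨Or.inl, fun h => h.resolve_right fun h' => he.2 h' hc⟩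

end Decide

/-! ### Constructing a sequence -/

section Connect

variable {n : ℕ} {G : SimpleGraph (Fin n)} {sets : List (Finset (Fin n))} {k : ℕ}

/-- Field 14 receives the positions of the spine vertices. -/
def indexSpine : Cmd := forN 10 (.reg 2) (st 14 (fd 0 (.reg 10)) (.reg 10))

theorem wp_indexSpine {C : Spine G} {s : Rec} (hC : Stored C s) :
    Wp (inp G sets) indexSpine (fun t s' => t ≤ n * 60 + 20 ∧ Same [10] [14] s s' ∧
      ∀ i, i < C.m → s'.f 14 (C.s i) = i) s := by
  refine wp_for_frame [10] [14] (fun i s' => ∀ j, j < i → s'.f 14 (C.s j) = j) C.m 40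
    (by simp [mod_st]) (by simp) (fun s' hs => by rw [ev_reg, hs.reg 2 (by decide), hC.m]) ?_
    (by simp) ?_
  · intro i s1 hi a1 a2 a3
    refine wp_st (by decide) ⟨by simp [AExp.cost], by simpa using a3, fun j hj => ?_⟩
    have b1 := (hC.same a1 (by decide) (by decide) (by decide)).sp i hi
    simp only [Rec.setr_f, Rec.setf_f, ev_reg, a3, true_and, ev_fd _ _ (show 0 < 16 by decide), b1,
      Fin.val_inj]
    by_cases hji : j = i
    · rw [if_pos (by rw [hji]), hji]
    · rw [if_neg (fun h => hji (C.s_inj (by omega) hi h))]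
      exact a2 j (by omega)
  · intro t s1 a1 a2 a3 a4
    refine ⟨?_, a3, a4⟩
    have := C.m_le
    simp only [AExp.cost] at a1
    omega

/-- Register 14 receives a vertex with a token that has no mark in field 10. -/
def findExtra : Cmd :=
  forN 11 nE (.cond (.mul (fd 5 (.reg 11)) (.eq (fd 10 (.reg 11)) (.const 0)))
    (.assign 14 (.reg 11)) .skip)

theorem wp_findExtra {X W : Finset (Fin n)} {l : List (Fin n × Fin n)} {s : Rec} (hM : Mem X l s)
    (hW : ∀ v : Fin n, s.f 10 v = if v ∈ W then 1 else 0) (hx : ∃ x ∈ X, x ∉ W) :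
    Wp (inp G sets) findExtra (fun t s' => t ≤ n * 80 + 20 ∧ Same [11, 14] [] s s' ∧
      ∃ x ∈ X, x ∉ W ∧ s'.r 14 = x) s := by
  refine wp_for_frame [11, 14] [] (fun i s' => (∃ x ∈ X, x ∉ W ∧ x.val < i) →
    ∃ x ∈ X, x ∉ W ∧ s'.r 14 = x) n 60 (by simp) (by simp) (fun s' _ => ev_nE_inp s') ?_
    (by simp) ?_
  · intro i s1 hi a1 a2 a3
    have b2 := (hM.same a1 (by decide) (by decide) (by decide) (by decide)).tok ⟨i, hi⟩
    have b3 := hW ⟨i, hi⟩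
    rw [show s.f 10 = s1.f 10 from (a1.fld 10 (by decide) (by decide)).symm] at b3
    simp only at b2 b3
    have he : ev (inp G sets) s1 (.mul (fd 5 (.reg 11)) (.eq (fd 10 (.reg 11)) (.const 0))) ≠ 0 ↔
        (⟨i, hi⟩ : Fin n) ∈ X ∧ (⟨i, hi⟩ : Fin n) ∉ W := by
      simp only [ev_mul, ev_eq, ev_fd _ _ (show 5 < 16 by decide), ev_const,
        ev_fd _ _ (show 10 < 16 by decide), ev_reg, a3, b2, b3]
      by_cases h1 : (⟨i, hi⟩ : Fin n) ∈ X <;> by_cases h2 : (⟨i, hi⟩ : Fin n) ∈ W <;>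
        simp [h1, h2]
    refine wp_cond (fun hc => wp_assign ⟨by simp [AExp.cost], by simpa using a3, fun _ =>
      ⟨⟨i, hi⟩, (he.1 hc).1, (he.1 hc).2, by simpa using a3⟩⟩)
      (fun hc => wp_skip ⟨by simp [AExp.cost], a3, ?_⟩)
    rintro ⟨x, h1, h2, h3⟩
    have : x.val ≠ i := by
      rintro rfl
      exact he.2 ⟨h1, h2⟩ hc
    simpa using a2 ⟨x, h1, h2, by omega⟩
  · intro t s1 a1 a2 a3 a4
    refine ⟨by simp only [cost_nE] at a1; omega, a3, a4 ?_⟩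
    obtain ⟨x, h1, h2⟩ := hx
    exact ⟨x, h1, h2, x.2⟩

/-- Move the hole on the spine from the position in register 3 to the one in register 15. -/
def moveHole : Cmd :=
  .loop (.sub (.const 1) (.eq (.reg 3) (.reg 15)))
    (.cond (.lt (.reg 3) (.reg 15)) (.assign 4 (.add (.reg 3) (.const 1)))
        (.assign 4 (.sub (.reg 3) (.const 1))) ;;
      .assign 5 (fd 0 (.reg 4)) ;; .assign 6 (fd 0 (.reg 3)) ;; slide 5 6 ;; .assign 3 (.reg 4))

theorem mod_moveHole {R F : List ℕ} (hR : [3, 4, 5, 6, 7] ⊆ R) (hF : [5, 8, 9] ⊆ F) :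
    Mod R F moveHole :=
  Mod.mono (by simp [moveHole, mod_slide]) hR hF

/-- Moving the hole by one vertex means sliding the token ahead of it into the hole. Along a full
spine this is always legal, and the distance to the target bounds the number of rounds. -/
theorem wp_moveHole (hk : 4 ≤ k) {C : Spine G} {I X : Finset (Fin n)}
    {l : List (Fin n × Fin n)} {s : Rec} (hC : Stored C s) (hX : C.Full X) {y : Fin n} (hy : y ∉ X)
    {i j : ℕ} (hi : i < C.m) (hj : j < C.m) (h3 : s.r 3 = i) (h15 : s.r 15 = j)
    (hM : Mem (mv X (C.s i) y) l s) (hl : Log G k I l (mv X (C.s i) y)) :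
    Wp (inp G sets) moveHole (fun t s' => t ≤ n * 250 + 20 ∧ Same [3, 4, 5, 6, 7] [5, 8, 9] s s' ∧
      ∃ l', Mem (mv X (C.s j) y) l' s' ∧ Log G k I l' (mv X (C.s j) y)) s := by
  refine wp_loop_frame [3, 4, 5, 6, 7] [5, 8, 9] (γ := ℕ) (fun a s' => a < C.m ∧ s'.r 3 = a ∧
    ∃ l', Mem (mv X (C.s a) y) l' s' ∧ Log G k I l' (mv X (C.s a) y))
    (fun a => ((a - j) + (j - a)) * 250) (mod_moveHole (R := [3, 4, 5, 6, 7]) (F := [5, 8, 9])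
      (List.Subset.refl _) (List.Subset.refl _)) ?_ i
    ⟨hi, h3, l, hM, hl⟩ ?_
  · rintro a s1 a1 ⟨a2, a3, l₁, a4, a5⟩ he
    have b15 : s1.r 15 = j := by rw [a1.reg 15 (by decide), h15]
    have hC1 := hC.same a1 (by decide) (by decide) (by decide)
    have haj : a ≠ j := by
      rintro rfl
      simp [a3, b15] at he
    have hmove : ∀ b, b < C.m → a + 1 = b ∨ b + 1 = a → (b - j) + (j - b) + 1 = (a - j) + (j - a) →
        ∀ s2 T, Same [4] [] s1 s2 → s2.r 4 = b → T ≤ 30 →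
        Wp (inp G sets) (.assign 5 (fd 0 (.reg 4)) ;; .assign 6 (fd 0 (.reg 3)) ;; slide 5 6 ;;
          .assign 3 (.reg 4)) (fun t s'' => ∃ g', (g' < C.m ∧ s''.r 3 = g' ∧
            ∃ l', Mem (mv X (C.s g') y) l' s'' ∧ Log G k I l' (mv X (C.s g') y)) ∧
            T + t + (AExp.sub (.const 1) (.eq (.reg 3) (.reg 15))).cost + 1 +
              ((g' - j) + (j - g')) * 250 ≤ ((a - j) + (j - a)) * 250) s2 := by
      intro b hb hab hmeas s2 T hs2 h4 hT
      refine wp_seq (wp_assign (wp_seq (wp_assign ?_)))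
      set s3 := (s2.setr 5 (ev (inp G sets) s2 (fd 0 (.reg 4)))).setr 6 (ev (inp G sets)
        (s2.setr 5 (ev (inp G sets) s2 (fd 0 (.reg 4)))) (fd 0 (.reg 3))) with hs3
      have hs : Same [4, 5, 6] [] s1 s3 := ((hs2.mono (by simp) (by simp)).trans
        (same_setr (by simp))).trans (same_setr (by simp))
      have hC2 := hC1.same hs2 (by decide) (by decide) (by decide)
      have e5 : s3.r 5 = C.s b := by
        simp [hs3, ev_fd _ _ (show 0 < 16 by decide), h4, hC2.sp b hb]
      have e6 : s3.r 6 = C.s a := by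
        simp [hs3, ev_fd _ _ (show 0 < 16 by decide), hs2.reg 3 (by decide), a3, hC2.sp a a2]
      have e4 : s3.r 4 = b := by simp [hs3, h4]
      refine wp_seq ((wp_slide (a4.same hs (by decide) (by decide) (by decide) (by decide))
        e5 e6).mono ?_)
      rintro t4 s4 ⟨c1, c2, c3⟩
      rw [C.mv_hole hX hy a2 hb (by omega)] at c3
      refine wp_assign ⟨b, ⟨hb, by simp [c2.reg 4 (by decide), e4], _,
        c3.same (same_setr (R := [3]) (F := []) (by simp)) (by decide) (by decide) (by decide)
          (by decide), a5.append (C.log_hole_step hk hX hy a2 hb hab)⟩, ?_⟩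
      simp only [AExp.cost, cost_fd]
      omega
    refine wp_seq (wp_cond (fun hc => wp_assign ?_) (fun hc => wp_assign ?_))
    · have hlt : a < j := by
        by_contra h
        simp [a3, b15, h] at hc
      exact hmove (a + 1) (by omega) (Or.inl rfl) (by omega) _ _ (same_setr (by simp))
        (by simp [a3]) (by simp [AExp.cost])
    · have hlt : ¬ a < j := by
        intro h
        simp [a3, b15, h] at hc
      exact hmove (a - 1) (by omega) (Or.inr (by omega)) (by omega) _ _ (same_setr (by simp))
        (by simp [a3]) (by simp [AExp.cost])
  · rintro t s1 a a1 ⟨a2, a3, l', a4, a5⟩ he ht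
    have b15 : s1.r 15 = j := by rw [a1.reg 15 (by decide), h15]
    have haj : a = j := by
      by_contra h
      simp [a3, b15, h] at he
    subst haj
    refine ⟨?_, a1, l', a4, a5⟩
    have := C.m_le
    have h1 : ((i - a) + (a - i)) * 250 ≤ n * 250 := Nat.mul_le_mul_right _ (by omega)
    simp only [AExp.cost] at ht
    omega

/-- Fill the vacant leaf in register 10 with a token from an occupied leaf without mark. -/
def moveLeaf : Cmd :=
  findExtra ;; .assign 5 (fd 1 (.reg 10)) ;; .assign 6 (.reg 10) ;; slide 5 6 ;;
  .assign 3 (fd 14 (.reg 5)) ;; .assign 15 (fd 14 (fd 1 (.reg 14))) ;; moveHole ;;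
  .assign 5 (.reg 14) ;; .assign 6 (fd 1 (.reg 14)) ;; slide 5 6

theorem mod_moveLeaf {R F : List ℕ} (hR : [3, 4, 5, 6, 7, 11, 14, 15] ⊆ R) (hF : [5, 8, 9] ⊆ F) :
    Mod R F moveLeaf :=
  Mod.mono (by simp [moveLeaf, findExtra, mod_moveHole, mod_slide]) hR hF

/-- The token at the owner of `y` steps onto `y`, the hole moves to the owner of a superfluous token
`x`, and `x` fills it. That `x` is on a leaf follows from `x ∉ W` and the fullness of `W`. -/
theorem wp_moveLeaf (hk : 4 ≤ k) {C : Spine G} {I X W : Finset (Fin n)}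
    {l : List (Fin n × Fin n)} {s : Rec} (hC : Stored C s) (hX : C.Full X) (hWF : C.Full W)
    {y : Fin n} (hy : y ∉ X) (h10 : s.r 10 = y) (hM : Mem X l s) (hl : Log G k I l X)
    (hW : ∀ v : Fin n, s.f 10 v = if v ∈ W then 1 else 0) (hx : ∃ x ∈ X, x ∉ W)
    (hidx : ∀ i, i < C.m → s.f 14 (C.s i) = i) :
    Wp (inp G sets) moveLeaf (fun t s' => t ≤ n * 330 + 600 ∧ ∃ x l', x ∈ X ∧ x ∉ W ∧
      C.ow x ≠ x ∧ Mem (mv X x y) l' s' ∧ Log G k I l' (mv X x y)) s := by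
  refine wp_seq ((wp_findExtra hM hW hx).mono ?_)
  rintro t1 s1 ⟨a1, a2, x, a3, a4, a5⟩
  have hxl : C.ow x ≠ x := hWF.leaf a4
  have hC1 := hC.same a2 (by decide) (by decide) (by decide)
  have hM1 := hM.same a2 (by decide) (by decide) (by decide) (by decide)
  have h10' : s1.r 10 = y := by rw [a2.reg 10 (by decide), h10]
  refine wp_seq (wp_assign (wp_seq (wp_assign ?_)))
  set s2 := (s1.setr 5 (ev (inp G sets) s1 (fd 1 (.reg 10)))).setr 6 (ev (inp G sets)
    (s1.setr 5 (ev (inp G sets) s1 (fd 1 (.reg 10)))) (.reg 10)) with hs2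
  have hs : Same [5, 6] [] s1 s2 := (same_setr (by simp)).trans (same_setr (by simp))
  have e5 : s2.r 5 = C.ow y := by
    simp [hs2, ev_fd _ _ (show 1 < 16 by decide), h10', hC1.own y]
  have e6 : s2.r 6 = y := by simp [hs2, h10']
  refine wp_seq ((wp_slide (hM1.same hs (by decide) (by decide) (by decide) (by decide))
    e5 e6).mono ?_)
  rintro t3 s3 ⟨b1, b2, b3⟩
  refine wp_seq (wp_assign (wp_seq (wp_assign ?_)))
  set s4 := (s3.setr 3 (ev (inp G sets) s3 (fd 14 (.reg 5)))).setr 15 (ev (inp G sets)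
    (s3.setr 3 (ev (inp G sets) s3 (fd 14 (.reg 5)))) (fd 14 (fd 1 (.reg 14)))) with hs4
  have hs' : Same [3, 15] [] s3 s4 := (same_setr (by simp)).trans (same_setr (by simp))
  have hC3 := (hC1.same hs (by decide) (by decide) (by decide)).same b2 (by decide) (by decide)
    (by decide)
  have h14 : s3.f 14 = s.f 14 := by
    rw [b2.fld 14 (by decide) (by decide), hs.fld 14 (by decide) (by decide),
      a2.fld 14 (by decide) (by decide)]
  have g14 : s3.r 14 = x := by rw [b2.reg 14 (by decide), hs.reg 14 (by decide), a5]
  have g5 : s3.r 5 = C.ow y := by rw [b2.reg 5 (by decide), e5]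
  have e3 : s4.r 3 = C.o y := by
    simp [hs4, ev_fd _ _ (show 14 < 16 by decide), g5, h14, Spine.ow, hidx _ (C.o_lt y)]
  have e15 : s4.r 15 = C.o x := by
    simp [hs4, ev_fd _ _ (show 14 < 16 by decide), ev_fd _ _ (show 1 < 16 by decide), g14, hC3.own,
      h14, Spine.ow, hidx _ (C.o_lt x)]
  refine wp_seq ((wp_moveHole hk (hC3.same hs' (by decide) (by decide) (by decide)) hX hy
    (C.o_lt y) (C.o_lt x) e3 e15 (b3.same hs' (by decide) (by decide) (by decide) (by decide))
    (hl.append (C.log_hole_start hk hX hy))).mono ?_)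
  rintro t5 s5 ⟨c1, c2, l', c3, c4⟩
  refine wp_seq (wp_assign (wp_seq (wp_assign ?_)))
  set s6 := (s5.setr 5 (ev (inp G sets) s5 (.reg 14))).setr 6 (ev (inp G sets)
    (s5.setr 5 (ev (inp G sets) s5 (.reg 14))) (fd 1 (.reg 14))) with hs6
  have hs'' : Same [5, 6] [] s5 s6 := (same_setr (by simp)).trans (same_setr (by simp))
  have hC5 := (hC3.same hs' (by decide) (by decide) (by decide)).same c2 (by decide) (by decide)
    (by decide)
  have g14' : s5.r 14 = x := by rw [c2.reg 14 (by decide), hs'.reg 14 (by decide), g14]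
  have q5 : s6.r 5 = x := by simp [hs6, g14']
  have q6 : s6.r 6 = C.ow x := by
    simp [hs6, ev_fd _ _ (show 1 < 16 by decide), g14', hC5.own]
  refine (wp_slide (c3.same hs'' (by decide) (by decide) (by decide) (by decide)) q5 q6).mono ?_
  rintro t7 s7 ⟨d1, d2, d3⟩
  have hset : mv (mv X (C.s (C.o x)) y) x (C.ow x) = mv X x y := by
    ext v
    have h1 : C.ow x ∈ X := hX _ (C.o_lt x)
    have h2 : x ≠ y := by rintro rfl; exact hy a3
    change v ∈ mv (mv X (C.ow x) y) x (C.ow x) ↔ _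
    simp only [mem_mv]
    constructor
    · rintro (rfl | ⟨h3, rfl | ⟨-, h4⟩⟩)
      · exact Or.inr ⟨hxl, h1⟩
      · exact Or.inl rfl
      · exact Or.inr ⟨h3, h4⟩
    · rintro (rfl | ⟨h3, h4⟩)
      · exact Or.inr ⟨h2.symm, Or.inl rfl⟩
      · by_cases h5 : v = C.ow x
        · exact Or.inl h5
        · exact Or.inr ⟨h3, Or.inr ⟨h5, h4⟩⟩
  rw [hset] at d3
  refine ⟨?_, x, _, a3, a4, hxl, d3,
    c4.append (C.log_hole_end hk hX hy (C.mem_leafTok.2 ⟨a3, hxl⟩))⟩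
  simp only [AExp.cost, cost_fd] at *
  omega

/-- Move the tokens to the marks in field 10. -/
def connect : Cmd :=
  indexSpine ;;
  forN 10 nE (.cond (.mul (.eq (fd 5 (.reg 10)) (.const 0)) (fd 10 (.reg 10))) moveLeaf .skip)

theorem mod_connect {R F : List ℕ} (hR : [3, 4, 5, 6, 7, 10, 11, 14, 15] ⊆ R)
    (hF : [5, 8, 9, 14] ⊆ F) : Mod R F connect :=
  Mod.mono (by simp [connect, indexSpine, mod_moveLeaf, mod_st]) hR hF

/-- The vertices of `W` are filled in turn, each with a token from outside `W`, so no vertex filled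
before is given up. Equal sizes guarantee that such a token exists. -/
theorem wp_connect (hk : 4 ≤ k) {C : Spine G} {I Z W : Finset (Fin n)}
    {l : List (Fin n × Fin n)} {s : Rec} (hC : Stored C s) (hM : Mem Z l s) (hl : Log G k I l Z)
    (hW : ∀ v : Fin n, s.f 10 v = if v ∈ W then 1 else 0)
    (hZW : Z = W ∨ (C.Full Z ∧ C.Full W ∧ Z.card = W.card)) :
    Wp (inp G sets) connect (fun t s' => t ≤ n * (n * 330 + 730) + 60 ∧
      ∃ l', Mem W l' s' ∧ Log G k I l' W) s := by
  refine wp_seq ((wp_indexSpine hC).mono ?_)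
  rintro t1 s1 ⟨a1, a2, a3⟩
  have hC1 := hC.same a2 (by decide) (by decide) (by decide)
  have hM1 := hM.same a2 (by decide) (by decide) (by decide) (by decide)
  have hW1 : ∀ v : Fin n, s1.f 10 v = if v ∈ W then 1 else 0 := by
    rw [a2.fld 10 (by decide) (by decide)]; exact hW
  refine wp_for_frame [3, 4, 5, 6, 7, 10, 11, 14, 15] [5, 8, 9] (fun i s' => ∃ X l', Mem X l' s' ∧
    Log G k I l' X ∧ (X = W ∨ (C.Full X ∧ C.Full W ∧ X.card = W.card)) ∧
    ∀ v ∈ W, v.val < i → v ∈ X) n (n * 330 + 650) (by simp [mod_moveLeaf]) (by simp)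
    (fun s' _ => ev_nE_inp s') ?_ ?_ ?_
  · rintro i s2 hi b1 ⟨X, l', b2, b3, b4, b5⟩ b6
    have hW2 : ∀ v : Fin n, s2.f 10 v = if v ∈ W then 1 else 0 := by
      rw [b1.fld 10 (by decide) (by decide)]; exact hW1
    have c1 := b2.tok ⟨i, hi⟩
    have c2 := hW2 ⟨i, hi⟩
    simp only at c1 c2
    have he : ev (inp G sets) s2 (.mul (.eq (fd 5 (.reg 10)) (.const 0)) (fd 10 (.reg 10))) ≠ 0 ↔
        (⟨i, hi⟩ : Fin n) ∉ X ∧ (⟨i, hi⟩ : Fin n) ∈ W := by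
      simp only [ev_mul, ev_eq, ev_fd _ _ (show 5 < 16 by decide), ev_const,
        ev_fd _ _ (show 10 < 16 by decide), ev_reg, b6, c1, c2]
      by_cases h1 : (⟨i, hi⟩ : Fin n) ∈ X <;> by_cases h2 : (⟨i, hi⟩ : Fin n) ∈ W <;>
        simp [h1, h2]
    refine wp_cond (fun hc => ?_) (fun hc => wp_skip ⟨?_, b6, X, l',
      b2.same (same_setr (R := [10]) (F := []) (by simp)) (by decide) (by decide) (by decide)
        (by decide), b3, b4, fun v hv hvi => ?_⟩)
    · obtain ⟨h1, h2⟩ := he.1 hc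
      obtain ⟨d1, d2, d3⟩ := b4.resolve_left fun h => h1 (h ▸ h2)
      have hex : ∃ x ∈ X, x ∉ W := by
        by_contra! hno
        exact h1 (Finset.eq_of_subset_of_card_le hno d3.ge ▸ h2)
      refine (Wp.frame (R := [3, 4, 5, 6, 7, 11, 14, 15]) (F := [5, 8, 9])
        (mod_moveLeaf (List.Subset.refl _) (List.Subset.refl _))
        (wp_moveLeaf hk (hC1.same b1 (by decide) (by decide) (by decide)) d1 d2 h1
        (by simpa using b6) b2 b3 hW2 hex
        (by rw [b1.fld 14 (by decide) (by decide)]; exact a3))).mono ?_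
      rintro t3 s3 ⟨⟨e1, x, l₂, e2, e3, e4, e5, e6⟩, e7⟩
      refine ⟨?_, by rw [e7.reg 10 (by decide), b6], _, l₂,
        e5.same (same_setr (R := [10]) (F := []) (by simp)) (by decide) (by decide) (by decide)
        (by decide), e6, Or.inr ⟨C.full_mv_leaf d1 e4, d2, by rw [card_mv e2 h1, d3]⟩, ?_⟩
      · simp only [AExp.cost, cost_fd]; omega
      · intro v hv hvi
        rw [mem_mv]
        by_cases hvi' : v.val = i
        · exact Or.inl (Fin.ext hvi')
        · exact Or.inr ⟨by rintro rfl; exact e3 hv, b5 v hv (by omega)⟩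
    · simp only [AExp.cost, cost_fd]; omega
    · by_cases hvi' : v.val = i
      · obtain rfl : v = ⟨i, hi⟩ := Fin.ext hvi'
        by_contra h
        exact he.2 ⟨h, hv⟩ hc
      · exact b5 v hv (by omega)
  · exact ⟨Z, l, hM1.same (same_setr (R := [10]) (F := []) (by simp)) (by decide) (by decide)
      (by decide) (by decide), hl, hZW, by simp⟩
  · rintro t2 s2 b0 b1 b2 ⟨X, l', b3, b4, b5, b6⟩
    have hXW : X = W := by
      rcases b5 with h | ⟨-, -, h⟩
      · exact h
      · exact (Finset.eq_of_subset_of_card_le (fun v hv => b6 v hv v.2) h.le).symm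
    subst hXW
    refine ⟨?_, l', b3, b4⟩
    simp only [cost_nE] at b0
    have : n * (n * 330 + 650 + 2 + 7) + n * 60 ≤ n * (n * 330 + 730) := by
      rw [← mul_add]; exact Nat.mul_le_mul_left _ (by omega)
    omega

end Connect

/-! ### Joining two sequences and writing out the result -/

section Construct

variable {n : ℕ} {G : SimpleGraph (Fin n)} {sets : List (Finset (Fin n))} {k : ℕ}

/-- The list of slides is in fields 11 and 12, its length in register 20. -/
structure Saved (l : List (Fin n × Fin n)) (s : Rec) : Prop where
  len : s.r 20 = l.length
  fst : ∀ (i : ℕ) (h : i < l.length), s.f 11 i = (l[i]).1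
  snd : ∀ (i : ℕ) (h : i < l.length), s.f 12 i = (l[i]).2

theorem Saved.same {l : List (Fin n × Fin n)} {s s' : Rec} (h : Saved l s) {R F : List ℕ}
    (hs : Same R F s s') (h20 : 20 ∉ R) (h11 : 11 ∉ F) (h12 : 12 ∉ F) : Saved l s' := by
  refine ⟨?_, ?_, ?_⟩
  · rw [hs.reg 20 h20]; exact h.len
  · rw [hs.fld 11 (by decide) h11]; exact h.fst
  · rw [hs.fld 12 (by decide) h12]; exact h.snd

/-- Copy the list of slides to fields 11 and 12. -/
def saveLog : Cmd :=
  forN 10 (.reg 7) (st 11 (.reg 10) (fd 8 (.reg 10)) ;; st 12 (.reg 10) (fd 9 (.reg 10))) ;;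
  .assign 20 (.reg 7)

theorem wp_saveLog {X : Finset (Fin n)} {l : List (Fin n × Fin n)} {s : Rec} (hM : Mem X l s) :
    Wp (inp G sets) saveLog (fun t s' => t ≤ l.length * 110 + 20 ∧ Same [10, 20] [11, 12] s s' ∧
      Saved l s') s := by
  refine wp_seq (wp_for_frame [10, 20] [11, 12] (fun i s' => ∀ j (h : j < l.length), j < i →
    s'.f 11 j = (l[j]).1 ∧ s'.f 12 j = (l[j]).2) l.length 90 (by simp [mod_st]) (by simp)
    (fun s' hs => by rw [ev_reg, hs.reg 7 (by decide), hM.len]) ?_ (by simp) ?_)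
  · intro i s1 hi a1 a2 a3
    have hM1 := hM.same a1 (by decide) (by decide) (by decide) (by decide)
    refine wp_seq (wp_st (by decide) (wp_st (by decide) ⟨by simp [AExp.cost], by simpa using a3,
      fun j hj hji => ?_⟩))
    simp only [Rec.setr_f, Rec.setf_f, Rec.setf_r, ev_reg, a3, true_and,
      ev_fd _ _ (show 8 < 16 by decide), ev_fd _ _ (show 9 < 16 by decide), hM1.fst i hi,
      hM1.snd i hi, show (11 : ℕ) ≠ 12 by decide, show (12 : ℕ) ≠ 11 by decide,
      show (9 : ℕ) ≠ 11 by decide, false_and, if_false]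
    by_cases h : j = i
    · subst h; simp
    · rw [if_neg h, if_neg h]; exact a2 j hj (by omega)
  · intro t s1 a1 a2 a3 a4
    refine wp_assign ⟨?_, a3.trans (same_setr (by simp)), ?_, fun i h => (a4 i h h).1,
      fun i h => (a4 i h h).2⟩
    · simp only [AExp.cost] at *; omega
    · simp [a3.reg 7 (by decide), hM.len]

/-- Append the reverse of the saved list of slides. -/
def appendReverse : Cmd :=
  forN 10 (.reg 20) (
    st 8 (.reg 7) (fd 12 (.sub (.sub (.reg 20) (.const 1)) (.reg 10))) ;;
    st 9 (.reg 7) (fd 11 (.sub (.sub (.reg 20) (.const 1)) (.reg 10))) ;; inc 7)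

/-- Only the list changes; the marks in field 5 stay at `X`, although the extended list describes
further moves. From here on only the list is used. -/
theorem wp_appendReverse {X : Finset (Fin n)} {l l' : List (Fin n × Fin n)} {s : Rec}
    (hM : Mem X l s) (hS : Saved l' s) :
    Wp (inp G sets) appendReverse (fun t s' => t ≤ l'.length * 120 + 20 ∧
      Mem X (l ++ l'.reverse.map Prod.swap) s') s := by
  obtain ⟨L, hL⟩ : ∃ L, L = l'.reverse.map Prod.swap := ⟨_, rfl⟩
  have hlen : L.length = l'.length := by simp [hL]
  rw [← hL]
  refine wp_for_frame [7, 10] [8, 9] (fun i s' => Mem X (l ++ L.take i) s') l'.length 110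
    (by simp [mod_st, inc]) (by simp) (fun s' hs => by rw [ev_reg, hs.reg 20 (by decide), hS.len])
    ?_ ?_ ?_
  · intro i s1 hi a1 a2 a3
    have hS1 := hS.same a1 (by decide) (by decide) (by decide)
    have hi' : i < L.length := by omega
    have e1 : L.take (i + 1) = L.take i ++ [L[i]] := by rw [List.take_concat_get']
    have h7 := a2.len
    have hel : L[i] = ((l'[l'.length - 1 - i]'(by omega)).2, (l'[l'.length - 1 - i]'(by omega)).1) := by
      simp [hL, List.getElem_reverse, Prod.swap]
    refine wp_seq (wp_st (by decide) (wp_seq (wp_st (by decide) (wp_assign ⟨by simp [AExp.cost],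
      by simpa using a3, ?_⟩))))
    rw [e1, ← List.append_assoc]
    refine ⟨?_, ?_, ?_, ?_⟩
    · simpa using a2.tok
    · simp [h7]; omega
    · intro j hj
      simp only [List.length_append, List.length_singleton] at hj
      simp only [Rec.setr_f, Rec.setf_f, Rec.setf_r, ev_reg, ev_sub, ev_const, hS1.len, a3, h7,
        ev_fd _ _ (show 12 < 16 by decide), ev_fd _ _ (show 11 < 16 by decide), true_and,
        show (8 : ℕ) ≠ 9 by decide, false_and, if_false]
      by_cases hjl : j = (l ++ L.take i).length
      · rw [if_pos hjl, hS1.snd _ (by omega)]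
        simp [hjl, hel]
      · rw [if_neg hjl, List.getElem_append_left (by simp only [List.length_append] at hjl ⊢; omega)]
        exact a2.fst j (by simp only [List.length_append] at hjl ⊢; omega)
    · intro j hj
      simp only [List.length_append, List.length_singleton] at hj
      simp only [Rec.setr_f, Rec.setf_f, Rec.setf_r, ev_reg, ev_sub, ev_const, hS1.len, a3, h7,
        ev_fd _ _ (show 12 < 16 by decide), ev_fd _ _ (show 11 < 16 by decide), true_and,
        show (9 : ℕ) ≠ 8 by decide, show (11 : ℕ) ≠ 8 by decide, false_and, if_false]
      by_cases hjl : j = (l ++ L.take i).length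
      · rw [if_pos hjl, hS1.fst _ (by omega)]
        simp [hjl, hel]
      · rw [if_neg hjl, List.getElem_append_left (by simp only [List.length_append] at hjl ⊢; omega)]
        exact a2.snd j (by simp only [List.length_append] at hjl ⊢; omega)
  · simpa using hM.same (same_setr (R := [10]) (F := []) (by simp)) (by decide) (by decide)
      (by decide) (by decide)
  · intro t s1 a1 a2 a3 a4
    rw [List.take_of_length_le hlen.le] at a4
    exact ⟨by simp only [AExp.cost] at a1; omega, a4⟩

/-- Write the slides to field 13, one after the other. -/
def interleave : Cmd :=
  .assign 11 (.const 0) ;;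
  forN 10 (.reg 7) (st 13 (.add (.reg 10) (.reg 10)) (fd 8 (.reg 10)) ;;
    st 13 (.add (.add (.reg 10) (.reg 10)) (.const 1)) (fd 9 (.reg 10)) ;; inc 11 ;; inc 11)

theorem wp_interleave {X : Finset (Fin n)} {l : List (Fin n × Fin n)} {s : Rec}
    (hM : Mem X l s) :
    Wp (inp G sets) interleave (fun t s' => t ≤ l.length * 130 + 20 ∧ s'.r 11 = 2 * l.length ∧
      s'.r 7 = l.length ∧ ∀ i (h : i < l.length), s'.f 13 (2 * i) = (l[i]).1 ∧
        s'.f 13 (2 * i + 1) = (l[i]).2) s := by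
  have hs : Same [10, 11] [13] s (s.setr 11 (ev (inp G sets) s (.const 0))) := same_setr (by simp)
  refine wp_seq (wp_assign (wp_for_frame [10, 11] [13] (fun i s' => s'.r 11 = 2 * i ∧
    ∀ j (h : j < l.length), j < i → s'.f 13 (2 * j) = (l[j]).1 ∧ s'.f 13 (2 * j + 1) = (l[j]).2)
    l.length 110 (by simp [mod_st, inc]) (by simp)
    (fun s' h => by rw [ev_reg, h.reg 7 (by decide), hs.reg 7 (by decide), hM.len]) ?_ (by simp)
    ?_))
  · rintro i s1 hi a1 ⟨a2, a4⟩ a3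
    have hM1 := hM.same (hs.trans a1) (by decide) (by decide) (by decide) (by decide)
    refine wp_seq (wp_st (by decide) (wp_seq (wp_st (by decide) (wp_seq (wp_assign (wp_assign
      ⟨by simp [AExp.cost], by simpa using a3, by simp [a2]; omega, fun j hj hji => ?_⟩))))))
    simp only [Rec.setr_f, Rec.setf_f, Rec.setf_r, ev_reg, ev_add, ev_const, a3, true_and,
      ev_fd _ _ (show 8 < 16 by decide), ev_fd _ _ (show 9 < 16 by decide), hM1.fst i hi,
      hM1.snd i hi, show (9 : ℕ) ≠ 13 by decide, false_and, if_false]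
    rw [if_neg (show ¬ 2 * j = i + i + 1 by omega), if_neg (show ¬ 2 * j + 1 = i + i by omega)]
    by_cases h : j = i
    · subst h
      rw [if_pos (by omega), if_pos (by omega)]
      exact ⟨rfl, rfl⟩
    · rw [if_neg (by omega), if_neg (by omega)]; exact a4 j hj (by omega)
  · rintro t s1 a1 a2 a3 ⟨a4, a5⟩
    refine ⟨by simp only [AExp.cost] at *; omega, a4, ?_, fun i h => a5 i h h⟩
    rw [a3.reg 7 (by decide), hs.reg 7 (by decide), hM.len]

/-- Save a terminal position reached from the second set and move the tokens of the first set
there. -/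
def meet (k : ℕ) : Cmd :=
  (setup ;; toTerminal k 1) ;; saveTokens ;; saveLog ;; toTerminal k 0 ;; connect

/-- The common position `W` is the terminal position of `J`: the tokens of `I` are taken to their
own terminal position and from there to `W`. As in `wp_start`, tameness bounds the length of the
list. -/
theorem wp_meet (hk : 4 ≤ k) (hG : IsCaterpillar G) (hn : 1 ≤ n) {I J : Finset (Fin n)}
    (hI : IsPVC G k I) (hJ : IsPVC G k J) (hIJ : Reachable G k I J) :
    Wp (inp G [I, J]) (meet k) (fun T s' => T ≤ (k * 400000 + 8000000) * (n * n * n) ∧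
      ∃ l l' W, Mem W l s' ∧ Saved l' s' ∧ Log G k I l W ∧ Log G k J l' W ∧
        l.length ≤ (k * 800000 + 17000000) * (n * n * n) ∧
        l'.length ≤ (k * 3600 + 65000) * (n * n * n)) (rec0 G [I, J]) := by
  have hle : (conc (inp G [I, J]) (rec0 G [I, J])).Le n := by
    rw [← inputState_eq]; exact inputState_le G _ hn
  have hp : 1 ≤ n * n := Nat.mul_pos hn hn
  have hp1 : n ≤ n * n * n := Nat.le_mul_of_pos_left n hp
  have hp2 : n * n ≤ n * n * n := Nat.le_mul_of_pos_right _ hn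
  refine (Wp.le (M := n) rfl hle (Q := fun T s' => T ≤ (k * 400000 + 8000000) * (n * n * n) ∧
      ∃ l l' W, Mem W l s' ∧ Saved l' s' ∧ Log G k I l W ∧ Log G k J l' W ∧
        l'.length ≤ (k * 3600 + 65000) * (n * n * n)) ?_).mono ?_
  · refine wp_seq ((wp_start (sets := [I, J]) hk hG hn (t := 1) (by simp) (by simp) hJ).mono ?_)
    rintro t1 s1 ⟨a1, C, a2, W, l', a3, a4, a5, a6⟩
    refine wp_seq ((wp_saveTokens a3).mono ?_)
    rintro t2 s2 ⟨b1, b2, b3⟩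
    refine wp_seq ((wp_saveLog
      (a3.same b2 (by decide) (by decide) (by decide) (by decide))).mono ?_)
    rintro t3 s3 ⟨c1, c2, c3⟩
    refine wp_seq ((wp_toTerminal (sets := [I, J]) hk (t := 0) (by simp) (by simp) hI
      (C.m_pos ⟨0, hn⟩) ((a2.same b2 (by decide) (by decide) (by decide)).same c2 (by decide)
        (by decide) (by decide))).mono ?_)
    rintro t4 s4 ⟨d1, d2, d3, Z, l, d4, d5, d6⟩
    refine ((wp_connect (I := I) (W := W) hk d3 d4 d6.log ?_
      ((d6.reachable_iff hk a5).1 hIJ)).frame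
        (mod_connect (List.Subset.refl _) (List.Subset.refl _))).mono ?_
    · rw [d2.fld 10 (by decide) (by decide), c2.fld 10 (by decide) (by decide)]
      exact b3
    rintro t5 s5 ⟨⟨e1, l₂, e2, e3⟩, e4⟩
    refine ⟨?_, l₂, l', W, e2, (c3.same d2 (by decide) (by decide) (by decide)).same e4 (by decide)
      (by decide) (by decide), e3, a5.log, a6⟩
    have h1 : n * (n * 330 + 730) = 330 * (n * n) + 730 * n := by ring
    have h2 : (k * 400000 + 8000000) * (n * n * n) = (k * 1800 + 32000) * (n * n * n) +
      (k * 3600 + 65000) * (n * n * n) * 110 + (k * 60 + 1000) * 30 * (n * n * n) +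
      k * 400 * (n * n * n) + 788000 * (n * n * n) := by ring
    omega
  · rintro T s' ⟨⟨a1, l, l', W, a2, a3, a4, a5, a6⟩, a7⟩
    refine ⟨a1, l, l', W, a2, a3, a4, a5, ?_, a6⟩
    have h3 := a7.1 7
    rw [show (conc (inp G [I, J]) s').regs 7 = l.length from a2.len] at h3
    have h4 : (k * 800000 + 17000000) * (n * n * n) =
      2 * ((k * 400000 + 8000000) * (n * n * n)) + 1000000 * (n * n * n) := by ring
    omega

/-- The program that constructs a token-sliding sequence. -/
def sequenceProgram (k : ℕ) : Cmd :=
  meet k ;; appendReverse ;; interleave ;; emit ;; .assign 0 (.reg 7)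

theorem wp_sequenceProgram (hk : 4 ≤ k) (hG : IsCaterpillar G) (hn : 1 ≤ n) {I J : Finset (Fin n)}
    (hI : IsPVC G k I) (hJ : IsPVC G k J) (hIJ : Reachable G k I J) :
    Wp (inp G [I, J]) (sequenceProgram k)
      (fun T s' => T ≤ (k * 2000000000 + 100000000000) * n ^ 3 ∧
        OutputsTSSequence G k I J (conc (inp G [I, J]) s')) (rec0 G [I, J]) := by
  refine wp_seq ((wp_meet hk hG hn hI hJ hIJ).mono ?_)
  rintro t1 s1 ⟨a1, l, l', W, a2, a3, a4, a5, a6, a7⟩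
  refine wp_seq ((wp_appendReverse a2 a3).mono ?_)
  rintro t2 s2 ⟨b1, b2⟩
  have hlen : (l ++ l'.reverse.map Prod.swap).length = l.length + l'.length := by simp
  have hlog := a4.append a5.reverse
  generalize l ++ l'.reverse.map Prod.swap = L at b2 hlen hlog
  refine wp_seq ((wp_interleave b2).mono ?_)
  rintro t3 s3 ⟨c1, c2, c3, c4⟩
  refine wp_seq ((wp_emit c2).mono ?_)
  rintro t4 s4 ⟨d1, d2, d3⟩
  refine wp_assign ⟨?_, ?_⟩
  · have h1 : n ≤ n * n * n := Nat.le_mul_of_pos_left n (Nat.mul_pos hn hn)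
    have h2 : n * n ≤ n * n * n := Nat.le_mul_of_pos_right _ hn
    have h3 := baseAddr_inp_le (G := G) (sets := [I, J]) hn
    have h4 : (k * 2000000000 + 100000000000) * n ^ 3 = (k * 400000 + 8000000) * (n * n * n) +
      (k * 800000 + 17000000) * (n * n * n) * 1490 +
      (k * 3600 + 65000) * (n * n * n) * 1610 + k * 801804000 * (n * n * n) +
        74557350000 * (n * n * n) := by ring
    simp only [AExp.cost] at *
    omega
  · obtain ⟨S, e1, e2, e3, e4⟩ := hlog.exists_seq
    have h0 : (conc (inp G [I, J]) (s4.setr 0 (ev (inp G [I, J]) s4 (.reg 7)))).regs 0 =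
        L.length := by
      change (s4.setr 0 (s4.r 7)).r 0 = _
      simp [d2 7 (by decide) (by decide), c3]
    have h1 : (conc (inp G [I, J]) (s4.setr 0 (ev (inp G [I, J]) s4 (.reg 7)))).regs 1 =
        s4.r 1 := by
      change (s4.setr 0 (s4.r 7)).r 1 = _
      simp
    refine ⟨S, by rw [h0]; exact e1, e2, by rw [h0]; exact e3, fun i hi => ?_⟩
    rw [h0] at hi
    refine ⟨_, _, e4 i hi, ?_, ?_⟩
    · rw [h1, ← (c4 i hi).1]; exact d3 _ (by omega)
    · rw [h1, ← (c4 i hi).2, add_assoc]; exact d3 _ (by omega)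

end Construct

/-- A tame program that halts in polynomial time does so on a word RAM. -/
theorem exists_haltsWith {P : Cmd} (hP : P.tame = true) (A p : ℕ) :
    ∃ c d, p ≤ d ∧ ∀ (n : ℕ) (G : SimpleGraph (Fin n)) (sets : List (Finset (Fin n)))
      (Q : State → Prop), 1 ≤ n →
      Wp (inp G sets) P (fun t s' => t ≤ A * n ^ p ∧ Q (conc (inp G sets) s')) (rec0 G sets) →
      HaltsWith P (c * n ^ d) (c * n ^ p) (inputState G sets) Q := by
  obtain ⟨B, q, h⟩ := exists_wordBound hP A p
  refine ⟨A + B, p + q, Nat.le_add_right _ _, ?_⟩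
  rintro n G sets Q hn ⟨t, s', h1, h2, h3⟩
  refine ⟨t, _, h2.trans (Nat.mul_le_mul_right _ (Nat.le_add_right _ _)), ?_, h3⟩
  rw [← inputState_eq] at h1
  exact h n t _ _ hn (inputState_le G sets hn) h2 h1 _ (Nat.mul_le_mul (Nat.le_add_left _ _)
    (Nat.pow_le_pow_right hn (Nat.le_add_left _ _)))

theorem IsCaterpillar.one_le {n : ℕ} {G : SimpleGraph (Fin n)} (hG : IsCaterpillar G) : 1 ≤ n :=
  have := hG.1.1.nonempty
  Fin.pos_iff_nonempty.2 this

end PVCR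

theorem mainTheorem1 (k : ℕ) (hk : 4 ≤ k) :
    -- characterization of reachability
    (∀ (V : Type u) [Fintype V] [DecidableEq V] (G : SimpleGraph V), PVCR.IsCaterpillar G →
      ∀ I J : Finset V, PVCR.IsPVC G k I → PVCR.IsPVC G k J →
        (PVCR.Reachable G k I J ↔
          I.card = J.card ∧ PVCR.rigidSet G k I = PVCR.rigidSet G k J ∧
          ∀ C : (PVCR.removeVerts G (PVCR.rigidSet G k I)).ConnectedComponent,
            PVCR.tokensIn I C = PVCR.tokensIn J C)) ∧
    -- the rigid tokens can be found in cubic time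
    (∃ (P : PVCR.Cmd) (c d : ℕ), ∀ (n : ℕ) (G : SimpleGraph (Fin n)), PVCR.IsCaterpillar G →
      ∀ I : Finset (Fin n), PVCR.IsPVC G k I →
        PVCR.HaltsWith P (c * n ^ d) (c * n ^ 3) (PVCR.inputState G [I])
          (PVCR.OutputsSet (PVCR.rigidSet G k I))) ∧
    -- reachability can be decided in cubic time
    (∃ (P : PVCR.Cmd) (c d : ℕ), ∀ (n : ℕ) (G : SimpleGraph (Fin n)), PVCR.IsCaterpillar G →
      ∀ I J : Finset (Fin n), PVCR.IsPVC G k I → PVCR.IsPVC G k J →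
        PVCR.HaltsWith P (c * n ^ d) (c * n ^ 3) (PVCR.inputState G [I, J])
          (PVCR.Answers (PVCR.Reachable G k I J))) ∧
    -- for yes-instances a sequence can be constructed in polynomial time
    (∃ (P : PVCR.Cmd) (c d : ℕ), ∀ (n : ℕ) (G : SimpleGraph (Fin n)), PVCR.IsCaterpillar G →
      ∀ I J : Finset (Fin n), PVCR.IsPVC G k I → PVCR.IsPVC G k J → PVCR.Reachable G k I J →
        PVCR.HaltsWith P (c * n ^ d) (c * n ^ d) (PVCR.inputState G [I, J])
          (PVCR.OutputsTSSequence G k I J)) := by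
  refine ⟨fun V _ _ G hG I J hI hJ => PVCR.reachable_iff hk hG hI hJ, ?_, ?_, ?_⟩
  -- Tameness is settled by evaluation although `k` is a variable: `k` occurs only in the guard
  -- `slideE k`, and `tame` does not inspect guards.
  · obtain ⟨c, d, -, h⟩ := PVCR.exists_haltsWith (P := PVCR.rigidProgram k) rfl
      (k * 1000000 + 20000000) 3
    exact ⟨_, c, d, fun n G hG I hI => h n G _ _ hG.one_le
      (PVCR.wp_rigidProgram hk hG hG.one_le hI)⟩
  · obtain ⟨c, d, -, h⟩ := PVCR.exists_haltsWith (P := PVCR.reachabilityProgram k) rfl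
      (k * 10000 + 100000) 3
    exact ⟨_, c, d, fun n G hG I J hI hJ => h n G _ _ hG.one_le
      (PVCR.wp_reachabilityProgram hk hG hG.one_le hI hJ)⟩
  · obtain ⟨c, d, hd, h⟩ := PVCR.exists_haltsWith (P := PVCR.sequenceProgram k) rfl
      (k * 2000000000 + 100000000000) 3
    refine ⟨PVCR.sequenceProgram k, c, d, fun n G hG I J hI hJ hIJ => ?_⟩
    obtain ⟨t, τ, ht, h1, h2⟩ := h n G _ _ hG.one_le
      (PVCR.wp_sequenceProgram hk hG hG.one_le hI hJ hIJ)
    -- Here time and word size share one exponent, so the cubic time bound is weakened to `n ^ d` by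
    -- means of `3 ≤ d`.
    exact ⟨t, τ, ht.trans (Nat.mul_le_mul_left _ (Nat.pow_le_pow_right hG.one_le hd)), h1, h2⟩
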